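/- Fix an integer $k\ge 1$ and $a\in(0,1)$. For an integer $m\ge 1$ let $L^k_m(a)$ be the error of the best uniform approximation of $\operatorname{sgn}(x)$ on $[-1,-a]\cup[a,1]$ by real Laurent polynomials $\sum_{j=-(2k-1)}^{2m-1}c_jx^j$; the best approximation exists and is unique, and is denoted by $f(x;k,m;a)$. For $B>0$ let $\Omega^k_m(B)$ be the half strip $\{u+iv: v>0,\ 0<u<(k+m)\pi\}$ with the region $\{u+iv: v\ge B,\ |u-\pi k|\le\arccos(\cosh B/\cosh v)\}$ deleted, and let $\infty_1$ and $\infty_2$ be its boundary points at infinity to the left and to the right of the deleted region. Let $\phi$ be the conformal map of the open first quadrant onto $\Omega^k_m(B)$, extended continuously to the boundary, with $\phi(0)=\infty_1$, $\phi(1)=(k+m)\pi$, $\phi(\infty)=\infty_2$. There is exactly one $B>0$ for which $\phi^{-1}(0)=a$; it is denoted by $B^k_m(a)$. Then $$\lim_{m\to\infty}\Big\{B^k_m(a)-\Big(m-\tfrac12\Big)\log\frac{1+a}{1-a}-\Big(k+\tfrac12\Big)\log(2m-1)\Big\}=\Big(k+\tfrac12\Big)\log\frac{2a}{1-a^2}-\log\frac{\Gamma(k+\frac12)}{\pi}.$$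 Moreover $L^k_m(a)=1/\cosh B^k_m(a)$ for all $m\ge1$, and hence $$\lim_{m\to\infty}\Big(\frac{1+a}{1-a}\Big)^{m-\frac12}(2m-1)^{k+\frac12}L^k_m(a)=\frac{2\,\Gamma(k+\frac12)}{\pi}\Big(\frac{1-a^2}{2a}\Big)^{k+\frac12}.$$ Finally, uniformly for $\lambda$ in compact subsets of $(0,\infty)$, $$\lim_{m\to\infty}f\Big(\sqrt{\tfrac{2a}{2m-1}}\,\lambda;k,m;a\Big)=1+\frac{(-1)^{k+1}}{\pi}\int_0^\infty\Big(\frac{\mu}{\lambda}\Big)^{2k-1}e^{-(\lambda^2+\mu^2)}\frac{2\mu\,d\mu}{\lambda^2+\mu^2}.$$ -/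

import Mathlib

noncomputable section

namespace SgnLaurent

/-- `f` is a real Laurent polynomial `∑_{j = -l}^{n} c_j x^j` of degree `(l, n)`. -/
def IsLaurentPoly (l n : ℕ) (f : ℝ → ℝ) : Prop :=
  ∃ c : ℤ → ℝ, ∀ x : ℝ, f x = ∑ j ∈ Finset.Icc (-(l : ℤ)) (n : ℤ), c j * x ^ j

/-- The two intervals `[-1, -a] ∪ [a, 1]`. -/
def twoIntervals (a : ℝ) : Set ℝ := {x | a ≤ |x| ∧ |x| ≤ 1}

/-- The uniform distance on `[-1, -a] ∪ [a, 1]` between `f` and `sgn`. -/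
def sgnDist (a : ℝ) (f : ℝ → ℝ) : ℝ :=
  sSup ((fun x => |f x - Real.sign x|) '' twoIntervals a)

/-- The error `L^k_m(a)` of the best uniform approximation of `sgn` on `[-1, -a] ∪ [a, 1]`
by Laurent polynomials of degree `(2k-1, 2m-1)`. -/
def bestError (k m : ℕ) (a : ℝ) : ℝ :=
  sInf (sgnDist a '' {f | IsLaurentPoly (2 * k - 1) (2 * m - 1) f})

/-- `f` is a best approximation: it attains the error `L^k_m(a)`. -/
def IsExtremal (k m : ℕ) (a : ℝ) (f : ℝ → ℝ) : Prop :=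
  IsLaurentPoly (2 * k - 1) (2 * m - 1) f ∧ sgnDist a f = bestError k m a

/-- The extremal function `f(x; k, m; a)`. -/
def extremalFun (k m : ℕ) (a : ℝ) : ℝ → ℝ :=
  Classical.epsilon (IsExtremal k m a)

/-- The open first quadrant. -/
def quadrant : Set ℂ := {z | 0 < z.re ∧ 0 < z.im}

/-- The closed first quadrant without the origin. -/
def quadrantBar : Set ℂ := {z | 0 ≤ z.re ∧ 0 ≤ z.im ∧ z ≠ 0}

/-- The domain `Ω^k_m(B)`: the half strip `0 < u < (k+m)π`, `v > 0`, without the region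
`|u - πk| ≤ arccos (cosh B / cosh v)`, `v ≥ B`. -/
def Omega (k m : ℕ) (B : ℝ) : Set ℂ :=
  {w | 0 < w.im ∧ 0 < w.re ∧ w.re < (k + m) * Real.pi} \
  {w | |w.re - Real.pi * k| ≤ Real.arccos (Real.cosh B / Real.cosh w.im) ∧ B ≤ w.im}

/-- `φ` is the conformal map of the first quadrant onto `Ω^k_m(B)`, together with its continuous
extension to the boundary, normalized by `φ(0) = ∞₁`, `φ(1) = (k+m)π`, `φ(∞) = ∞₂`. Here `∞₁` and
`∞₂` are the boundary points at infinity of `Ω^k_m(B)` to the left and to the right of the deleted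
region, i.e. in the parts `u < πk` and `u > πk`. -/
structure IsConformalMap (k m : ℕ) (B : ℝ) (φ : ℂ → ℂ) : Prop where
  holo : DifferentiableOn ℂ φ quadrant
  bij : Set.BijOn φ quadrant (Omega k m B)
  cont : ContinuousOn φ quadrantBar
  bij_closure : Set.BijOn φ quadrantBar (closure (Omega k m B))
  map_zero_im : Filter.Tendsto (fun z => (φ z).im) (nhdsWithin 0 quadrantBar) Filter.atTop
  map_zero_re : ∀ᶠ z in nhdsWithin 0 quadrantBar, (φ z).re < Real.pi * k
  map_one : φ 1 = (k + m) * Real.pi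
  map_infty_im : Filter.Tendsto (fun z => (φ z).im)
    (Bornology.cobounded ℂ ⊓ Filter.principal quadrantBar) Filter.atTop
  map_infty_re : ∀ᶠ z in Bornology.cobounded ℂ ⊓ Filter.principal quadrantBar,
    Real.pi * k < (φ z).re

/-- `B > 0` is a parameter for which the normalized conformal map `φ(·; k, m; B)` has
`φ⁻¹(0) = a`. -/
def IsParam (k m : ℕ) (a B : ℝ) : Prop :=
  0 < B ∧ ∃ φ : ℂ → ℂ, IsConformalMap k m B φ ∧ φ (a : ℂ) = 0

/-- The parameter `B^k_m(a)`. -/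
def paramB (k m : ℕ) (a : ℝ) : ℝ := Classical.epsilon (IsParam k m a)

/-- The limit of the rescaled extremal functions. -/
def limitFun (k : ℕ) (l : ℝ) : ℝ :=
  1 + (-1) ^ (k + 1) / Real.pi *
    ∫ μ in Set.Ioi (0 : ℝ), (μ / l) ^ (2 * k - 1) * Real.exp (-(l ^ 2 + μ ^ 2)) *
      (2 * μ / (l ^ 2 + μ ^ 2))

end SgnLaurent

end

namespace SgnLaurent

open Polynomial Set

/-! ### Alternation and polynomial interpolation -/

/-! Put n = m + k - 1. The first half of the proof identifies L with 1 / cosh B exactly; the second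
half finds the asymptotics of L by an explicit, nearly optimal approximation and reads those of B
from L.

Alternation. By symmetry the best approximation is odd, f(x) = x^{-(2k-1)} Q(x²) with deg Q ≤ n, and
1 - f takes the values ±L alternately at n + 2 points of [a, 1]. Interior extremal points are zeros
of f', which has at most n of them on the positive axis. Hence a and 1 are extremal points and f'
factors completely over the others (`exists_isAlternant`). Uniqueness is
`IsAlternant.eq_of_sgnDist_le`.

The conformal map. The function h = (-1)^k (1 - f) / L should be cos φ. Since f maps the imaginary
axis into itself, the winding of arguments along that axis counts the solutions of f = w in the
right half plane: n + 1 if Re w > 0 and n - 1 if Re w < 0 (`IsAlternant.card_roots_right`,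
`IsAlternant.leading_sign`). Alternation already supplies n + 1 real solutions for every level
strictly between 1 - L and 1 + L, so h omits [-1, 1] on the open quadrant and a branch φ of arccos h
exists there, continuous up to the boundary (`IsAlternant.exists_arccos`). On the positive axis φ
follows the left edge, the bottom and the right edge of the strip. On the imaginary axis Re h =
(-1)^k / L, so φ lies on cos(u - πk) cosh v = 1 / L, the edge of the deleted region when cosh B = 1
/ L. The image covers Ω by an open-closed argument, and the same root count leaves no room for
values outside Ω or for double values (`ArccosData.eq_of_rightInverse`). Thus this B is a parameter.

Uniqueness of B. If B₁ < B₂ were both parameters, then Ω(B₁) is contained in Ω(B₂), and φ₂⁻¹ ∘ φ₁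
reflects to a holomorphic self-map of the right half plane fixing a and 1. By Schwarz's lemma it is
the identity, although the domains differ (`IsParam.not_lt_param`).

Asymptotics of L. Let ρ = (1 - a) / (1 + a) and (1 + ρz)(1 + ρ/z) = (1 + ρ)² x², so that |z| = 1
corresponds to x in [a, 1]. In 1/x = (1/π) ∫ dτ / (√τ (x² + τ)), each integrand, times x^{2k}, is
approximated by an explicit polynomial in x² (`exists_kernel_poly`). Integration gives P with an
exact error formula (`exists_near_optimal`). On the circle the relative error is an amplitude times
the cosine of a phase running from 0 to (m + k)π, up to a term smaller by a factor of order 1/m. De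
la Vallée-Poussin's bound then pins L to the amplitude (`IsAlternant.abs_sub_amp_le`), and Laplace's
method at y of order 1 / (m + k) produces Γ(k + 1/2) (`tendsto_bestError_scaled`).

The limit of f. For 0 < x < a the same error formula holds with z = -e^{-η} / ρ, and x of order
m^{-1/2} makes (m + k)η converge to λ² (`abs_gap_error_sub_le`). A Bernstein–Walsh estimate
transfers the limit from P to the extremal Q (`tendsto_extremalFun`). -/

/-- The product has exactly n + 1 - i negative factors, so the weights of the divided difference
over increasing nodes alternate in sign. -/
theorem nodal_sign {n : ℕ} {t : ℕ → ℝ} (ht : ∀ i j, i < j → j ≤ n + 1 → t i < t j) {i : ℕ}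
    (hi : i ≤ n + 1) :
    0 < (-1 : ℝ) ^ (n + 1) * ((-1) ^ i * ∏ j ∈ (Finset.range (n + 2)).erase i, (t i - t j)) := by
  have hsplit : (Finset.range (n + 2)).erase i = Finset.range i ∪ Finset.Ico (i + 1) (n + 2) := by
    ext j; simp only [Finset.mem_erase, Finset.mem_range, Finset.mem_union, Finset.mem_Ico]; omega
  have hdisj : Disjoint (Finset.range i) (Finset.Ico (i + 1) (n + 2)) := by
    rw [Finset.disjoint_left]; intro j; simp only [Finset.mem_range, Finset.mem_Ico]; omega
  rw [hsplit, Finset.prod_union hdisj]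
  have h1 : 0 < ∏ j ∈ Finset.range i, (t i - t j) := Finset.prod_pos fun j hj => by
    have := ht j i (Finset.mem_range.1 hj) hi; linarith
  have h2 : ∏ j ∈ Finset.Ico (i + 1) (n + 2), (t i - t j)
      = (-1) ^ (n + 1 - i) * ∏ j ∈ Finset.Ico (i + 1) (n + 2), (t j - t i) := by
    have : (n + 1 - i) = (Finset.Ico (i + 1) (n + 2)).card := by simp
    rw [this, ← Finset.prod_const, ← Finset.prod_mul_distrib]
    exact Finset.prod_congr rfl fun j _ => by ring
  have h3 : 0 < ∏ j ∈ Finset.Ico (i + 1) (n + 2), (t j - t i) := Finset.prod_pos fun j hj => by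
    rw [Finset.mem_Ico] at hj
    have := ht i j (by omega) (by omega); linarith
  have h4 : (-1 : ℝ) ^ (n + 1) * ((-1) ^ i * (-1) ^ (n + 1 - i)) = 1 := by
    rw [← pow_add, Nat.add_sub_cancel' hi, ← pow_add, Even.neg_one_pow ⟨n + 1, rfl⟩]
  rw [h2]
  have : (-1 : ℝ) ^ (n + 1) * ((-1) ^ i * ((∏ j ∈ Finset.range i, (t i - t j)) *
      ((-1) ^ (n + 1 - i) * ∏ j ∈ Finset.Ico (i + 1) (n + 2), (t j - t i))))
      = ((-1 : ℝ) ^ (n + 1) * ((-1) ^ i * (-1) ^ (n + 1 - i))) *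
        ((∏ j ∈ Finset.range i, (t i - t j)) *
          ∏ j ∈ Finset.Ico (i + 1) (n + 2), (t j - t i)) := by ring
  rw [this, h4, one_mul]
  exact mul_pos h1 h3

theorem injOn_of_lt {n : ℕ} {t : ℕ → ℝ} (ht : ∀ i j, i < j → j ≤ n + 1 → t i < t j) :
    Set.InjOn t (Finset.range (n + 2) : Finset ℕ) := by
  intro i hi j hj hij
  simp only [Finset.coe_range, Set.mem_Iio] at hi hj
  rcases lt_trichotomy i j with h | h | h
  · exact absurd hij (ht i j h (by omega)).ne
  · exact h
  · exact absurd hij (ht j i h (by omega)).ne'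

/-- The divided difference over n + 2 nodes kills polynomials of degree at most n. Under weak
alternation all its terms have the same sign, hence all vanish, and D has n + 2 zeros. -/
theorem eq_zero_of_weak_alternation {n : ℕ} {t : ℕ → ℝ}
    (ht : ∀ i j, i < j → j ≤ n + 1 → t i < t j) {D : ℝ[X]} (hD : D.natDegree ≤ n)
    (h : ∀ i ≤ n + 1, 0 ≤ (-1) ^ i * D.eval (t i)) : D = 0 := by
  set V : ℕ → ℝ := fun i => ∏ j ∈ (Finset.range (n + 2)).erase i, (t i - t j) with hV
  have hinj := injOn_of_lt ht
  have hdeg : D.degree < (Finset.range (n + 2)).card := by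
    rw [Finset.card_range]
    exact lt_of_le_of_lt (degree_le_of_natDegree_le hD) (by exact_mod_cast (by omega : n < n + 2))
  have hsum := Lagrange.coeff_eq_sum hinj hdeg
  rw [Finset.card_range, coeff_eq_zero_of_natDegree_lt (by omega)] at hsum
  have hVne : ∀ i ≤ n + 1, V i ≠ 0 := fun i hi h0 => by
    have := nodal_sign ht hi
    simp only [hV] at h0
    rw [h0] at this; simp at this
  have hnn : ∀ i ∈ Finset.range (n + 2), 0 ≤ (-1) ^ (n + 1) * (D.eval (t i) / V i) := by
    intro i hi
    have hi' : i ≤ n + 1 := by have := Finset.mem_range.1 hi; omega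
    have h1 := nodal_sign ht hi'
    have h2 := h i hi'
    have h3 : (-1 : ℝ) ^ (n + 1) * (D.eval (t i) / V i)
        = ((-1) ^ i * D.eval (t i)) * ((-1) ^ (n + 1) * ((-1) ^ i * V i)) / (V i) ^ 2 := by
      have := hVne i hi'
      have e : ((-1 : ℝ) ^ i) * (-1) ^ i = 1 := by rw [← pow_add, Even.neg_one_pow ⟨i, rfl⟩]
      have e2 : D.eval (t i) / V i * V i = D.eval (t i) := div_mul_cancel₀ _ this
      rw [eq_div_iff (pow_ne_zero 2 this)]
      linear_combination ((-1) ^ (n + 1) * V i) * e2 - (D.eval (t i) * (-1) ^ (n + 1) * V i) * e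
    rw [h3]
    exact div_nonneg (mul_nonneg h2 h1.le) (sq_nonneg _)
  have hz : ∑ i ∈ Finset.range (n + 2), (-1 : ℝ) ^ (n + 1) * (D.eval (t i) / V i) = 0 := by
    rw [← Finset.mul_sum, ← hsum, mul_zero]
  have hall := (Finset.sum_eq_zero_iff_of_nonneg hnn).1 hz
  refine eq_zero_of_degree_lt_of_eval_index_eq_zero (s := Finset.range (n + 2)) (v := t) hinj hdeg ?_
  intro i hi
  have hi' : i ≤ n + 1 := by have := Finset.mem_range.1 hi; omega
  have := hall i hi
  simpa [hVne i hi'] using this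

/-- If the signs of `e` do not alternate on `n + 2` nodes, some polynomial of degree at most `n`
has the sign of `e` at all the nodes. -/
theorem exists_same_sign_of_not_alternating {n : ℕ} {t : ℕ → ℝ}
    (ht : ∀ i j, i < j → j ≤ n + 1 → t i < t j) {e : ℕ → ℝ} (he : ∀ i ≤ n + 1, e i ≠ 0)
    {i₀ : ℕ} (hi₀ : i₀ ≤ n) (h : 0 < e i₀ * e (i₀ + 1)) :
    ∃ p : ℝ[X], p.natDegree ≤ n ∧ ∀ i ≤ n + 1, 0 < e i * p.eval (t i) := by
  set V : ℕ → ℝ := fun i => ∏ j ∈ (Finset.range (n + 2)).erase i, (t i - t j) with hV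
  have hinj := injOn_of_lt ht
  have hVne : ∀ i ≤ n + 1, V i ≠ 0 := fun i hi h0 => by
    have := nodal_sign ht hi
    simp only [hV] at h0
    rw [h0] at this; simp at this
  have hVV : V i₀ * V (i₀ + 1) < 0 := by
    have h1 := nodal_sign ht (show i₀ ≤ n + 1 by omega)
    have h2 := nodal_sign ht (show i₀ + 1 ≤ n + 1 by omega)
    have h3 := mul_pos h1 h2
    have e1 : ((-1 : ℝ) ^ (n + 1)) ^ 2 = 1 := by rw [← pow_mul, mul_comm, pow_mul]; simp
    have e2 : ((-1 : ℝ) ^ i₀) ^ 2 = 1 := by rw [← pow_mul, mul_comm, pow_mul]; simp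
    have h4 : (-1 : ℝ) ^ (n + 1) * ((-1) ^ i₀ * V i₀) *
        ((-1) ^ (n + 1) * ((-1) ^ (i₀ + 1) * V (i₀ + 1))) = - (V i₀ * V (i₀ + 1)) := by
      rw [pow_succ (-1 : ℝ) i₀]
      linear_combination (-(V i₀ * V (i₀ + 1)) * ((-1 : ℝ) ^ i₀) ^ 2) * e1
        - (V i₀ * V (i₀ + 1)) * e2
    have h5 := h3.trans_eq h4
    linarith
  set u : ℕ → ℝ := fun i => e i / V i with hu
  have huu : u i₀ * u (i₀ + 1) < 0 := by
    have : u i₀ * u (i₀ + 1) = (e i₀ * e (i₀ + 1)) / (V i₀ * V (i₀ + 1)) := by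
      simp only [hu]; rw [div_mul_div_comm]
    rw [this]; exact div_neg_of_pos_of_neg h hVV
  set S := ∑ i ∈ Finset.range (n + 2), u i with hS
  -- an index whose contribution can compensate the sum
  obtain ⟨j, hj, huj, hSj⟩ : ∃ j ≤ n + 1, u j ≠ 0 ∧ S / u j ≤ 0 := by
    rcases le_total 0 S with hS0 | hS0 <;> rcases lt_or_gt_of_ne
      (show u i₀ ≠ 0 from fun h0 => by rw [h0, zero_mul] at huu; exact lt_irrefl _ huu) with h0 | h0
    · exact ⟨i₀, by omega, h0.ne, div_nonpos_of_nonneg_of_nonpos hS0 h0.le⟩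
    · have h1 : u (i₀ + 1) < 0 := by by_contra h1; push Not at h1; nlinarith
      exact ⟨i₀ + 1, by omega, h1.ne, div_nonpos_of_nonneg_of_nonpos hS0 h1.le⟩
    · have h1 : 0 < u (i₀ + 1) := by by_contra h1; push Not at h1; nlinarith
      exact ⟨i₀ + 1, by omega, h1.ne', div_nonpos_of_nonpos_of_nonneg hS0 h1.le⟩
    · exact ⟨i₀, by omega, h0.ne', div_nonpos_of_nonpos_of_nonneg hS0 h0.le⟩
  -- The sum S is the coefficient that obstructs degree n. Multiplying the value at j by 1 - S / u
  -- j, which is at least 1 by the choice of j, cancels it without changing a sign.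
  set c : ℕ → ℝ := fun i => if i = j then 1 - S / u j else 1 with hc
  have hcpos : ∀ i, 0 < c i := fun i => by
    simp only [hc]; split_ifs <;> linarith
  set p := Lagrange.interpolate (Finset.range (n + 2)) t (fun i => c i * e i) with hp
  have hdeg : p.degree < (Finset.range (n + 2)).card := Lagrange.degree_interpolate_lt _ hinj
  have hev : ∀ i ≤ n + 1, p.eval (t i) = c i * e i := fun i hi =>
    Lagrange.eval_interpolate_at_node _ hinj (Finset.mem_range.2 (by omega))
  refine ⟨p, ?_, fun i hi => ?_⟩
  · have hco := Lagrange.coeff_eq_sum hinj hdeg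
    have : ∑ i ∈ Finset.range (n + 2), p.eval (t i) / V i = 0 := by
      have h1 : ∀ i ∈ Finset.range (n + 2), p.eval (t i) / V i
          = u i + if i = j then -S else 0 := by
        intro i hi
        rw [hev i (by have := Finset.mem_range.1 hi; omega)]
        simp only [hc, hu]
        split_ifs with hij
        · subst hij
          have h2 : e i / V i ≠ 0 := huj
          have : e i ≠ 0 := he i (by have := Finset.mem_range.1 hi; omega)
          have := hVne i hj
          field_simp
          ring
        · ring
      rw [Finset.sum_congr rfl h1, Finset.sum_add_distrib, Finset.sum_ite_eq',
        if_pos (Finset.mem_range.2 (by omega))]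
      linarith
    rw [Finset.card_range] at hdeg hco
    have h0 : p.coeff (n + 1) = 0 := by
      rw [show n + 1 = n + 2 - 1 by omega, hco]; exact this
    rw [natDegree_le_iff_coeff_eq_zero]
    intro i hi
    rcases Nat.lt_or_ge i (n + 2) with h1 | h1
    · obtain rfl : i = n + 1 := by omega
      exact h0
    · exact coeff_eq_zero_of_degree_lt (lt_of_lt_of_le hdeg (by exact_mod_cast h1))
  · rw [hev i hi]
    have := mul_pos (hcpos i) (mul_self_pos.2 (he i hi))
    linarith [this, show e i * (c i * e i) = c i * (e i * e i) by ring]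

/-- A uniform bound that is perturbed in a direction having the sign of the function at all of its
extremal points decreases. -/
theorem exists_perturbation {X : Type*} [TopologicalSpace X] {K : Set X} (hK : IsCompact K)
    {g q : X → ℝ} (hg : ContinuousOn g K) (hq : ContinuousOn q K) {L : ℝ}
    (hgL : ∀ x ∈ K, |g x| ≤ L) (h : ∀ x ∈ K, |g x| = L → 0 < g x * q x) :
    ∃ ε : ℝ, ∀ x ∈ K, |g x - ε * q x| < L := by
  rcases K.eq_empty_or_nonempty with rfl | hne
  · exact ⟨0, by simp⟩
  have hL0 : 0 ≤ L := by
    obtain ⟨x, hx⟩ := hne; exact (abs_nonneg _).trans (hgL x hx)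
  -- This maximum is positive on all of K, hence at least some δ > 0: each point either has room
  -- below L or gains from the perturbation.
  obtain ⟨y, hy, hymin⟩ := hK.exists_isMinOn hne
    (f := fun x => max (L ^ 2 - g x ^ 2) (g x * q x)) (by fun_prop)
  set δ := max (L ^ 2 - g y ^ 2) (g y * q y) with hδ
  have hδ0 : 0 < δ := by
    rcases (hgL y hy).lt_or_eq with h1 | h1
    · refine lt_max_of_lt_left ?_
      have := sq_lt_sq' (by linarith [abs_nonneg (g y)]) h1
      rw [sq_abs] at this; linarith
    · exact lt_max_of_lt_right (h y hy h1)
  obtain ⟨M, hM⟩ := hK.exists_bound_of_continuousOn hq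
  have hM1 : ∀ x ∈ K, |q x| ≤ |M| + 1 := fun x hx => (hM x hx).trans (by
    have := le_abs_self M; linarith)
  set A := |M| + 1 with hA
  have hApos : 0 < A := by positivity
  -- D is large enough that ε = δ / D satisfies ε ≤ 1 and ε(2LA + 2A² + 1) ≤ δ, which serves both
  -- cases of the maximum.
  set D := 2 * L * A + 2 * A ^ 2 + 1 + δ with hD
  have hDpos : 0 < D := by positivity
  refine ⟨δ / D, fun x hx => ?_⟩
  set ε := δ / D with hε
  have hεpos : 0 < ε := by positivity
  have hε1 : ε ≤ 1 := (div_le_one hDpos).2 (by simp only [hD]; nlinarith [sq_nonneg A])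
  have hεD : ε * D = δ := by simp only [hε]; field_simp
  have hq2 : q x ^ 2 ≤ A ^ 2 := by rw [← sq_abs]; gcongr; exact hM1 x hx
  have hg2 : g x ^ 2 ≤ L ^ 2 := by rw [← sq_abs]; gcongr; exact hgL x hx
  have hgq : |g x * q x| ≤ L * A := by
    rw [abs_mul]; exact mul_le_mul (hgL x hx) (hM1 x hx) (abs_nonneg _) hL0
  have hkey : (g x - ε * q x) ^ 2 < L ^ 2 := by
    have e1 : (g x - ε * q x) ^ 2 = g x ^ 2 - 2 * ε * (g x * q x) + ε * (ε * q x ^ 2) := by ring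
    have e2 : ε * (ε * q x ^ 2) ≤ ε * A ^ 2 * ε := by nlinarith [hεpos.le, mul_pos hεpos hεpos]
    have hεδ : ε * (2 * L * A) + 2 * ε * A ^ 2 + ε ≤ δ := by
      rw [← hεD]; simp only [hD]; nlinarith [mul_pos hεpos hδ0]
    have hA2 : ε * A ^ 2 * ε ≤ ε * A ^ 2 := by
      have : 0 ≤ ε * A ^ 2 := by positivity
      nlinarith
    have hxδ : δ ≤ max (L ^ 2 - g x ^ 2) (g x * q x) := isMinOn_iff.1 hymin x hx
    rcases le_max_iff.1 hxδ with h1 | h1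
    · have := neg_abs_le (g x * q x)
      nlinarith
    · have h2 : ε * A ^ 2 * ε ≤ ε * δ := by
        have : A ^ 2 * ε ≤ δ := by nlinarith [mul_nonneg hL0 hApos.le, mul_nonneg hεpos.le (mul_nonneg hL0 hApos.le)]
        nlinarith
      nlinarith [mul_pos hεpos hδ0, mul_le_mul_of_nonneg_left h1 hεpos.le]
  exact abs_lt_of_sq_lt_sq hkey hL0

end SgnLaurent

noncomputable section
namespace SgnLaurent

open Polynomial Set

/-! ### The best odd approximation -/

/-- The odd Laurent polynomial `x^{-(2k-1)} Q(x²)`. -/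
def oddFun (k : ℕ) (Q : ℝ[X]) (x : ℝ) : ℝ := Q.eval (x ^ 2) / x ^ (2 * k - 1)

/-- The polynomial `R` with `(x^{-(2k-1)} Q(x²))' = x^{-2k} R(x²)`. -/
def derivPoly (k : ℕ) (Q : ℝ[X]) : ℝ[X] := C 2 * X * derivative Q - C (2 * (k : ℝ) - 1) * Q

theorem coeff_derivPoly (k : ℕ) (Q : ℝ[X]) (j : ℕ) :
    (derivPoly k Q).coeff j = (2 * (j : ℝ) - (2 * k - 1)) * Q.coeff j := by
  rw [derivPoly, coeff_sub, coeff_C_mul, mul_assoc, coeff_C_mul]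
  rcases j with _ | j
  · simp; ring
  · rw [coeff_X_mul, coeff_derivative]; push_cast; ring

theorem natDegree_derivPoly_le (k : ℕ) {Q : ℝ[X]} {n : ℕ} (hQ : Q.natDegree ≤ n) :
    (derivPoly k Q).natDegree ≤ n := by
  rw [natDegree_le_iff_coeff_eq_zero]
  intro j hj
  rw [coeff_derivPoly, coeff_eq_zero_of_natDegree_lt (by omega), mul_zero]

theorem derivPoly_ne_zero (k : ℕ) {Q : ℝ[X]} (hQ : Q ≠ 0) : derivPoly k Q ≠ 0 := by
  intro h
  apply hQ
  ext j
  have h1 := coeff_derivPoly k Q j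
  rw [h, coeff_zero] at h1
  rcases mul_eq_zero.1 h1.symm with h2 | h2
  · exfalso
    have h3 : ((2 * j + 1 : ℕ) : ℝ) = ((2 * k : ℕ) : ℝ) := by push_cast; linarith
    have := Nat.cast_injective h3
    omega
  · simpa using h2

theorem hasDerivAt_oddFun {k : ℕ} (hk : 1 ≤ k) (Q : ℝ[X]) {x : ℝ} (hx : x ≠ 0) :
    HasDerivAt (oddFun k Q) ((derivPoly k Q).eval (x ^ 2) / x ^ (2 * k)) x := by
  obtain ⟨l, rfl⟩ : ∃ l, k = l + 1 := ⟨k - 1, by omega⟩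
  have h1 : HasDerivAt (fun x : ℝ => Q.eval (x ^ 2)) ((derivative Q).eval (x ^ 2) * (2 * x)) x := by
    have := (Q.hasDerivAt (x ^ 2)).comp x (hasDerivAt_pow 2 x)
    refine this.congr_deriv ?_
    simp
  have h2 := h1.div (hasDerivAt_pow (2 * (l + 1) - 1) x) (pow_ne_zero _ hx)
  refine h2.congr_deriv ?_
  rw [show 2 * (l + 1) - 1 = 2 * l + 1 by omega, show 2 * l + 1 - 1 = 2 * l by omega,
    show 2 * (l + 1) = 2 * l + 2 by ring, derivPoly]
  simp only [eval_sub, eval_mul, eval_C, eval_X]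
  push_cast
  field_simp
  ring

theorem continuousOn_oddFun {k : ℕ} (Q : ℝ[X]) {a : ℝ} (ha : 0 < a) :
    ContinuousOn (oddFun k Q) (Icc a 1) := by
  unfold oddFun
  refine ContinuousOn.div (by fun_prop) (by fun_prop) fun x hx => ?_
  exact pow_ne_zero _ (by have := hx.1; linarith)

theorem oddFun_add (k : ℕ) (P Q : ℝ[X]) (x : ℝ) :
    oddFun k (P + Q) x = oddFun k P x + oddFun k Q x := by
  simp [oddFun, add_div]

theorem oddFun_sub (k : ℕ) (P Q : ℝ[X]) (x : ℝ) :
    oddFun k (P - Q) x = oddFun k P x - oddFun k Q x := by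
  simp [oddFun, sub_div]

theorem oddFun_C_mul (k : ℕ) (c : ℝ) (Q : ℝ[X]) (x : ℝ) :
    oddFun k (C c * Q) x = c * oddFun k Q x := by
  simp [oddFun, mul_div_assoc]

/-- A best approximation to `1` on `[a, 1]` by odd Laurent polynomials exists. -/
theorem exists_best_oddFun (k n : ℕ) {a : ℝ} (ha0 : 0 < a) (ha1 : a < 1) :
    ∃ Q : ℝ[X], Q.natDegree ≤ n ∧ ∃ L : ℝ, (∀ x ∈ Icc a 1, |1 - oddFun k Q x| ≤ L) ∧
      ∀ P : ℝ[X], P.natDegree ≤ n → ∃ x ∈ Icc a 1, L ≤ |1 - oddFun k P x| := by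
  have hne : Nonempty (Icc a 1) := ⟨⟨a, le_refl _, ha1.le⟩⟩
  let T : degreeLT ℝ (n + 1) →ₗ[ℝ] C(Icc a 1, ℝ) :=
    { toFun := fun Q => ⟨fun x => oddFun k Q.1 x.1,
        (continuousOn_oddFun Q.1 ha0).comp_continuous continuous_subtype_val (fun x => x.2)⟩
      map_add' := fun P Q => by ext x; simp [oddFun_add]
      map_smul' := fun c Q => by ext x; simp [oddFun, mul_div_assoc] }
  let V := LinearMap.range T
  have hfin : FiniteDimensional ℝ (degreeLT ℝ (n + 1)) :=
    Module.Finite.equiv (degreeLTEquiv ℝ (n + 1)).symm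
  have : FiniteDimensional ℝ V := by infer_instance
  -- Functions of norm above 2 are farther than 1 from the constant 1, worse than the zero function,
  -- so a minimizer over this compact ball is a global one.
  let K : Set C(Icc a 1, ℝ) := (V : Set C(Icc a 1, ℝ)) ∩ Metric.closedBall 0 2
  have hK : IsCompact K := by
    have : ProperSpace V := FiniteDimensional.proper_real V
    have h1 := (isCompact_closedBall (0 : V) 2).image continuous_subtype_val
    suffices h2 : K = Subtype.val '' Metric.closedBall (0 : V) 2 by rw [h2]; exact h1
    ext f
    simp only [K, mem_inter_iff, SetLike.mem_coe, Metric.mem_closedBall, dist_zero_right, mem_image,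
      Subtype.exists]
    constructor
    · rintro ⟨h, h'⟩; exact ⟨f, h, h', rfl⟩
    · rintro ⟨g, h, h', rfl⟩; exact ⟨h, h'⟩
  obtain ⟨f, hf, hmin⟩ := hK.exists_isMinOn ⟨0, V.zero_mem, by simp⟩
    (f := fun f : C(Icc a 1, ℝ) => ‖1 - f‖) (by fun_prop)
  obtain ⟨Q, rfl⟩ := hf.1
  refine ⟨Q.1, ?_, ‖1 - T Q‖, fun x hx => ?_,
    fun P hP => ?_⟩
  · have := mem_degreeLT.1 Q.2
    rw [← Nat.lt_succ_iff]
    by_cases h0 : Q.1 = 0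
    · rw [h0]; simp
    · exact (natDegree_lt_iff_degree_lt h0).2 this
  · exact (1 - T Q).norm_coe_le_norm ⟨x, hx⟩
  · set P' : degreeLT ℝ (n + 1) := ⟨P, mem_degreeLT.2 (lt_of_le_of_lt
      (degree_le_of_natDegree_le hP) (by exact_mod_cast Nat.lt_succ_self n))⟩
    have hle : ‖1 - T Q‖ ≤ ‖1 - T P'‖ := by
      by_cases hPK : T P' ∈ K
      · exact isMinOn_iff.1 hmin _ hPK
      · have h1 : 2 < ‖T P'‖ := by
          by_contra h
          push Not at h
          exact hPK ⟨⟨P', rfl⟩, by simpa using h⟩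
        have h2 := isMinOn_iff.1 hmin 0 ⟨V.zero_mem, by simp⟩
        have h3 : ‖(1 : C(Icc a 1, ℝ))‖ ≤ 1 := by
          rw [ContinuousMap.norm_le _ zero_le_one]; intro x; simp
        have h4 : ‖T P'‖ ≤ ‖1 - T P'‖ + ‖(1 : C(Icc a 1, ℝ))‖ := by
          have := norm_sub_le (1 : C(Icc a 1, ℝ)) (1 - T P')
          rw [sub_sub_cancel] at this; linarith
        simp only [sub_zero] at h2
        linarith
    obtain ⟨x, hx⟩ : ∃ x, ‖(1 - T P') x‖ = ‖1 - T P'‖ := by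
      obtain ⟨x, -, hx⟩ := isCompact_univ.exists_isMaxOn (univ_nonempty (α := Icc a 1))
        (f := fun x => ‖(1 - T P') x‖) (by fun_prop)
      refine ⟨x, le_antisymm (ContinuousMap.norm_coe_le_norm _ x) ?_⟩
      rw [ContinuousMap.norm_le _ (norm_nonneg _)]
      exact fun y => isMaxOn_iff.1 hx y (mem_univ y)
    exact ⟨x.1, x.2, hle.trans (le_of_eq hx.symm)⟩

/-- The data of an odd Laurent polynomial whose deviation from `1` on `[a, 1]` equioscillates
between the values `±L` at the maximal number of points. -/
structure IsAlternant (k n : ℕ) (a L σ c : ℝ) (Q : ℝ[X]) (x : ℕ → ℝ) : Prop where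
  deg : Q.natDegree ≤ n
  L_pos : 0 < L
  L_lt_one : L < 1
  mono : ∀ i j, i < j → j ≤ n + 1 → x i < x j
  left : x 0 = a
  right : x (n + 1) = 1
  bound : ∀ y ∈ Icc a 1, |1 - oddFun k Q y| ≤ L
  sign : σ = 1 ∨ σ = -1
  alt : ∀ i ≤ n + 1, 1 - oddFun k Q (x i) = σ * (-1) ^ i * L
  c_ne : c ≠ 0
  deriv : derivPoly k Q = C c * ∏ i ∈ Finset.Ico 1 (n + 1), (X - C (x i ^ 2))

theorem coeff_expand_two_odd (Q : ℝ[X]) {j : ℕ} (hj : Odd j) : (expand ℝ 2 Q).coeff j = 0 := by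
  rw [coeff_expand (by norm_num), if_neg]
  rintro ⟨l, rfl⟩
  exact (Nat.not_odd_iff_even.2 (even_two_mul l)) hj

/-- Chebyshev's theorem in the variable x². With fewer than n + 2 extremal points, or two neighbours
of equal sign, a polynomial with the sign of the deviation at all of them would improve Q. More than
n + 2 are impossible, because interior ones are zeros of `derivPoly k Q`. -/
theorem exists_isAlternant {k n : ℕ} (hk : 1 ≤ k) (hkn : k ≤ n) {a : ℝ} (ha0 : 0 < a)
    (ha1 : a < 1) : ∃ L σ c Q x, IsAlternant k n a L σ c Q x := by
  classical
  obtain ⟨Q, hdeg, L, hbound, hbest⟩ := exists_best_oddFun k n ha0 ha1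
  -- The competitor f(x) = x, that is Q = X^k, is admissible because k ≤ n, and its error is below
  -- 1.
  have hL1 : L < 1 := by
    obtain ⟨x, hx, hxL⟩ := hbest (X ^ k) (by rw [natDegree_X_pow]; exact hkn)
    have hx0 : 0 < x := by have := hx.1; linarith
    have : oddFun k (X ^ k) x = x := by
      simp only [oddFun, eval_pow, eval_X]
      rw [← pow_mul, div_eq_iff (pow_ne_zero _ hx0.ne'), ← pow_succ']
      congr 1; omega
    rw [this, abs_of_nonneg (by have := hx.2; linarith)] at hxL
    have := hx.1; linarith
  have hL0' : 0 ≤ L := (abs_nonneg _).trans (hbound a ⟨le_refl _, ha1.le⟩)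
  have hL0 : 0 < L := by
    refine hL0'.lt_of_ne fun h0 => ?_
    -- L = 0 would force the even polynomial Q(x²) to equal the odd monomial x^{2k-1}.
    have h1 : expand ℝ 2 Q - X ^ (2 * k - 1) = 0 := by
      refine eq_zero_of_infinite_isRoot _ ((Icc_infinite ha1).mono fun x hx => ?_)
      have h2 := hbound x hx
      rw [← h0] at h2
      have h3 := abs_eq_zero.1 (le_antisymm h2 (abs_nonneg _))
      have hx0 : x ≠ 0 := by have := hx.1; intro h; linarith
      have h4 : oddFun k Q x = 1 := by linarith
      rw [oddFun, div_eq_one_iff_eq (pow_ne_zero _ hx0)] at h4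
      simp only [mem_ofPred_eq, IsRoot.def, eval_sub, expand_eval, h4, eval_pow, eval_X, sub_self]
    have h2 := congrArg (fun p => coeff p (2 * k - 1)) h1
    simp only [coeff_sub, coeff_X_pow, if_true, coeff_zero] at h2
    rw [coeff_expand_two_odd Q ⟨k - 1, by omega⟩] at h2
    norm_num at h2
  have hQ0 : Q ≠ 0 := by
    rintro rfl
    have := hbound a ⟨le_refl _, ha1.le⟩
    simp [oddFun] at this
    linarith
  have hR0 := derivPoly_ne_zero k hQ0
  have hRdeg := natDegree_derivPoly_le k hdeg
  set R := derivPoly k Q with hR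
  have hcont := continuousOn_oddFun (k := k) Q ha0
  -- interior extremal points are critical
  have hcrit : ∀ x ∈ Ioo a 1, |1 - oddFun k Q x| = L → R.eval (x ^ 2) = 0 := by
    intro x hx hxL
    have hx0 : x ≠ 0 := by have := hx.1; intro h; linarith
    have hd := hasDerivAt_oddFun hk Q hx0
    have hnhds : Icc a 1 ∈ nhds x := Icc_mem_nhds hx.1 hx.2
    have hext : IsLocalExtr (oddFun k Q) x := by
      rcases abs_eq hL0' |>.1 hxL with h | h
      · left
        filter_upwards [hnhds] with y hy
        have := (abs_le.1 (hbound y hy)).2; linarith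
      · right
        filter_upwards [hnhds] with y hy
        have := (abs_le.1 (hbound y hy)).1; linarith
    have := hext.hasDerivAt_eq_zero hd
    rwa [div_eq_zero_iff, or_iff_left (pow_ne_zero _ hx0)] at this
  set Z : Finset ℝ := (R.roots.toFinset.image Real.sqrt).filter (fun x => x ∈ Ioo a 1) with hZ
  have hZcard : Z.card ≤ n := by
    refine (Finset.card_filter_le _ _).trans (Finset.card_image_le.trans ?_)
    exact (Multiset.toFinset_card_le _).trans ((card_roots' R).trans hRdeg)
  have hmemZ : ∀ x ∈ Ioo a 1, R.eval (x ^ 2) = 0 → x ∈ Z := by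
    intro x hx h
    rw [hZ, Finset.mem_filter, Finset.mem_image]
    refine ⟨⟨x ^ 2, ?_, Real.sqrt_sq (by have := hx.1; linarith)⟩, hx⟩
    rw [Multiset.mem_toFinset, mem_roots hR0]; exact h
  set E : Finset ℝ := (insert a (insert 1 Z)).filter (fun x => |1 - oddFun k Q x| = L) with hE
  have hEsub : ∀ x ∈ E, x ∈ Icc a 1 := by
    intro x hx
    rw [hE, Finset.mem_filter, Finset.mem_insert, Finset.mem_insert, hZ, Finset.mem_filter] at hx
    rcases hx.1 with h | h | h
    · rw [h]; exact ⟨le_refl _, ha1.le⟩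
    · rw [h]; exact ⟨ha1.le, le_refl _⟩
    · exact ⟨h.2.1.le, h.2.2.le⟩
  have hmemE : ∀ x ∈ Icc a 1, |1 - oddFun k Q x| = L → x ∈ E := by
    intro x hx h
    rw [hE, Finset.mem_filter, Finset.mem_insert, Finset.mem_insert]
    refine ⟨?_, h⟩
    rcases hx.1.eq_or_lt with h1 | h1
    · exact Or.inl h1.symm
    rcases hx.2.eq_or_lt with h2 | h2
    · exact Or.inr (Or.inl h2)
    · exact Or.inr (Or.inr (hmemZ x ⟨h1, h2⟩ (hcrit x ⟨h1, h2⟩ h)))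
  have hEval : ∀ x ∈ E, |1 - oddFun k Q x| = L := fun x hx => (Finset.mem_filter.1 hx).2
  have hEne : ∀ x ∈ E, 1 - oddFun k Q x ≠ 0 := fun x hx h => by
    have := hEval x hx; rw [h, abs_zero] at this; linarith
  -- no polynomial has the sign of the deviation at all extremal points
  have hnop : ¬ ∃ p : ℝ[X], p.natDegree ≤ n ∧ ∀ x ∈ E, 0 < (1 - oddFun k Q x) * p.eval (x ^ 2) := by
    rintro ⟨p, hp, hpos⟩
    obtain ⟨ε, hε⟩ := exists_perturbation (K := Icc a 1) isCompact_Icc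
      (g := fun x => 1 - oddFun k Q x) (q := oddFun k p)
      (continuousOn_const.sub hcont) (continuousOn_oddFun p ha0) hbound (by
        intro x hx h
        have hx0 : 0 < x := by have := hx.1; linarith
        rw [oddFun.eq_def k p x, ← mul_div_assoc]
        exact div_pos (hpos x (hmemE x hx h)) (pow_pos hx0 _))
    obtain ⟨x, hx, hxL⟩ := hbest (Q + C ε * p) (natDegree_add_le_of_degree_le hdeg
      ((natDegree_C_mul_le ε p).trans hp))
    have := hε x hx
    rw [oddFun_add, oddFun_C_mul, ← sub_sub] at hxL
    linarith
  have hsqinj : Set.InjOn (fun x : ℝ => x ^ 2) (E : Set ℝ) := by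
    intro x hx y hy hxy
    have h1 := (hEsub x hx).1
    have h2 := (hEsub y hy).1
    exact (sq_eq_sq₀ (by linarith) (by linarith)).1 hxy
  -- If there were fewer points, interpolating the deviation itself on them would give a polynomial
  -- of degree at most n contradicting `hnop`.
  have hEcard : E.card = n + 2 := by
    have hle : E.card ≤ n + 2 := by
      refine (Finset.card_filter_le _ _).trans ((Finset.card_insert_le _ _).trans ?_)
      have := Finset.card_insert_le (1 : ℝ) Z
      omega
    by_contra hne
    have hlt : E.card < n + 2 := lt_of_le_of_ne hle hne
    apply hnop
    refine ⟨Lagrange.interpolate E (fun x => x ^ 2) (fun x => 1 - oddFun k Q x), ?_, ?_⟩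
    · have := Lagrange.degree_interpolate_lt (fun x => 1 - oddFun k Q x) hsqinj
      rw [natDegree_le_iff_coeff_eq_zero]
      intro j hj
      exact coeff_eq_zero_of_degree_lt (this.trans_le (by exact_mod_cast (by omega : E.card ≤ j)))
    · intro x hx
      rw [Lagrange.eval_interpolate_at_node (fun x => 1 - oddFun k Q x) hsqinj hx]
      exact mul_self_pos.2 (hEne x hx)
  set x : ℕ → ℝ := fun i => if h : i < n + 2 then E.orderEmbOfFin hEcard ⟨i, h⟩ else 0 with hx
  have hxmem : ∀ i ≤ n + 1, x i ∈ E := fun i hi => by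
    simp only [hx]; rw [dif_pos (by omega)]; exact E.orderEmbOfFin_mem hEcard _
  have hmono : ∀ i j, i < j → j ≤ n + 1 → x i < x j := by
    intro i j hij hj
    simp only [hx]
    rw [dif_pos (by omega), dif_pos (by omega)]
    exact (E.orderEmbOfFin hEcard).strictMono hij
  have hxsurj : ∀ y ∈ E, ∃ i ≤ n + 1, x i = y := by
    intro y hy
    have : y ∈ Set.range (E.orderEmbOfFin hEcard) := by rw [Finset.range_orderEmbOfFin]; exact hy
    obtain ⟨i, rfl⟩ := this
    refine ⟨i, by omega, ?_⟩
    simp only [hx]; rw [dif_pos i.2]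
  have hEeq : E = insert a (insert 1 Z) := by
    refine Finset.eq_of_subset_of_card_le (Finset.filter_subset _ _) ?_
    rw [hEcard]
    have h1 := Finset.card_insert_le a (insert 1 Z)
    have h2 := Finset.card_insert_le (1 : ℝ) Z
    omega
  have haE : a ∈ E := by rw [hEeq]; simp
  have h1E : (1 : ℝ) ∈ E := by rw [hEeq]; simp
  have hleft : x 0 = a := by
    obtain ⟨i, hi, hia⟩ := hxsurj a haE
    rcases Nat.eq_zero_or_pos i with rfl | hi0
    · exact hia
    · have h1 := hmono 0 i hi0 hi
      have h2 := (hEsub _ (hxmem 0 (by omega))).1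
      linarith
  have hright : x (n + 1) = 1 := by
    obtain ⟨i, hi, hia⟩ := hxsurj 1 h1E
    rcases hi.eq_or_lt with rfl | hi0
    · exact hia
    · have h1 := hmono i (n + 1) hi0 le_rfl
      have h2 := (hEsub _ (hxmem (n + 1) le_rfl)).2
      linarith
  have hmono2 : ∀ i j, i < j → j ≤ n + 1 → x i ^ 2 < x j ^ 2 := by
    intro i j hij hj
    have h1 := (hEsub _ (hxmem i (by omega))).1
    have := hmono i j hij hj
    exact pow_lt_pow_left₀ this (by linarith) two_ne_zero
  set e : ℕ → ℝ := fun i => 1 - oddFun k Q (x i) with he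
  have halt : ∀ i ≤ n, e (i + 1) = - e i := by
    intro i hi
    have h1 := hEval _ (hxmem i (by omega))
    have h2 := hEval _ (hxmem (i + 1) (by omega))
    rcases (abs_eq_abs.1 (h2.trans h1.symm)) with h | h
    · exfalso
      apply hnop
      have h3 : 0 < e i * e (i + 1) := by
        simp only [he]; rw [h]; exact mul_self_pos.2 (hEne _ (hxmem i (by omega)))
      obtain ⟨p, hp, hpe⟩ := exists_same_sign_of_not_alternating hmono2
        (fun j hj => hEne _ (hxmem j hj)) hi h3
      refine ⟨p, hp, fun y hy => ?_⟩
      obtain ⟨j, hj, rfl⟩ := hxsurj y hy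
      exact hpe j hj
    · exact h
  have hzero : ∀ i ∈ Finset.Ico 1 (n + 1), R.eval (x i ^ 2) = 0 := by
    intro i hi
    rw [Finset.mem_Ico] at hi
    refine hcrit _ ⟨?_, ?_⟩ (hEval _ (hxmem i (by omega)))
    · rw [← hleft]; exact hmono 0 i (by omega) (by omega)
    · rw [← hright]; exact hmono i (n + 1) (by omega) le_rfl
  -- R has degree at most n and vanishes at n distinct squares, so it is a multiple of the nodal
  -- polynomial.
  obtain ⟨c, hc⟩ : ∃ c, R = C c * ∏ i ∈ Finset.Ico 1 (n + 1), (X - C (x i ^ 2)) := by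
    set M := ∏ i ∈ Finset.Ico 1 (n + 1), (X - C (x i ^ 2)) with hM
    have hMm : M.Monic := monic_prod_X_sub_C _ _
    have hMd : M.natDegree = n := by
      rw [hM, natDegree_finsetProd_X_sub_C_eq_card]; simp
    have hinj : Set.InjOn (fun i => x i ^ 2) (Finset.Ico 1 (n + 1) : Finset ℕ) := by
      intro i hi j hj hij
      simp only [Finset.coe_Ico, mem_Ico] at hi hj
      rcases lt_trichotomy i j with h | h | h
      · exact absurd hij (hmono2 i j h (by omega)).ne
      · exact h
      · exact absurd hij (hmono2 j i h (by omega)).ne'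
    refine ⟨R.coeff n, sub_eq_zero.1 ?_⟩
    refine eq_zero_of_degree_lt_of_eval_index_eq_zero (s := Finset.Ico 1 (n + 1))
      (v := fun i => x i ^ 2) hinj ?_ ?_
    · rw [Nat.card_Ico, Nat.add_sub_cancel, degree_lt_iff_coeff_zero]
      intro j hj
      rw [coeff_sub, coeff_C_mul]
      rcases Nat.eq_or_lt_of_le hj with h | h
      · rw [← h]
        have : M.coeff n = 1 := by rw [← hMd]; exact hMm.coeff_natDegree
        rw [this]; ring
      · rw [coeff_eq_zero_of_natDegree_lt (show R.natDegree < j by omega),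
          coeff_eq_zero_of_natDegree_lt (show M.natDegree < j by omega)]
        ring
    · intro i hi
      rw [eval_sub, hzero i hi, eval_mul, hM, eval_prod, Finset.prod_eq_zero hi (by simp)]
      simp
  obtain ⟨σ, hσ, hσ0⟩ : ∃ σ : ℝ, (σ = 1 ∨ σ = -1) ∧ e 0 = σ * L := by
    rcases (abs_eq hL0').1 (hEval _ (hxmem 0 (by omega))) with h | h
    · exact ⟨1, Or.inl rfl, by simpa [he] using h⟩
    · exact ⟨-1, Or.inr rfl, by simpa [he] using h⟩
  refine ⟨L, σ, c, Q, x, ⟨hdeg, hL0, hL1, hmono, hleft, hright, hbound, hσ, ?_, ?_, hc⟩⟩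
  · intro i
    induction i with
    | zero => intro _; simpa using hσ0
    | succ i ih =>
      intro hi
      have h1 := halt i (by omega)
      simp only [he] at h1
      rw [h1, ih (by omega)]; ring
  · rintro rfl
    exact hR0 (by rw [hc]; simp)

end SgnLaurent

end

noncomputable section
namespace SgnLaurent

open Polynomial Set

/-! ### Laurent polynomials and the extremal function -/

theorem IsAlternant.mem_Icc {k n : ℕ} {a L σ c : ℝ} {Q : ℝ[X]} {x : ℕ → ℝ}
    (h : IsAlternant k n a L σ c Q x) {i : ℕ} (hi : i ≤ n + 1) : x i ∈ Icc a 1 := by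
  constructor
  · rcases Nat.eq_zero_or_pos i with rfl | h0
    · exact h.left.ge
    · rw [← h.left]; exact (h.mono 0 i h0 hi).le
  · rcases hi.eq_or_lt with rfl | h0
    · exact h.right.le
    · rw [← h.right]; exact (h.mono i _ h0 le_rfl).le

theorem IsAlternant.sq_mono {k n : ℕ} {a L σ c : ℝ} {Q : ℝ[X]} {x : ℕ → ℝ}
    (h : IsAlternant k n a L σ c Q x) (ha0 : 0 < a) :
    ∀ i j, i < j → j ≤ n + 1 → x i ^ 2 < x j ^ 2 := by
  intro i j hij hj
  have h1 := (h.mem_Icc (show i ≤ n + 1 by omega)).1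
  exact pow_lt_pow_left₀ (h.mono i j hij hj) (by linarith) two_ne_zero

/-- Multiplication by the positive numbers x^{2k-1} reduces this to polynomials in x², to which
`eq_zero_of_weak_alternation` applies. -/
theorem eq_of_oddFun_weak_alternation {k n : ℕ} {x : ℕ → ℝ} (hx0 : ∀ i ≤ n + 1, 0 < x i)
    (hx : ∀ i j, i < j → j ≤ n + 1 → x i < x j) {P Q : ℝ[X]} (hP : P.natDegree ≤ n)
    (hQ : Q.natDegree ≤ n) {σ : ℝ} (hσ : σ = 1 ∨ σ = -1)
    (h : ∀ i ≤ n + 1, 0 ≤ σ * (-1) ^ i * (oddFun k P (x i) - oddFun k Q (x i))) : P = Q := by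
  have hσ0 : σ ≠ 0 := by rcases hσ with rfl | rfl <;> norm_num
  have hmono : ∀ i j, i < j → j ≤ n + 1 → x i ^ 2 < x j ^ 2 := fun i j hij hj =>
    pow_lt_pow_left₀ (hx i j hij hj) (hx0 i (by omega)).le two_ne_zero
  have h0 : C σ * (P - Q) = 0 := by
    refine eq_zero_of_weak_alternation hmono
      ((natDegree_C_mul_le _ _).trans ((natDegree_sub_le_of_le hP hQ).trans (max_self n).le)) fun i hi => ?_
    have h1 := h i hi
    rw [← oddFun_sub, oddFun, ← mul_div_assoc] at h1
    have h2 := (le_div_iff₀ (pow_pos (hx0 i hi) (2 * k - 1))).1 h1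
    rw [zero_mul] at h2
    rw [eval_mul, eval_C]
    linarith [h2]
  have := (mul_eq_zero.1 h0).resolve_left (by simpa using hσ0)
  exact sub_eq_zero.1 this

/-- De la Vallée-Poussin's lower bound. -/
theorem IsAlternant.le_of_alternation {k n : ℕ} {a L σ c : ℝ} {Q : ℝ[X]} {x : ℕ → ℝ}
    (h : IsAlternant k n a L σ c Q x) (ha0 : 0 < a) {P : ℝ[X]} (hP : P.natDegree ≤ n)
    {y : ℕ → ℝ} (hy : ∀ i j, i < j → j ≤ n + 1 → y i < y j) (hyI : ∀ i ≤ n + 1, y i ∈ Icc a 1)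
    {τ δ : ℝ} (hτ : τ = 1 ∨ τ = -1)
    (hδ : ∀ i ≤ n + 1, δ ≤ τ * (-1) ^ i * (1 - oddFun k P (y i))) : δ ≤ L := by
  by_contra hlt
  push Not at hlt
  have hsq : ∀ i, |τ * (-1) ^ i| = 1 := fun i => by
    rcases hτ with rfl | rfl <;> simp
  have hbd : ∀ i ≤ n + 1, τ * (-1) ^ i * (1 - oddFun k Q (y i)) ≤ L := fun i hi => by
    refine (le_abs_self _).trans ?_
    rw [abs_mul, hsq, one_mul]
    exact h.bound _ (hyI i hi)
  have hPQ : Q = P := by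
    refine eq_of_oddFun_weak_alternation (k := k) (fun i hi => ha0.trans_le (hyI i hi).1) hy h.deg
      hP hτ fun i hi => ?_
    have h1 := hδ i hi
    have h2 := hbd i hi
    nlinarith
  have h1 := hδ 0 (by omega)
  have h2 := hbd 0 (by omega)
  rw [hPQ] at h2
  linarith

/-- A competitor with error below L would differ from Q with weakly alternating signs at the nodes,
hence equal Q, whose error at the nodes is exactly L. -/
theorem IsAlternant.le_of_bound {k n : ℕ} {a L σ c : ℝ} {Q : ℝ[X]} {x : ℕ → ℝ}
    (h : IsAlternant k n a L σ c Q x) (ha0 : 0 < a) {P : ℝ[X]} (hP : P.natDegree ≤ n)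
    {δ : ℝ} (hδ : ∀ y ∈ Icc a 1, |1 - oddFun k P y| ≤ δ) : L ≤ δ := by
  by_contra hlt
  push Not at hlt
  have hs : ∀ i, (σ * (-1) ^ i) * (σ * (-1) ^ i) = 1 := fun i => by
    have : ((-1 : ℝ) ^ i) * (-1) ^ i = 1 := by rw [← pow_add, Even.neg_one_pow ⟨i, rfl⟩]
    rcases h.sign with rfl | rfl <;> linear_combination this
  have hsq : ∀ i, |σ * (-1) ^ i| = 1 := fun i => by
    rcases h.sign with rfl | rfl <;> simp
  have hbd : ∀ i ≤ n + 1, σ * (-1) ^ i * (1 - oddFun k P (x i)) ≤ δ := fun i hi => by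
    refine (le_abs_self _).trans ?_
    rw [abs_mul, hsq, one_mul]
    exact hδ _ (h.mem_Icc hi)
  have hPQ : P = Q := by
    refine eq_of_oddFun_weak_alternation (k := k) (fun i hi => ha0.trans_le (h.mem_Icc hi).1)
      h.mono hP h.deg h.sign fun i hi => ?_
    have h1 := congrArg (fun z => σ * (-1) ^ i * z) (h.alt i hi)
    beta_reduce at h1
    rw [← mul_assoc, hs, one_mul] at h1
    have h2 := hbd i hi
    nlinarith
  have h1 := h.alt 0 (by omega)
  have h2 := hδ (x 0) (h.mem_Icc (by omega))
  rw [hPQ, h1, abs_mul, hsq, one_mul, abs_of_pos h.L_pos] at h2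
  linarith

theorem isLaurentPoly_zpow {l n : ℕ} {j : ℤ} (hj : j ∈ Finset.Icc (-(l : ℤ)) n) :
    IsLaurentPoly l n (fun x => x ^ j) :=
  ⟨fun i => if i = j then 1 else 0, fun x => by simp [Finset.sum_ite_eq', ite_mul, hj]⟩

theorem IsLaurentPoly.const_mul {l n : ℕ} {f : ℝ → ℝ} (hf : IsLaurentPoly l n f) (c : ℝ) :
    IsLaurentPoly l n (fun x => c * f x) := by
  obtain ⟨b, hb⟩ := hf
  exact ⟨fun i => c * b i, fun x => by simp only [hb, Finset.mul_sum, mul_assoc]⟩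

theorem isLaurentPoly_sum {l n : ℕ} {ι : Type*} (s : Finset ι) {f : ι → ℝ → ℝ}
    (hf : ∀ i ∈ s, IsLaurentPoly l n (f i)) : IsLaurentPoly l n (fun x => ∑ i ∈ s, f i x) := by
  classical
  choose! b hb using hf
  refine ⟨fun j => ∑ i ∈ s, b i j, fun x => ?_⟩
  simp only [Finset.sum_mul]
  rw [Finset.sum_comm]
  exact Finset.sum_congr rfl fun i hi => hb i hi x

theorem isLaurentPoly_oddFun {k m : ℕ} (hk : 1 ≤ k) (hm : 1 ≤ m) {Q : ℝ[X]}
    (hQ : Q.natDegree ≤ m + k - 1) :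
    IsLaurentPoly (2 * k - 1) (2 * m - 1) (oddFun k Q) := by
  have h : oddFun k Q = fun x => ∑ i ∈ Finset.range (m + k),
      Q.coeff i * x ^ (2 * (i : ℤ) - (2 * k - 1)) := by
    ext x
    rw [oddFun, eval_eq_sum_range' (show Q.natDegree < m + k by omega), Finset.sum_div]
    refine Finset.sum_congr rfl fun i _ => ?_
    rw [mul_div_assoc]
    congr 1
    rcases eq_or_ne x 0 with rfl | hx
    · rw [zero_pow (show 2 * k - 1 ≠ 0 by omega), div_zero, zero_zpow _ (by omega)]
    · rw [zpow_sub₀ hx, ← pow_mul, show (2 * (k : ℤ) - 1) = ((2 * k - 1 : ℕ) : ℤ) by omega,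
        zpow_natCast, show (2 * (i : ℤ)) = ((2 * i : ℕ) : ℤ) by push_cast; ring, zpow_natCast]
  rw [h]
  refine isLaurentPoly_sum _ fun i hi => (isLaurentPoly_zpow ?_).const_mul _
  rw [Finset.mem_range] at hi
  rw [Finset.mem_Icc]
  omega

theorem sum_range_two_mul_add_one (g : ℕ → ℝ) (n : ℕ) :
    ∑ l ∈ Finset.range (2 * n + 1), g l
      = ∑ i ∈ Finset.range (n + 1), g (2 * i) + ∑ i ∈ Finset.range n, g (2 * i + 1) := by
  induction n with
  | zero => simp
  | succ n ih =>
    rw [show 2 * (n + 1) + 1 = 2 * n + 1 + 1 + 1 by ring, Finset.sum_range_succ,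
      Finset.sum_range_succ, ih, Finset.sum_range_succ _ (n + 1),
      Finset.sum_range_succ (fun i => g (2 * i + 1)) n]
    ring_nf

/-- Exponents are sorted by parity. The value at 0 is recorded separately because 0 ^ j = 0 for
every j ≠ 0, negative ones included, and uniqueness of the extremal function is claimed at every
real point. -/
theorem IsLaurentPoly.exists_odd_even {k m : ℕ} (hk : 1 ≤ k) (hm : 1 ≤ m) {f : ℝ → ℝ}
    (hf : IsLaurentPoly (2 * k - 1) (2 * m - 1) f) :
    ∃ E O : ℝ[X], E.natDegree ≤ m + k - 1 ∧ O.natDegree ≤ m + k - 1 ∧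
      (∀ x ≠ 0, f x = oddFun k E x + O.eval (x ^ 2) / x ^ (2 * k - 2)) ∧ f 0 = O.coeff (k - 1) := by
  obtain ⟨c, hc⟩ := hf
  set n := m + k - 1 with hn
  set E : ℝ[X] := ∑ i ∈ Finset.range (n + 1), C (c (2 * (i : ℤ) - (2 * k - 1))) * X ^ i with hE
  set O : ℝ[X] := ∑ i ∈ Finset.range n, C (c (2 * (i : ℤ) + 1 - (2 * k - 1))) * X ^ i with hO
  refine ⟨E, O, ?_, ?_, fun x hx => ?_, ?_⟩
  · refine natDegree_sum_le_of_forall_le _ _ fun i hi => (natDegree_C_mul_X_pow_le _ _).trans ?_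
    have := Finset.mem_range.1 hi; omega
  · refine natDegree_sum_le_of_forall_le _ _ fun i hi => (natDegree_C_mul_X_pow_le _ _).trans ?_
    have := Finset.mem_range.1 hi; omega
  · have hre : ∑ j ∈ Finset.Icc (-((2 * k - 1 : ℕ) : ℤ)) ((2 * m - 1 : ℕ) : ℤ), c j * x ^ j
        = ∑ l ∈ Finset.range (2 * n + 1), c ((l : ℤ) - (2 * k - 1)) * x ^ ((l : ℤ) - (2 * k - 1)) := by
      symm
      refine Finset.sum_nbij (fun l => (l : ℤ) - (2 * k - 1)) ?_ ?_ ?_ fun _ _ => rfl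
      · intro l hl; rw [Finset.mem_range] at hl; rw [Finset.mem_Icc]; omega
      · intro l _ l' _ h; simp only at h; omega
      · intro j hj
        rw [Finset.coe_Icc, mem_Icc] at hj
        refine ⟨(j + (2 * k - 1)).toNat, ?_, ?_⟩
        · rw [Finset.coe_range, mem_Iio]; omega
        · simp only; omega
    rw [hc, hre, sum_range_two_mul_add_one, oddFun, hE, hO, eval_finsetSum, eval_finsetSum,
      Finset.sum_div, Finset.sum_div]
    congr 1
    · refine Finset.sum_congr rfl fun i _ => ?_
      simp only [eval_mul, eval_C, eval_pow, eval_X]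
      push_cast
      rw [mul_div_assoc, zpow_sub₀ hx, ← pow_mul,
        show (2 * (k : ℤ) - 1) = ((2 * k - 1 : ℕ) : ℤ) by omega, zpow_natCast,
        show (2 * (i : ℤ)) = ((2 * i : ℕ) : ℤ) by push_cast; ring, zpow_natCast]
    · refine Finset.sum_congr rfl fun i _ => ?_
      simp only [eval_mul, eval_C, eval_pow, eval_X]
      push_cast
      rw [mul_div_assoc]
      congr 1
      rw [show (2 * (i : ℤ) + 1 - (2 * k - 1)) = ((2 * i : ℕ) : ℤ) - ((2 * k - 2 : ℕ) : ℤ) by omega,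
        zpow_sub₀ hx, zpow_natCast, zpow_natCast, pow_mul]
  · rw [hc]
    have h0 : ∀ j : ℤ, c j * (0 : ℝ) ^ j = if j = 0 then c 0 else 0 := fun j => by
      split_ifs with h
      · subst h; simp
      · rw [zero_zpow _ h, mul_zero]
    simp only [h0]
    rw [Finset.sum_ite_eq', if_pos (by rw [Finset.mem_Icc]; omega), hO, finsetSum_coeff]
    simp only [coeff_C_mul, coeff_X_pow, mul_ite, mul_one, mul_zero]
    rw [Finset.sum_ite_eq, if_pos (by rw [Finset.mem_range]; omega)]
    congr 1; omega

theorem mem_twoIntervals_of_Icc {a x : ℝ} (ha0 : 0 < a) (hx : x ∈ Icc a 1) :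
    x ∈ twoIntervals a ∧ -x ∈ twoIntervals a := by
  have : |x| = x := abs_of_pos (ha0.trans_le hx.1)
  simp only [twoIntervals, mem_ofPred_eq, abs_neg, this]
  exact ⟨⟨hx.1, hx.2⟩, ⟨hx.1, hx.2⟩⟩

/-- Without this bound the `sSup` in `sgnDist` would take its default value and control nothing. -/
theorem IsLaurentPoly.bddAbove {k m : ℕ} (hk : 1 ≤ k) (hm : 1 ≤ m) {a : ℝ} (ha0 : 0 < a)
    {f : ℝ → ℝ} (hf : IsLaurentPoly (2 * k - 1) (2 * m - 1) f) :
    BddAbove ((fun x => |f x - Real.sign x|) '' twoIntervals a) := by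
  obtain ⟨E, O, -, -, hfx, -⟩ := hf.exists_odd_even hk hm
  have hne : ∀ x ∈ twoIntervals a, x ≠ 0 := fun x hx h => by
    rw [twoIntervals, mem_ofPred_eq, h, abs_zero] at hx; linarith [hx.1]
  have hcomp : IsCompact (twoIntervals a) := by
    refine Metric.isCompact_of_isClosed_isBounded ?_ ?_
    · exact (isClosed_le continuous_const continuous_abs).inter
        (isClosed_le continuous_abs continuous_const)
    · refine (Metric.isBounded_closedBall (x := (0 : ℝ)) (r := 1)).subset fun x hx => ?_
      simpa using hx.2
  have hcont : ContinuousOn f (twoIntervals a) := by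
    refine ContinuousOn.congr (f := fun x => oddFun k E x + O.eval (x ^ 2) / x ^ (2 * k - 2))
      ?_ fun x hx => hfx x (hne x hx)
    unfold oddFun
    refine ContinuousOn.add ?_ ?_
    · exact ContinuousOn.div (by fun_prop) (by fun_prop) fun x hx => pow_ne_zero _ (hne x hx)
    · exact ContinuousOn.div (by fun_prop) (by fun_prop) fun x hx => pow_ne_zero _ (hne x hx)
  obtain ⟨M, hM⟩ := hcomp.exists_bound_of_continuousOn hcont
  refine ⟨M + 1, ?_⟩
  rintro _ ⟨x, hx, rfl⟩
  have h1 : |Real.sign x| ≤ 1 := by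
    rcases Real.sign_apply_eq x with h | h | h <;> rw [h] <;> norm_num
  exact (abs_sub _ _).trans (add_le_add (hM x hx) h1)

theorem oddFun_neg {k : ℕ} (hk : 1 ≤ k) (Q : ℝ[X]) (x : ℝ) : oddFun k Q (-x) = - oddFun k Q x := by
  rw [oddFun, oddFun, neg_sq, Odd.neg_pow ⟨k - 1, by omega⟩, div_neg]

/-- The alternant is the only Laurent polynomial with deviation at most `L`. -/
theorem IsAlternant.eq_of_sgnDist_le {k m : ℕ} (hk : 1 ≤ k) (hm : 1 ≤ m) {a L σ c : ℝ} {Q : ℝ[X]}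
    {x : ℕ → ℝ} (h : IsAlternant k (m + k - 1) a L σ c Q x) (ha0 : 0 < a) {f : ℝ → ℝ}
    (hf : IsLaurentPoly (2 * k - 1) (2 * m - 1) f) (hfL : sgnDist a f ≤ L) : f = oddFun k Q := by
  obtain ⟨E, O, hE, hO, hfx, hf0⟩ := hf.exists_odd_even hk hm
  have hb := hf.bddAbove hk hm ha0
  have hle : ∀ y ∈ twoIntervals a, |f y - Real.sign y| ≤ L := fun y hy =>
    (le_csSup hb (mem_image_of_mem _ hy)).trans hfL
  have hpos : ∀ i ≤ m + k - 1 + 1, 0 < x i := fun i hi => ha0.trans_le (h.mem_Icc hi).1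
  set o : ℝ → ℝ := fun x => O.eval (x ^ 2) / x ^ (2 * k - 2) with ho
  have hoe : ∀ y, o (-y) = o y := fun y => by
    simp only [ho]; rw [neg_sq, Even.neg_pow ⟨k - 1, by omega⟩]
  -- The bounds at x i and at -x i contain the even part o with opposite signs, so their mean bounds
  -- the odd part alone.
  have key : ∀ i ≤ m + k - 1 + 1, |1 - oddFun k E (x i) - o (x i)| ≤ L ∧
      |1 - oddFun k E (x i) + o (x i)| ≤ L := by
    intro i hi
    have hxi := hpos i hi
    obtain ⟨h1, h2⟩ := mem_twoIntervals_of_Icc ha0 (h.mem_Icc hi)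
    have h3 := hle _ h1
    have h4 := hle _ h2
    rw [hfx _ hxi.ne', Real.sign_of_pos hxi, abs_sub_comm] at h3
    rw [hfx _ (neg_ne_zero.2 hxi.ne'), Real.sign_of_neg (by linarith), oddFun_neg hk] at h4
    have h5 := hoe (x i)
    simp only [ho] at h5
    rw [h5] at h4
    constructor
    · convert h3 using 2; simp only [ho]; ring
    · convert h4 using 2; simp only [ho]; ring
  have hs : ∀ i, (σ * (-1) ^ i) * (σ * (-1) ^ i) = 1 := fun i => by
    have : ((-1 : ℝ) ^ i) * (-1) ^ i = 1 := by rw [← pow_add, Even.neg_one_pow ⟨i, rfl⟩]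
    rcases h.sign with rfl | rfl <;> linear_combination this
  have hsq : ∀ i, |σ * (-1) ^ i| = 1 := fun i => by
    rcases h.sign with rfl | rfl <;> simp
  have hEQ : E = Q := by
    refine eq_of_oddFun_weak_alternation (k := k) hpos h.mono hE h.deg h.sign fun i hi => ?_
    have h1 := congrArg (fun z => σ * (-1) ^ i * z) (h.alt i hi)
    beta_reduce at h1
    rw [← mul_assoc, hs, one_mul] at h1
    have h2 : σ * (-1) ^ i * (1 - oddFun k E (x i)) ≤ L := by
      refine (le_abs_self _).trans ?_
      rw [abs_mul, hsq, one_mul]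
      obtain ⟨h3, h4⟩ := key i hi
      rw [abs_le] at h3 h4 ⊢
      constructor <;> linarith
    nlinarith
  -- Once E = Q, the odd part already deviates by exactly ±L at every node, so the even part must
  -- vanish at n + 2 points.
  have hO0 : O = 0 := by
    refine eq_zero_of_weak_alternation (h.sq_mono ha0) hO fun i hi => ?_
    obtain ⟨h3, h4⟩ := key i hi
    rw [hEQ, h.alt i hi] at h3 h4
    have h5 : o (x i) = 0 := by
      rw [abs_le] at h3 h4
      have h6 : σ * (-1) ^ i = 1 ∨ σ * (-1) ^ i = -1 := by
        have := hsq i; rwa [abs_eq (by norm_num)] at this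
      rcases h6 with h6 | h6 <;> rw [h6] at h3 h4 <;> linarith
    simp only [ho] at h5
    rw [div_eq_zero_iff, or_iff_left (pow_ne_zero _ (hpos i hi).ne')] at h5
    rw [h5, mul_zero]
  ext y
  rcases eq_or_ne y 0 with rfl | hy
  · rw [hf0, hO0, oddFun, zero_pow (by omega : 2 * k - 1 ≠ 0), div_zero, coeff_zero]
  · rw [hfx y hy, hEQ, hO0]; simp

theorem IsAlternant.sgnDist_eq {k m : ℕ} (hk : 1 ≤ k) (hm : 1 ≤ m) {a L σ c : ℝ} {Q : ℝ[X]}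
    {x : ℕ → ℝ} (h : IsAlternant k (m + k - 1) a L σ c Q x) (ha0 : 0 < a) :
    sgnDist a (oddFun k Q) = L := by
  have hb := (isLaurentPoly_oddFun hk hm h.deg).bddAbove hk hm ha0
  obtain ⟨h1, -⟩ := mem_twoIntervals_of_Icc ha0 (h.mem_Icc (show 0 ≤ m + k - 1 + 1 by omega))
  refine le_antisymm (csSup_le ⟨_, mem_image_of_mem _ h1⟩ ?_) ?_
  · rintro _ ⟨y, hy, rfl⟩
    rcases lt_trichotomy y 0 with h0 | h0 | h0
    · have h2 := h.bound (-y) ⟨by rw [← abs_of_neg h0]; exact hy.1,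
        by rw [← abs_of_neg h0]; exact hy.2⟩
      rw [oddFun_neg hk] at h2
      simp only [Real.sign_of_neg h0]
      rw [show oddFun k Q y - -1 = 1 - -oddFun k Q y by ring]
      exact h2
    · rw [h0, twoIntervals, mem_ofPred_eq, abs_zero] at hy
      linarith [hy.1]
    · have h2 := h.bound y ⟨by rw [← abs_of_pos h0]; exact hy.1,
        by rw [← abs_of_pos h0]; exact hy.2⟩
      simp only [Real.sign_of_pos h0]
      rwa [abs_sub_comm]
  · have h2 := le_csSup hb (mem_image_of_mem _ h1)
    refine le_trans (le_of_eq ?_) h2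
    have h3 := h.alt 0 (by omega)
    simp only [Real.sign_of_pos (ha0.trans_le (h.mem_Icc (show 0 ≤ m + k - 1 + 1 by omega)).1)]
    rw [abs_sub_comm, h3]
    rcases h.sign with rfl | rfl <;> simp [abs_of_pos h.L_pos]

theorem IsAlternant.bestError_eq {k m : ℕ} (hk : 1 ≤ k) (hm : 1 ≤ m) {a L σ c : ℝ} {Q : ℝ[X]}
    {x : ℕ → ℝ} (h : IsAlternant k (m + k - 1) a L σ c Q x) (ha0 : 0 < a) :
    bestError k m a = L := by
  have hLQ := isLaurentPoly_oddFun hk hm h.deg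
  have hlow : ∀ f, IsLaurentPoly (2 * k - 1) (2 * m - 1) f → L ≤ sgnDist a f := by
    intro f hf
    by_contra hlt
    push Not at hlt
    rw [h.eq_of_sgnDist_le hk hm ha0 hf hlt.le, h.sgnDist_eq hk hm ha0] at hlt
    exact lt_irrefl _ hlt
  have hmem : sgnDist a (oddFun k Q) ∈
      sgnDist a '' {f | IsLaurentPoly (2 * k - 1) (2 * m - 1) f} := ⟨oddFun k Q, hLQ, rfl⟩
  refine le_antisymm ?_ (le_csInf ⟨_, hmem⟩ ?_)
  · refine (csInf_le ⟨L, ?_⟩ hmem).trans (h.sgnDist_eq hk hm ha0).le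
    rintro _ ⟨f, hf, rfl⟩
    exact hlow f hf
  · rintro _ ⟨f, hf, rfl⟩
    exact hlow f hf

theorem IsAlternant.isExtremal_iff {k m : ℕ} (hk : 1 ≤ k) (hm : 1 ≤ m) {a L σ c : ℝ} {Q : ℝ[X]}
    {x : ℕ → ℝ} (h : IsAlternant k (m + k - 1) a L σ c Q x) (ha0 : 0 < a) {f : ℝ → ℝ} :
    IsExtremal k m a f ↔ f = oddFun k Q := by
  rw [IsExtremal, h.bestError_eq hk hm ha0]
  constructor
  · rintro ⟨hf, hfL⟩
    exact h.eq_of_sgnDist_le hk hm ha0 hf hfL.le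
  · rintro rfl
    exact ⟨isLaurentPoly_oddFun hk hm h.deg, h.sgnDist_eq hk hm ha0⟩

theorem IsAlternant.extremalFun_eq {k m : ℕ} (hk : 1 ≤ k) (hm : 1 ≤ m) {a L σ c : ℝ} {Q : ℝ[X]}
    {x : ℕ → ℝ} (h : IsAlternant k (m + k - 1) a L σ c Q x) (ha0 : 0 < a) :
    extremalFun k m a = oddFun k Q := by
  have hex : ∃ f, IsExtremal k m a f := ⟨_, (h.isExtremal_iff hk hm ha0).2 rfl⟩
  exact (h.isExtremal_iff hk hm ha0).1 (Classical.epsilon_spec hex)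

end SgnLaurent

end

noncomputable section
namespace SgnLaurent

open Polynomial Set Complex Filter Topology

/-! ### Counting roots in the right half plane -/

theorem one_add_mul_I_eq (t : ℝ) :
    (1 : ℂ) + t * I = (√(1 + t ^ 2) : ℝ) * exp (Real.arctan t * I) := by
  have h : (0 : ℝ) < 1 + t ^ 2 := by positivity
  have hs : √(1 + t ^ 2) ≠ 0 := (Real.sqrt_pos.2 h).ne'
  rw [exp_mul_I, ← ofReal_cos, ← ofReal_sin, Real.cos_arctan, Real.sin_arctan]
  push_cast
  have hs' : ((√(1 + t ^ 2) : ℝ) : ℂ) ≠ 0 := by exact_mod_cast hs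
  field_simp

/-- Off the imaginary axis arctan(Im / Re) is an argument up to the sign of Re. It stays continuous
along any curve that avoids the axis, with no branch cut to cross. -/
theorem exists_polar_of_re_ne_zero {z : ℂ} (hz : z.re ≠ 0) :
    ∃ r : ℝ, 0 < r ∧ z = (SignType.sign z.re : ℝ) * r * exp (Real.arctan (z.im / z.re) * I) := by
  refine ⟨|z.re| * √(1 + (z.im / z.re) ^ 2), by positivity, ?_⟩
  have h1 := one_add_mul_I_eq (z.im / z.re)
  have h2 : ((SignType.sign z.re : ℝ) * |z.re|) = z.re := sign_mul_abs z.re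
  rw [ofReal_mul, mul_assoc, mul_assoc, ← h1, ← mul_assoc, ← ofReal_mul, h2]
  push_cast
  have : (z.re : ℂ) ≠ 0 := by exact_mod_cast hz
  rw [mul_add, mul_one, ← mul_assoc, mul_div_cancel₀ _ this]
  exact (re_add_im z).symm

/-- The difference g y - g y₀ is continuous with values in the discrete group 2πℤ. -/
theorem eq_of_exp_mul_I_eq {g : ℝ → ℝ} {S : Set ℝ} (hS : IsPreconnected S) (hg : ContinuousOn g S)
    {y₀ : ℝ} (h0 : y₀ ∈ S) (h : ∀ y ∈ S, exp (g y * I) = exp (g y₀ * I)) : ∀ y ∈ S, g y = g y₀ := by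
  intro y hy
  have : DiscreteTopology (AddSubgroup.zmultiples (2 * Real.pi) : Set ℝ) :=
    NormedSpace.discreteTopology_zmultiples (2 * Real.pi)
  have hm : MapsTo (fun y => g y - g y₀) S (AddSubgroup.zmultiples (2 * Real.pi) : Set ℝ) := by
    intro y hy
    obtain ⟨n, hn⟩ := exp_eq_exp_iff_exists_int.1 (h y hy)
    rw [SetLike.mem_coe, AddSubgroup.mem_zmultiples_iff]
    refine ⟨n, ?_⟩
    have h1 : (g y : ℂ) = g y₀ + n * (2 * Real.pi) :=
      mul_right_cancel₀ I_ne_zero (by rw [hn]; ring)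
    have h2 : g y = g y₀ + n * (2 * Real.pi) := by exact_mod_cast h1
    simp only [zsmul_eq_mul]
    linarith
  have := hS.constant_of_mapsTo ⟨this⟩ (f := fun y => g y - g y₀) (hg.sub continuousOn_const) hm hy h0
  simp only [sub_self] at this
  linarith

theorem tendsto_arctan_div_atTop {b : ℝ} (hb : b ≠ 0) {l : Filter ℝ} {g : ℝ → ℝ}
    (hg : Tendsto g l atTop) :
    Tendsto (fun y => Real.arctan (g y / b)) l (𝓝 ((SignType.sign b : ℝ) * (Real.pi / 2))) := by
  rcases lt_or_gt_of_ne hb with h | h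
  · have h1 : Tendsto (fun y => g y / b) l atBot := by
      simpa [div_eq_mul_inv] using hg.atTop_mul_const_of_neg (inv_lt_zero.2 h)
    have h2 := (Real.tendsto_arctan_atBot.mono_right nhdsWithin_le_nhds).comp h1
    simpa [sign_neg h, Function.comp_def, neg_div] using h2
  · have h1 : Tendsto (fun y => g y / b) l atTop := hg.atTop_div_const h
    have h2 := (Real.tendsto_arctan_atTop.mono_right nhdsWithin_le_nhds).comp h1
    simpa [sign_pos h, Function.comp_def] using h2

theorem tendsto_arctan_div_atBot {b : ℝ} (hb : b ≠ 0) {l : Filter ℝ} {g : ℝ → ℝ}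
    (hg : Tendsto g l atBot) :
    Tendsto (fun y => Real.arctan (g y / b)) l (𝓝 (-((SignType.sign b : ℝ) * (Real.pi / 2)))) := by
  have h := (tendsto_arctan_div_atTop hb (tendsto_neg_atBot_atTop.comp hg)).neg
  refine h.congr fun y => ?_
  simp only [Function.comp_apply]
  rw [neg_div, Real.arctan_neg, neg_neg]

/-- The continuous argument of a product of linear factors along the imaginary axis. -/
theorem exists_argument_of_roots (s : Multiset ℂ) (hs : ∀ ζ ∈ s, ζ.re ≠ 0) :
    ∃ Θ : ℝ → ℝ, Continuous Θ ∧
      (∃ κ : ℂ, ∀ y : ℝ, ∃ r : ℝ, 0 < r ∧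
        (s.map fun ζ => (y * I - ζ)).prod = κ * r * exp (Θ y * I)) ∧
      Tendsto Θ atTop (𝓝 ((s.map fun ζ => (SignType.sign (-ζ.re) : ℝ)).sum * (Real.pi / 2))) ∧
      Tendsto Θ atBot (𝓝 (-((s.map fun ζ => (SignType.sign (-ζ.re) : ℝ)).sum * (Real.pi / 2)))) := by
  induction s using Multiset.induction_on with
  | empty =>
    refine ⟨fun _ => 0, continuous_const, ⟨1, fun y => ⟨1, one_pos, by simp⟩⟩, ?_, ?_⟩ <;>
      simp
  | cons ζ s ih =>
    obtain ⟨Θ, hc, ⟨κ, hκ⟩, ht, hb⟩ := ih fun ξ hξ => hs ξ (Multiset.mem_cons_of_mem hξ)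
    have hζ : -ζ.re ≠ 0 := neg_ne_zero.2 (hs ζ (Multiset.mem_cons_self ζ s))
    have hlt : Tendsto (fun y : ℝ => y - ζ.im) atTop atTop := tendsto_atTop_add_const_right _ _ tendsto_id
    have hlb : Tendsto (fun y : ℝ => y - ζ.im) atBot atBot := tendsto_atBot_add_const_right _ _ tendsto_id
    -- The real part of iy - ζ is the constant -Re ζ, so its argument changes by π times the sign of
    -- -Re ζ along the whole axis.
    refine ⟨fun y => Real.arctan ((y - ζ.im) / (-ζ.re)) + Θ y, by fun_prop,
      ⟨(SignType.sign (-ζ.re) : ℝ) * κ, fun y => ?_⟩, ?_, ?_⟩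
    · obtain ⟨r, hr, hrE⟩ := hκ y
      obtain ⟨r', hr', hrE'⟩ := exists_polar_of_re_ne_zero (z := y * I - ζ) (by simpa using hζ)
      refine ⟨r' * r, mul_pos hr' hr, ?_⟩
      rw [Multiset.map_cons, Multiset.prod_cons, hrE, hrE']
      have e1 : ((y : ℂ) * I - ζ).re = -ζ.re := by simp
      have e2 : ((y : ℂ) * I - ζ).im = y - ζ.im := by simp
      rw [e1, e2]
      push_cast
      rw [add_mul, Complex.exp_add]
      ring
    · rw [Multiset.map_cons, Multiset.sum_cons, add_mul]
      exact (tendsto_arctan_div_atTop hζ hlt).add ht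
    · rw [Multiset.map_cons, Multiset.sum_cons, add_mul, neg_add]
      exact (tendsto_arctan_div_atBot hζ hlb).add hb

/-- Two continuous arguments of the same curve differ by a constant. The factors κ and κ' absorb
constant phases; comparing moduli shows that they do not interfere. -/
theorem sub_eq_of_argument {κ κ' : ℂ} {S : Set ℝ} (hS : IsPreconnected S) {Θ Ψ : ℝ → ℝ}
    (hκ' : κ' ≠ 0) (hΘ : ContinuousOn Θ S) (hΨ : ContinuousOn Ψ S) {y₀ : ℝ} (h0 : y₀ ∈ S)
    (h : ∀ y ∈ S, ∃ r r' : ℝ, 0 < r ∧ 0 < r' ∧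
      κ * r * exp (Θ y * I) = κ' * r' * exp (Ψ y * I)) :
    ∀ y ∈ S, Θ y - Ψ y = Θ y₀ - Ψ y₀ := by
  have key : ∀ y ∈ S, ∃ r : ℝ, 0 < r ∧ κ * exp ((Θ y - Ψ y : ℝ) * I) = κ' * r := by
    intro y hy
    obtain ⟨r, r', hr, hr', hE⟩ := h y hy
    have hr0 : (r : ℂ) ≠ 0 := by exact_mod_cast hr.ne'
    refine ⟨r' / r, div_pos hr' hr, ?_⟩
    push_cast
    rw [sub_mul, Complex.exp_sub]
    have := Complex.exp_ne_zero (Ψ y * I)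
    rw [mul_div_assoc', mul_div_assoc', div_eq_div_iff this hr0]
    linear_combination hE
  refine eq_of_exp_mul_I_eq hS (hΘ.sub hΨ) h0 fun y hy => ?_
  obtain ⟨r, hr, hE⟩ := key y hy
  obtain ⟨r', hr', hE'⟩ := key y₀ h0
  have hκ : κ ≠ 0 := by
    rintro rfl
    rw [zero_mul] at hE
    exact mul_ne_zero hκ' (by exact_mod_cast hr.ne') hE.symm
  have hn : ‖κ‖ = ‖κ'‖ * r := by
    have := congrArg norm hE
    rwa [norm_mul, norm_mul, Complex.norm_exp_ofReal_mul_I, mul_one, Complex.norm_real,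
      Real.norm_of_nonneg hr.le] at this
  have hn' : ‖κ‖ = ‖κ'‖ * r' := by
    have := congrArg norm hE'
    rwa [norm_mul, norm_mul, Complex.norm_exp_ofReal_mul_I, mul_one, Complex.norm_real,
      Real.norm_of_nonneg hr'.le] at this
  have hrr : r = r' := mul_left_cancel₀ (norm_ne_zero_iff.2 hκ') (hn.symm.trans hn')
  exact mul_left_cancel₀ hκ ((hE.trans (by rw [hrr])).trans hE'.symm)

/-- If `P(iy) = (iy)^N (i F(y) - c)` with `F` odd running from `-ε∞` to `ε∞` on `(0, ∞)`, then the
difference of the numbers of roots of `P` in the left and the right half planes is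
`-2 ε sign (Re c)`. -/
theorem sum_sign_roots {P : ℂ[X]} {N : ℕ} {F : ℝ → ℝ} {c : ℂ} {ε : ℝ} (hε : ε = 1 ∨ ε = -1)
    (hc : c.re ≠ 0) (hP0 : P ≠ 0) (hroots : ∀ ζ ∈ P.roots, ζ.re ≠ 0)
    (hP : ∀ y : ℝ, y ≠ 0 → P.eval (y * I) = (y * I) ^ N * (F y * I - c))
    (hF : ContinuousOn F {0}ᶜ) (hodd : ∀ y, F (-y) = -F y)
    (h0 : Tendsto (fun y => ε * F y) (𝓝[>] 0) atBot) (htop : Tendsto (fun y => ε * F y) atTop atTop) :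
    (P.roots.map fun ζ => (SignType.sign (-ζ.re) : ℝ)).sum = -2 * ε * (SignType.sign c.re : ℝ) := by
  obtain ⟨Θ, hΘc, ⟨κ, hκ⟩, hΘt, hΘb⟩ := exists_argument_of_roots P.roots hroots
  set D := (P.roots.map fun ζ => (SignType.sign (-ζ.re) : ℝ)).sum with hD
  have hprod : ∀ z, P.eval z = P.leadingCoeff * (P.roots.map fun ζ => (z - ζ)).prod := by
    intro z
    have h := C_leadingCoeff_mul_prod_multiset_X_sub_C
      (IsAlgClosed.card_roots_eq_natDegree (p := P))
    conv_lhs => rw [← h]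
    rw [eval_mul, eval_C, eval_multiset_prod, Multiset.map_map]
    simp
  -- The real part of i F(y) - c is the constant -Re c, so Ψ is a continuous argument of this factor
  -- on each half axis, up to the sign of -Re c.
  set Ψ : ℝ → ℝ := fun y => Real.arctan ((F y - c.im) / (-c.re)) with hΨ
  have hΨc : ContinuousOn Ψ {0}ᶜ := by
    refine Real.continuous_arctan.comp_continuousOn ?_
    exact (hF.sub continuousOn_const).div_const _
  have hcr : -c.re ≠ 0 := neg_ne_zero.2 hc
  have hlead : P.leadingCoeff ≠ 0 := leadingCoeff_ne_zero.2 hP0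
  have hsg : ((SignType.sign (-c.re) : ℝ) : ℂ) ≠ 0 := by
    rcases lt_or_gt_of_ne hcr with h | h
    · rw [sign_neg h]; simp
    · rw [sign_pos h]; simp
  have hpol : ∀ y : ℝ, ∃ r : ℝ, 0 < r ∧
      (F y * I - c) = (SignType.sign (-c.re) : ℝ) * r * exp (Ψ y * I) := by
    intro y
    obtain ⟨r, hr, hE⟩ := exists_polar_of_re_ne_zero (z := F y * I - c) (by simpa using hcr)
    refine ⟨r, hr, ?_⟩
    have e1 : ((F y : ℂ) * I - c).re = -c.re := by simp
    have e2 : ((F y : ℂ) * I - c).im = F y - c.im := by simp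
    rw [e1, e2] at hE
    exact hE
  have hposeq : ∀ y ∈ Ioi (0 : ℝ), Θ y - Ψ y = Θ 1 - Ψ 1 := by
    refine sub_eq_of_argument (κ := P.leadingCoeff * κ)
      (κ' := I ^ N * (SignType.sign (-c.re) : ℝ)) isPreconnected_Ioi
      (mul_ne_zero (pow_ne_zero _ I_ne_zero) hsg) hΘc.continuousOn
      (hΨc.mono fun y hy => (ne_of_gt hy)) (mem_Ioi.2 one_pos) fun y hy => ?_
    obtain ⟨r, hr, hE⟩ := hκ y
    obtain ⟨r', hr', hE'⟩ := hpol y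
    refine ⟨r, y ^ N * r', hr, mul_pos (pow_pos hy _) hr', ?_⟩
    have h1 := hP y (ne_of_gt hy)
    rw [hprod, hE, hE', mul_pow] at h1
    push_cast
    linear_combination h1
  have hnegeq : ∀ y ∈ Iio (0 : ℝ), Θ y - Ψ y = Θ (-1) - Ψ (-1) := by
    refine sub_eq_of_argument (κ := P.leadingCoeff * κ)
      (κ' := (-1) ^ N * I ^ N * (SignType.sign (-c.re) : ℝ)) isPreconnected_Iio
      (mul_ne_zero (mul_ne_zero (by simp) (pow_ne_zero _ I_ne_zero)) hsg) hΘc.continuousOn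
      (hΨc.mono fun y hy => (ne_of_lt hy)) (by simp) fun y hy => ?_
    obtain ⟨r, hr, hE⟩ := hκ y
    obtain ⟨r', hr', hE'⟩ := hpol y
    refine ⟨r, (-y) ^ N * r', hr, mul_pos (pow_pos (neg_pos.2 hy) _) hr', ?_⟩
    have h1 := hP y (ne_of_lt hy)
    rw [hprod, hE, hE', mul_pow] at h1
    have h2 : ((-1 : ℂ)) ^ N * (-y) ^ N = y ^ N := by rw [← mul_pow]; ring
    push_cast
    linear_combination h1 - (I ^ N * (SignType.sign (-c.re) : ℝ) * r' * exp (Ψ y * I)) * h2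
  -- one-sided limits of `Ψ`
  set q := (SignType.sign (-c.re) : ℝ) * (Real.pi / 2) with hq
  have lims : Tendsto Ψ atTop (𝓝 (ε * q)) ∧ Tendsto Ψ (𝓝[>] 0) (𝓝 (-(ε * q))) ∧
      Tendsto Ψ atBot (𝓝 (-(ε * q))) ∧ Tendsto Ψ (𝓝[<] 0) (𝓝 (ε * q)) := by
    have hodd' : F = fun y => -F (-y) := by ext y; rw [hodd, neg_neg]
    have hneg0 : Tendsto (fun y : ℝ => -y) (𝓝[<] 0) (𝓝[>] 0) := by
      have := tendsto_neg_nhdsLT (a := (0 : ℝ)); simpa using this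
    rcases hε with rfl | rfl
    · simp only [one_mul] at *
      have hb : Tendsto F atBot atBot := by
        rw [hodd']
        exact tendsto_neg_atTop_atBot.comp (htop.comp tendsto_neg_atBot_atTop)
      have h0' : Tendsto F (𝓝[<] 0) atTop := by
        rw [hodd']
        exact tendsto_neg_atBot_atTop.comp (h0.comp hneg0)
      exact ⟨tendsto_arctan_div_atTop hcr (tendsto_atTop_add_const_right _ _ htop),
        tendsto_arctan_div_atBot hcr (tendsto_atBot_add_const_right _ _ h0),
        tendsto_arctan_div_atBot hcr (tendsto_atBot_add_const_right _ _ hb),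
        tendsto_arctan_div_atTop hcr (tendsto_atTop_add_const_right _ _ h0')⟩
    · have htop' : Tendsto F atTop atBot := by
        refine (tendsto_neg_atTop_atBot.comp htop).congr fun y => by simp
      have h0'' : Tendsto F (𝓝[>] 0) atTop := by
        refine (tendsto_neg_atBot_atTop.comp h0).congr fun y => by simp
      have hb : Tendsto F atBot atTop := by
        rw [hodd']
        exact tendsto_neg_atBot_atTop.comp (htop'.comp tendsto_neg_atBot_atTop)
      have h0' : Tendsto F (𝓝[<] 0) atBot := by
        rw [hodd']
        exact tendsto_neg_atTop_atBot.comp (h0''.comp hneg0)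
      simp only [neg_mul, one_mul, neg_neg]
      exact ⟨tendsto_arctan_div_atBot hcr (tendsto_atBot_add_const_right _ _ htop'),
        tendsto_arctan_div_atTop hcr (tendsto_atTop_add_const_right _ _ h0''),
        tendsto_arctan_div_atTop hcr (tendsto_atTop_add_const_right _ _ hb),
        tendsto_arctan_div_atBot hcr (tendsto_atBot_add_const_right _ _ h0')⟩
  obtain ⟨l1, l2, l3, l4⟩ := lims
  -- Θ is continuous at 0 while Ψ jumps there from εq to -εq. Equating the limits of Θ - Ψ at the
  -- two ends of each half axis gives D π/2 = 2εq.
  have hΘ0 : Tendsto Θ (𝓝 0) (𝓝 (Θ 0)) := hΘc.tendsto 0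
  have e1 : D * (Real.pi / 2) - ε * q = Θ 1 - Ψ 1 := by
    refine tendsto_nhds_unique (hΘt.sub l1) (tendsto_const_nhds.congr' ?_)
    filter_upwards [eventually_gt_atTop 0] with y hy using (hposeq y hy).symm
  have e2 : Θ 0 - -(ε * q) = Θ 1 - Ψ 1 := by
    refine tendsto_nhds_unique ((hΘ0.mono_left nhdsWithin_le_nhds).sub l2)
      (tendsto_const_nhds.congr' ?_)
    filter_upwards [self_mem_nhdsWithin] with y hy using (hposeq y hy).symm
  have e3 : -(D * (Real.pi / 2)) - -(ε * q) = Θ (-1) - Ψ (-1) := by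
    refine tendsto_nhds_unique (hΘb.sub l3) (tendsto_const_nhds.congr' ?_)
    filter_upwards [eventually_lt_atBot 0] with y hy using (hnegeq y hy).symm
  have e4 : Θ 0 - ε * q = Θ (-1) - Ψ (-1) := by
    refine tendsto_nhds_unique ((hΘ0.mono_left nhdsWithin_le_nhds).sub l4)
      (tendsto_const_nhds.congr' ?_)
    filter_upwards [self_mem_nhdsWithin] with y hy using (hnegeq y hy).symm
  have e5 : D * (Real.pi / 2) = (2 * ε * (SignType.sign (-c.re) : ℝ)) * (Real.pi / 2) := by
    rw [mul_assoc (2 * ε), ← hq]; linarith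
  have e6 := mul_right_cancel₀ (by positivity : (Real.pi / 2) ≠ 0) e5
  rw [e6, Left.sign_neg, SignType.coe_neg]
  ring

end SgnLaurent

end

noncomputable section
namespace SgnLaurent

open Polynomial Set Complex Filter Topology

/-! ### The extremal function in the complex plane -/

/-- The odd Laurent polynomial `z^{-(2k-1)} Q(z²)` in the complex plane. -/
def cfun (k : ℕ) (Q : ℝ[X]) (z : ℂ) : ℂ := (Q.map ofRealHom).eval (z ^ 2) / z ^ (2 * k - 1)

/-- The values on the imaginary axis: `f(iy) = i F(y)`. -/
def imagFun (k : ℕ) (Q : ℝ[X]) (y : ℝ) : ℝ := (-1) ^ k * Q.eval (-y ^ 2) / y ^ (2 * k - 1)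

/-- The polynomial `z^{2k-1} (f(z) - c)`. -/
def levelPoly (k : ℕ) (Q : ℝ[X]) (c : ℂ) : ℂ[X] :=
  expand ℂ 2 (Q.map ofRealHom) - C c * X ^ (2 * k - 1)

theorem cfun_ofReal (k : ℕ) (Q : ℝ[X]) (x : ℝ) : cfun k Q x = (oddFun k Q x : ℝ) := by
  rw [cfun, oddFun, ← ofReal_pow, ← ofRealHom_eq_coe, eval_map_apply]
  simp

theorem map_eval_conj (Q : ℝ[X]) (z : ℂ) : (Q.map ofRealHom).eval ((starRingEnd ℂ) z)
    = (starRingEnd ℂ) ((Q.map ofRealHom).eval z) := by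
  rw [eval_map, eval_map, eval₂_eq_sum_range, eval₂_eq_sum_range, map_sum]
  simp

theorem cfun_conj (k : ℕ) (Q : ℝ[X]) (z : ℂ) :
    cfun k Q ((starRingEnd ℂ) z) = (starRingEnd ℂ) (cfun k Q z) := by
  rw [cfun, cfun, ← map_pow, map_eval_conj, map_div₀, map_pow]

theorem cfun_mul_I {k : ℕ} (hk : 1 ≤ k) (Q : ℝ[X]) (y : ℝ) :
    cfun k Q (y * I) = imagFun k Q y * I := by
  obtain ⟨l, rfl⟩ : ∃ l, k = l + 1 := ⟨k - 1, by omega⟩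
  rw [cfun, imagFun, mul_pow, I_sq, show (y : ℂ) ^ 2 * -1 = ((-y ^ 2 : ℝ) : ℂ) by push_cast; ring,
    ← ofRealHom_eq_coe, eval_map_apply, mul_pow, show 2 * (l + 1) - 1 = 2 * l + 1 by omega,
    pow_succ I, pow_mul I, I_sq, ofRealHom_eq_coe]
  push_cast
  rcases eq_or_ne y 0 with rfl | hy
  · simp
  · have hy' : (y : ℂ) ≠ 0 := by exact_mod_cast hy
    have h1 : ((-1 : ℂ) ^ l) * (-1) ^ l = 1 := by rw [← pow_add, Even.neg_one_pow ⟨l, rfl⟩]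
    have h2 : ((-1 : ℂ) ^ l) ≠ 0 := by simp
    rw [div_mul_eq_mul_div, div_eq_div_iff (by
      exact mul_ne_zero (pow_ne_zero _ hy') (mul_ne_zero h2 I_ne_zero)) (pow_ne_zero _ hy')]
    rw [pow_succ (-1 : ℂ) l]
    have h3 := I_sq
    linear_combination (-(eval (-y ^ 2) Q : ℝ) * y ^ (2 * l + 1) : ℂ) * h1 +
      ((eval (-y ^ 2) Q : ℝ) * y ^ (2 * l + 1) * (-1) ^ l * (-1) ^ l : ℂ) * h3

theorem hasDerivAt_cfun {k : ℕ} (hk : 1 ≤ k) (Q : ℝ[X]) {z : ℂ} (hz : z ≠ 0) :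
    HasDerivAt (cfun k Q) (((derivPoly k Q).map ofRealHom).eval (z ^ 2) / z ^ (2 * k)) z := by
  obtain ⟨l, rfl⟩ : ∃ l, k = l + 1 := ⟨k - 1, by omega⟩
  have h1 : HasDerivAt (fun x : ℂ => (Q.map ofRealHom).eval (x ^ 2))
      ((derivative (Q.map ofRealHom)).eval (z ^ 2) * (2 * z)) z := by
    have := ((Q.map ofRealHom).hasDerivAt (z ^ 2)).comp z (hasDerivAt_pow 2 z)
    refine this.congr_deriv ?_
    simp
  have h2 := h1.div (hasDerivAt_pow (2 * (l + 1) - 1) z) (pow_ne_zero _ hz)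
  refine h2.congr_deriv ?_
  rw [show 2 * (l + 1) - 1 = 2 * l + 1 by omega, show 2 * l + 1 - 1 = 2 * l by omega,
    show 2 * (l + 1) = 2 * l + 2 by ring, derivPoly]
  simp only [Polynomial.map_sub, Polynomial.map_mul, map_C, map_X, eval_sub, eval_mul, eval_C,
    eval_X, derivative_map]
  simp only [ofRealHom_eq_coe]
  push_cast
  field_simp
  ring

theorem eval_levelPoly (k : ℕ) (Q : ℝ[X]) (c : ℂ) {z : ℂ} (hz : z ≠ 0) :
    (levelPoly k Q c).eval z = z ^ (2 * k - 1) * (cfun k Q z - c) := by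
  rw [levelPoly, eval_sub, expand_eval, eval_mul, eval_C, eval_pow, eval_X, cfun]
  have := pow_ne_zero (2 * k - 1) hz
  field_simp

theorem sum_sign_eq (s : Multiset ℂ) (hs : ∀ ζ ∈ s, ζ.re ≠ 0) :
    (s.map fun ζ => (SignType.sign (-ζ.re) : ℝ)).sum
      = s.card - 2 * ((s.filter fun ζ => 0 < ζ.re).card : ℝ) := by
  induction s using Multiset.induction_on with
  | empty => simp
  | cons ζ s ih =>
    rw [Multiset.map_cons, Multiset.sum_cons, ih fun ξ hξ => hs ξ (Multiset.mem_cons_of_mem hξ),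
      Multiset.card_cons, Multiset.filter_cons]
    rcases lt_or_gt_of_ne (hs ζ (Multiset.mem_cons_self ζ s)) with h | h
    · rw [sign_pos (neg_pos.2 h), if_neg (not_lt.2 h.le)]
      push_cast; simp; ring
    · rw [sign_neg (neg_lt_zero.2 h), if_pos h]
      push_cast; simp; ring

section
variable {k n : ℕ} {a L σ c : ℝ} {Q : ℝ[X]} {x : ℕ → ℝ}

theorem IsAlternant.pos (h : IsAlternant k n a L σ c Q x) (ha0 : 0 < a) {i : ℕ} (hi : i ≤ n + 1) :
    0 < x i := ha0.trans_le (h.mem_Icc hi).1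

theorem IsAlternant.coeff_top (h : IsAlternant k n a L σ c Q x) :
    (2 * (n : ℝ) - (2 * k - 1)) * Q.coeff n = c := by
  rw [← coeff_derivPoly, h.deriv, coeff_C_mul]
  have hm : (∏ i ∈ Finset.Ico 1 (n + 1), (X - C (x i ^ 2))).Monic := monic_prod_X_sub_C _ _
  have hd : (∏ i ∈ Finset.Ico 1 (n + 1), (X - C (x i ^ 2))).natDegree = n := by
    rw [natDegree_finsetProd_X_sub_C_eq_card]; simp
  have := hm.coeff_natDegree
  rw [hd] at this
  rw [this, mul_one]

/-- All zeros of the derivative polynomial are positive, so c determines the signs of both extreme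
coefficients of Q. These decide the behaviour of f(iy) as y → 0 and y → ∞. -/
theorem IsAlternant.coeff_zero (h : IsAlternant k n a L σ c Q x) :
    (2 * (k : ℝ) - 1) * Q.coeff 0 = -((-1) ^ n * c * ∏ i ∈ Finset.Ico 1 (n + 1), x i ^ 2) := by
  have h1 := coeff_derivPoly k Q 0
  rw [h.deriv, coeff_C_mul, coeff_zero_eq_eval_zero, eval_prod] at h1
  have h2 : ∏ i ∈ Finset.Ico 1 (n + 1), eval 0 (X - C (x i ^ 2))
      = (-1) ^ n * ∏ i ∈ Finset.Ico 1 (n + 1), x i ^ 2 := by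
    have : (-1 : ℝ) ^ n = (-1) ^ (Finset.Ico 1 (n + 1)).card := by simp
    rw [this, ← Finset.prod_const, ← Finset.prod_mul_distrib]
    exact Finset.prod_congr rfl fun i _ => by simp
  rw [h2] at h1
  push_cast at h1
  linarith

theorem IsAlternant.prod_sq_pos (h : IsAlternant k n a L σ c Q x) (ha0 : 0 < a) :
    0 < ∏ i ∈ Finset.Ico 1 (n + 1), x i ^ 2 :=
  Finset.prod_pos fun i hi => by
    have := h.pos ha0 (i := i) (by have := Finset.mem_Ico.1 hi; omega)
    positivity

theorem IsAlternant.coeff_top_ne (h : IsAlternant k n a L σ c Q x) : Q.coeff n ≠ 0 := fun h0 =>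
  h.c_ne (by rw [← h.coeff_top, h0, mul_zero])

theorem IsAlternant.coeff_zero_ne (h : IsAlternant k n a L σ c Q x) (ha0 : 0 < a) :
    Q.coeff 0 ≠ 0 := fun h0 => by
  have h1 := h.coeff_zero
  rw [h0, mul_zero] at h1
  have h2 : (-1 : ℝ) ^ n * c * ∏ i ∈ Finset.Ico 1 (n + 1), x i ^ 2 ≠ 0 :=
    mul_ne_zero (mul_ne_zero (by simp) h.c_ne) (h.prod_sq_pos ha0).ne'
  exact h2 (by linarith)

theorem IsAlternant.natDegree_eq (h : IsAlternant k n a L σ c Q x) : Q.natDegree = n :=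
  le_antisymm h.deg (le_natDegree_of_ne_zero h.coeff_top_ne)

theorem IsAlternant.natDegree_levelPoly (h : IsAlternant k n a L σ c Q x) (hk : 1 ≤ k)
    (hkn : k ≤ n) (w : ℂ) : (levelPoly k Q w).natDegree = 2 * n := by
  have h1 : (expand ℂ 2 (Q.map ofRealHom)).natDegree = 2 * n := by
    rw [natDegree_expand, natDegree_map, h.natDegree_eq, mul_comm]
  rw [levelPoly, natDegree_sub_eq_left_of_natDegree_lt, h1]
  rw [h1]
  exact (natDegree_C_mul_X_pow_le _ _).trans_lt (by omega)

theorem IsAlternant.levelPoly_ne_zero (h : IsAlternant k n a L σ c Q x) (hk : 1 ≤ k)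
    (hkn : k ≤ n) (w : ℂ) : levelPoly k Q w ≠ 0 := fun h0 => by
  have := h.natDegree_levelPoly hk hkn w
  rw [h0, natDegree_zero] at this
  omega

theorem imagFun_neg (hk : 1 ≤ k) (Q : ℝ[X]) (y : ℝ) : imagFun k Q (-y) = - imagFun k Q y := by
  rw [imagFun, imagFun, neg_sq, (show Odd (2 * k - 1) from ⟨k - 1, by omega⟩).neg_pow y, div_neg]

theorem continuousOn_imagFun (k : ℕ) (Q : ℝ[X]) : ContinuousOn (imagFun k Q) {0}ᶜ := by
  unfold imagFun
  exact ContinuousOn.div (by fun_prop) (by fun_prop) fun y hy => pow_ne_zero _ hy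

theorem IsAlternant.tendsto_imagFun_zero (h : IsAlternant k n a L σ c Q x) (ha0 : 0 < a)
    (hk : 1 ≤ k) {ε : ℝ} (hε : 0 < ε * ((-1) ^ (k + n) * c)) :
    Tendsto (fun y => ε * imagFun k Q y) (𝓝[>] 0) atBot := by
  have h1 : Tendsto (fun y : ℝ => ε * (-1) ^ k * Q.eval (-y ^ 2)) (𝓝[>] 0)
      (𝓝 (ε * (-1) ^ k * Q.coeff 0)) := by
    rw [coeff_zero_eq_eval_zero]
    have : Continuous fun y : ℝ => ε * (-1) ^ k * Q.eval (-y ^ 2) := by fun_prop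
    have := this.tendsto 0
    simp only [ne_eq, OfNat.ofNat_ne_zero, not_false_eq_true, zero_pow, neg_zero] at this
    exact this.mono_left nhdsWithin_le_nhds
  have h2 : Tendsto (fun y : ℝ => (y ^ (2 * k - 1))⁻¹) (𝓝[>] 0) atTop := by
    refine tendsto_inv_nhdsGT_zero.comp (tendsto_nhdsWithin_iff.2 ⟨?_, ?_⟩)
    · have : Continuous fun y : ℝ => y ^ (2 * k - 1) := by fun_prop
      have := this.tendsto 0
      rw [zero_pow (by omega : 2 * k - 1 ≠ 0)] at this
      exact this.mono_left nhdsWithin_le_nhds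
    · filter_upwards [self_mem_nhdsWithin] with y hy using pow_pos (mem_Ioi.1 hy) _
  have hneg : ε * (-1) ^ k * Q.coeff 0 < 0 := by
    have h3 := h.coeff_zero
    have h4 := h.prod_sq_pos ha0
    have hk' : (0 : ℝ) < 2 * k - 1 := by
      have : (1 : ℝ) ≤ k := by exact_mod_cast hk
      linarith
    have h5 : (2 * (k : ℝ) - 1) * (ε * (-1) ^ k * Q.coeff 0)
        = -((ε * ((-1) ^ (k + n) * c)) * ∏ i ∈ Finset.Ico 1 (n + 1), x i ^ 2) := by
      rw [pow_add]; linear_combination (ε * (-1) ^ k) * h3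
    have h6 := mul_pos hε h4
    by_contra h7
    push Not at h7
    have := mul_nonneg hk'.le h7
    linarith
  refine (h1.neg_mul_atTop hneg h2).congr fun y => ?_
  rw [imagFun]; ring

theorem IsAlternant.tendsto_imagFun_atTop (h : IsAlternant k n a L σ c Q x) (hk : 1 ≤ k)
    (hkn : k ≤ n) {ε : ℝ} (hε : 0 < ε * ((-1) ^ (k + n) * c)) :
    Tendsto (fun y => ε * imagFun k Q y) atTop atTop := by
  have hε0 : ε ≠ 0 := by rintro rfl; simp at hε
  have hX : (-X ^ 2 : ℝ[X]).natDegree = 2 := by rw [natDegree_neg, natDegree_X_pow]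
  have hcomp : (Q.comp (-X ^ 2)).natDegree = n * 2 := by rw [natDegree_comp, hX, h.natDegree_eq]
  have hcomp0 : Q.comp (-X ^ 2) ≠ 0 := fun h0 => by
    rw [h0, natDegree_zero] at hcomp; omega
  have hlc : (Q.comp (-X ^ 2)).leadingCoeff = Q.coeff n * (-1) ^ n := by
    rw [leadingCoeff_comp (by rw [hX]; norm_num), leadingCoeff_neg, leadingCoeff_X_pow, leadingCoeff,
      h.natDegree_eq]
  have hb : ε * (-1) ^ k ≠ 0 := mul_ne_zero hε0 (by simp)
  have key := div_tendsto_atTop_of_degree_gt (C (ε * (-1) ^ k) * Q.comp (-X ^ 2))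
    (X ^ (2 * k - 1) : ℝ[X]) (by
      rw [degree_C_mul hb, degree_X_pow, degree_eq_natDegree hcomp0, hcomp]
      exact_mod_cast (by omega : 2 * k - 1 < n * 2)) (pow_ne_zero _ X_ne_zero) (by
      rw [leadingCoeff_mul, leadingCoeff_C, hlc, leadingCoeff_X_pow, div_one]
      have h3 := h.coeff_top
      have hpos : (0 : ℝ) < 2 * n - (2 * k - 1) := by
        have : (k : ℝ) ≤ n := by exact_mod_cast hkn
        linarith
      have h5 : (2 * (n : ℝ) - (2 * k - 1)) * (ε * (-1) ^ k * (Q.coeff n * (-1) ^ n))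
          = ε * ((-1) ^ (k + n) * c) := by
        rw [pow_add]; linear_combination (ε * (-1) ^ k * (-1) ^ n) * h3
      by_contra h7
      push Not at h7
      have := mul_neg_of_pos_of_neg hpos h7
      linarith)
  refine key.congr fun y => ?_
  simp only [eval_mul, eval_C, eval_comp, eval_neg, eval_pow, eval_X, imagFun]
  ring

/-- The level polynomial has 2n roots, and `sum_sign_roots` gives the excess on one side. No root is
imaginary, because f(iy) is purely imaginary while Re w ≠ 0, and 0 is not a root because Q(0) ≠ 0.
-/
theorem IsAlternant.card_roots_right (h : IsAlternant k n a L σ c Q x) (ha0 : 0 < a) (hk : 1 ≤ k)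
    (hkn : k ≤ n) {ε : ℝ} (hε1 : ε = 1 ∨ ε = -1) (hε : 0 < ε * ((-1) ^ (k + n) * c)) {w : ℂ}
    (hw : w.re ≠ 0) :
    (((levelPoly k Q w).roots.filter fun ζ => 0 < ζ.re).card : ℝ)
      = n + ε * (SignType.sign w.re : ℝ) := by
  have hne := h.levelPoly_ne_zero hk hkn w
  have hP : ∀ y : ℝ, y ≠ 0 → (levelPoly k Q w).eval (y * I)
      = (y * I) ^ (2 * k - 1) * (imagFun k Q y * I - w) := fun y hy => by
    rw [eval_levelPoly k Q w (mul_ne_zero (by exact_mod_cast hy) I_ne_zero), cfun_mul_I hk]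
  have hroots : ∀ ζ ∈ (levelPoly k Q w).roots, ζ.re ≠ 0 := by
    intro ζ hζ h0
    rw [mem_roots hne, IsRoot.def] at hζ
    have hζe : ζ = ζ.im * I := by
      conv_lhs => rw [← re_add_im ζ, h0]
      simp
    rcases eq_or_ne ζ.im 0 with h1 | h1
    · rw [h1, ofReal_zero, zero_mul] at hζe
      rw [hζe, levelPoly, eval_sub, expand_eval, eval_mul, eval_pow, eval_X,
        zero_pow (by omega : 2 * k - 1 ≠ 0), zero_pow two_ne_zero, ← coeff_zero_eq_eval_zero,
        coeff_map] at hζ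
      simp only [mul_zero, sub_zero, ofRealHom_eq_coe, ofReal_eq_zero] at hζ
      exact h.coeff_zero_ne ha0 hζ
    · rw [hζe, hP _ h1] at hζ
      have h2 := (mul_eq_zero.1 hζ).resolve_left
        (pow_ne_zero _ (mul_ne_zero (by exact_mod_cast h1) I_ne_zero))
      have h3 := congrArg re h2
      simp at h3
      exact hw h3
  have hs := sum_sign_roots hε1 hw hne hroots hP (continuousOn_imagFun k Q) (imagFun_neg hk Q)
    (h.tendsto_imagFun_zero ha0 hk hε) (h.tendsto_imagFun_atTop hk hkn hε)
  rw [sum_sign_eq _ hroots, IsAlgClosed.card_roots_eq_natDegree, h.natDegree_levelPoly hk hkn] at hs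
  push_cast at hs
  linarith

theorem IsAlternant.card_le_of_level (h : IsAlternant k n a L σ c Q x) (hk : 1 ≤ k)
    (hkn : k ≤ n) {w : ℂ} {T : Finset ℂ} (hT : ∀ z ∈ T, 0 < z.re ∧ cfun k Q z = w) :
    T.card ≤ ((levelPoly k Q w).roots.filter fun ζ => 0 < ζ.re).card := by
  classical
  refine le_trans ?_ (Multiset.toFinset_card_le _)
  refine Finset.card_le_card fun z hz => ?_
  obtain ⟨h1, h2⟩ := hT z hz
  have hz0 : z ≠ 0 := by rintro rfl; simp at h1
  rw [Multiset.mem_toFinset, Multiset.mem_filter, mem_roots (h.levelPoly_ne_zero hk hkn w),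
    IsRoot.def, eval_levelPoly k Q w hz0, h2]
  exact ⟨by simp, h1⟩

theorem IsAlternant.exists_level (h : IsAlternant k n a L σ c Q x) (ha0 : 0 < a) {τ : ℝ}
    (hτ : τ ∈ Ioo (-1) 1) {j : ℕ} (hj : j ≤ n) :
    ∃ y ∈ Ioo (x j) (x (j + 1)), oddFun k Q y = 1 - L * τ := by
  have hlt := h.mono j (j + 1) (by omega) (by omega)
  have hcont : ContinuousOn (oddFun k Q) (Icc (x j) (x (j + 1))) :=
    (continuousOn_oddFun Q ha0).mono (Icc_subset_Icc (h.mem_Icc (by omega)).1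
      (h.mem_Icc (by omega)).2)
  have h1 := h.alt j (by omega)
  have h2 := h.alt (j + 1) (by omega)
  have hs : σ * (-1) ^ j = 1 ∨ σ * (-1) ^ j = -1 := by
    rcases neg_one_pow_eq_or ℝ j with e | e <;> rcases h.sign with e' | e' <;> rw [e, e'] <;> simp
  have hL := h.L_pos
  have e1 : σ * (-1) ^ (j + 1) = -(σ * (-1) ^ j) := by ring
  rw [e1] at h2
  have ht1 := mul_lt_mul_of_pos_left hτ.1 hL
  have ht2 := mul_lt_mul_of_pos_left hτ.2 hL
  rcases hs with hs | hs <;> rw [hs] at h1 h2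
  · have := intermediate_value_Ioo hlt.le hcont (show 1 - L * τ ∈ _ from ⟨by linarith, by linarith⟩)
    exact this
  · have := intermediate_value_Ioo' hlt.le hcont (show 1 - L * τ ∈ _ from ⟨by linarith, by linarith⟩)
    exact this

/-- On each level strictly between `1 - L` and `1 + L` there are `n + 1` points of `(a, 1)`. -/
theorem IsAlternant.exists_level_finset (h : IsAlternant k n a L σ c Q x) (ha0 : 0 < a) {τ : ℝ}
    (hτ : τ ∈ Ioo (-1) 1) : ∃ T : Finset ℂ, T.card = n + 1 ∧
      ∀ z ∈ T, (0 < z.re ∧ cfun k Q z = ((1 - L * τ : ℝ) : ℂ)) ∧ z.im = 0 := by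
  classical
  have hex : ∀ j : ℕ, ∃ y : ℝ, j ≤ n → y ∈ Ioo (x j) (x (j + 1)) ∧ oddFun k Q y = 1 - L * τ :=
    fun j => by
      by_cases hj : j ≤ n
      · obtain ⟨y, hy, hy'⟩ := h.exists_level ha0 hτ hj
        exact ⟨y, fun _ => ⟨hy, hy'⟩⟩
      · exact ⟨0, fun h' => absurd h' hj⟩
  choose y hy using hex
  have hmono : ∀ i j, i < j → j ≤ n → y i < y j := fun i j hij hj => by
    have h1 := (hy i (by omega)).1.2
    have h2 := (hy j hj).1.1
    rcases Nat.eq_or_lt_of_le (Nat.succ_le_of_lt hij) with h3 | h3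
    · subst h3; exact h1.trans h2
    · exact h1.trans ((h.mono _ _ h3 (by omega)).trans h2)
  refine ⟨(Finset.range (n + 1)).image fun j => (y j : ℂ), ?_, ?_⟩
  · rw [Finset.card_image_of_injOn, Finset.card_range]
    intro i hi j hj hij
    simp only [Finset.coe_range, mem_Iio] at hi hj
    have hij' : y i = y j := ofReal_injective hij
    rcases lt_trichotomy i j with h3 | h3 | h3
    · exact absurd hij' (hmono i j h3 (by omega)).ne
    · exact h3
    · exact absurd hij' (hmono j i h3 (by omega)).ne'
  · intro z hz
    obtain ⟨j, hj, rfl⟩ := Finset.mem_image.1 hz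
    have hj' : j ≤ n := by have := Finset.mem_range.1 hj; omega
    obtain ⟨h1, h2⟩ := hy j hj'
    refine ⟨⟨?_, ?_⟩, by simp⟩
    · rw [ofReal_re]; exact (h.pos ha0 (by omega)).trans h1.1
    · rw [cfun_ofReal, h2]

/-- With the opposite sign the level f = 1 would have only n - 1 solutions in the right half plane,
but alternation yields n + 1 of them on (a, 1). -/
theorem IsAlternant.leading_sign (h : IsAlternant k n a L σ c Q x) (ha0 : 0 < a) (hk : 1 ≤ k)
    (hkn : k ≤ n) : 0 < (-1) ^ (k + n) * c := by
  have hne : (-1) ^ (k + n) * c ≠ 0 := mul_ne_zero (by simp) h.c_ne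
  by_contra hle
  have hlt : (-1) ^ (k + n) * c < 0 := lt_of_le_of_ne (not_lt.1 hle) hne
  obtain ⟨T, hTc, hT⟩ := h.exists_level_finset ha0 (τ := 0) (by norm_num)
  have h1 := h.card_le_of_level hk hkn (w := ((1 - L * 0 : ℝ) : ℂ)) (T := T) fun z hz => (hT z hz).1
  have h2 := h.card_roots_right ha0 hk hkn (ε := -1) (Or.inr rfl) (by linarith)
    (w := ((1 - L * 0 : ℝ) : ℂ)) (by simp)
  have h3 : SignType.sign ((((1 - L * 0 : ℝ) : ℂ)).re) = 1 := sign_pos (by simp)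
  rw [h3] at h2
  have h4 : (n : ℝ) + 1 ≤ (((levelPoly k Q ((1 - L * 0 : ℝ) : ℂ)).roots.filter
      fun ζ => 0 < ζ.re).card : ℝ) := by
    rw [hTc] at h1; exact_mod_cast h1
  rw [h2] at h4
  simp at h4
  linarith

theorem IsAlternant.card_level_le_of_pos (h : IsAlternant k n a L σ c Q x) (ha0 : 0 < a)
    (hk : 1 ≤ k) (hkn : k ≤ n) {w : ℂ} (hw : 0 < w.re) {T : Finset ℂ}
    (hT : ∀ z ∈ T, 0 < z.re ∧ cfun k Q z = w) : T.card ≤ n + 1 := by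
  have h1 := h.card_le_of_level hk hkn hT
  have h2 := h.card_roots_right ha0 hk hkn (ε := 1) (Or.inl rfl)
    (by rw [one_mul]; exact h.leading_sign ha0 hk hkn) hw.ne'
  rw [sign_pos hw] at h2
  simp only [SignType.coe_one, mul_one] at h2
  have h3 : ((levelPoly k Q w).roots.filter fun ζ => 0 < ζ.re).card = n + 1 := by exact_mod_cast h2
  omega

theorem IsAlternant.card_level_le_of_neg (h : IsAlternant k n a L σ c Q x) (ha0 : 0 < a)
    (hk : 1 ≤ k) (hkn : k ≤ n) {w : ℂ} (hw : w.re < 0) {T : Finset ℂ}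
    (hT : ∀ z ∈ T, 0 < z.re ∧ cfun k Q z = w) : T.card + 1 ≤ n := by
  have h1 := h.card_le_of_level hk hkn hT
  have h2 := h.card_roots_right ha0 hk hkn (ε := 1) (Or.inl rfl)
    (by rw [one_mul]; exact h.leading_sign ha0 hk hkn) hw.ne
  rw [sign_neg hw] at h2
  simp only [SignType.coe_neg, SignType.coe_one, mul_neg, mul_one] at h2
  have h3 : (((levelPoly k Q w).roots.filter fun ζ => 0 < ζ.re).card : ℝ) + 1 = n := by linarith
  have h4 : ((levelPoly k Q w).roots.filter fun ζ => 0 < ζ.re).card + 1 = n := by exact_mod_cast h3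
  omega

theorem IsAlternant.deriv_eval (h : IsAlternant k n a L σ c Q x) (t : ℝ) :
    (derivPoly k Q).eval t = c * ∏ i ∈ Finset.Ico 1 (n + 1), (t - x i ^ 2) := by
  rw [h.deriv, eval_mul, eval_C, eval_prod]; simp

theorem IsAlternant.deriv_ceval (h : IsAlternant k n a L σ c Q x) (t : ℂ) :
    ((derivPoly k Q).map ofRealHom).eval t
      = c * ∏ i ∈ Finset.Ico 1 (n + 1), (t - (x i : ℂ) ^ 2) := by
  rw [h.deriv, Polynomial.map_mul, map_C, Polynomial.map_prod, eval_mul, eval_C, eval_prod]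
  simp

/-- All critical points of f are the real numbers ±x i. -/
theorem IsAlternant.deriv_ne_zero (h : IsAlternant k n a L σ c Q x) {z : ℂ}
    (hz : 0 ≤ z.re) (hzi : z.im ≠ 0) :
    ((derivPoly k Q).map ofRealHom).eval (z ^ 2) / z ^ (2 * k) ≠ 0 := by
  have hz0 : z ≠ 0 := by rintro rfl; simp at hzi
  refine div_ne_zero ?_ (pow_ne_zero _ hz0)
  rw [h.deriv_ceval]
  refine mul_ne_zero (by exact_mod_cast h.c_ne) (Finset.prod_ne_zero_iff.2 fun i _ h0 => ?_)
  rw [sub_eq_zero, sq_eq_sq_iff_eq_or_eq_neg] at h0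
  rcases h0 with h0 | h0 <;> rw [h0] at hzi <;> simp at hzi

theorem IsAlternant.map_nhds (h : IsAlternant k n a L σ c Q x) (hk : 1 ≤ k) {z : ℂ}
    (hz : 0 ≤ z.re) (hzi : z.im ≠ 0) : map (cfun k Q) (𝓝 z) = 𝓝 (cfun k Q z) := by
  have hz0 : z ≠ 0 := by rintro rfl; simp at hzi
  have hd : ∀ᶠ w in 𝓝 z, DifferentiableAt ℂ (cfun k Q) w := by
    filter_upwards [isOpen_ne.mem_nhds hz0] with w hw using (hasDerivAt_cfun hk Q hw).differentiableAt
  have han : AnalyticAt ℂ (cfun k Q) z := analyticAt_iff_eventually_differentiableAt.2 hd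
  have hs := han.hasStrictDerivAt
  rw [(hasDerivAt_cfun hk Q hz0).deriv] at hs
  exact hs.map_nhds_eq (h.deriv_ne_zero hz hzi)

/-- The n + 1 solutions on (a, 1) exhaust the root count for this level. -/
theorem IsAlternant.ne_level_of_lt (h : IsAlternant k n a L σ c Q x) (ha0 : 0 < a) (hk : 1 ≤ k)
    (hkn : k ≤ n) {z : ℂ} (hz : 0 < z.re) (hzi : z.im ≠ 0) {τ : ℝ} (hτ : τ ∈ Ioo (-1) 1) :
    cfun k Q z ≠ ((1 - L * τ : ℝ) : ℂ) := by
  classical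
  intro h0
  obtain ⟨T, hTc, hT⟩ := h.exists_level_finset ha0 hτ
  have hzT : z ∉ T := fun h1 => hzi (hT z h1).2
  have hpos : 0 < (((1 - L * τ : ℝ) : ℂ)).re := by
    rw [ofReal_re]
    have h1 := h.L_lt_one
    have h2 := mul_lt_mul_of_pos_left hτ.2 h.L_pos
    linarith
  have := h.card_level_le_of_pos ha0 hk hkn hpos (T := insert z T) fun w hw => by
    rcases Finset.mem_insert.1 hw with rfl | hw
    · exact ⟨hz, h0⟩
    · exact (hT w hw).1
  rw [Finset.card_insert_of_notMem hzT] at this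
  omega

/-- The end levels τ = ±1 follow from the interior ones: f is open at z, so taking an end level off
the real axis would force nearby interior levels to be taken there too. -/
theorem IsAlternant.ne_level (h : IsAlternant k n a L σ c Q x) (ha0 : 0 < a) (hk : 1 ≤ k)
    (hkn : k ≤ n) {z : ℂ} (hz : 0 < z.re) (hzi : z.im ≠ 0) {τ : ℝ} (hτ : τ ∈ Icc (-1) 1) :
    cfun k Q z ≠ ((1 - L * τ : ℝ) : ℂ) := by
  intro h0
  have hU : {w : ℂ | 0 < w.re ∧ w.im ≠ 0} ∈ 𝓝 z :=
    ((isOpen_lt continuous_const continuous_re).inter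
      (isOpen_ne_fun continuous_im continuous_const)).mem_nhds ⟨hz, hzi⟩
  have h1 := image_mem_map (m := cfun k Q) hU
  rw [h.map_nhds hk hz.le hzi, h0] at h1
  have hcont : Tendsto (fun s : ℝ => ((1 - L * (τ * s) : ℝ) : ℂ)) (𝓝[<] 1)
      (𝓝 ((1 - L * τ : ℝ) : ℂ)) := by
    have : Continuous (fun s : ℝ => ((1 - L * (τ * s) : ℝ) : ℂ)) := by fun_prop
    have := this.tendsto 1
    rw [mul_one] at this
    exact this.mono_left nhdsWithin_le_nhds
  have h2 := hcont.eventually h1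
  have h3 : ∀ᶠ s in 𝓝[<] (1 : ℝ), s ∈ Ioo (0 : ℝ) 1 := Ioo_mem_nhdsLT one_pos
  obtain ⟨s, ⟨w, hw, hws⟩, hs⟩ := (h2.and h3).exists
  refine h.ne_level_of_lt ha0 hk hkn hw.1 hw.2 (τ := τ * s) ?_ hws
  have := hτ.1
  have := hτ.2
  constructor <;> nlinarith [hs.1, hs.2]

theorem prod_sign_of_between {t : ℝ} {j : ℕ} (hj : j ≤ n)
    (hlow : ∀ i, 1 ≤ i → i ≤ j → x i ^ 2 < t) (hup : ∀ i, j < i → i ≤ n → t < x i ^ 2) :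
    0 < (-1) ^ (n - j) * ∏ i ∈ Finset.Ico 1 (n + 1), (t - x i ^ 2) := by
  rw [← Finset.prod_Ico_consecutive _ (show 1 ≤ j + 1 by omega) (show j + 1 ≤ n + 1 by omega)]
  have h1 : 0 < ∏ i ∈ Finset.Ico 1 (j + 1), (t - x i ^ 2) := Finset.prod_pos fun i hi => by
    rw [Finset.mem_Ico] at hi
    have := hlow i hi.1 (by omega); linarith
  have h2 : 0 < ∏ i ∈ Finset.Ico (j + 1) (n + 1), (x i ^ 2 - t) := Finset.prod_pos fun i hi => by
    rw [Finset.mem_Ico] at hi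
    have := hup i (by omega) (by omega); linarith
  have h3 : ∏ i ∈ Finset.Ico (j + 1) (n + 1), (t - x i ^ 2)
      = (-1) ^ (n - j) * ∏ i ∈ Finset.Ico (j + 1) (n + 1), (x i ^ 2 - t) := by
    have : n - j = (Finset.Ico (j + 1) (n + 1)).card := by simp
    rw [this, ← Finset.prod_const, ← Finset.prod_mul_distrib]
    exact Finset.prod_congr rfl fun i _ => by ring
  have h4 : ((-1 : ℝ) ^ (n - j)) * (-1) ^ (n - j) = 1 := by
    rw [← pow_add, Even.neg_one_pow ⟨_, rfl⟩]
  rw [h3]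
  have : (-1 : ℝ) ^ (n - j) * ((∏ i ∈ Finset.Ico 1 (j + 1), (t - x i ^ 2)) *
      ((-1) ^ (n - j) * ∏ i ∈ Finset.Ico (j + 1) (n + 1), (x i ^ 2 - t)))
      = ((-1 : ℝ) ^ (n - j) * (-1) ^ (n - j)) * ((∏ i ∈ Finset.Ico 1 (j + 1), (t - x i ^ 2)) *
        ∏ i ∈ Finset.Ico (j + 1) (n + 1), (x i ^ 2 - t)) := by ring
  rw [this, h4, one_mul]
  exact mul_pos h1 h2

/-- The sign of the derivative of the extremal function between two critical points. -/
theorem IsAlternant.deriv_sign (h : IsAlternant k n a L σ c Q x) (ha0 : 0 < a) (hk : 1 ≤ k)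
    (hkn : k ≤ n) {y : ℝ} (hy : 0 < y) {j : ℕ} (hj : j ≤ n)
    (hlow : ∀ i, 1 ≤ i → i ≤ j → x i < y) (hup : ∀ i, j < i → i ≤ n → y < x i) :
    0 < (-1) ^ (k + j) * ((derivPoly k Q).eval (y ^ 2) / y ^ (2 * k)) := by
  have h1 := prod_sign_of_between (x := x) (t := y ^ 2) hj
    (fun i h1 h2 => pow_lt_pow_left₀ (hlow i h1 h2) (h.pos ha0 (by omega)).le two_ne_zero)
    (fun i h1 h2 => pow_lt_pow_left₀ (hup i h1 h2) hy.le two_ne_zero)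
  have h2 := mul_pos (h.leading_sign ha0 hk hkn) h1
  rw [h.deriv_eval, ← mul_div_assoc]
  refine div_pos ?_ (pow_pos hy _)
  have h3 : (-1 : ℝ) ^ (k + n) * (-1) ^ (n - j) = (-1) ^ (k + j) := by
    obtain ⟨d, rfl⟩ : ∃ d, n = j + d := ⟨n - j, by omega⟩
    rw [Nat.add_sub_cancel_left, ← pow_add, show k + (j + d) + d = (k + j) + (d + d) by ring,
      pow_add, Even.neg_one_pow ⟨d, rfl⟩, mul_one]
  rw [← h3]
  linarith [h2]

/-- On (x n, 1) the derivative has the sign of (-1)^{k+n}, while f(1) - f(x n) = 2σ(-1)^n L. -/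
theorem IsAlternant.sigma_eq (h : IsAlternant k n a L σ c Q x) (ha0 : 0 < a) (hk : 1 ≤ k)
    (hkn : k ≤ n) : σ = (-1) ^ k := by
  have hlt := h.mono n (n + 1) (by omega) (by omega)
  have hcont : ContinuousOn (oddFun k Q) (Icc (x n) (x (n + 1))) :=
    (continuousOn_oddFun Q ha0).mono (Icc_subset_Icc (h.mem_Icc (by omega)).1
      (h.mem_Icc (by omega)).2)
  have hpos := h.pos ha0 (i := n) (by omega)
  obtain ⟨y, hy, hyd⟩ := exists_hasDerivAt_eq_slope (oddFun k Q) _ hlt hcont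
    (fun y hy => hasDerivAt_oddFun hk Q (hpos.trans hy.1).ne')
  have h1 := h.deriv_sign ha0 hk hkn (y := y) (hpos.trans hy.1) (j := n) le_rfl
    (fun i h1 h2 => by
      rcases h2.eq_or_lt with rfl | h3
      · exact hy.1
      · exact (h.mono i n h3 (by omega)).trans hy.1) (fun i h1 h2 => by omega)
  rw [hyd, ← mul_div_assoc] at h1
  have h2 := (div_pos_iff_of_pos_right (sub_pos.2 hlt)).1 h1
  have e1 := h.alt n (by omega)
  have e2 := h.alt (n + 1) (by omega)
  have e3 : oddFun k Q (x (n + 1)) - oddFun k Q (x n) = 2 * (σ * (-1) ^ n * L) := by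
    rw [pow_succ] at e2; linarith
  rw [e3, pow_add] at h2
  have hL := h.L_pos
  have e4 : ((-1 : ℝ) ^ n) * (-1) ^ n = 1 := by rw [← pow_add, Even.neg_one_pow ⟨n, rfl⟩]
  have e5 : 0 < (-1) ^ k * σ := by
    have : (-1 : ℝ) ^ k * (-1) ^ n * (2 * (σ * (-1) ^ n * L)) = ((-1) ^ k * σ) * (2 * L) := by
      linear_combination (2 * (-1) ^ k * σ * L) * e4
    rw [this] at h2
    exact pos_of_mul_pos_left h2 (by linarith)
  rcases h.sign with rfl | rfl <;> rcases neg_one_pow_eq_or ℝ k with e | e <;> rw [e] at e5 ⊢ <;>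
    norm_num at e5

end

end SgnLaurent

end

noncomputable section
namespace SgnLaurent

open Polynomial Set Complex Filter Topology

/-! ### The inverse Joukowski map -/

/-- The segment `[-1, 1]` of the complex plane. -/
def unitSeg : Set ℂ := {w | w.im = 0 ∧ |w.re| ≤ 1}

/-- The inverse of `w ↦ (w + w⁻¹) / 2` from the complement of `[-1, 1]` to the unit disk. -/
def joukInv (w : ℂ) : ℂ := w * (1 - (1 - w⁻¹ ^ 2) ^ (2⁻¹ : ℂ))

theorem ne_zero_of_notMem_unitSeg {w : ℂ} (hw : w ∉ unitSeg) : w ≠ 0 := by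
  rintro rfl
  exact hw ⟨by simp, by simp⟩

/-- If 1 - w⁻² is real and nonpositive, then w² lies in (0, 1], that is, w is in the segment. -/
theorem mem_slitPlane_of_notMem_unitSeg {w : ℂ} (hw : w ∉ unitSeg) : 1 - w⁻¹ ^ 2 ∈ slitPlane := by
  have hw0 := ne_zero_of_notMem_unitSeg hw
  by_contra h
  rw [mem_slitPlane_iff] at h
  push Not at h
  obtain ⟨h1, h2⟩ := h
  apply hw
  set r := (w⁻¹ ^ 2).re with hr
  have hr1 : 1 ≤ r := by
    simp only [sub_re, one_re] at h1; linarith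
  have hE : w⁻¹ ^ 2 = r := by
    apply Complex.ext
    · rw [ofReal_re]
    · simp only [sub_im, one_im, zero_sub, neg_eq_zero] at h2
      rw [h2, ofReal_im]
  have hE2 : w ^ 2 * r = 1 := by
    rw [← hE, inv_pow, mul_inv_cancel₀ (pow_ne_zero 2 hw0)]
  have him := congrArg im hE2
  have hre := congrArg re hE2
  simp only [pow_two, mul_im, mul_re, ofReal_re, ofReal_im, one_im, one_re] at him hre
  have h3 : w.re * w.im = 0 := by
    have : r * (w.re * w.im) = 0 := by linarith
    exact (mul_eq_zero.1 this).resolve_left (by linarith)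
  have h4 : w.im = 0 := by
    rcases mul_eq_zero.1 h3 with h | h
    · rw [h] at hre; nlinarith [mul_self_nonneg w.im]
    · exact h
  refine ⟨h4, ?_⟩
  rw [h4] at hre
  rw [← sq_le_one_iff_abs_le_one]
  nlinarith [mul_self_nonneg w.re]

theorem re_sqrt_pos {z : ℂ} (hz : z ∈ slitPlane) : 0 < (z ^ (2⁻¹ : ℂ)).re := by
  have hz0 := slitPlane_ne_zero hz
  rw [cpow_def_of_ne_zero hz0]
  rw [exp_re]
  refine mul_pos (Real.exp_pos _) (Real.cos_pos_of_mem_Ioo ?_)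
  have him : (log z * 2⁻¹).im = z.arg / 2 := by
    rw [show (2⁻¹ : ℂ) = ((2⁻¹ : ℝ) : ℂ) by push_cast; rfl, mul_comm, im_ofReal_mul,
      log_im]
    ring
  rw [him]
  have h1 := neg_pi_lt_arg z
  have h2 : z.arg < Real.pi := lt_of_le_of_ne (arg_le_pi z) (mem_slitPlane_iff_arg.1 hz).1
  constructor <;> linarith

/-- The roots of v² - 2wv + 1 are w(1 ± u) with product 1. Since the principal square root u has
positive real part, the minus sign selects the root inside the disk. -/
theorem joukInv_spec {w : ℂ} (hw : w ∉ unitSeg) :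
    joukInv w ^ 2 - 2 * w * joukInv w + 1 = 0 ∧ ‖joukInv w‖ < 1 := by
  have hw0 := ne_zero_of_notMem_unitSeg hw
  have hs := mem_slitPlane_of_notMem_unitSeg hw
  set u := (1 - w⁻¹ ^ 2) ^ (2⁻¹ : ℂ) with hu
  have hu2 : u ^ 2 = 1 - w⁻¹ ^ 2 := by
    have := cpow_nat_inv_pow (1 - w⁻¹ ^ 2) (n := 2) two_ne_zero
    exact_mod_cast this
  have hre : 0 < u.re := re_sqrt_pos hs
  have hJ : joukInv w = w * (1 - u) := rfl
  have hww : w ^ 2 * (1 - u ^ 2) = 1 := by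
    rw [hu2]; field_simp; ring
  refine ⟨?_, ?_⟩
  · rw [hJ]
    linear_combination -hww
  · have h1 : joukInv w * (w * (1 + u)) = 1 := by rw [hJ]; linear_combination hww
    have hlt : ‖1 - u‖ < ‖1 + u‖ := by
      refine lt_of_pow_lt_pow_left₀ 2 (norm_nonneg _) ?_
      rw [← normSq_eq_norm_sq, ← normSq_eq_norm_sq, normSq_apply, normSq_apply]
      simp only [sub_re, one_re, sub_im, one_im, add_re, add_im]
      nlinarith
    have hwn : 0 < ‖w‖ := norm_pos_iff.2 hw0
    have h2 : ‖joukInv w‖ < ‖w * (1 + u)‖ := by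
      rw [hJ, norm_mul, norm_mul]; exact mul_lt_mul_of_pos_left hlt hwn
    have h3 := congrArg norm h1
    rw [norm_mul, norm_one] at h3
    by_contra h4
    push Not at h4
    nlinarith [norm_nonneg (joukInv w)]

theorem joukInv_ne_zero {w : ℂ} (hw : w ∉ unitSeg) : joukInv w ≠ 0 := fun h => by
  have := (joukInv_spec hw).1
  rw [h] at this; simp at this

theorem differentiableAt_joukInv {w : ℂ} (hw : w ∉ unitSeg) : DifferentiableAt ℂ joukInv w := by
  have hw0 := ne_zero_of_notMem_unitSeg hw
  have hs := mem_slitPlane_of_notMem_unitSeg hw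
  unfold joukInv
  have h1 : DifferentiableAt ℂ (fun w : ℂ => 1 - w⁻¹ ^ 2) w :=
    (differentiableAt_const _).sub ((differentiableAt_inv hw0).pow 2)
  exact differentiableAt_id.mul ((differentiableAt_const _).sub (h1.cpow_const hs))

/-- The imaginary parts of `w` and of its image have opposite signs. -/
theorem joukInv_im_mul_neg {w : ℂ} (hw : w ∉ unitSeg) {s : ℝ} (hs : 0 < s * w.im) :
    s * (joukInv w).im < 0 := by
  obtain ⟨h1, h2⟩ := joukInv_spec hw
  set v := joukInv w with hv
  have hv0 : v ≠ 0 := joukInv_ne_zero hw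
  have h3 : 2 * w = v + v⁻¹ := by
    field_simp; linear_combination -h1
  have h4 : 2 * w.im = v.im * (1 - (normSq v)⁻¹) := by
    have := congrArg im h3
    simp only [mul_im, re_ofNat, im_ofNat, zero_mul, add_zero, add_im, inv_im] at this
    rw [this]; ring
  have hn : normSq v < 1 := by
    rw [normSq_eq_norm_sq]; exact pow_lt_one₀ (norm_nonneg _) h2 two_ne_zero
  have hn' : 1 < (normSq v)⁻¹ := (one_lt_inv₀ (normSq_pos.2 hv0)).2 hn
  by_contra hcon
  push Not at hcon
  have : 2 * (s * w.im) = (s * v.im) * (1 - (normSq v)⁻¹) := by linear_combination s * h4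
  nlinarith

/-- With v₀ = h₀ - isq the quadratic equation becomes (v - v₀)(v - conj v₀) = 2(H - h₀)v. The sign
of Im v keeps v at distance at least q from the second root, so v approaches the first. -/
theorem tendsto_joukInv_of_mem_Ioo {ι : Type*} {l : Filter ι} {H : ι → ℂ} {h₀ : ℝ}
    (h0 : h₀ ^ 2 < 1) (hH : Tendsto H l (𝓝 h₀)) (hseg : ∀ᶠ z in l, H z ∉ unitSeg) {s : ℝ}
    (hs1 : s = 1 ∨ s = -1) (hs : ∀ᶠ z in l, 0 < s * (H z).im) :
    Tendsto (fun z => joukInv (H z)) l (𝓝 (h₀ - s * √(1 - h₀ ^ 2) * I)) := by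
  set q := √(1 - h₀ ^ 2) with hq
  have hq0 : 0 < q := Real.sqrt_pos.2 (by linarith)
  have hq2 : q ^ 2 = 1 - h₀ ^ 2 := Real.sq_sqrt (by linarith)
  have hss : s ^ 2 = 1 := by rcases hs1 with rfl | rfl <;> norm_num
  rw [tendsto_iff_norm_sub_tendsto_zero]
  have hlim : Tendsto (fun z => 2 * ‖H z - h₀‖ / q) l (𝓝 0) := by
    have := (tendsto_iff_norm_sub_tendsto_zero.1 hH).const_mul 2 |>.div_const q
    simpa using this
  refine squeeze_zero' (Eventually.of_forall fun _ => norm_nonneg _) ?_ hlim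
  filter_upwards [hseg, hs] with z hz hzs
  obtain ⟨h1, h2⟩ := joukInv_spec hz
  have h3 := joukInv_im_mul_neg hz hzs
  set v := joukInv (H z) with hv
  have hprod : (v - (h₀ - s * q * I)) * (v - (h₀ + s * q * I)) = 2 * (H z - h₀) * v := by
    have e1 : (q : ℂ) ^ 2 = 1 - h₀ ^ 2 := by exact_mod_cast hq2
    have e2 : (s : ℂ) ^ 2 = 1 := by exact_mod_cast hss
    linear_combination h1 + (s : ℂ) ^ 2 * e1 + (1 - (h₀ : ℂ) ^ 2) * e2 - ((s : ℂ) ^ 2 * q ^ 2) * I_sq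
  have hbig : q ≤ ‖v - (h₀ + s * q * I)‖ := by
    have h4 : |(v - (h₀ + s * q * I)).im| ≤ ‖v - (h₀ + s * q * I)‖ := abs_im_le_norm _
    refine le_trans ?_ h4
    have e : (v - (h₀ + s * q * I)).im = v.im - s * q := by simp
    rw [e]
    have : q ≤ -(s * (v.im - s * q)) := by nlinarith
    refine this.trans ((le_abs_self _).trans ?_)
    rw [abs_neg, abs_mul]
    have : |s| = 1 := by rcases hs1 with rfl | rfl <;> simp
    rw [this, one_mul]
  have hn := congrArg norm hprod
  rw [norm_mul, norm_mul, norm_mul] at hn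
  simp only [norm_ofNat] at hn
  rw [le_div_iff₀ hq0]
  calc ‖v - (h₀ - s * q * I)‖ * q ≤ ‖v - (h₀ - s * q * I)‖ * ‖v - (h₀ + s * q * I)‖ := by gcongr
    _ = 2 * ‖H z - h₀‖ * ‖v‖ := hn
    _ ≤ 2 * ‖H z - h₀‖ * 1 := by gcongr
    _ = _ := by ring

/-- At h₀ = ±1 the two roots merge and (v - h₀)² = 2(H - h₀)v needs no choice of side. -/
theorem tendsto_joukInv_of_sq_eq_one {ι : Type*} {l : Filter ι} {H : ι → ℂ} {h₀ : ℝ}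
    (h0 : h₀ ^ 2 = 1) (hH : Tendsto H l (𝓝 h₀)) (hseg : ∀ᶠ z in l, H z ∉ unitSeg) :
    Tendsto (fun z => joukInv (H z)) l (𝓝 h₀) := by
  rw [tendsto_iff_norm_sub_tendsto_zero]
  have hlim : Tendsto (fun z => √(2 * ‖H z - h₀‖)) l (𝓝 0) := by
    have := ((tendsto_iff_norm_sub_tendsto_zero.1 hH).const_mul 2).sqrt
    simpa using this
  refine squeeze_zero' (Eventually.of_forall fun _ => norm_nonneg _) ?_ hlim
  filter_upwards [hseg] with z hz
  obtain ⟨h1, h2⟩ := joukInv_spec hz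
  set v := joukInv (H z) with hv
  refine Real.le_sqrt_of_sq_le ?_
  have hprod : (v - h₀) ^ 2 = 2 * (H z - h₀) * v := by
    have e1 : (h₀ : ℂ) ^ 2 = 1 := by exact_mod_cast h0
    linear_combination h1 + e1
  rw [← norm_pow, hprod, norm_mul, norm_mul]
  simp only [norm_ofNat]
  nlinarith [norm_nonneg (H z - h₀), norm_nonneg v]

theorem tendsto_mul_joukInv_cobounded :
    Tendsto (fun w : ℂ => w * joukInv w) (Bornology.cobounded ℂ) (𝓝 2⁻¹) := by
  have hseg : ∀ᶠ w : ℂ in Bornology.cobounded ℂ, w ∉ unitSeg := by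
    have : ∀ᶠ w : ℂ in Bornology.cobounded ℂ, 1 < ‖w‖ :=
      tendsto_norm_cobounded_atTop.eventually_gt_atTop 1
    filter_upwards [this] with w hw h
    have : w = w.re := by apply Complex.ext <;> simp [h.1]
    rw [this, norm_real, Real.norm_eq_abs] at hw
    exact absurd h.2 (not_le.2 hw)
  -- `2 w v = v² + 1` and `v → 0`
  have hv : Tendsto joukInv (Bornology.cobounded ℂ) (𝓝 0) := by
    rw [tendsto_zero_iff_norm_tendsto_zero]
    have hlim : Tendsto (fun w : ℂ => ‖w‖⁻¹) (Bornology.cobounded ℂ) (𝓝 0) :=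
      tendsto_norm_cobounded_atTop.inv_tendsto_atTop
    refine squeeze_zero' (Eventually.of_forall fun _ => norm_nonneg _) ?_ hlim
    filter_upwards [hseg] with w hw
    obtain ⟨h1, h2⟩ := joukInv_spec hw
    have hw0 : 0 < ‖w‖ := norm_pos_iff.2 (ne_zero_of_notMem_unitSeg hw)
    have h3 : 2 * (w * joukInv w) = joukInv w ^ 2 + 1 := by linear_combination -h1
    have h4 := congrArg norm h3
    rw [norm_mul, norm_mul] at h4
    simp only [norm_ofNat] at h4
    have h5 : ‖joukInv w ^ 2 + 1‖ ≤ 2 := by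
      refine (norm_add_le _ _).trans ?_
      rw [norm_pow, norm_one]
      have := pow_le_one₀ (n := 2) (norm_nonneg (joukInv w)) h2.le
      linarith
    rw [le_inv_comm₀ (norm_pos_iff.2 (joukInv_ne_zero hw)) hw0, ← one_div,
      le_div_iff₀ (norm_pos_iff.2 (joukInv_ne_zero hw))]
    linarith
  have h1 : Tendsto (fun w : ℂ => (joukInv w ^ 2 + 1) * 2⁻¹) (Bornology.cobounded ℂ) (𝓝 2⁻¹) := by
    have := ((hv.pow 2).add_const 1).mul_const (2⁻¹ : ℂ)
    simpa using this
  refine h1.congr' ?_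
  filter_upwards [hseg] with w hw
  have := (joukInv_spec hw).1
  linear_combination (2⁻¹ : ℂ) * this

end SgnLaurent

end

noncomputable section
namespace SgnLaurent

open Polynomial Set Complex Filter Topology

/-! ### Logarithms on convex sets -/

/-- A convex set is contractible and locally path connected, so maps into ℂ \ {0} lift through the
covering exp. -/
theorem exists_continuousOn_log {K : Set ℂ} (hK : Convex ℝ K) (hne : K.Nonempty) {g : ℂ → ℂ}
    (hg : ContinuousOn g K) (h0 : ∀ z ∈ K, g z ≠ 0) :
    ∃ l : ℂ → ℂ, ContinuousOn l K ∧ ∀ z ∈ K, exp (l z) = g z := by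
  classical
  have : ContractibleSpace K := hK.contractibleSpace hne
  have : LocallyPathConnectedSpace K := hK.locallyPathConnectedSpace
  obtain ⟨x₀, hx₀⟩ := hne
  rcases isCoveringMapOn_exp.existsUnique_continuousMap_lifts
    ⟨K.domRestrict g, continuousOn_iff_continuous_domRestrict.mp hg⟩ (a₀ := ⟨x₀, hx₀⟩)
    (exp_log (h0 x₀ hx₀)) (fun x => h0 x x.2) with ⟨f, ⟨-, hf⟩, -⟩
  obtain ⟨g', hg'⟩ : ∃ g' : ℂ → ℂ, ∀ z : K, g' z = f z :=
    ⟨fun z => if hz : z ∈ K then f ⟨z, hz⟩ else 0, by simp⟩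
  refine ⟨g', ?_, fun z hz => ?_⟩
  · rw [continuousOn_iff_continuous_domRestrict]
    convert! map_continuous f
    ext z
    exact hg' z
  · have := congrFun hf ⟨z, hz⟩
    simpa [hg' ⟨z, hz⟩] using this

/-- Near z the function f equals f(z) plus the principal logarithm of exp(f) / exp(f(z)), because
its imaginary part moves by less than π. -/
theorem differentiableAt_of_exp {f : ℂ → ℂ} {z : ℂ} (hf : ContinuousAt f z)
    (h : DifferentiableAt ℂ (fun w => exp (f w)) z) : DifferentiableAt ℂ f z := by
  have h1 : DifferentiableAt ℂ (fun w => log (exp (f w) / exp (f z)) + f z) z := by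
    refine (DifferentiableAt.clog (h.div_const _) ?_).add_const _
    rw [div_self (exp_ne_zero _)]; exact one_mem_slitPlane
  refine h1.congr_of_eventuallyEq ?_
  have h2 : Tendsto (fun w => (f w - f z).im) (𝓝 z) (𝓝 0) := by
    have h3 : ContinuousAt (fun w => (f w - f z).im) z :=
      continuous_im.continuousAt.comp (hf.sub continuousAt_const)
    have h4 := h3.tendsto
    rwa [sub_self, zero_im] at h4
  filter_upwards [h2.eventually (Ioo_mem_nhds (neg_lt_zero.2 Real.pi_pos) Real.pi_pos)] with w hw
  rw [← exp_sub, log_exp hw.1 hw.2.le, sub_add_cancel]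

/-! ### The normalized extremal function -/

/-- The function `(-1)^k (1 - f(z)) / L`, equal to `cos φ(z)`. -/
def normFun (k : ℕ) (L : ℝ) (Q : ℝ[X]) (z : ℂ) : ℂ := (-1) ^ k * (1 - cfun k Q z) / L

/-- The normalized extremal function on the real axis. -/
def normFunReal (k : ℕ) (L : ℝ) (Q : ℝ[X]) (y : ℝ) : ℝ := (-1) ^ k * (1 - oddFun k Q y) / L

theorem normFun_ofReal (k : ℕ) (L : ℝ) (Q : ℝ[X]) (y : ℝ) :
    normFun k L Q y = (normFunReal k L Q y : ℝ) := by
  rw [normFun, normFunReal, cfun_ofReal]; push_cast; rfl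

theorem hasDerivAt_normFun {k : ℕ} (hk : 1 ≤ k) (L : ℝ) (Q : ℝ[X]) {z : ℂ} (hz : z ≠ 0) :
    HasDerivAt (normFun k L Q)
      (-((-1) ^ k * (((derivPoly k Q).map ofRealHom).eval (z ^ 2) / z ^ (2 * k)) / L)) z := by
  have := (((hasDerivAt_cfun hk Q hz).const_sub 1).const_mul ((-1 : ℂ) ^ k)).div_const (L : ℂ)
  refine this.congr_deriv ?_
  ring

theorem hasDerivAt_normFunReal {k : ℕ} (hk : 1 ≤ k) (L : ℝ) (Q : ℝ[X]) {y : ℝ} (hy : y ≠ 0) :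
    HasDerivAt (normFunReal k L Q)
      (-((-1) ^ k * ((derivPoly k Q).eval (y ^ 2) / y ^ (2 * k)) / L)) y := by
  have := (((hasDerivAt_oddFun hk Q hy).const_sub 1).const_mul ((-1 : ℝ) ^ k)).div_const L
  refine this.congr_deriv ?_
  ring

theorem mem_quadrantBar_ofReal {y : ℝ} (hy : 0 < y) : (y : ℂ) ∈ quadrantBar :=
  ⟨by simpa using hy.le, by simp, by exact_mod_cast hy.ne'⟩

theorem mem_quadrantBar_mul_I {y : ℝ} (hy : 0 < y) : (y : ℂ) * I ∈ quadrantBar :=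
  ⟨by simp, by simpa using hy.le, mul_ne_zero (by exact_mod_cast hy.ne') I_ne_zero⟩

theorem quadrant_subset : quadrant ⊆ quadrantBar := fun z hz =>
  ⟨hz.1.le, hz.2.le, by rintro rfl; exact lt_irrefl _ hz.1⟩

theorem isOpen_quadrant : IsOpen quadrant :=
  (isOpen_lt continuous_const continuous_re).inter (isOpen_lt continuous_const continuous_im)

theorem closure_quadrant : closure quadrant = {z : ℂ | 0 ≤ z.re ∧ 0 ≤ z.im} := by
  have h : quadrant = Ioi (0 : ℝ) ×ℂ Ioi (0 : ℝ) := by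
    ext z; simp [quadrant, mem_reProdIm]
  rw [h, closure_reProdIm, closure_Ioi]
  ext z; simp [mem_reProdIm]

theorem quadrantBar_subset_closure : quadrantBar ⊆ closure quadrant := by
  rw [closure_quadrant]; exact fun z hz => ⟨hz.1, hz.2.1⟩

theorem convex_closure_quadrant : Convex ℝ (closure quadrant) := by
  refine Convex.closure ?_
  exact (convex_halfSpace_re_gt 0).inter (convex_halfSpace_im_gt 0)

section
variable {k n : ℕ} {a L σ c : ℝ} {Q : ℝ[X]} {x : ℕ → ℝ}

theorem IsAlternant.normFunReal_node (h : IsAlternant k n a L σ c Q x) (ha0 : 0 < a) (hk : 1 ≤ k)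
    (hkn : k ≤ n) {i : ℕ} (hi : i ≤ n + 1) : normFunReal k L Q (x i) = (-1) ^ i := by
  rw [normFunReal, h.alt i hi, h.sigma_eq ha0 hk hkn]
  have h1 : ((-1 : ℝ) ^ k) * (-1) ^ k = 1 := by rw [← pow_add, Even.neg_one_pow ⟨k, rfl⟩]
  have := h.L_pos.ne'
  rw [div_eq_iff this]
  linear_combination ((-1) ^ i * L) * h1

/-- Only the nodes x 1, …, x n are critical, so the first and the last interval of monotonicity are
(0, x 1] and [x n, ∞). They reach beyond [a, 1], which is how |h| > 1 is obtained outside that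
interval. -/
theorem IsAlternant.normFunReal_lt (h : IsAlternant k n a L σ c Q x) (ha0 : 0 < a) (hk : 1 ≤ k)
    (hkn : k ≤ n) {j : ℕ} (hj : j ≤ n) {y₁ y₂ : ℝ} (hy₁ : 0 < y₁) (hy : y₁ < y₂)
    (hlow : ∀ i, 1 ≤ i → i ≤ j → x i ≤ y₁) (hup : ∀ i, j < i → i ≤ n → y₂ ≤ x i) :
    (-1) ^ (j + 1) * normFunReal k L Q y₁ < (-1) ^ (j + 1) * normFunReal k L Q y₂ := by
  obtain ⟨y, hy', hyd⟩ := exists_hasDerivAt_eq_slope (normFunReal k L Q) _ hy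
    (fun y hy => (hasDerivAt_normFunReal hk L Q
      (hy₁.trans_le hy.1).ne').continuousAt.continuousWithinAt)
    (fun y hy => hasDerivAt_normFunReal hk L Q (hy₁.trans hy.1).ne')
  have h1 := h.deriv_sign ha0 hk hkn (y := y) (hy₁.trans hy'.1) hj
    (fun i h1 h2 => (hlow i h1 h2).trans_lt hy'.1) (fun i h1 h2 => hy'.2.trans_le (hup i h1 h2))
  have hL := h.L_pos
  have h2 : 0 < (-1) ^ (j + 1) *
      (-((-1) ^ k * ((derivPoly k Q).eval (y ^ 2) / y ^ (2 * k)) / L)) := by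
    have := div_pos h1 hL
    rw [pow_add] at this
    rw [pow_succ]
    refine this.trans_eq ?_
    ring
  rw [hyd, ← mul_div_assoc, lt_div_iff₀ (sub_pos.2 hy)] at h2
  linarith

theorem IsAlternant.le_node (h : IsAlternant k n a L σ c Q x) {i j : ℕ} (hij : i ≤ j)
    (hj : j ≤ n + 1) : x i ≤ x j := by
  rcases hij.eq_or_lt with rfl | hlt
  · exact le_rfl
  · exact (h.mono i j hlt hj).le

theorem IsAlternant.one_lt_normFunReal (h : IsAlternant k n a L σ c Q x) (ha0 : 0 < a) (hk : 1 ≤ k)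
    (hkn : k ≤ n) {y : ℝ} (hy : 0 < y) (hya : y < a) : 1 < normFunReal k L Q y := by
  have h1 := h.normFunReal_lt ha0 hk hkn (j := 0) (by omega) hy hya (fun i h1 h2 => by omega)
    (fun i h1 h2 => by rw [← h.left]; exact h.le_node (by omega) (by omega))
  have h2 := h.normFunReal_node ha0 hk hkn (i := 0) (by omega)
  rw [h.left] at h2
  rw [h2] at h1
  simp at h1
  exact h1

theorem IsAlternant.one_lt_mul_normFunReal (h : IsAlternant k n a L σ c Q x) (ha0 : 0 < a)
    (hk : 1 ≤ k) (hkn : k ≤ n) {y : ℝ} (hy : 1 < y) :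
    1 < (-1) ^ (n + 1) * normFunReal k L Q y := by
  have h1 := h.normFunReal_lt ha0 hk hkn (j := n) le_rfl one_pos hy
    (fun i h1 h2 => by rw [← h.right]; exact h.le_node (by omega) (by omega))
    (fun i h1 h2 => by omega)
  have h2 := h.normFunReal_node ha0 hk hkn (i := n + 1) le_rfl
  rw [h.right] at h2
  rw [h2, ← pow_add, Even.neg_one_pow ⟨n + 1, rfl⟩] at h1
  exact h1

theorem IsAlternant.normFunReal_sq_lt (h : IsAlternant k n a L σ c Q x) (ha0 : 0 < a) (hk : 1 ≤ k)
    (hkn : k ≤ n) {j : ℕ} (hj : j ≤ n) {y : ℝ} (hy : y ∈ Ioo (x j) (x (j + 1))) :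
    normFunReal k L Q y ^ 2 < 1 := by
  have hpos := h.pos ha0 (i := j) (by omega)
  have h1 := h.normFunReal_lt ha0 hk hkn hj hpos hy.1
    (fun i _ h2 => h.le_node h2 (by omega))
    (fun i h1 h2 => hy.2.le.trans (h.le_node h1 (by omega)))
  have h2 := h.normFunReal_lt ha0 hk hkn hj (hpos.trans hy.1) hy.2
    (fun i _ h2 => (h.le_node h2 (by omega)).trans hy.1.le)
    (fun i h1 h2 => h.le_node h1 (by omega))
  rw [h.normFunReal_node ha0 hk hkn (by omega)] at h1 h2
  have e1 : ((-1 : ℝ) ^ (j + 1)) * (-1) ^ (j + 1) = 1 := by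
    rw [← pow_add, Even.neg_one_pow ⟨_, rfl⟩]
  have e2 : ((-1 : ℝ) ^ (j + 1)) * (-1) ^ j = -1 := by rw [pow_succ] at e1 ⊢; linarith
  rw [e2] at h1
  rw [e1] at h2
  have e3 : ((-1) ^ (j + 1) * normFunReal k L Q y) ^ 2 = normFunReal k L Q y ^ 2 := by
    rw [mul_pow, ← pow_mul, mul_comm (j + 1) 2, pow_mul]; simp
  rw [← e3, sq_lt_one_iff_abs_lt_one, abs_lt]
  exact ⟨h1, h2⟩

theorem IsAlternant.exists_piece (h : IsAlternant k n a L σ c Q x) {y : ℝ} (hya : a < y)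
    (hy1 : y < 1) : (∃ i ≤ n + 1, y = x i) ∨ ∃ j ≤ n, y ∈ Ioo (x j) (x (j + 1)) := by
  classical
  have hex : ∃ i, i ≤ n + 1 ∧ y ≤ x i := ⟨n + 1, le_rfl, by rw [h.right]; exact hy1.le⟩
  obtain ⟨hi, hyi⟩ := Nat.find_spec hex
  set i := Nat.find hex with hidef
  rcases hyi.eq_or_lt with h1 | h1
  · exact Or.inl ⟨i, hi, h1⟩
  · right
    have hi0 : i ≠ 0 := fun h0 => by rw [h0, h.left] at h1; linarith
    refine ⟨i - 1, by omega, ?_, by rwa [Nat.sub_add_cancel (by omega)]⟩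
    have := Nat.find_min hex (m := i - 1) (by omega)
    push Not at this
    exact this (by omega)

theorem IsAlternant.normFun_notMem (h : IsAlternant k n a L σ c Q x) (ha0 : 0 < a) (hk : 1 ≤ k)
    (hkn : k ≤ n) {z : ℂ} (hz : z ∈ quadrant) : normFun k L Q z ∉ unitSeg := by
  rintro ⟨h1, h2⟩
  set r := (normFun k L Q z).re with hr
  have hE : normFun k L Q z = (r : ℂ) := by apply Complex.ext <;> simp [hr, h1]
  have hL : (L : ℂ) ≠ 0 := by exact_mod_cast h.L_pos.ne'
  refine h.ne_level ha0 hk hkn hz.1 hz.2.ne' (τ := (-1) ^ k * r) ?_ ?_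
  · rw [Set.mem_Icc, ← abs_le, abs_mul, abs_pow, abs_neg, abs_one, one_pow, one_mul]; exact h2
  · rw [normFun, div_eq_iff hL] at hE
    have h3 : ((-1 : ℂ) ^ k) * (-1) ^ k = 1 := by rw [← pow_add, Even.neg_one_pow ⟨k, rfl⟩]
    push_cast
    linear_combination (-(-1 : ℂ) ^ k) * hE + (1 - cfun k Q z) * h3

/-- The imaginary axis goes into a vertical line. Under the arccosine this line becomes the edge of
the deleted region. -/
theorem IsAlternant.normFun_mul_I (hk : 1 ≤ k) (y : ℝ) :
    (normFun k L Q (y * I)).re = (-1) ^ k / L := by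
  have h3 : (normFun k L Q (y * I)) = (((-1) ^ k / L : ℝ) : ℂ) * (1 - imagFun k Q y * I) := by
    rw [normFun, cfun_mul_I hk]; push_cast; ring
  rw [h3, re_ofReal_mul]
  simp

theorem IsAlternant.normFun_mul_I_notMem (h : IsAlternant k n a L σ c Q x) (hk : 1 ≤ k) (y : ℝ) :
    normFun k L Q (y * I) ∉ unitSeg := by
  rintro ⟨-, h2⟩
  rw [normFun_mul_I hk, abs_div, abs_pow, abs_neg, abs_one, one_pow, abs_of_pos h.L_pos,
    div_le_one h.L_pos] at h2
  exact absurd h.L_lt_one (not_lt.2 h2)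

/-- h is real on the axis and the vertical derivative of Im h is Re h'. The mean value theorem on a
short vertical segment transfers the sign of h'(y), and so tells from which side h approaches (-1,
1). -/
theorem IsAlternant.normFun_im_sign (h : IsAlternant k n a L σ c Q x) (ha0 : 0 < a) (hk : 1 ≤ k)
    (hkn : k ≤ n) {j : ℕ} (hj : j ≤ n) {y : ℝ} (hy : y ∈ Ioo (x j) (x (j + 1))) :
    ∀ᶠ z in 𝓝[quadrant] (y : ℂ), 0 < (-1) ^ (j + 1) * (normFun k L Q z).im := by
  have hpos := (h.pos ha0 (i := j) (by omega)).trans hy.1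
  set D : ℂ → ℂ := fun z =>
    -((-1) ^ k * (((derivPoly k Q).map ofRealHom).eval (z ^ 2) / z ^ (2 * k)) / L) with hD
  have hy0 : (y : ℂ) ≠ 0 := by exact_mod_cast hpos.ne'
  have hDc : ContinuousAt (fun z => (-1) ^ (j + 1) * (D z).re) (y : ℂ) := by
    have h1 : ContinuousAt D (y : ℂ) := by
      simp only [hD]
      refine (ContinuousAt.div_const ?_ _).neg
      refine continuousAt_const.mul (ContinuousAt.div ?_ ?_ (pow_ne_zero _ hy0))
      · have : Continuous fun z : ℂ => ((derivPoly k Q).map ofRealHom).eval (z ^ 2) := by fun_prop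
        exact this.continuousAt
      · fun_prop
    exact continuousAt_const.mul (continuous_re.continuousAt.comp h1)
  have hD0 : 0 < (-1) ^ (j + 1) * (D y).re := by
    have h1 := h.deriv_sign ha0 hk hkn (y := y) hpos hj
      (fun i _ h2 => (h.le_node h2 (by omega)).trans_lt hy.1)
      (fun i h1 h2 => hy.2.trans_le (h.le_node h1 (by omega)))
    have h2 := div_pos h1 h.L_pos
    have h3 : D y = ((-((-1) ^ k * ((derivPoly k Q).eval (y ^ 2) / y ^ (2 * k)) / L) : ℝ) : ℂ) := by
      simp only [hD]
      rw [← ofReal_pow, ← ofRealHom_eq_coe, eval_map_apply]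
      simp
    rw [h3, ofReal_re]
    refine h2.trans_eq ?_
    rw [pow_add, pow_succ]; ring
  obtain ⟨r, hr, hball⟩ := Metric.eventually_nhds_iff_ball.1
    ((hDc.eventually (lt_mem_nhds hD0)).and (isOpen_ne.mem_nhds hy0 : ∀ᶠ z in 𝓝 (y : ℂ), z ≠ 0))
  filter_upwards [inter_mem_nhdsWithin quadrant (Metric.ball_mem_nhds (y : ℂ) hr)] with z hz
  have hseg : ∀ s ∈ Icc 0 z.im, ((z.re : ℂ) + s * I) ∈ Metric.ball (y : ℂ) r := by
    intro s hs
    refine Metric.mem_ball.2 (lt_of_le_of_lt ?_ (Metric.mem_ball.1 hz.2))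
    rw [dist_eq, dist_eq, ← abs_norm, ← abs_norm (z - y), ← sq_le_sq, ← normSq_eq_norm_sq,
      ← normSq_eq_norm_sq, normSq_apply, normSq_apply]
    simp
    nlinarith [hs.1, hs.2]
  set g : ℝ → ℝ := fun s => (normFun k L Q ((z.re : ℂ) + s * I)).im with hg
  have hgd : ∀ s ∈ Icc 0 z.im, HasDerivAt g (D ((z.re : ℂ) + s * I)).re s := by
    intro s hs
    have h1 := hasDerivAt_normFun hk L Q (hball _ (hseg s hs)).2
    have h2 : HasDerivAt (fun s : ℝ => (z.re : ℂ) + s * I) I s := by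
      have := (ofRealCLM.hasDerivAt (x := s)).mul_const I |>.const_add (z.re : ℂ)
      simpa using this
    have h3 := h1.comp s h2
    have h4 : HasDerivAt g ((D ((z.re : ℂ) + s * I)) * I).im s :=
      imCLM.hasFDerivAt.comp_hasDerivAt s h3
    simpa using h4
  obtain ⟨s, hs, hsd⟩ := exists_hasDerivAt_eq_slope g _ hz.1.2
    (fun s hs => (hgd s hs).continuousAt.continuousWithinAt)
    (fun s hs => hgd s (Ioo_subset_Icc_self hs))
  have hg0 : g 0 = 0 := by
    simp only [hg, ofReal_zero, zero_mul, add_zero]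
    rw [normFun_ofReal, ofReal_im]
  have hgz : g z.im = (normFun k L Q z).im := by
    simp only [hg]; rw [re_add_im]
  have h5 := (hball _ (hseg s (Ioo_subset_Icc_self hs))).1
  have him : 0 < z.im := hz.1.2
  rw [hsd, hg0, hgz, sub_zero, sub_zero, ← mul_div_assoc, lt_div_iff₀ him, zero_mul] at h5
  exact h5

end

end SgnLaurent

end

noncomputable section
namespace SgnLaurent

open Polynomial Set Complex Filter Topology

/-! ### Boundary limits and a continuous branch of the arccosine -/

section
variable {k n : ℕ} {a L σ c : ℝ} {Q : ℝ[X]} {x : ℕ → ℝ}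

theorem tendsto_normFun (hk : 1 ≤ k) (L : ℝ) (Q : ℝ[X]) {z : ℂ} (hz : z ≠ 0) (s : Set ℂ) :
    Tendsto (normFun k L Q) (𝓝[s] z) (𝓝 (normFun k L Q z)) :=
  (hasDerivAt_normFun hk L Q hz).continuousAt.tendsto.mono_left nhdsWithin_le_nhds

theorem tendsto_joukInv_normFun (hk : 1 ≤ k) (L : ℝ) (Q : ℝ[X]) {z : ℂ} (hz : z ≠ 0) (s : Set ℂ)
    (hseg : normFun k L Q z ∉ unitSeg) :
    Tendsto (fun z => joukInv (normFun k L Q z)) (𝓝[s] z) (𝓝 (joukInv (normFun k L Q z))) :=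
  (differentiableAt_joukInv hseg).continuousAt.tendsto.comp (tendsto_normFun hk L Q hz s)

theorem IsAlternant.eventually_notMem (h : IsAlternant k n a L σ c Q x) (ha0 : 0 < a) (hk : 1 ≤ k)
    (hkn : k ≤ n) (p : ℂ) : ∀ᶠ z in 𝓝[quadrant] p, normFun k L Q z ∉ unitSeg :=
  eventually_nhdsWithin_of_forall fun _ hz => h.normFun_notMem ha0 hk hkn hz

theorem IsAlternant.tendsto_joukInv_piece (h : IsAlternant k n a L σ c Q x) (ha0 : 0 < a)
    (hk : 1 ≤ k) (hkn : k ≤ n) {j : ℕ} (hj : j ≤ n) {y : ℝ} (hy : y ∈ Ioo (x j) (x (j + 1))) :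
    Tendsto (fun z => joukInv (normFun k L Q z)) (𝓝[quadrant] (y : ℂ))
      (𝓝 ((normFunReal k L Q y : ℝ) -
        ((-1) ^ (j + 1) : ℝ) * √(1 - normFunReal k L Q y ^ 2) * I)) := by
  have hpos := (h.pos ha0 (i := j) (by omega)).trans hy.1
  refine tendsto_joukInv_of_mem_Ioo (h.normFunReal_sq_lt ha0 hk hkn hj hy) ?_
    (h.eventually_notMem ha0 hk hkn _) (neg_one_pow_eq_or ℝ _) (h.normFun_im_sign ha0 hk hkn hj hy)
  rw [← normFun_ofReal]
  exact tendsto_normFun hk L Q (by exact_mod_cast hpos.ne') _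

theorem notMem_unitSeg_of_one_lt {r : ℝ} (hr : 1 < |r|) : (r : ℂ) ∉ unitSeg := fun h => by
  have := h.2
  rw [ofReal_re] at this
  linarith

theorem IsAlternant.tendsto_joukInv_node (h : IsAlternant k n a L σ c Q x) (ha0 : 0 < a)
    (hk : 1 ≤ k) (hkn : k ≤ n) {i : ℕ} (hi : i ≤ n + 1) :
    Tendsto (fun z => joukInv (normFun k L Q z)) (𝓝[quadrant] (x i : ℂ)) (𝓝 (((-1) ^ i : ℝ) : ℂ)) := by
  refine tendsto_joukInv_of_sq_eq_one (by rw [← pow_mul, mul_comm, pow_mul]; simp) ?_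
    (h.eventually_notMem ha0 hk hkn _)
  rw [← h.normFunReal_node ha0 hk hkn hi, ← normFun_ofReal]
  exact tendsto_normFun hk L Q (by exact_mod_cast (h.pos ha0 hi).ne') _

theorem IsAlternant.exists_tendsto_joukInv (h : IsAlternant k n a L σ c Q x) (ha0 : 0 < a)
    (hk : 1 ≤ k) (hkn : k ≤ n) {p : ℂ} (hp : p ∈ quadrantBar) :
    ∃ e, Tendsto (fun z => joukInv (normFun k L Q z)) (𝓝[quadrant] p) (𝓝 e) := by
  obtain ⟨h1, h2, h3⟩ := hp
  rcases h1.eq_or_lt with hre | hre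
  · have hp : p = (p.im : ℂ) * I := by apply Complex.ext <;> simp [hre.symm]
    refine ⟨_, tendsto_joukInv_normFun hk L Q h3 _ ?_⟩
    rw [hp]
    exact h.normFun_mul_I_notMem hk _
  rcases h2.eq_or_lt with him | him
  · have hp : p = (p.re : ℂ) := by apply Complex.ext <;> simp [him.symm]
    set y := p.re
    by_cases ha : y < a
    · refine ⟨_, tendsto_joukInv_normFun hk L Q h3 _ ?_⟩
      rw [hp, normFun_ofReal]
      exact notMem_unitSeg_of_one_lt
        ((h.one_lt_normFunReal ha0 hk hkn hre ha).trans_le (le_abs_self _))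
    by_cases hb : 1 < y
    · refine ⟨_, tendsto_joukInv_normFun hk L Q h3 _ ?_⟩
      rw [hp, normFun_ofReal]
      refine notMem_unitSeg_of_one_lt
        ((h.one_lt_mul_normFunReal ha0 hk hkn hb).trans_le ((le_abs_self _).trans ?_))
      rw [abs_mul, abs_pow, abs_neg, abs_one, one_pow, one_mul]
    push Not at ha hb
    have hnode : ∀ i ≤ n + 1, y = x i →
        ∃ e, Tendsto (fun z => joukInv (normFun k L Q z)) (𝓝[quadrant] p) (𝓝 e) := by
      intro i hi hyi
      rw [hp, hyi]
      exact ⟨_, h.tendsto_joukInv_node ha0 hk hkn hi⟩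
    rcases ha.eq_or_lt with ha | ha
    · exact hnode 0 (by omega) (by rw [h.left, ha])
    rcases hb.eq_or_lt with hb | hb
    · exact hnode (n + 1) le_rfl (by rw [h.right, hb])
    rcases h.exists_piece ha hb with ⟨i, hi, hyi⟩ | ⟨j, hj, hyj⟩
    · exact hnode i hi hyi
    · rw [hp]
      exact ⟨_, h.tendsto_joukInv_piece ha0 hk hkn hj hyj⟩
  · exact ⟨_, tendsto_joukInv_normFun hk L Q h3 _ (h.normFun_notMem ha0 hk hkn ⟨hre, him⟩)⟩

theorem mem_closure_quadrant_neBot {p : ℂ} (hp : p ∈ quadrantBar) : (𝓝[quadrant] p).NeBot :=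
  mem_closure_iff_nhdsWithin_neBot.1 (quadrantBar_subset_closure hp)

theorem tendsto_normFun_mul_pow (hk : 1 ≤ k) (L : ℝ) (Q : ℝ[X]) :
    Tendsto (fun z : ℂ => normFun k L Q z * z ^ (2 * k - 1)) (𝓝[≠] 0)
      (𝓝 (((-1) ^ (k + 1) * Q.coeff 0 / L : ℝ) : ℂ)) := by
  have hc : Continuous fun z : ℂ =>
      (-1) ^ k * (z ^ (2 * k - 1) - (Q.map ofRealHom).eval (z ^ 2)) / L := by fun_prop
  have h0 := hc.tendsto 0
  have e : (-1) ^ k * ((0 : ℂ) ^ (2 * k - 1) - (Q.map ofRealHom).eval ((0 : ℂ) ^ 2)) / L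
      = (((-1) ^ (k + 1) * Q.coeff 0 / L : ℝ) : ℂ) := by
    rw [zero_pow (by omega), zero_pow two_ne_zero, ← coeff_zero_eq_eval_zero, coeff_map]
    push_cast
    simp [pow_succ]
  rw [e] at h0
  refine (h0.mono_left nhdsWithin_le_nhds).congr' ?_
  refine eventually_nhdsWithin_of_forall fun z hz => ?_
  have hz0 : z ≠ 0 := hz
  have := pow_ne_zero (2 * k - 1) hz0
  simp only [normFun, cfun]
  field_simp

theorem normFun_limit_ne_zero (k : ℕ) {L : ℝ} (hL : L ≠ 0) (hQ : Q.coeff 0 ≠ 0) :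
    (((-1) ^ (k + 1) * Q.coeff 0 / L : ℝ) : ℂ) ≠ 0 := by
  have h1 : ((-1) ^ (k + 1) * Q.coeff 0 / L : ℝ) ≠ 0 :=
    div_ne_zero (mul_ne_zero (pow_ne_zero _ (by norm_num)) hQ) hL
  exact ofReal_ne_zero.2 h1

theorem tendsto_normFun_zero (hk : 1 ≤ k) (hL : L ≠ 0) (hQ : Q.coeff 0 ≠ 0) :
    Tendsto (normFun k L Q) (𝓝[≠] 0) (Bornology.cobounded ℂ) := by
  have hz0 : Tendsto (fun z : ℂ => z ^ (2 * k - 1)) (𝓝[≠] 0) (𝓝 0) := by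
    have := ((continuous_pow (2 * k - 1)).tendsto (0 : ℂ)).mono_left
      (nhdsWithin_le_nhds (s := {0}ᶜ))
    rwa [zero_pow (by omega)] at this
  have h1 : Tendsto (fun z : ℂ => (z ^ (2 * k - 1))⁻¹) (𝓝[≠] 0) (Bornology.cobounded ℂ) := by
    refine tendsto_inv₀_nhdsNE_zero.comp (tendsto_nhdsWithin_iff.2 ⟨hz0, ?_⟩)
    exact eventually_nhdsWithin_of_forall fun z hz => pow_ne_zero _ hz
  rw [← tendsto_norm_atTop_iff_cobounded] at h1 ⊢
  refine ((tendsto_normFun_mul_pow hk L Q).norm.pos_mul_atTop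
    (norm_pos_iff.2 (normFun_limit_ne_zero k hL hQ)) h1).congr' ?_
  refine eventually_nhdsWithin_of_forall fun z hz => ?_
  have hz0 : z ≠ 0 := hz
  have := pow_ne_zero (2 * k - 1) hz0
  show ‖_‖ * ‖_‖ = ‖_‖
  rw [← norm_mul, mul_assoc, mul_inv_cancel₀ this, mul_one]

/-- h has a pole of order 2k - 1 at 0 and the inverse Joukowski map behaves like 1 / (2h). Dividing
by z^{2k-1} leaves a nonzero limit, so a logarithm can be taken on a set that contains the origin.
-/
theorem IsAlternant.exists_tendsto_zero (h : IsAlternant k n a L σ c Q x) (ha0 : 0 < a)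
    (hk : 1 ≤ k) (hkn : k ≤ n) :
    ∃ e ≠ 0, Tendsto (fun z => joukInv (normFun k L Q z) / z ^ (2 * k - 1))
      (𝓝[quadrant] 0) (𝓝 e) := by
  refine ⟨_, div_ne_zero (by norm_num : (2⁻¹ : ℂ) ≠ 0) (normFun_limit_ne_zero k h.L_pos.ne' (h.coeff_zero_ne ha0)), ?_⟩
  have hle : 𝓝[quadrant] (0 : ℂ) ≤ 𝓝[≠] 0 :=
    nhdsWithin_mono _ fun z hz => (quadrant_subset hz).2.2
  refine ((tendsto_mul_joukInv_cobounded.comp ((tendsto_normFun_zero hk h.L_pos.ne' (h.coeff_zero_ne ha0)).mono_left hle)).div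
    ((tendsto_normFun_mul_pow hk L Q).mono_left hle) (normFun_limit_ne_zero k h.L_pos.ne' (h.coeff_zero_ne ha0))).congr' ?_
  refine eventually_nhdsWithin_of_forall fun z hz => ?_
  have := ne_zero_of_notMem_unitSeg (h.normFun_notMem ha0 hk hkn hz)
  have := pow_ne_zero (2 * k - 1) (quadrant_subset hz).2.2
  show normFun k L Q z * joukInv (normFun k L Q z) / (normFun k L Q z * z ^ (2 * k - 1)) = _
  field_simp

/-- The candidate for the conformal map: a continuous branch of `arccos` of the normalized
extremal function. -/
theorem IsAlternant.exists_arccos (h : IsAlternant k n a L σ c Q x) (ha0 : 0 < a)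
    (hk : 1 ≤ k) (hkn : k ≤ n) :
    ∃ φ : ℂ → ℂ, ContinuousOn φ quadrantBar ∧ DifferentiableOn ℂ φ quadrant ∧
      (∀ z ∈ quadrantBar, cos (φ z) = normFun k L Q z) ∧ (∀ z ∈ quadrant, 0 < (φ z).im) ∧
      (∀ z ∈ quadrantBar, 0 ≤ (φ z).im) ∧ φ a = 0 ∧
      (∃ C, Tendsto (fun z => (φ z).re - (2 * k - 1 : ℕ) * arg z) (𝓝[quadrantBar] 0) (𝓝 C)) ∧
      ∀ j ≤ n, ∀ y ∈ Ioo (x j) (x (j + 1)), 0 < (-1) ^ j * Real.sin (φ y).re := by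
  set E : ℂ → ℂ := fun z => joukInv (normFun k L Q z) with hE
  set G : ℂ → ℂ := fun z => E z / z ^ (2 * k - 1) with hG
  have hlim : ∀ p ∈ quadrantBar, ∃ e, Tendsto E (𝓝[quadrant] p) (𝓝 e) ∧
      e ^ 2 - 2 * normFun k L Q p * e + 1 = 0 ∧ ‖e‖ ≤ 1 := by
    intro p hp
    have := mem_closure_quadrant_neBot hp
    obtain ⟨e, he⟩ := h.exists_tendsto_joukInv ha0 hk hkn hp
    refine ⟨e, he, ?_, ?_⟩
    · have hH := tendsto_normFun hk L Q hp.2.2 quadrant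
      refine tendsto_nhds_unique_of_eventuallyEq
        (((he.pow 2).sub ((hH.const_mul 2).mul he)).add_const 1) tendsto_const_nhds
        (eventually_nhdsWithin_of_forall fun z hz =>
          (joukInv_spec (h.normFun_notMem ha0 hk hkn hz)).1)
    · exact le_of_tendsto he.norm (eventually_nhdsWithin_of_forall fun z hz =>
          (joukInv_spec (h.normFun_notMem ha0 hk hkn hz)).2.le)
  have hGlim : ∀ p ∈ quadrantBar, ∀ e, Tendsto E (𝓝[quadrant] p) (𝓝 e) →
      Tendsto G (𝓝[quadrant] p) (𝓝 (e / p ^ (2 * k - 1))) := fun p hp e he =>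
    he.div (((continuous_pow _).tendsto p).mono_left nhdsWithin_le_nhds) (pow_ne_zero _ hp.2.2)
  obtain ⟨e₀, he₀, hlim0⟩ := h.exists_tendsto_zero ha0 hk hkn
  have hcl : ∀ p ∈ closure quadrant, p ≠ 0 → p ∈ quadrantBar := by
    intro p hp hp0
    rw [closure_quadrant] at hp
    exact ⟨hp.1, hp.2, hp0⟩
  have hGc : ContinuousOn (extendFrom quadrant G) (closure quadrant) := by
    refine continuousOn_extendFrom subset_rfl fun p hp => ?_
    rcases eq_or_ne p 0 with rfl | hp0
    · exact ⟨_, hlim0⟩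
    · obtain ⟨e, he, -⟩ := hlim p (hcl p hp hp0)
      exact ⟨_, hGlim p (hcl p hp hp0) e he⟩
  have hGval : ∀ p ∈ quadrantBar, ∀ e, Tendsto E (𝓝[quadrant] p) (𝓝 e) →
      extendFrom quadrant G p = e / p ^ (2 * k - 1) := fun p hp e he =>
    extendFrom_eq (quadrantBar_subset_closure hp) (hGlim p hp e he)
  have hG0 : ∀ p ∈ closure quadrant, extendFrom quadrant G p ≠ 0 := by
    intro p hp
    rcases eq_or_ne p 0 with rfl | hp0
    · rw [extendFrom_eq hp hlim0]; exact he₀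
    · obtain ⟨e, he, he2, -⟩ := hlim p (hcl p hp hp0)
      rw [hGval p (hcl p hp hp0) e he]
      refine div_ne_zero ?_ (pow_ne_zero _ hp0)
      rintro rfl
      simp at he2
  -- The extension of G is continuous and zero-free on the whole closed quadrant, which is convex.
  obtain ⟨l, hlc, hl⟩ := exists_continuousOn_log convex_closure_quadrant
    ⟨0, by rw [closure_quadrant]; simp⟩ hGc hG0
  -- Adding (2k - 1) log z restores the removed power, so exp(iψ) is the boundary extension of E,
  -- and cos ψ = (E + 1/E) / 2 = h.
  set ψ : ℂ → ℂ := fun z => -I * (l z + (2 * k - 1 : ℕ) * log z) with hψ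
  have haQ := mem_quadrantBar_ofReal ha0
  have hslit : ∀ z ∈ quadrantBar, z ∈ slitPlane := by
    intro z hz
    rw [mem_slitPlane_iff]
    rcases hz.1.eq_or_lt with h1 | h1
    · right; intro h2; exact hz.2.2 (Complex.ext h1.symm h2)
    · exact Or.inl h1
  have hψc : ContinuousOn ψ quadrantBar := by
    refine continuousOn_const.mul ((hlc.mono quadrantBar_subset_closure).add
      (continuousOn_const.mul fun z hz => ?_))
    exact (continuousAt_clog (hslit z hz)).continuousWithinAt
  have hψe : ∀ p ∈ quadrantBar, ∀ e, Tendsto E (𝓝[quadrant] p) (𝓝 e) → exp (I * ψ p) = e := by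
    intro p hp e he
    have h1 : I * ψ p = l p + (2 * k - 1 : ℕ) * log p := by
      simp only [hψ]; linear_combination (-(l p + (2 * k - 1 : ℕ) * log p)) * I_sq
    have h2 := pow_ne_zero (2 * k - 1) hp.2.2
    rw [h1, exp_add, hl p (quadrantBar_subset_closure hp), hGval p hp e he, exp_nat_mul,
      exp_log hp.2.2, div_mul_cancel₀ _ h2]
  have hψa : exp (I * ψ a) = 1 := by
    have h0 := h.tendsto_joukInv_node ha0 hk hkn (i := 0) (by omega)
    rw [h.left] at h0
    rw [hψe a haQ _ h0]; simp
  have hφe : ∀ p ∈ quadrantBar, ∀ e, Tendsto E (𝓝[quadrant] p) (𝓝 e) →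
      exp (I * (ψ p - ψ a)) = e := by
    intro p hp e he
    rw [mul_sub, exp_sub, hψa, hψe p hp e he, div_one]
  have hnorm : ∀ p, ‖exp (I * p)‖ = Real.exp (-p.im) := by
    intro p; rw [norm_exp]; simp
  have hEq : ∀ z ∈ quadrant, Tendsto E (𝓝[quadrant] z) (𝓝 (E z)) := fun z hz =>
    tendsto_joukInv_normFun hk L Q (quadrant_subset hz).2.2 _ (h.normFun_notMem ha0 hk hkn hz)
  have hφc : ContinuousOn (fun z => ψ z - ψ a) quadrantBar := hψc.sub continuousOn_const
  refine ⟨fun z => ψ z - ψ a, hφc, ?_, ?_, ?_, ?_, sub_self _, ?_, ?_⟩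
  · intro z hz
    refine DifferentiableAt.differentiableWithinAt ?_
    have hca : ContinuousAt (fun z => I * (ψ z - ψ a)) z :=
      continuousAt_const.mul ((hφc z (quadrant_subset hz)).continuousAt
        (mem_of_superset (isOpen_quadrant.mem_nhds hz) quadrant_subset))
    have hd : DifferentiableAt ℂ (fun z => I * (ψ z - ψ a)) z := by
      refine differentiableAt_of_exp hca ?_
      have h1 : DifferentiableAt ℂ E z :=
        (differentiableAt_joukInv (h.normFun_notMem ha0 hk hkn hz)).comp z
          (hasDerivAt_normFun hk L Q (quadrant_subset hz).2.2).differentiableAt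
      refine h1.congr_of_eventuallyEq ?_
      filter_upwards [isOpen_quadrant.mem_nhds hz] with w hw
      exact hφe w (quadrant_subset hw) _ (hEq w hw)
    refine (hd.const_mul (-I)).congr_of_eventuallyEq (Eventually.of_forall fun w => ?_)
    show ψ w - ψ a = -I * (I * (ψ w - ψ a))
    rw [← mul_assoc, neg_mul, I_mul_I, neg_neg, one_mul]
  · intro z hz
    obtain ⟨e, he, he2, -⟩ := hlim z hz
    have h1 := hφe z hz e he
    have he0 : e ≠ 0 := by rintro rfl; simp at he2
    rw [cos, neg_mul, exp_neg, mul_comm _ I, h1]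
    field_simp
    linear_combination he2
  · intro z hz
    have h1 := hφe z (quadrant_subset hz) _ (hEq z hz)
    have h2 := (joukInv_spec (h.normFun_notMem ha0 hk hkn hz)).2
    have h3 := hnorm (ψ z - ψ a)
    rw [h1] at h3
    have h4 : Real.exp (-(ψ z - ψ a).im) < 1 := h3 ▸ h2
    rw [Real.exp_lt_one_iff] at h4
    linarith
  · intro z hz
    obtain ⟨e, he, -, he1⟩ := hlim z hz
    have h3 := hnorm (ψ z - ψ a)
    rw [hφe z hz e he] at h3
    rw [h3, Real.exp_le_one_iff] at he1
    linarith
  -- Re ψ = Im l + (2k - 1) arg z, and l is continuous at 0.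
  · refine ⟨(l 0).im - (ψ a).re, ?_⟩
    have h1 : Tendsto l (𝓝[quadrantBar] 0) (𝓝 (l 0)) :=
      (hlc 0 (by rw [closure_quadrant]; simp)).tendsto.mono_left
        (nhdsWithin_mono _ quadrantBar_subset_closure)
    refine (((continuous_im.tendsto _).comp h1).sub_const _).congr fun z => ?_
    simp only [hψ, Function.comp]
    simp [log_im]
    ring
  · intro j hj y hy
    have hpos := (h.pos ha0 (i := j) (by omega)).trans hy.1
    have h1 := hφe y (mem_quadrantBar_ofReal hpos) _ (h.tendsto_joukInv_piece ha0 hk hkn hj hy)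
    have h2 := congrArg im h1
    rw [exp_im] at h2
    have h4 : 0 < √(1 - normFunReal k L Q y ^ 2) :=
      Real.sqrt_pos.2 (by linarith [h.normFunReal_sq_lt ha0 hk hkn hj hy])
    have h5 : Real.exp (I * (ψ y - ψ a)).re * Real.sin (ψ y - ψ a).re =
        (-1) ^ j * √(1 - normFunReal k L Q y ^ 2) := by
      have : (I * (ψ y - ψ a)).im = (ψ y - ψ a).re := by simp
      rw [this] at h2
      rw [h2]
      have h6 : (((normFunReal k L Q y : ℝ) : ℂ) -
        ((-1) ^ (j + 1) : ℝ) * √(1 - normFunReal k L Q y ^ 2) * I).im =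
          -((-1) ^ (j + 1) * √(1 - normFunReal k L Q y ^ 2)) := by
        rw [← ofReal_mul, sub_im, ofReal_im, im_ofReal_mul, I_im]; ring
      rw [h6, pow_succ]; ring
    have h7 := Real.exp_pos (I * (ψ y - ψ a)).re
    have h8 : ((-1 : ℝ) ^ j) * (-1) ^ j = 1 := by rw [← pow_add, Even.neg_one_pow ⟨j, rfl⟩]
    have h9 : Real.exp (I * (ψ y - ψ a)).re * ((-1) ^ j * Real.sin (ψ y - ψ a).re) =
        √(1 - normFunReal k L Q y ^ 2) := by
      linear_combination (-1) ^ j * h5 + √(1 - normFunReal k L Q y ^ 2) * h8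
    exact pos_of_mul_pos_right (h9 ▸ h4) h7.le

end

end SgnLaurent

end

noncomputable section
namespace SgnLaurent

open Polynomial Set Complex Filter Topology

/-! ### Auxiliary facts about connectedness and the cosine -/

theorem lt_of_forall_ne_of_isPreconnected {X : Type*} [TopologicalSpace X] {s : Set X}
    (hs : IsPreconnected s) {f : X → ℝ} (hf : ContinuousOn f s) {r : ℝ} (hr : ∀ x ∈ s, f x ≠ r)
    {x y : X} (hx : x ∈ s) (hy : y ∈ s) (hxr : f x < r) : f y < r := by
  by_contra h
  obtain ⟨z, hz, hzr⟩ := hs.intermediate_value hx hy hf ⟨hxr.le, not_lt.1 h⟩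
  exact hr z hz hzr

theorem gt_of_forall_ne_of_isPreconnected {X : Type*} [TopologicalSpace X] {s : Set X}
    (hs : IsPreconnected s) {f : X → ℝ} (hf : ContinuousOn f s) {r : ℝ} (hr : ∀ x ∈ s, f x ≠ r)
    {x y : X} (hx : x ∈ s) (hy : y ∈ s) (hxr : r < f x) : r < f y := by
  by_contra h
  obtain ⟨z, hz, hzr⟩ := hs.intermediate_value hy hx hf ⟨not_lt.1 h, hxr.le⟩
  exact hr z hz hzr

/-- A continuous function with values in πℤ on a connected set is constant; it cannot cross the
values jπ ± π/2. -/
theorem eq_of_sin_eq_zero_of_isPreconnected {X : Type*} [TopologicalSpace X] {s : Set X}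
    (hs : IsPreconnected s) {f : X → ℝ} (hf : ContinuousOn f s)
    (h0 : ∀ x ∈ s, Real.sin (f x) = 0) {x y : X} (hx : x ∈ s) (hy : y ∈ s) : f y = f x := by
  obtain ⟨j, hj⟩ := Real.sin_eq_zero_iff.1 (h0 x hx)
  have hpi := Real.pi_pos
  have hs2 : ∀ t : ℝ, Real.sin (j * Real.pi + t) = (-1) ^ j * Real.sin t := by
    intro t; rw [add_comm, Real.sin_add_int_mul_pi]
  have hne : ∀ t : ℝ, Real.sin t ≠ 0 → ∀ z ∈ s, f z ≠ j * Real.pi + t := by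
    intro t ht z hz hzt
    have h1 := h0 z hz
    rw [hzt, hs2] at h1
    exact ht ((mul_eq_zero.1 h1).resolve_left (zpow_ne_zero _ (by norm_num)))
  have h1 := lt_of_forall_ne_of_isPreconnected hs hf (hne (Real.pi / 2) (by simp)) hx hy
    (by rw [← hj]; linarith)
  have h2 := gt_of_forall_ne_of_isPreconnected hs hf (hne (-(Real.pi / 2)) (by simp)) hx hy
    (by rw [← hj]; linarith)
  have h3 := h0 y hy
  rw [show f y = j * Real.pi + (f y - j * Real.pi) by ring, hs2] at h3
  have h4 := (mul_eq_zero.1 h3).resolve_left (zpow_ne_zero _ (by norm_num))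
  have h5 := (Real.sin_eq_zero_iff_of_lt_of_lt (by linarith) (by linarith)).1 h4
  rw [← hj]; linarith

theorem cos_re (w : ℂ) : (cos w).re = Real.cos w.re * Real.cosh w.im := by
  rw [Complex.cos_eq, ← ofReal_cos, ← ofReal_cosh, ← ofReal_sin, ← ofReal_sinh, ← ofReal_mul,
    ← ofReal_mul, sub_re, ofReal_re, re_ofReal_mul, I_re, mul_zero, sub_zero]

theorem cos_im (w : ℂ) : (cos w).im = -(Real.sin w.re * Real.sinh w.im) := by
  rw [Complex.cos_eq, ← ofReal_cos, ← ofReal_cosh, ← ofReal_sin, ← ofReal_sinh, ← ofReal_mul,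
    ← ofReal_mul, sub_im, ofReal_im, im_ofReal_mul, I_im, mul_one, zero_sub]

theorem norm_cos_le (w : ℂ) : ‖cos w‖ ≤ Real.cosh w.im := by
  have h1 := normSq_apply (cos w)
  rw [normSq_eq_norm_sq, cos_re, cos_im] at h1
  have h2 := Real.cosh_sq w.im
  have h3 := Real.sin_sq_add_cos_sq w.re
  have h4 : ‖cos w‖ ^ 2 ≤ Real.cosh w.im ^ 2 := by
    have : ‖cos w‖ ^ 2 = Real.cosh w.im ^ 2 - Real.sin w.re ^ 2 := by
      rw [h1, h2]; linear_combination (Real.sinh w.im ^ 2) * h3 +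
        (Real.cos w.re ^ 2) * h2 + h3
    rw [this]; linarith [sq_nonneg (Real.sin w.re)]
  exact le_of_sq_le_sq h4 (Real.cosh_pos _).le

/-- Since |cos w| ≤ cosh(Im w), a large cosine forces a large imaginary part. -/
theorem tendsto_im_of_cos_cobounded {ι : Type*} {l : Filter ι} {φ : ι → ℂ}
    (h : Tendsto (fun z => cos (φ z)) l (Bornology.cobounded ℂ))
    (h0 : ∀ᶠ z in l, 0 ≤ (φ z).im) : Tendsto (fun z => (φ z).im) l atTop := by
  rw [← tendsto_norm_atTop_iff_cobounded] at h
  refine tendsto_atTop.2 fun b => ?_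
  filter_upwards [h.eventually_gt_atTop (Real.cosh b), h0] with z hz hz0
  have h1 := hz.trans_le (norm_cos_le _)
  have h2 := Real.cosh_lt_cosh.1 h1
  rw [abs_of_nonneg hz0] at h2
  exact (le_abs_self b).trans h2.le

/-- Inversion reverses the coefficients of Q and exchanges k with n - k + 1, so behaviour at
infinity reduces to behaviour at the origin. -/
theorem cfun_inv {k n : ℕ} (hk : 1 ≤ k) (hkn : k ≤ n) {Q : ℝ[X]} (hQ : Q.natDegree = n) {z : ℂ}
    (hz : z ≠ 0) : cfun k Q z = cfun (n - k + 1) Q.reverse z⁻¹ := by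
  have hz2 : z ^ 2 ≠ 0 := pow_ne_zero _ hz
  let : Invertible (z ^ 2) := invertibleOfNonzero hz2
  have h1 := eval₂_reverse_mul_pow ofRealHom (z ^ 2) Q
  rw [invOf_eq_inv, ← inv_pow] at h1
  rw [cfun, cfun, eval_map, eval_map, ← h1, hQ]
  have h2 := pow_ne_zero (2 * k - 1) hz
  have h3 : (z ^ 2) ^ n = z ^ (2 * (n - k + 1) - 1) * z ^ (2 * k - 1) := by
    rw [← pow_mul, ← pow_add]; congr 1; omega
  rw [h3, inv_pow z (2 * (n - k + 1) - 1), div_inv_eq_mul]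
  field_simp

/-! ### Values of the arccosine branch on the two half axes -/

section
variable {k n : ℕ} {a L σ c : ℝ} {Q : ℝ[X]} {x : ℕ → ℝ}

theorem IsAlternant.tendsto_normFun_infty (h : IsAlternant k n a L σ c Q x) (hk : 1 ≤ k)
    (hkn : k ≤ n) : Tendsto (normFun k L Q) (Bornology.cobounded ℂ) (Bornology.cobounded ℂ) := by
  have h0 : Q.reverse.coeff 0 ≠ 0 := by
    rw [coeff_zero_reverse]
    exact leadingCoeff_ne_zero.2 fun h1 => h.coeff_top_ne (by rw [h1, Polynomial.coeff_zero])
  have hinv : Tendsto (fun z : ℂ => z⁻¹) (Bornology.cobounded ℂ) (𝓝[≠] 0) :=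
    tendsto_inv₀_cobounded'
  have h1 := (tendsto_normFun_zero (k := n - k + 1) (by omega) h.L_pos.ne' h0).comp hinv
  rw [← tendsto_norm_atTop_iff_cobounded] at h1 ⊢
  refine h1.congr' ?_
  filter_upwards [tendsto_norm_cobounded_atTop.eventually_gt_atTop 0] with z hz
  simp only [Function.comp, normFun]
  rw [cfun_inv hk hkn h.natDegree_eq (norm_pos_iff.1 hz)]
  simp

/-- A continuous branch of `arccos` of the normalized extremal function on the closed quadrant. -/
structure IsArccos (k n : ℕ) (a L : ℝ) (Q : ℝ[X]) (x : ℕ → ℝ) (φ : ℂ → ℂ) : Prop where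
  cont : ContinuousOn φ quadrantBar
  holo : DifferentiableOn ℂ φ quadrant
  cos_eq : ∀ z ∈ quadrantBar, cos (φ z) = normFun k L Q z
  im_pos : ∀ z ∈ quadrant, 0 < (φ z).im
  im_nonneg : ∀ z ∈ quadrantBar, 0 ≤ (φ z).im
  map_left : φ a = 0
  arg_lim : ∃ C, Tendsto (fun z => (φ z).re - (2 * k - 1 : ℕ) * arg z) (𝓝[quadrantBar] 0) (𝓝 C)
  sin_pos : ∀ j ≤ n, ∀ y ∈ Ioo (x j) (x (j + 1)), 0 < (-1) ^ j * Real.sin (φ y).re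

variable {φ : ℂ → ℂ}

theorem IsArccos.continuousOn_re (hφ : IsArccos k n a L Q x φ) :
    ContinuousOn (fun y : ℝ => (φ y).re) (Ioi 0) :=
  continuous_re.comp_continuousOn (hφ.cont.comp continuous_ofReal.continuousOn
    fun _ hy => mem_quadrantBar_ofReal hy)

theorem IsArccos.continuousOn_re_mul_I (hφ : IsArccos k n a L Q x φ) :
    ContinuousOn (fun y : ℝ => (φ (y * I)).re) (Ioi 0) :=
  continuous_re.comp_continuousOn (hφ.cont.comp (by fun_prop)
    fun _ hy => mem_quadrantBar_mul_I hy)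

theorem IsArccos.cos_re_eq (hφ : IsArccos k n a L Q x φ) {y : ℝ} (hy : 0 < y) :
    Real.cos (φ y).re * Real.cosh (φ y).im = normFunReal k L Q y := by
  rw [← cos_re, hφ.cos_eq y (mem_quadrantBar_ofReal hy), normFun_ofReal, ofReal_re]

theorem IsArccos.sin_re_mul (hφ : IsArccos k n a L Q x φ) {y : ℝ} (hy : 0 < y) :
    Real.sin (φ y).re = 0 ∨ (φ y).im = 0 := by
  have h1 := cos_im (φ y)
  rw [hφ.cos_eq y (mem_quadrantBar_ofReal hy), normFun_ofReal, ofReal_im, eq_comm, neg_eq_zero,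
    mul_eq_zero, Real.sinh_eq_zero] at h1
  exact h1

theorem IsArccos.im_pos_of_one_lt (hφ : IsArccos k n a L Q x φ) {y : ℝ} (hy : 0 < y)
    (h1 : 1 < |normFunReal k L Q y|) : 0 < (φ y).im := by
  refine lt_of_le_of_ne (hφ.im_nonneg y (mem_quadrantBar_ofReal hy)) fun h0 => ?_
  have h2 := hφ.cos_re_eq hy
  rw [← h0, Real.cosh_zero, mul_one] at h2
  rw [← h2] at h1
  exact absurd (Real.abs_cos_le_one _) (not_le.2 h1)

theorem IsArccos.sin_re_of_one_lt (hφ : IsArccos k n a L Q x φ) {y : ℝ} (hy : 0 < y)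
    (h1 : 1 < |normFunReal k L Q y|) : Real.sin (φ y).re = 0 :=
  (hφ.sin_re_mul hy).resolve_right (hφ.im_pos_of_one_lt hy h1).ne'

theorem IsArccos.node_im (hφ : IsArccos k n a L Q x φ) (h : IsAlternant k n a L σ c Q x)
    (ha0 : 0 < a) (hk : 1 ≤ k) (hkn : k ≤ n) {i : ℕ} (hi : i ≤ n + 1) :
    (φ (x i)).im = 0 ∧ Real.cos (φ (x i)).re = (-1) ^ i := by
  have hpos := h.pos ha0 hi
  have h1 := hφ.cos_re_eq hpos
  rw [h.normFunReal_node ha0 hk hkn hi] at h1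
  have him : (φ (x i)).im = 0 := by
    rcases hφ.sin_re_mul hpos with h2 | h2
    · have h3 := Real.sin_sq_add_cos_sq (φ (x i)).re
      rw [h2] at h3
      have h4 : Real.cosh (φ (x i)).im ^ 2 = 1 := by
        have h5 : (Real.cos (φ (x i)).re * Real.cosh (φ (x i)).im) ^ 2 = 1 := by
          rw [h1, ← pow_mul, mul_comm, pow_mul]; simp
        rw [mul_pow] at h5
        nlinarith
      rw [Real.cosh_sq] at h4
      have h6 : Real.sinh (φ (x i)).im = 0 := by
        have : Real.sinh (φ (x i)).im ^ 2 = 0 := by linarith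
        exact pow_eq_zero_iff two_ne_zero |>.1 this
      exact Real.sinh_eq_zero.1 h6
    · exact h2
  rw [him, Real.cosh_zero, mul_one] at h1
  exact ⟨him, h1⟩

theorem IsArccos.re_left (hφ : IsArccos k n a L Q x φ) (h : IsAlternant k n a L σ c Q x)
    (ha0 : 0 < a) (hk : 1 ≤ k) (hkn : k ≤ n) {y : ℝ} (hy : 0 < y) (hya : y ≤ a) :
    (φ y).re = 0 := by
  have h1 := eq_of_sin_eq_zero_of_isPreconnected (isPreconnected_Ioc (a := (0 : ℝ)) (b := a))
    (hφ.continuousOn_re.mono Ioc_subset_Ioi_self) ?_ ⟨ha0, le_rfl⟩ ⟨hy, hya⟩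
  · rw [h1, hφ.map_left, zero_re]
  · intro t ht
    rcases ht.2.eq_or_lt with h2 | h2
    · show Real.sin (φ t).re = 0
      rw [h2, hφ.map_left, zero_re, Real.sin_zero]
    · exact hφ.sin_re_of_one_lt ht.1
        ((h.one_lt_normFunReal ha0 hk hkn ht.1 h2).trans_le (le_abs_self _))

theorem IsArccos.re_right (hφ : IsArccos k n a L Q x φ) (h : IsAlternant k n a L σ c Q x)
    (ha0 : 0 < a) (hk : 1 ≤ k) (hkn : k ≤ n) {y : ℝ} (hy : 1 ≤ y) :
    (φ y).re = (φ 1).re := by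
  have h1 := eq_of_sin_eq_zero_of_isPreconnected (isPreconnected_Ici (a := (1 : ℝ)))
    (hφ.continuousOn_re.mono fun t (ht : 1 ≤ t) => (by simp; linarith : t ∈ Ioi (0 : ℝ))) ?_ (self_mem_Ici) hy
  · simpa using h1
  · intro t ht
    rcases (show 1 ≤ t from ht).eq_or_lt with h2 | h2
    · have h3 := (hφ.node_im h ha0 hk hkn (i := n + 1) le_rfl).2
      rw [h.right] at h3
      show Real.sin (φ t).re = 0
      rw [← h2]
      have h4 := Real.sin_sq_add_cos_sq (φ (1 : ℝ)).re
      rw [h3, ← pow_mul, mul_comm, pow_mul] at h4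
      simp at h4
      simpa using h4
    · refine hφ.sin_re_of_one_lt (one_pos.trans h2)
        ((h.one_lt_mul_normFunReal ha0 hk hkn h2).trans_le ((le_abs_self _).trans ?_))
      rw [abs_mul, abs_pow, abs_neg, abs_one, one_pow, one_mul]

/-- sin(Re φ - jπ) is positive on the open piece, so Re φ never meets a multiple of π there. It
tends to jπ at the left end, and positivity of the sine selects the interval above jπ. -/
theorem IsArccos.piece_aux (hφ : IsArccos k n a L Q x φ) (h : IsAlternant k n a L σ c Q x)
    (ha0 : 0 < a) {j : ℕ} (hj : j ≤ n)
    (hxj : (φ (x j)).re = j * Real.pi) {y : ℝ} (hy : y ∈ Ioo (x j) (x (j + 1))) :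
    (φ y).re ∈ Ioo (j * Real.pi) ((j + 1) * Real.pi) := by
  have hpi := Real.pi_pos
  have hpos := h.pos ha0 (i := j) (by omega)
  have hlt := h.mono j (j + 1) (by omega) (by omega)
  have hsin : ∀ t ∈ Ioo (x j) (x (j + 1)), 0 < Real.sin ((φ t).re - j * Real.pi) := by
    intro t ht
    rw [Real.sin_sub_nat_mul_pi]; exact hφ.sin_pos j hj t ht
  have hcont : ContinuousOn (fun y : ℝ => (φ y).re) (Ioo (x j) (x (j + 1))) :=
    hφ.continuousOn_re.mono fun t ht => hpos.trans ht.1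
  have hne : ∀ r : ℤ, ∀ t ∈ Ioo (x j) (x (j + 1)), (φ t).re ≠ j * Real.pi + r * Real.pi := by
    intro r t ht h1
    have h2 := hsin t ht
    rw [h1, add_sub_cancel_left, Real.sin_int_mul_pi] at h2
    exact lt_irrefl _ h2
  -- a point close to the left end
  obtain ⟨t, ht, ht1⟩ : ∃ t ∈ Ioo (x j) (x (j + 1)), |(φ t).re - j * Real.pi| < Real.pi := by
    have h1 : ContinuousAt (fun y : ℝ => (φ y).re) (x j) :=
      hφ.continuousOn_re.continuousAt (Ioi_mem_nhds hpos)
    have h2 := h1.eventually (Metric.ball_mem_nhds _ hpi)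
    have h3 := (h2.filter_mono nhdsWithin_le_nhds).and (Ioo_mem_nhdsGT hlt)
    obtain ⟨t, ht1, ht2⟩ := h3.exists
    refine ⟨t, ht2, ?_⟩
    rw [← hxj]
    exact ht1
  have hst := hsin t ht
  rw [abs_lt] at ht1
  have ht0 : 0 < (φ t).re - j * Real.pi := by
    by_contra hle
    exact absurd (Real.sin_nonpos_of_nonpos_of_neg_pi_le (not_lt.1 hle) ht1.1.le) (not_le.2 hst)
  refine ⟨gt_of_forall_ne_of_isPreconnected isPreconnected_Ioo hcont (r := j * Real.pi) ?_ ht hy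
    (by linarith), lt_of_forall_ne_of_isPreconnected isPreconnected_Ioo hcont
    (r := (j + 1) * Real.pi) ?_ ht hy (by linarith)⟩
  · intro s hs; have := hne 0 s hs; simpa using this
  · intro s hs; have := hne 1 s hs; rw [Int.cast_one] at this; convert this using 1; ring

/-- Induction along the nodes: at the right end of a piece Re φ lies in the closed interval from jπ
to (j + 1)π, and h(x (j + 1)) = (-1)^{j+1} singles out the upper end. -/
theorem IsArccos.node_re (hφ : IsArccos k n a L Q x φ) (h : IsAlternant k n a L σ c Q x)
    (ha0 : 0 < a) (hk : 1 ≤ k) (hkn : k ≤ n) {i : ℕ} (hi : i ≤ n + 1) :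
    (φ (x i)).re = i * Real.pi := by
  induction i with
  | zero => rw [h.left, hφ.map_left]; simp
  | succ j ih =>
    have hj := ih (by omega)
    have hpi := Real.pi_pos
    have hlt := h.mono j (j + 1) (by omega) (by omega)
    have hpos := h.pos ha0 hi
    have hcos := (hφ.node_im h ha0 hk hkn hi).2
    have hc : ContinuousWithinAt (fun y : ℝ => (φ y).re) (Ioo (x j) (x (j + 1))) (x (j + 1)) :=
      (hφ.continuousOn_re.continuousAt (Ioi_mem_nhds hpos)).continuousWithinAt
    have hmem : (φ (x (j + 1))).re ∈ closure (Ioo (j * Real.pi) ((j + 1) * Real.pi)) := by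
      refine hc.mem_closure ?_ fun y hy => hφ.piece_aux h ha0 (by omega) hj hy
      rw [closure_Ioo hlt.ne]; exact ⟨hlt.le, le_rfl⟩
    rw [closure_Ioo (by nlinarith)] at hmem
    have h1 : Real.cos ((φ (x (j + 1))).re - j * Real.pi) = -1 := by
      rw [Real.cos_sub_nat_mul_pi, hcos, ← pow_add, show j + (j + 1) = 2 * j + 1 by ring, pow_succ,
        pow_mul]
      simp
    have h2 := Real.injOn_cos (x₁ := (φ (x (j + 1))).re - j * Real.pi) (x₂ := Real.pi)
      ⟨by linarith [hmem.1], by linarith [hmem.2]⟩ ⟨hpi.le, le_rfl⟩ (by rw [h1, Real.cos_pi])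
    push_cast; linarith

theorem IsArccos.piece (hφ : IsArccos k n a L Q x φ) (h : IsAlternant k n a L σ c Q x)
    (ha0 : 0 < a) (hk : 1 ≤ k) (hkn : k ≤ n) {j : ℕ} (hj : j ≤ n) {y : ℝ}
    (hy : y ∈ Ioo (x j) (x (j + 1))) :
    (φ y).re ∈ Ioo (j * Real.pi) ((j + 1) * Real.pi) ∧ (φ y).im = 0 := by
  refine ⟨hφ.piece_aux h ha0 hj (hφ.node_re h ha0 hk hkn (by omega)) hy, ?_⟩
  refine (hφ.sin_re_mul ((h.pos ha0 (i := j) (by omega)).trans hy.1)).resolve_left fun h0 => ?_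
  have := hφ.sin_pos j hj y hy
  rw [h0, mul_zero] at this
  exact lt_irrefl _ this

theorem IsArccos.map_one (hφ : IsArccos k n a L Q x φ) (h : IsAlternant k n a L σ c Q x)
    (ha0 : 0 < a) (hk : 1 ≤ k) (hkn : k ≤ n) : φ 1 = (n + 1) * Real.pi := by
  have h1 := hφ.node_re h ha0 hk hkn (i := n + 1) le_rfl
  have h2 := (hφ.node_im h ha0 hk hkn (i := n + 1) le_rfl).1
  rw [h.right, ofReal_one] at h1 h2
  have e : ((n : ℂ) + 1) * Real.pi = (((n + 1 : ℕ) * Real.pi : ℝ) : ℂ) := by push_cast; ring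
  rw [e]
  apply Complex.ext
  · rw [h1, ofReal_re]
  · rw [h2, ofReal_im]

theorem IsArccos.cos_mul_I (hφ : IsArccos k n a L Q x φ) (hk : 1 ≤ k) {y : ℝ} (hy : 0 < y) :
    Real.cos ((φ (y * I)).re - k * Real.pi) * Real.cosh (φ (y * I)).im = 1 / L := by
  have h1 := cos_re (φ (y * I))
  rw [hφ.cos_eq _ (mem_quadrantBar_mul_I hy), IsAlternant.normFun_mul_I hk] at h1
  rw [Real.cos_sub_nat_mul_pi, mul_assoc, ← h1, ← mul_div_assoc, ← pow_add,
    Even.neg_one_pow ⟨k, rfl⟩]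

/-- Re φ - (2k - 1) arg z has a limit at 0. On the positive axis both terms vanish near 0, so the
limit is 0; on the imaginary axis arg z = π/2 then gives (2k - 1)π/2. This decides around which
multiple of π the deleted region sits. -/
theorem IsArccos.tendsto_re_mul_I (hφ : IsArccos k n a L Q x φ) (h : IsAlternant k n a L σ c Q x)
    (ha0 : 0 < a) (hk : 1 ≤ k) (hkn : k ≤ n) :
    Tendsto (fun y : ℝ => (φ (y * I)).re) (𝓝[>] 0) (𝓝 (k * Real.pi - Real.pi / 2)) := by
  obtain ⟨C, hC⟩ := hφ.arg_lim
  have hr : Tendsto (fun y : ℝ => (y : ℂ)) (𝓝[>] 0) (𝓝[quadrantBar] 0) := by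
    refine tendsto_nhdsWithin_iff.2 ⟨?_, eventually_nhdsWithin_of_forall fun y hy =>
      mem_quadrantBar_ofReal hy⟩
    have := (continuous_ofReal.tendsto (0 : ℝ)).mono_left (nhdsWithin_le_nhds (s := Ioi 0))
    simpa using this
  have hi : Tendsto (fun y : ℝ => (y : ℂ) * I) (𝓝[>] 0) (𝓝[quadrantBar] 0) := by
    refine tendsto_nhdsWithin_iff.2 ⟨?_, eventually_nhdsWithin_of_forall fun y hy =>
      mem_quadrantBar_mul_I hy⟩
    have := ((hr.mono_right nhdsWithin_le_nhds).mul_const I)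
    simpa using this
  have hC0 : C = 0 := by
    refine tendsto_nhds_unique_of_eventuallyEq (hC.comp hr) tendsto_const_nhds ?_
    filter_upwards [Ioc_mem_nhdsGT ha0] with y hy
    simp only [Function.comp]
    rw [hφ.re_left h ha0 hk hkn hy.1 hy.2, arg_ofReal_of_nonneg hy.1.le, mul_zero, sub_zero]
  rw [hC0] at hC
  have h1 := (hC.comp hi).add_const ((2 * k - 1 : ℕ) * (Real.pi / 2))
  have e : 0 + (2 * k - 1 : ℕ) * (Real.pi / 2) = k * Real.pi - Real.pi / 2 := by
    rw [Nat.cast_sub (by omega)]; push_cast; ring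
  rw [e] at h1
  refine h1.congr' ?_
  filter_upwards [self_mem_nhdsWithin] with y hy
  have h2 : arg ((y : ℂ) * I) = Real.pi / 2 := by
    rw [arg_real_mul _ hy, arg_I]
  simp only [Function.comp]
  rw [h2]; ring

/-- cos(Re φ - kπ) is positive all along the imaginary axis, so Re φ cannot leave the interval of
length π around kπ that it occupies near 0. -/
theorem IsArccos.re_mul_I (hφ : IsArccos k n a L Q x φ) (h : IsAlternant k n a L σ c Q x)
    (ha0 : 0 < a) (hk : 1 ≤ k) (hkn : k ≤ n) {y : ℝ} (hy : 0 < y) :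
    |(φ (y * I)).re - k * Real.pi| < Real.pi / 2 := by
  have hpi := Real.pi_pos
  have hcos : ∀ t : ℝ, 0 < t → 0 < Real.cos ((φ (t * I)).re - k * Real.pi) := by
    intro t ht
    have h1 := hφ.cos_mul_I hk ht
    have h2 : 0 < 1 / L := one_div_pos.2 h.L_pos
    rw [← h1] at h2
    exact pos_of_mul_pos_left h2 (Real.cosh_pos _).le
  have h3 := (hφ.tendsto_re_mul_I h ha0 hk hkn).eventually (Metric.ball_mem_nhds _ hpi)
  obtain ⟨t, ht1, ht⟩ := (h3.and (self_mem_nhdsWithin : Ioi (0 : ℝ) ∈ 𝓝[>] 0)).exists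
  replace ht1 : |(φ (t * I)).re - (k * Real.pi - Real.pi / 2)| < Real.pi := ht1
  rw [abs_lt] at ht1
  have ht2 : -(Real.pi / 2) < (φ (t * I)).re - k * Real.pi := by
    by_contra hle
    have h4 := Real.cos_nonpos_of_pi_div_two_le_of_le
      (x := -((φ (t * I)).re - k * Real.pi)) (by linarith) (by linarith)
    rw [Real.cos_neg] at h4
    exact absurd (hcos t ht) (not_lt.2 h4)
  have hne : ∀ r : ℝ, Real.cos r = 0 → ∀ s ∈ Ioi (0 : ℝ), (φ (s * I)).re ≠ k * Real.pi + r := by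
    intro r hr s hs h5
    have := hcos s hs
    rw [h5, add_sub_cancel_left, hr] at this
    exact lt_irrefl _ this
  have h6 := lt_of_forall_ne_of_isPreconnected isPreconnected_Ioi hφ.continuousOn_re_mul_I
    (hne (Real.pi / 2) Real.cos_pi_div_two) ht hy (by linarith)
  have h7 := gt_of_forall_ne_of_isPreconnected isPreconnected_Ioi hφ.continuousOn_re_mul_I
    (hne (-(Real.pi / 2)) (by simp)) ht hy (by linarith)
  rw [abs_lt]
  constructor <;> linarith

end

end SgnLaurent

end

noncomputable section
namespace SgnLaurent

open Polynomial Set Complex Filter Topology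

/-! ### The domain `Ω` -/

/-- The arccosine is decreasing, so the deleted region is a superlevel set of cos d cosh v; in this
form it can be compared with Re cos φ. -/
theorem deleted_iff {B v d : ℝ} (hB : 0 < B) (hv : 0 ≤ v) :
    (|d| ≤ Real.arccos (Real.cosh B / Real.cosh v) ∧ B ≤ v) ↔
      (|d| < Real.pi / 2 ∧ Real.cosh B ≤ Real.cos d * Real.cosh v) := by
  have hcv := Real.cosh_pos v
  have hcB := Real.cosh_pos B
  have hq : 0 < Real.cosh B / Real.cosh v := div_pos hcB hcv
  have hpi := Real.pi_pos
  constructor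
  · rintro ⟨h1, h2⟩
    have hq1 : Real.cosh B / Real.cosh v ≤ 1 := by
      rw [div_le_one hcv, Real.cosh_le_cosh, abs_of_pos hB, abs_of_nonneg hv]; exact h2
    refine ⟨h1.trans_lt (Real.arccos_lt_pi_div_two.2 hq), ?_⟩
    have h3 := Real.cos_le_cos_of_nonneg_of_le_pi (abs_nonneg d) (Real.arccos_le_pi _) h1
    rw [Real.cos_arccos (by linarith) hq1, Real.cos_abs, div_le_iff₀ hcv] at h3
    exact h3
  · rintro ⟨h1, h2⟩
    have h3 : Real.cosh B ≤ Real.cosh v :=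
      h2.trans (mul_le_of_le_one_left hcv.le (Real.cos_le_one d))
    rw [Real.cosh_le_cosh, abs_of_pos hB, abs_of_nonneg hv] at h3
    refine ⟨?_, h3⟩
    rw [← div_le_iff₀ hcv, ← Real.cos_abs] at h2
    have h4 := Real.arccos_le_arccos h2
    rwa [Real.arccos_cos (abs_nonneg d) (by linarith)] at h4

theorem mem_Omega_iff {k m : ℕ} {B : ℝ} (hB : 0 < B) {w : ℂ} : w ∈ Omega k m B ↔
    0 < w.im ∧ 0 < w.re ∧ w.re < (k + m) * Real.pi ∧
      ¬(|w.re - Real.pi * k| < Real.pi / 2 ∧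
        Real.cosh B ≤ Real.cos (w.re - Real.pi * k) * Real.cosh w.im) := by
  rw [Omega, Set.mem_sdiff, mem_ofPred_eq, mem_ofPred_eq]
  constructor
  · rintro ⟨⟨h1, h2, h3⟩, h4⟩
    exact ⟨h1, h2, h3, fun h5 => h4 ((deleted_iff hB h1.le).2 h5)⟩
  · rintro ⟨h1, h2, h3, h4⟩
    exact ⟨⟨h1, h2, h3⟩, fun h5 => h4 ((deleted_iff hB h1.le).1 h5)⟩

theorem isOpen_Omega (k m : ℕ) (B : ℝ) : IsOpen (Omega k m B) := by
  refine IsOpen.sdiff ?_ ?_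
  · exact (isOpen_lt continuous_const continuous_im).inter
      ((isOpen_lt continuous_const continuous_re).inter (isOpen_lt continuous_re continuous_const))
  · have h1 : Continuous fun w : ℂ => |w.re - Real.pi * k| := by fun_prop
    have h2 : Continuous fun w : ℂ => Real.arccos (Real.cosh B / Real.cosh w.im) :=
      Real.continuous_arccos.comp (continuous_const.div (Real.continuous_cosh.comp continuous_im)
        fun w => (Real.cosh_pos _).ne')
    exact (isClosed_le h1 h2).inter (isClosed_le continuous_const continuous_im)

theorem mem_Omega_of_im_lt {k m : ℕ} {B : ℝ} {w : ℂ} (h1 : 0 < w.im)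
    (h2 : 0 < w.re) (h3 : w.re < (k + m) * Real.pi) (h4 : w.im < B) : w ∈ Omega k m B :=
  ⟨⟨h1, h2, h3⟩, fun h5 => absurd h5.2 (not_le.2 h4)⟩

/-- Each point is joined vertically to height B / 2 and then horizontally to p₀. The deleted region
is closed under moving upwards and lies above B, so neither segment enters it. -/
theorem isPreconnected_Omega {k m : ℕ} {B : ℝ} (hB : 0 < B) (hk : 1 ≤ k) :
    IsPreconnected (Omega k m B) := by
  have hpi := Real.pi_pos
  have hk' : (1 : ℝ) ≤ k := by exact_mod_cast hk
  set p₀ : ℂ := ⟨Real.pi / 2, B / 2⟩ with hp₀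
  refine isPreconnected_of_forall p₀ fun w hw => ?_
  obtain ⟨h1, h2, h3, h4⟩ := (mem_Omega_iff hB).1 hw
  set p : ℂ := ⟨w.re, B / 2⟩ with hp
  refine ⟨segment ℝ w p ∪ segment ℝ p p₀, union_subset ?_ ?_, Or.inr (right_mem_segment _ _ _),
    Or.inl (left_mem_segment _ _ _), IsPreconnected.union p (right_mem_segment _ _ _)
      (left_mem_segment _ _ _) (convex_segment _ _).isPreconnected
      (convex_segment _ _).isPreconnected⟩
  · rintro _ ⟨s, t, hs, ht, hst, rfl⟩
    have e1 : (s • w + t • p).re = w.re := by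
      simp [hp, ← add_mul, hst]
    have e2 : (s • w + t • p).im = s * w.im + t * (B / 2) := by simp [hp]
    have hpos : 0 < (s • w + t • p).im := by
      rw [e2]
      rcases hs.eq_or_lt with h5 | h5
      · rw [← h5] at hst ⊢; nlinarith
      · nlinarith
    by_cases hlt : (s • w + t • p).im < B
    · exact mem_Omega_of_im_lt hpos (by rwa [e1]) (by rwa [e1]) hlt
    · rw [mem_Omega_iff hB, e1]
      refine ⟨hpos, h2, h3, fun h5 => h4 ⟨h5.1, h5.2.trans ?_⟩⟩
      have hc : 0 ≤ Real.cos (w.re - Real.pi * k) := by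
        have := abs_lt.1 h5.1
        exact Real.cos_nonneg_of_mem_Icc ⟨by linarith, by linarith⟩
      refine mul_le_mul_of_nonneg_left ?_ hc
      rw [Real.cosh_le_cosh, abs_of_pos hpos, abs_of_pos h1, e2]
      rw [e2] at hlt
      have hs1 : s = 1 - t := by linarith
      subst hs1
      by_contra hcon
      push Not at hcon hlt
      nlinarith
  · rintro _ ⟨s, t, hs, ht, hst, rfl⟩
    have e1 : (s • p + t • p₀).re = s * w.re + t * (Real.pi / 2) := by simp [hp, hp₀]
    have e2 : (s • p + t • p₀).im = B / 2 := by simp [hp, hp₀, ← add_mul, hst]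
    have hs1 : s = 1 - t := by linarith
    have hm' : (0 : ℝ) ≤ m := by positivity
    refine mem_Omega_of_im_lt (by rw [e2]; linarith) ?_ ?_ (by rw [e2]; linarith)
    · rw [e1]
      rcases hs.eq_or_lt with h5 | h5
      · rw [← h5] at hst ⊢; nlinarith
      · nlinarith
    · rw [e1]
      have h6 : Real.pi / 2 < (k + m) * Real.pi := by nlinarith
      rcases hs.eq_or_lt with h5 | h5
      · rw [← h5] at hst ⊢
        rw [zero_add] at hst
        rw [hst]; linarith
      · have : s * w.re < s * ((k + m) * Real.pi) := mul_lt_mul_of_pos_left h3 h5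
        nlinarith

theorem closure_Omega_subset {k m : ℕ} {B : ℝ} (hB : 0 < B) {w : ℂ}
    (hw : w ∈ closure (Omega k m B)) : 0 ≤ w.im ∧ 0 ≤ w.re ∧ w.re ≤ (k + m) * Real.pi ∧
      ¬(|w.re - Real.pi * k| < Real.pi / 2 ∧
        Real.cosh B < Real.cos (w.re - Real.pi * k) * Real.cosh w.im) := by
  have hcl : IsClosed {w : ℂ | 0 ≤ w.im ∧ 0 ≤ w.re ∧ w.re ≤ (k + m) * Real.pi ∧
      ¬(|w.re - Real.pi * k| < Real.pi / 2 ∧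
        Real.cosh B < Real.cos (w.re - Real.pi * k) * Real.cosh w.im)} := by
    refine (isClosed_le continuous_const continuous_im).inter
      ((isClosed_le continuous_const continuous_re).inter
      ((isClosed_le continuous_re continuous_const).inter ?_))
    have h1 : Continuous fun w : ℂ => |w.re - Real.pi * k| := by fun_prop
    have h2 : Continuous fun w : ℂ => Real.cos (w.re - Real.pi * k) * Real.cosh w.im :=
      (Real.continuous_cos.comp (by fun_prop)).mul (Real.continuous_cosh.comp continuous_im)
    exact isClosed_compl_iff.2 ((isOpen_lt h1 continuous_const).inter (isOpen_lt continuous_const h2))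
  refine closure_minimal (fun w hw => ?_) hcl hw
  obtain ⟨h1, h2, h3, h4⟩ := (mem_Omega_iff hB).1 hw
  exact ⟨h1.le, h2.le, h3.le, fun h5 => h4 ⟨h5.1, h5.2.le⟩⟩

/-- An interior point of the closure, off the real line, is in Ω: moving slightly in the directions
-1, 1 and i turns the weak inequalities of the closure into strict ones. -/
theorem mem_Omega_of_eventually {k m : ℕ} {B : ℝ} (hB : 0 < B) {w : ℂ} (hw0 : 0 < w.im)
    (hw : ∀ᶠ w' in 𝓝 w, w' ∈ closure (Omega k m B)) : w ∈ Omega k m B := by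
  obtain ⟨r, hr, hball⟩ := Metric.eventually_nhds_iff_ball.1 hw
  have hmem : ∀ d : ℂ, ‖d‖ = 1 → w + (r / 2 : ℝ) * d ∈ closure (Omega k m B) := by
    intro d hd
    refine hball _ ?_
    rw [Metric.mem_ball, dist_eq, add_sub_cancel_left, norm_mul, hd, mul_one, norm_real,
      Real.norm_of_nonneg (by linarith)]
    linarith
  obtain ⟨-, h1, -, -⟩ := closure_Omega_subset hB (hmem (-1) (by simp))
  obtain ⟨-, -, h2, -⟩ := closure_Omega_subset hB (hmem 1 (by simp))
  obtain ⟨-, -, -, h3⟩ := closure_Omega_subset hB (hmem I (by simp))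
  simp only [add_re, re_ofReal_mul, neg_re, one_re, I_re, add_im, im_ofReal_mul, I_im] at h1 h2 h3
  rw [mem_Omega_iff hB]
  refine ⟨hw0, by linarith, by linarith, fun h4 => h3 ?_⟩
  rw [mul_zero, add_zero]
  refine ⟨h4.1, h4.2.trans_lt (mul_lt_mul_of_pos_left ?_ ?_)⟩
  · rw [Real.cosh_lt_cosh, abs_of_pos hw0, abs_of_pos (by linarith)]; linarith
  · have := abs_lt.1 h4.1
    exact Real.cos_pos_of_mem_Ioo ⟨by linarith, by linarith⟩

/-! ### Conformality of the arccosine branch -/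

/-- The data attached to an extremal function. -/
structure ArccosData (k n m : ℕ) (a L σ c B : ℝ) (Q : ℝ[X]) (x : ℕ → ℝ) (φ : ℂ → ℂ) : Prop where
  alt : IsAlternant k n a L σ c Q x
  arc : IsArccos k n a L Q x φ
  a_pos : 0 < a
  one_le : 1 ≤ k
  le : k ≤ n
  n_eq : n + 1 = k + m
  B_pos : 0 < B
  cosh_eq : Real.cosh B = 1 / L

section
variable {k n m : ℕ} {a L σ c B : ℝ} {Q : ℝ[X]} {x : ℕ → ℝ} {φ : ℂ → ℂ}

theorem ArccosData.tendsto_im_zero (D : ArccosData k n m a L σ c B Q x φ) :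
    Tendsto (fun z => (φ z).im) (𝓝[quadrantBar] 0) atTop := by
  refine tendsto_im_of_cos_cobounded ?_ (eventually_nhdsWithin_of_forall D.arc.im_nonneg)
  have h1 := (tendsto_normFun_zero D.one_le D.alt.L_pos.ne' (D.alt.coeff_zero_ne D.a_pos)).mono_left
    (nhdsWithin_mono (0 : ℂ) fun z (hz : z ∈ quadrantBar) => hz.2.2)
  exact h1.congr' (eventually_nhdsWithin_of_forall fun z hz => (D.arc.cos_eq z hz).symm)

theorem ArccosData.tendsto_im_infty (D : ArccosData k n m a L σ c B Q x φ) :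
    Tendsto (fun z => (φ z).im) (Bornology.cobounded ℂ ⊓ 𝓟 quadrantBar) atTop := by
  have h0 : ∀ᶠ z in Bornology.cobounded ℂ ⊓ 𝓟 quadrantBar, z ∈ quadrantBar :=
    mem_inf_of_right (mem_principal_self _)
  refine tendsto_im_of_cos_cobounded ?_ (h0.mono D.arc.im_nonneg)
  have h1 := (D.alt.tendsto_normFun_infty D.one_le D.le).mono_left
    (inf_le_left (b := 𝓟 quadrantBar))
  exact h1.congr' (h0.mono fun z hz => (D.arc.cos_eq z hz).symm)

/-- Properness: preimages of compact sets stay in a compact part of the punctured quadrant. -/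
theorem mem_image_of_mem_closure {φ : ℂ → ℂ} (hc : ContinuousOn φ quadrantBar)
    (h0 : Tendsto (fun z => (φ z).im) (𝓝[quadrantBar] 0) atTop)
    (h1 : Tendsto (fun z => (φ z).im) (Bornology.cobounded ℂ ⊓ 𝓟 quadrantBar) atTop)
    {ι : Type*} {l : Filter ι} [l.NeBot] {g : ι → ℂ} (hg : ∀ᶠ i in l, g i ∈ quadrantBar) {w : ℂ}
    (hw : Tendsto (fun i => φ (g i)) l (𝓝 w)) :
    ∃ z ∈ quadrantBar, φ z = w ∧ MapClusterPt z l g := by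
  have hb : ∀ᶠ i in l, (φ (g i)).im < w.im + 1 :=
    ((continuous_im.tendsto w).comp hw).eventually (gt_mem_nhds (by linarith))
  obtain ⟨r, hr, hr1⟩ := Metric.mem_nhdsWithin_iff.1 (h0.eventually_ge_atTop (w.im + 1))
  obtain ⟨R, hR⟩ : ∃ R : ℝ, ∀ z ∈ quadrantBar, R < ‖z‖ → w.im + 1 ≤ (φ z).im := by
    have h2 := eventually_inf_principal.1 (h1.eventually_ge_atTop (w.im + 1))
    rw [← comap_norm_atTop] at h2
    obtain ⟨R, hR⟩ := (atTop_basis_Ioi.comap _).eventually_iff.1 h2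
    exact ⟨R, fun z hz hzR => hR.2 hzR hz⟩
  have hK : IsCompact (closure quadrant ∩ (Metric.closedBall 0 R \ Metric.ball 0 r)) :=
    ((isCompact_closedBall 0 R).diff Metric.isOpen_ball).inter_left isClosed_closure
  have hmem : ∀ᶠ i in l, g i ∈ closure quadrant ∩ (Metric.closedBall 0 R \ Metric.ball 0 r) := by
    filter_upwards [hg, hb] with i hi hi'
    refine ⟨quadrantBar_subset_closure hi, ?_, fun h2 => ?_⟩
    · rw [mem_closedBall_zero_iff]
      by_contra h2
      exact absurd (hR _ hi (not_le.1 h2)) (not_le.2 hi')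
    · exact absurd (hr1 ⟨h2, hi⟩) (not_le.2 hi')
  obtain ⟨z, hz, hcl⟩ := hK.exists_mapClusterPt (u := g) (le_principal_iff.2 hmem)
  have hz0 : z ∈ quadrantBar := by
    have h2 := hz.1
    rw [closure_quadrant] at h2
    refine ⟨h2.1, h2.2, ?_⟩
    rintro rfl
    exact hz.2.2 (Metric.mem_ball_self hr)
  refine ⟨z, hz0, ?_, hcl⟩
  have hcl2 : ClusterPt z (map g l ⊓ 𝓟 quadrantBar) := by
    have : map g l ≤ 𝓟 quadrantBar := by rw [le_principal_iff]; exact hg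
    rw [inf_eq_left.2 this]; exact hcl
  have h3 : ClusterPt (φ z) (map φ (map g l)) := by
    have h4 := (hc z hz0)
    have h5 : (𝓝[quadrantBar] z ⊓ map g l).NeBot := by
      rw [nhdsWithin, inf_assoc, inf_comm (𝓟 quadrantBar)]; exact hcl2
    exact (h5.map φ).mono (le_inf ((map_mono inf_le_left).trans h4) (map_mono inf_le_right))
  rw [map_map] at h3
  have h6 : ((𝓝 (φ z)) ⊓ 𝓝 w).NeBot := ClusterPt.mono h3 hw
  exact eq_of_nhds_neBot h6

/-- Differentiating cos φ = h gives -sin φ · φ' = h', and h' has no zeros off the real axis. -/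
theorem ArccosData.map_nhds (D : ArccosData k n m a L σ c B Q x φ) {z : ℂ} (hz : z ∈ quadrant) :
    map φ (𝓝 z) = 𝓝 (φ z) := by
  have hd : ∀ᶠ w in 𝓝 z, DifferentiableAt ℂ φ w := by
    filter_upwards [isOpen_quadrant.mem_nhds hz] with w hw using
      D.arc.holo.differentiableAt (isOpen_quadrant.mem_nhds hw)
  have han : AnalyticAt ℂ φ z := analyticAt_iff_eventually_differentiableAt.2 hd
  refine han.hasStrictDerivAt.map_nhds_eq fun h0 => ?_
  have h1 := (hasDerivAt_normFun D.one_le L Q (quadrant_subset hz).2.2)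
  have h2 : HasDerivAt (fun z => cos (φ z)) (-sin (φ z) * deriv φ z) z :=
    (hasDerivAt_cos _).comp z (hd.self_of_nhds.hasDerivAt)
  have h3 : HasDerivAt (normFun k L Q) (-sin (φ z) * deriv φ z) z := by
    refine h2.congr_of_eventuallyEq ?_
    filter_upwards [isOpen_quadrant.mem_nhds hz] with w hw
    exact (D.arc.cos_eq w (quadrant_subset hw)).symm
  have h4 := h1.unique h3
  rw [h0, mul_zero, neg_eq_zero, div_eq_zero_iff, mul_eq_zero] at h4
  rcases h4 with (h4 | h4) | h4
  · exact pow_ne_zero _ (by norm_num) h4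
  · exact D.alt.deriv_ne_zero hz.1.le hz.2.ne' h4
  · exact D.alt.L_pos.ne' (by exact_mod_cast h4)

theorem ArccosData.map_mul_I_notMem (D : ArccosData k n m a L σ c B Q x φ) {y : ℝ} (hy : 0 < y) :
    φ (y * I) ∉ Omega k m B := fun hmem => by
  refine ((mem_Omega_iff D.B_pos).1 hmem).2.2.2 ?_
  rw [mul_comm Real.pi]
  exact ⟨D.arc.re_mul_I D.alt D.a_pos D.one_le D.le hy, by
    rw [D.arc.cos_mul_I D.one_le hy, D.cosh_eq]⟩

theorem ArccosData.n_cast (D : ArccosData k n m a L σ c B Q x φ) : (n : ℝ) + 1 = k + m := by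
  exact_mod_cast D.n_eq

theorem ArccosData.re_one (D : ArccosData k n m a L σ c B Q x φ) :
    (φ 1).re = (k + m) * Real.pi := by
  rw [D.arc.map_one D.alt D.a_pos D.one_le D.le, ← D.n_cast]
  have : ((n : ℂ) + 1) * Real.pi = (((n + 1) * Real.pi : ℝ) : ℂ) := by push_cast; ring
  rw [this, ofReal_re]

/-- Classification of the boundary values on the positive real axis. -/
theorem ArccosData.real_cases (D : ArccosData k n m a L σ c B Q x φ) {y : ℝ} (hy : 0 < y) :
    (y < a ∧ (φ y).re = 0 ∧ 0 < (φ y).im) ∨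
    (y ∈ Icc a 1 ∧ (φ y).im = 0) ∨
    (1 < y ∧ (φ y).re = (k + m) * Real.pi ∧ 0 < (φ y).im) := by
  have ha0 := D.a_pos
  have hk := D.one_le
  have hkn := D.le
  by_cases ha : y < a
  · exact Or.inl ⟨ha, D.arc.re_left D.alt ha0 hk hkn hy ha.le, D.arc.im_pos_of_one_lt hy
      ((D.alt.one_lt_normFunReal ha0 hk hkn hy ha).trans_le (le_abs_self _))⟩
  by_cases hb : 1 < y
  · refine Or.inr (Or.inr ⟨hb, ?_, D.arc.im_pos_of_one_lt hy ?_⟩)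
    · rw [D.arc.re_right D.alt ha0 hk hkn hb.le, D.re_one]
    · refine (D.alt.one_lt_mul_normFunReal ha0 hk hkn hb).trans_le ((le_abs_self _).trans ?_)
      rw [abs_mul, abs_pow, abs_neg, abs_one, one_pow, one_mul]
  push Not at ha hb
  refine Or.inr (Or.inl ⟨⟨ha, hb⟩, ?_⟩)
  rcases ha.eq_or_lt with ha | ha
  · rw [← ha, D.arc.map_left, zero_im]
  rcases hb.eq_or_lt with hb | hb
  · have := (D.arc.node_im D.alt ha0 hk hkn (i := n + 1) le_rfl).1
    rw [D.alt.right] at this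
    rwa [hb]
  rcases D.alt.exists_piece ha hb with ⟨i, hi, hyi⟩ | ⟨j, hj, hyj⟩
  · rw [hyi]; exact (D.arc.node_im D.alt ha0 hk hkn hi).1
  · exact (D.arc.piece D.alt ha0 hk hkn hj hyj).2

theorem ArccosData.real_notMem (D : ArccosData k n m a L σ c B Q x φ) {y : ℝ} (hy : 0 < y) :
    φ y ∉ Omega k m B := fun hmem => by
  obtain ⟨h1, h2, h3, -⟩ := (mem_Omega_iff D.B_pos).1 hmem
  rcases D.real_cases hy with h | h | h <;> linarith [h.2]

theorem boundary_cases {z : ℂ} (hz : z ∈ quadrantBar) :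
    z ∈ quadrant ∨ (∃ y : ℝ, 0 < y ∧ z = y) ∨ ∃ y : ℝ, 0 < y ∧ z = y * I := by
  rcases hz.1.eq_or_lt with h1 | h1
  · refine Or.inr (Or.inr ⟨z.im, lt_of_le_of_ne hz.2.1 fun h2 => hz.2.2 ?_, ?_⟩)
    · exact Complex.ext h1.symm h2.symm
    · apply Complex.ext <;> simp [← h1]
  rcases hz.2.1.eq_or_lt with h2 | h2
  · exact Or.inr (Or.inl ⟨z.re, h1, by apply Complex.ext <;> simp [← h2]⟩)
  · exact Or.inl ⟨h1, h2⟩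

theorem ArccosData.mem_quadrant (D : ArccosData k n m a L σ c B Q x φ) {z : ℂ}
    (hz : z ∈ quadrantBar) (hmem : φ z ∈ Omega k m B) : z ∈ quadrant := by
  rcases boundary_cases hz with h | ⟨y, hy, rfl⟩ | ⟨y, hy, rfl⟩
  · exact h
  · exact absurd hmem (D.real_notMem hy)
  · exact absurd hmem (D.map_mul_I_notMem hy)

/-- The image of the quadrant is open, and properness makes it relatively closed in Ω, because
boundary points of the quadrant are not mapped into Ω. It meets Ω near the first piece of the bottom
edge, so the connected Ω is covered. That the image stays inside Ω is not used here. -/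
theorem ArccosData.Omega_subset (D : ArccosData k n m a L σ c B Q x φ) :
    Omega k m B ⊆ φ '' quadrant := by
  have hopen : IsOpen (φ '' quadrant) := by
    rw [isOpen_iff_mem_nhds]
    rintro _ ⟨z, hz, rfl⟩
    rw [← D.map_nhds hz]
    exact image_mem_map (isOpen_quadrant.mem_nhds hz)
  refine (isPreconnected_Omega D.B_pos D.one_le).subset_of_closure_inter_subset hopen ?_ ?_
  · have hlt := D.alt.mono 0 1 (by omega) (by omega)
    obtain ⟨y, hy⟩ := exists_between hlt
    have hpi := Real.pi_pos
    have hpos := (D.alt.pos D.a_pos (i := 0) (by omega)).trans hy.1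
    obtain ⟨h1, h2⟩ := D.arc.piece D.alt D.a_pos D.one_le D.le (j := 0) (by omega) hy
    have hyQ := mem_quadrantBar_ofReal hpos
    have := mem_closure_quadrant_neBot hyQ
    have hc := ((D.arc.cont y hyQ).mono quadrant_subset).tendsto
    have hN : (1 : ℝ) ≤ k + m := by
      rw [← D.n_cast]; have : (0 : ℝ) ≤ n := by positivity
      linarith
    have hopen : IsOpen {w : ℂ | 0 < w.re ∧ w.re < (k + m) * Real.pi ∧ w.im < B} :=
      (isOpen_lt continuous_const continuous_re).inter
      ((isOpen_lt continuous_re continuous_const).inter (isOpen_lt continuous_im continuous_const))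
    have h3 := hc.eventually (hopen.mem_nhds (by
      refine ⟨?_, ?_, ?_⟩
      · simpa using h1.1
      · have := h1.2
        simp only [Nat.cast_zero, zero_add, one_mul] at this
        nlinarith
      · rw [h2]; exact D.B_pos))
    obtain ⟨z, hz1, hz⟩ := (h3.and self_mem_nhdsWithin).exists
    exact ⟨φ z, mem_Omega_of_im_lt (D.arc.im_pos z hz) hz1.1 hz1.2.1 hz1.2.2, z, hz, rfl⟩
  · rintro w ⟨hw1, hw2⟩
    obtain ⟨u, hu, hlim⟩ := mem_closure_iff_seq_limit.1 hw1
    choose g hg hgu using hu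
    obtain ⟨z, hz, hzw, -⟩ := mem_image_of_mem_closure D.arc.cont D.tendsto_im_zero
      D.tendsto_im_infty (g := g) (Eventually.of_forall fun i => quadrant_subset (hg i))
      (by simpa only [hgu] using hlim)
    exact ⟨z, D.mem_quadrant hz (hzw ▸ hw2), hzw⟩

end

end SgnLaurent

end

noncomputable section
namespace SgnLaurent

open Polynomial Set Complex Filter Topology

/-! ### Bijectivity of the arccosine branch by root counting -/

theorem normFun_conj (k : ℕ) (L : ℝ) (Q : ℝ[X]) (z : ℂ) :
    normFun k L Q ((starRingEnd ℂ) z) = (starRingEnd ℂ) (normFun k L Q z) := by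
  rw [normFun, normFun, cfun_conj]
  simp

theorem cfun_eq_of_normFun {k : ℕ} {L : ℝ} (hL : L ≠ 0) (Q : ℝ[X]) (z : ℂ) :
    cfun k Q z = 1 - ((-1) ^ k * L : ℝ) * normFun k L Q z := by
  have hL' : (L : ℂ) ≠ 0 := ofReal_ne_zero.2 hL
  have h1 : ((-1 : ℂ) ^ k) * (-1) ^ k = 1 := by rw [← pow_add, Even.neg_one_pow ⟨k, rfl⟩]
  rw [normFun]
  push_cast
  field_simp
  linear_combination (1 - cfun k Q z) * h1

/-- The solution of `cos u = cos u₀` in the interval `(jπ, (j+1)π)`, for `u₀ ∈ (0, π)`. -/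
def levelPoint (u : ℝ) (j : ℕ) : ℝ :=
  if Even j then u + j * Real.pi else (j + 1 : ℕ) * Real.pi - u

theorem levelPoint_mem {u : ℝ} (hu : u ∈ Ioo 0 Real.pi) (j : ℕ) :
    levelPoint u j ∈ Ioo (j * Real.pi) ((j + 1) * Real.pi) := by
  obtain ⟨h1, h2⟩ := hu
  unfold levelPoint
  split_ifs
  · constructor <;> linarith
  · push_cast; constructor <;> linarith

theorem cos_levelPoint (u : ℝ) (j : ℕ) : Real.cos (levelPoint u j) = Real.cos u := by
  unfold levelPoint
  split_ifs with h
  · rw [Real.cos_add_nat_mul_pi, h.neg_one_pow, one_mul]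
  · rw [Real.cos_nat_mul_pi_sub, (Nat.not_even_iff_odd.1 h).add_one.neg_one_pow, one_mul]

theorem sin_levelPoint (u : ℝ) (j : ℕ) :
    Real.sin (levelPoint u j) = if Even j then Real.sin u else -Real.sin u := by
  unfold levelPoint
  split_ifs with h
  · rw [Real.sin_add_nat_mul_pi, h.neg_one_pow, one_mul]
  · rw [Real.sin_nat_mul_pi_sub, (Nat.not_even_iff_odd.1 h).add_one.neg_one_pow, one_mul]

theorem eq_of_mem_Ioo_pi {t : ℝ} {i j : ℕ} (hi : t ∈ Ioo (i * Real.pi) ((i + 1) * Real.pi))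
    (hj : t ∈ Ioo (j * Real.pi) ((j + 1) * Real.pi)) : i = j := by
  have hpi := Real.pi_pos
  have h1 := lt_of_mul_lt_mul_right (hi.1.trans hj.2) hpi.le
  have h2 := lt_of_mul_lt_mul_right (hj.1.trans hi.2) hpi.le
  have h3 : i < j + 1 := by exact_mod_cast h1
  have h4 : j < i + 1 := by exact_mod_cast h2
  omega

section
variable {k n m : ℕ} {a L σ c B : ℝ} {Q : ℝ[X]} {x : ℕ → ℝ} {φ : ℂ → ℂ}

/-- At the height v of φ(z) the domain contains enough points whose cosine is h(z) or its conjugate.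
Their preimages under φ, conjugated when necessary, are distinct solutions in the right half plane
of one equation f = C₀ and exhaust the count n + 1 or n - 1. As z or its conjugate is also a
solution, it is among them. -/
theorem ArccosData.eq_of_rightInverse (D : ArccosData k n m a L σ c B Q x φ) {g : ℂ → ℂ}
    (hg : ∀ w ∈ Omega k m B, g w ∈ quadrant ∧ φ (g w) = w) {z : ℂ} (hz : z ∈ quadrant)
    (him : (normFun k L Q z).im ≠ 0) (hre : (cfun k Q z).re ≠ 0) :
    φ z ∈ Omega k m B ∧ g (φ z) = z := by
  classical
  have hL := D.alt.L_pos
  have hv := D.arc.im_pos z hz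
  have hcos := D.arc.cos_eq z (quadrant_subset hz)
  set v := (φ z).im with hvdef
  set u₀ := (φ z).re with hu₀
  have hτre : (normFun k L Q z).re = Real.cos u₀ * Real.cosh v := by rw [← hcos, cos_re]
  have hτim : (normFun k L Q z).im = -(Real.sin u₀ * Real.sinh v) := by rw [← hcos, cos_im]
  have hsin0 : Real.sin u₀ ≠ 0 := fun h0 => him (by rw [hτim, h0, zero_mul, neg_zero])
  set u := Real.arccos (Real.cos u₀) with hu
  have hcosu : Real.cos u = Real.cos u₀ :=
    Real.cos_arccos (Real.neg_one_le_cos _) (Real.cos_le_one _)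
  have hsinu : Real.sin u = |Real.sin u₀| := by
    rw [hu, Real.sin_arccos, ← Real.sin_sq, Real.sqrt_sq_eq_abs]
  have hsinpos : 0 < Real.sin u := by rw [hsinu]; exact abs_pos.2 hsin0
  have huI : u ∈ Ioo 0 Real.pi := by
    refine ⟨lt_of_le_of_ne (Real.arccos_nonneg _) fun h0 => ?_,
      lt_of_le_of_ne (Real.arccos_le_pi _) fun h0 => ?_⟩
    · rw [← h0, Real.sin_zero] at hsinpos; exact lt_irrefl _ hsinpos
    · rw [h0, Real.sin_pi] at hsinpos; exact lt_irrefl _ hsinpos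
  set pt : ℕ → ℂ := fun j => ⟨levelPoint u j, v⟩ with hpt
  -- τ₀ is h(z) or its conjugate, normalized to have Im τ₀ < 0; even strips carry τ₀ and odd strips
  -- its conjugate.
  set τ₀ : ℂ := ⟨Real.cos u₀ * Real.cosh v, -(Real.sin u * Real.sinh v)⟩ with hτ₀
  have hcpt : ∀ j, cos (pt j) = if Even j then τ₀ else (starRingEnd ℂ) τ₀ := by
    intro j
    apply Complex.ext
    · rw [cos_re]
      simp only [hpt, cos_levelPoint, hcosu]
      split_ifs <;> simp [hτ₀]
    · rw [cos_im]
      simp only [hpt, sin_levelPoint]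
      split_ifs <;> simp [hτ₀]
  set C₀ : ℂ := 1 - ((-1) ^ k * L : ℝ) * τ₀ with hC₀
  have hCre : C₀.re = (cfun k Q z).re := by
    rw [hC₀, cfun_eq_of_normFun hL.ne', sub_re, sub_re, re_ofReal_mul, re_ofReal_mul, hτre]
  have hkey : (-1) ^ k * (Real.cos u₀ * Real.cosh v) = (1 - C₀.re) * Real.cosh B := by
    rw [D.cosh_eq, hC₀, sub_re, re_ofReal_mul, one_re]
    have h1 : ((-1 : ℝ) ^ k) ≠ 0 := by simp
    field_simp
    ring
  -- By this identity a point of the level can lie in the deleted region only if Re C₀ ≤ 0, and then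
  -- only if its strip touches the line u = πk.
  have hptc : ∀ j, Real.cos ((pt j).re - Real.pi * k) * Real.cosh (pt j).im
      = (1 - C₀.re) * Real.cosh B := by
    intro j
    rw [← hkey, mul_comm Real.pi, Real.cos_sub_nat_mul_pi]
    simp only [hpt, cos_levelPoint, hcosu]
    ring
  have hpi := Real.pi_pos
  have hptΩ : ∀ j ≤ n, (0 < C₀.re ∨ (j ≠ k ∧ j + 1 ≠ k)) → pt j ∈ Omega k m B := by
    intro j hj hor
    obtain ⟨h1, h2⟩ := levelPoint_mem huI j
    rw [mem_Omega_iff D.B_pos]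
    refine ⟨hv, ?_, ?_, ?_⟩
    · exact lt_of_le_of_lt (by positivity) h1
    · refine h2.trans_le (mul_le_mul_of_nonneg_right ?_ hpi.le)
      rw [← D.n_cast]
      have : (j : ℝ) ≤ n := by exact_mod_cast hj
      linarith
    · rintro ⟨h3, h4⟩
      rw [hptc] at h4
      rcases hor with h5 | ⟨h5, h6⟩
      · nlinarith [Real.cosh_pos B]
      · have h3' : |levelPoint u j - Real.pi * k| < Real.pi / 2 := h3
        rw [abs_lt] at h3'
        rcases lt_or_ge j k with h7 | h7
        · have h8 : (j : ℝ) + 1 + 1 ≤ k := by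
            have : j + 1 + 1 ≤ k := by omega
            exact_mod_cast this
          nlinarith
        · have h8 : (k : ℝ) + 1 ≤ j := by
            have : k + 1 ≤ j := by omega
            exact_mod_cast this
          nlinarith
  -- For Re C₀ < 0 the strips k - 1 and k, adjacent to u = πk, are discarded; at least n - 1 strips
  -- remain, which is the full root count in that case.
  set J : Finset ℕ := if 0 < C₀.re then Finset.range (n + 1) else
    Finset.range (n + 1) \ {k - 1, k} with hJ
  have hJΩ : ∀ j ∈ J, pt j ∈ Omega k m B := by
    intro j hj
    rw [hJ] at hj
    split_ifs at hj with h1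
    · exact hptΩ j (by have := Finset.mem_range.1 hj; omega) (Or.inl h1)
    · rw [Finset.mem_sdiff, Finset.mem_range, Finset.mem_insert, Finset.mem_singleton] at hj
      have := D.one_le
      exact hptΩ j (by omega) (Or.inr ⟨by omega, by omega⟩)
  -- Conjugating in the odd strips puts all preimages on the single level τ₀; the sign of Im ζ j
  -- then remembers the parity of j.
  set ζ : ℕ → ℂ := fun j => if Even j then g (pt j) else (starRingEnd ℂ) (g (pt j)) with hζ
  have hζim : ∀ j ∈ J, Even j ↔ 0 < (ζ j).im := by
    intro j hj
    have h1 := (hg _ (hJΩ j hj)).1.2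
    by_cases h2 : Even j
    · simp only [hζ, h2, if_true, true_iff]; exact h1
    · simp only [hζ, h2, if_false, false_iff, conj_im]; linarith
  have hζre : ∀ j ∈ J, 0 < (ζ j).re := by
    intro j hj
    have h1 := (hg _ (hJΩ j hj)).1.1
    simp only [hζ]
    split_ifs <;> simpa using h1
  have hζnorm : ∀ j ∈ J, normFun k L Q (ζ j) = τ₀ := by
    intro j hj
    have h1 := hg _ (hJΩ j hj)
    have h2 := D.arc.cos_eq _ (quadrant_subset h1.1)
    rw [h1.2, hcpt] at h2
    simp only [hζ]
    split_ifs at h2 ⊢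
    · exact h2.symm
    · rw [normFun_conj, ← h2, conj_conj]
  have hζinj : Set.InjOn ζ J := by
    intro i hi j hj hij
    have hpar : Even i ↔ Even j := by rw [hζim i hi, hζim j hj, hij]
    have hgg : g (pt i) = g (pt j) := by
      simp only [hζ] at hij
      by_cases h2 : Even i
      · rwa [if_pos h2, if_pos (hpar.1 h2)] at hij
      · rw [if_neg h2, if_neg (fun h => h2 (hpar.2 h))] at hij
        exact (starRingEnd ℂ).injective hij
    have hpp : pt i = pt j := by rw [← (hg _ (hJΩ i hi)).2, hgg, (hg _ (hJΩ j hj)).2]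
    have h3 : levelPoint u i = levelPoint u j := congrArg re hpp
    exact eq_of_mem_Ioo_pi (levelPoint_mem huI i) (h3 ▸ levelPoint_mem huI j)
  set ζ₀ : ℂ := if 0 < Real.sin u₀ then z else (starRingEnd ℂ) z with hζ₀
  have hζ₀norm : normFun k L Q ζ₀ = τ₀ := by
    simp only [hζ₀]
    split_ifs with h1
    · apply Complex.ext
      · rw [hτre]
      · rw [hτim, hτ₀, hsinu, abs_of_pos h1]
    · have h2 : Real.sin u₀ < 0 := lt_of_le_of_ne (not_lt.1 h1) hsin0
      rw [normFun_conj]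
      apply Complex.ext
      · rw [conj_re, hτre]
      · rw [conj_im, hτim, hτ₀, hsinu, abs_of_neg h2]; ring
  have hζ₀re : 0 < ζ₀.re := by
    simp only [hζ₀]; split_ifs <;> simpa using hz.1
  have hcard : (J.image ζ).card = J.card := Finset.card_image_of_injOn hζinj
  have hlev : ∀ w ∈ insert ζ₀ (J.image ζ), 0 < w.re ∧ cfun k Q w = C₀ := by
    intro w hw
    rw [cfun_eq_of_normFun hL.ne']
    rcases Finset.mem_insert.1 hw with rfl | hw
    · exact ⟨hζ₀re, by rw [hζ₀norm]⟩
    · obtain ⟨j, hj, rfl⟩ := Finset.mem_image.1 hw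
      exact ⟨hζre j hj, by rw [hζnorm j hj]⟩
  have hmem : ζ₀ ∈ J.image ζ := by
    by_contra hnot
    have h1 : (insert ζ₀ (J.image ζ)).card = J.card + 1 := by
      rw [Finset.card_insert_of_notMem hnot, hcard]
    by_cases hpos : 0 < C₀.re
    · have h2 := D.alt.card_level_le_of_pos D.a_pos D.one_le D.le hpos hlev
      rw [h1, hJ, if_pos hpos, Finset.card_range] at h2
      omega
    · have hneg : C₀.re < 0 := lt_of_le_of_ne (not_lt.1 hpos) (by rw [hCre]; exact hre)
      have h2 := D.alt.card_level_le_of_neg D.a_pos D.one_le D.le hneg hlev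
      rw [h1, hJ, if_neg hpos] at h2
      have h3 := Finset.le_card_sdiff ({k - 1, k} : Finset ℕ) (Finset.range (n + 1))
      rw [Finset.card_range] at h3
      have h4 : ({k - 1, k} : Finset ℕ).card ≤ 2 := Finset.card_le_two
      omega
  obtain ⟨j, hj, hjz⟩ := Finset.mem_image.1 hmem
  have hzg : z = g (pt j) := by
    have h1 := hζim j hj
    rw [hjz] at h1
    simp only [hζ, hζ₀] at hjz h1
    by_cases h2 : 0 < Real.sin u₀
    · rw [if_pos h2] at hjz h1
      rwa [if_pos (h1.2 hz.2), eq_comm] at hjz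
    · rw [if_neg h2] at hjz h1
      have h3 : ¬ Even j := fun h4 => by
        have := h1.1 h4
        rw [conj_im] at this
        linarith [hz.2]
      rw [if_neg h3] at hjz
      exact ((starRingEnd ℂ).injective hjz).symm
  have h5 := hg _ (hJΩ j hj)
  have h6 : φ z = pt j := by rw [hzg]; exact h5.2
  rw [h6]
  exact ⟨hJΩ j hj, hzg.symm⟩

/-- f is open on the quadrant, so every nonempty open subset contains points whose value lies off
both coordinate axes; there Im h ≠ 0 and Re f ≠ 0. -/
theorem ArccosData.exists_generic (D : ArccosData k n m a L σ c B Q x φ) {U : Set ℂ}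
    (hU : IsOpen U) (hne : U.Nonempty) (hUQ : U ⊆ quadrant) :
    ∃ z ∈ U, (normFun k L Q z).im ≠ 0 ∧ (cfun k Q z).re ≠ 0 := by
  obtain ⟨z₀, hz₀⟩ := hne
  have hdense : Dense ({w : ℂ | w.re ≠ 0} ∩ {w : ℂ | w.im ≠ 0}) := by
    refine Dense.inter_of_isOpen_left ?_ ?_ (isOpen_ne_fun continuous_re continuous_const)
    · exact (dense_compl_singleton (0 : ℝ)).preimage isOpenMap_re
    · exact (dense_compl_singleton (0 : ℝ)).preimage isOpenMap_im
  have h1 := image_mem_map (m := cfun k Q) (hU.mem_nhds hz₀)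
  rw [D.alt.map_nhds D.one_le (hUQ hz₀).1.le (hUQ hz₀).2.ne'] at h1
  obtain ⟨w, ⟨z, hz, rfl⟩, hw⟩ := (mem_closure_iff_nhds.1 (hdense (cfun k Q z₀)) _ h1)
  refine ⟨z, hz, fun h0 => hw.2 ?_, hw.1⟩
  rw [cfun_eq_of_normFun D.alt.L_pos.ne', sub_im, im_ofReal_mul, h0]
  simp

theorem ArccosData.exists_rightInverse (D : ArccosData k n m a L σ c B Q x φ) :
    ∃ g : ℂ → ℂ, ∀ w ∈ Omega k m B, g w ∈ quadrant ∧ φ (g w) = w := by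
  classical
  have h : ∀ w, ∃ z, w ∈ Omega k m B → z ∈ quadrant ∧ φ z = w := by
    intro w
    by_cases hw : w ∈ Omega k m B
    · obtain ⟨z, hz, hzw⟩ := D.Omega_subset hw
      exact ⟨z, fun _ => ⟨hz, hzw⟩⟩
    · exact ⟨0, fun h => absurd h hw⟩
  choose g hg using h
  exact ⟨g, hg⟩

/-- Generic points go into Ω, so by density all points go into its closure. Since φ is open and Im φ
> 0, the values are interior and lie in Ω. -/
theorem ArccosData.mapsTo (D : ArccosData k n m a L σ c B Q x φ) :
    MapsTo φ quadrant (Omega k m B) := by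
  obtain ⟨g, hg⟩ := D.exists_rightInverse
  have hcont : ContinuousOn φ quadrant := D.arc.cont.mono quadrant_subset
  have hcl : ∀ z ∈ quadrant, φ z ∈ closure (Omega k m B) := by
    by_contra hcon
    push Not at hcon
    obtain ⟨z₀, hz₀, hz₀'⟩ := hcon
    obtain ⟨z, hz, h1, h2⟩ := D.exists_generic
      (hcont.isOpen_inter_preimage isOpen_quadrant isClosed_closure.isOpen_compl)
      ⟨z₀, hz₀, hz₀'⟩ inter_subset_left
    exact hz.2 (subset_closure (D.eq_of_rightInverse hg hz.1 h1 h2).1)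
  intro z hz
  refine mem_Omega_of_eventually D.B_pos (D.arc.im_pos z hz) ?_
  rw [← D.map_nhds hz]
  exact mem_of_superset (image_mem_map (isOpen_quadrant.mem_nhds hz)) (image_subset_iff.2 hcl)

/-- A double value at two distinct points persists on disjoint neighbourhoods because φ is open; a
generic double value contradicts the left inverse property of g. -/
theorem ArccosData.injOn (D : ArccosData k n m a L σ c B Q x φ) : InjOn φ quadrant := by
  obtain ⟨g, hg⟩ := D.exists_rightInverse
  have hcont : ContinuousOn φ quadrant := D.arc.cont.mono quadrant_subset
  intro z₁ hz₁ z₂ hz₂ h12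
  by_contra hne
  obtain ⟨U₁, U₂, hU₁, hU₂, h1, h2, hdisj⟩ := t2_separation hne
  have hV : IsOpen (φ '' (U₂ ∩ quadrant)) := by
    rw [isOpen_iff_mem_nhds]
    rintro _ ⟨z, hz, rfl⟩
    rw [← D.map_nhds hz.2]
    exact image_mem_map ((hU₂.inter isOpen_quadrant).mem_nhds hz)
  obtain ⟨z, ⟨⟨hz, ⟨z', ⟨hz'U, hz'⟩, hzz'⟩⟩, hzU⟩, h3, h4⟩ := D.exists_generic
    ((hcont.isOpen_inter_preimage isOpen_quadrant hV).inter hU₁)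
    ⟨z₁, ⟨hz₁, z₂, ⟨h2, hz₂⟩, h12.symm⟩, h1⟩ (inter_subset_left.trans inter_subset_left)
  have hnorm : normFun k L Q z' = normFun k L Q z := by
    rw [← D.arc.cos_eq _ (quadrant_subset hz'), ← D.arc.cos_eq _ (quadrant_subset hz), hzz']
  have hcf : cfun k Q z' = cfun k Q z := by
    rw [cfun_eq_of_normFun D.alt.L_pos.ne', hnorm, ← cfun_eq_of_normFun D.alt.L_pos.ne']
  have h5 := (D.eq_of_rightInverse hg hz h3 h4).2
  have h6 := (D.eq_of_rightInverse hg hz' (by rwa [hnorm]) (by rwa [hcf])).2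
  rw [hzz', h5] at h6
  exact disjoint_left.1 hdisj hzU (h6 ▸ hz'U)

theorem ArccosData.bijOn (D : ArccosData k n m a L σ c B Q x φ) :
    BijOn φ quadrant (Omega k m B) := ⟨D.mapsTo, D.injOn, D.Omega_subset⟩

/-- By Rolle a repeated value gives a point with F' = 0. The derivative of f at iy equals F'(y) and
is real, so it would vanish off the real axis. -/
theorem imagFun_injOn (h : IsAlternant k n a L σ c Q x) (hk : 1 ≤ k) :
    InjOn (imagFun k Q) (Ioi 0) := by
  intro y₁ hy₁ y₂ hy₂ h12
  by_contra hne
  wlog hlt : y₁ < y₂ generalizing y₁ y₂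
  · exact this hy₂ hy₁ h12.symm (Ne.symm hne) (lt_of_le_of_ne (not_lt.1 hlt) (Ne.symm hne))
  have hd : ∀ y : ℝ, 0 < y → HasDerivAt (fun y : ℝ => ((imagFun k Q y : ℝ) : ℂ))
      (((derivPoly k Q).map ofRealHom).eval ((y * I : ℂ) ^ 2) / (y * I : ℂ) ^ (2 * k)) y := by
    intro y hy
    have h1 := hasDerivAt_cfun hk Q (mem_quadrantBar_mul_I hy).2.2
    have h2 : HasDerivAt (fun s : ℝ => (s : ℂ) * I) I y := by
      have := (ofRealCLM.hasDerivAt (x := y)).mul_const I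
      simpa using this
    have h3 := ((h1.comp y h2).mul_const (-I))
    refine (h3.congr_deriv ?_).congr_of_eventuallyEq (Eventually.of_forall fun s => ?_)
    · rw [mul_assoc, mul_neg, I_mul_I, neg_neg, mul_one]
    · simp only [Function.comp]
      rw [cfun_mul_I hk, mul_assoc, mul_neg, I_mul_I, neg_neg, mul_one]
  have hdr : ∀ y : ℝ, 0 < y → HasDerivAt (imagFun k Q)
      (((derivPoly k Q).map ofRealHom).eval ((y * I : ℂ) ^ 2) / (y * I : ℂ) ^ (2 * k)).re y := by
    intro y hy
    exact reCLM.hasFDerivAt.comp_hasDerivAt y (hd y hy)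
  obtain ⟨y, hy, hy0⟩ := exists_hasDerivAt_eq_zero hlt
    (fun y hy => (hdr y (lt_of_lt_of_le hy₁ hy.1)).continuousAt.continuousWithinAt) h12
    (fun y hy => hdr y (lt_trans hy₁ hy.1))
  have hypos : 0 < y := lt_trans hy₁ hy.1
  refine h.deriv_ne_zero (z := y * I) (by simp) (by simpa using hypos.ne') ?_
  have h4 := (imCLM.hasFDerivAt.comp_hasDerivAt y (hd y hypos))
  have h5 : HasDerivAt (fun _ : ℝ => (0 : ℝ))
      (((derivPoly k Q).map ofRealHom).eval ((y * I : ℂ) ^ 2) / (y * I : ℂ) ^ (2 * k)).im y := by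
    refine h4.congr_of_eventuallyEq (Eventually.of_forall fun s => ?_)
    simp
  exact Complex.ext hy0 (h5.unique (hasDerivAt_const y 0))

theorem ArccosData.injOn_Icc (D : ArccosData k n m a L σ c B Q x φ) {y₁ y₂ : ℝ} (hy₁ : a ≤ y₁)
    (hlt : y₁ < y₂) (hy₂ : y₂ ≤ 1) : φ y₁ ≠ φ y₂ := fun h12 => by
  have ha0 := D.a_pos
  have hk := D.one_le
  have hkn := D.le
  have hh : normFunReal k L Q y₁ = normFunReal k L Q y₂ := by
    have h1 := D.arc.cos_re_eq (ha0.trans_le hy₁)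
    rw [h12, D.arc.cos_re_eq (ha0.trans_le (hy₁.trans hlt.le))] at h1
    exact h1.symm
  -- the piece containing `y₁`
  obtain ⟨j, hj, hyj, hyj', hre⟩ : ∃ j ≤ n, x j ≤ y₁ ∧ y₁ < x (j + 1) ∧
      (φ y₁).re < (j + 1) * Real.pi := by
    have hpi := Real.pi_pos
    have hnode : ∀ i ≤ n, y₁ = x i → ∃ j ≤ n, x j ≤ y₁ ∧ y₁ < x (j + 1) ∧
      (φ y₁).re < (j + 1) * Real.pi := fun i hi hyi => by
      refine ⟨i, hi, hyi.ge, hyi ▸ D.alt.mono i (i + 1) (by omega) (by omega), ?_⟩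
      rw [hyi, D.arc.node_re D.alt ha0 hk hkn (by omega)]
      linarith
    rcases hy₁.eq_or_lt with h1 | h1
    · exact hnode 0 (by omega) (by rw [D.alt.left, h1])
    rcases D.alt.exists_piece h1 (hlt.trans_le hy₂) with ⟨i, hi, hyi⟩ | ⟨j, hj, hyj⟩
    · refine hnode i ?_ hyi
      rcases Nat.lt_or_ge n i with h2 | h2
      · have : i = n + 1 := by omega
        rw [this, D.alt.right] at hyi
        linarith
      · exact h2
    · exact ⟨j, hj, hyj.1.le, hyj.2, (D.arc.piece D.alt ha0 hk hkn hj hyj).1.2⟩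
  rcases le_or_gt y₂ (x (j + 1)) with h2 | h2
  · have h3 := D.alt.normFunReal_lt ha0 hk hkn hj (ha0.trans_le hy₁) hlt
      (fun i _ hi => (D.alt.le_node hi (by omega)).trans hyj)
      (fun i hi _ => h2.trans (D.alt.le_node hi (by omega)))
    rw [hh] at h3
    exact lt_irrefl _ h3
  · have hge : ∀ i, j + 1 ≤ i → (((j : ℕ) : ℝ) + 1) * Real.pi ≤ i * Real.pi := fun i hi => by
      have : ((j : ℕ) : ℝ) + 1 ≤ i := by exact_mod_cast hi
      exact mul_le_mul_of_nonneg_right this Real.pi_pos.le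
    have hlow : (j + 1) * Real.pi ≤ (φ y₂).re := by
      rcases hy₂.eq_or_lt with h3 | h3
      · have h4 := D.arc.node_re D.alt ha0 hk hkn (i := n + 1) le_rfl
        rw [D.alt.right] at h4
        rw [h3, h4]
        exact hge _ (by omega)
      rcases D.alt.exists_piece (hy₁.trans_lt hlt) h3 with ⟨i, hi, hyi⟩ | ⟨i, hi, hyi⟩
      · rw [hyi, D.arc.node_re D.alt ha0 hk hkn hi]
        refine hge i ?_
        by_contra h5
        have := D.alt.le_node (i := i) (j := j + 1) (by omega) (by omega)
        linarith
      · refine le_trans (hge i ?_) (D.arc.piece D.alt ha0 hk hkn hi hyi).1.1.le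
        by_contra h5
        have := D.alt.le_node (i := i + 1) (j := j + 1) (by omega) (by omega)
        linarith [hyi.2]
    rw [← h12] at hlow
    linarith

theorem ArccosData.real_injOn (D : ArccosData k n m a L σ c B Q x φ) {y₁ y₂ : ℝ} (hy₁ : 0 < y₁)
    (hlt : y₁ < y₂) : φ y₁ ≠ φ y₂ := fun h12 => by
  have ha0 := D.a_pos
  have hk := D.one_le
  have hkn := D.le
  have hh : normFunReal k L Q y₁ = normFunReal k L Q y₂ := by
    have h1 := D.arc.cos_re_eq hy₁
    rw [h12, D.arc.cos_re_eq (hy₁.trans hlt)] at h1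
    exact h1.symm
  have hN : 0 < (k + m : ℝ) * Real.pi := by
    rw [← D.n_cast]
    have := Real.pi_pos
    positivity
  rcases D.real_cases hy₁ with h1 | h1 | h1 <;> rcases D.real_cases (hy₁.trans hlt) with h2 | h2 | h2
  · have h3 := D.alt.normFunReal_lt ha0 hk hkn (j := 0) (by omega) hy₁ hlt
      (fun i h1 h2 => by omega)
      (fun i h4 h5 => h2.1.le.trans (by rw [← D.alt.left]; exact D.alt.le_node (by omega) (by omega)))
    rw [hh] at h3
    exact lt_irrefl _ h3
  · rw [h12] at h1; linarith [h1.2.2, h2.2]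
  · rw [h12] at h1; linarith [h1.2.1, h2.2.1]
  · linarith [h1.1.1, h2.1]
  · exact D.injOn_Icc h1.1.1 hlt h2.1.2 h12
  · rw [h12] at h1; linarith [h1.2, h2.2.2]
  · have := D.alt.mono 0 (n + 1) (by omega) le_rfl
    rw [D.alt.left, D.alt.right] at this
    linarith [h1.1, h2.1]
  · linarith [h1.1, h2.1.2]
  · have h3 := D.alt.normFunReal_lt ha0 hk hkn (j := n) le_rfl hy₁ hlt
      (fun i _ h5 => le_trans (by rw [← D.alt.right]; exact D.alt.le_node (by omega) le_rfl) h1.1.le)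
      (fun i h1 h2 => by omega)
    rw [hh] at h3
    exact lt_irrefl _ h3

theorem ArccosData.mul_I_im_pos (D : ArccosData k n m a L σ c B Q x φ) {y : ℝ} (hy : 0 < y) :
    0 < (φ (y * I)).im ∧ 0 < (φ (y * I)).re ∧ (φ (y * I)).re < (k + m) * Real.pi := by
  have hpi := Real.pi_pos
  have h1 := abs_lt.1 (D.arc.re_mul_I D.alt D.a_pos D.one_le D.le hy)
  have hk : (1 : ℝ) ≤ k := by exact_mod_cast D.one_le
  have hm : (1 : ℝ) ≤ m := by
    have : 1 ≤ m := by have := D.n_eq; have := D.le; omega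
    exact_mod_cast this
  refine ⟨lt_of_le_of_ne (D.arc.im_nonneg _ (mem_quadrantBar_mul_I hy)) fun h0 => ?_,
    by nlinarith, by nlinarith⟩
  have h2 := D.arc.cos_mul_I D.one_le hy
  rw [← h0, Real.cosh_zero, mul_one, ← D.cosh_eq] at h2
  have h3 := Real.cos_le_one ((φ (y * I)).re - k * Real.pi)
  have h4 := Real.one_lt_cosh.2 D.B_pos.ne'
  linarith

theorem ArccosData.injOn_closure (D : ArccosData k n m a L σ c B Q x φ) :
    InjOn φ quadrantBar := by
  have hri : ∀ y₁ y₂ : ℝ, 0 < y₁ → 0 < y₂ → φ y₁ ≠ φ (y₂ * I) := by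
    intro y₁ y₂ h1 h2 h12
    obtain ⟨h3, h4, h5⟩ := D.mul_I_im_pos h2
    rw [← h12] at h3 h4 h5
    rcases D.real_cases h1 with h | h | h <;> linarith [h.2]
  intro z₁ hz₁ z₂ hz₂ h12
  rcases boundary_cases hz₁ with h1 | ⟨y₁, hy₁, rfl⟩ | ⟨y₁, hy₁, rfl⟩
  · exact D.injOn h1 (D.mem_quadrant hz₂ (h12 ▸ D.mapsTo h1)) h12
  all_goals rcases boundary_cases hz₂ with h2 | ⟨y₂, hy₂, rfl⟩ | ⟨y₂, hy₂, rfl⟩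
  · exact absurd (h12 ▸ D.mapsTo h2) (D.real_notMem hy₁)
  · rcases lt_trichotomy y₁ y₂ with h | h | h
    · exact absurd h12 (D.real_injOn hy₁ h)
    · rw [h]
    · exact absurd h12.symm (D.real_injOn hy₂ h)
  · exact absurd h12 (hri _ _ hy₁ hy₂)
  · exact absurd (h12 ▸ D.mapsTo h2) (D.map_mul_I_notMem hy₁)
  · exact absurd h12.symm (hri _ _ hy₂ hy₁)
  · have h3 : cfun k Q (y₁ * I) = cfun k Q (y₂ * I) := by
      rw [cfun_eq_of_normFun D.alt.L_pos.ne', cfun_eq_of_normFun D.alt.L_pos.ne',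
        ← D.arc.cos_eq _ hz₁, ← D.arc.cos_eq _ hz₂, h12]
    rw [cfun_mul_I D.one_le, cfun_mul_I D.one_le] at h3
    have h4 : imagFun k Q y₁ = imagFun k Q y₂ := by
      exact_mod_cast mul_right_cancel₀ I_ne_zero h3
    rw [imagFun_injOn D.alt D.one_le hy₁ hy₂ h4]

theorem ArccosData.bijOn_closure (D : ArccosData k n m a L σ c B Q x φ) :
    BijOn φ quadrantBar (closure (Omega k m B)) := by
  refine ⟨fun z hz => ?_, D.injOn_closure, fun w hw => ?_⟩
  · have h1 : ContinuousWithinAt φ quadrant z := (D.arc.cont z hz).mono quadrant_subset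
    exact h1.mem_closure (quadrantBar_subset_closure hz) D.mapsTo
  · obtain ⟨u, hu, hlim⟩ := mem_closure_iff_seq_limit.1 hw
    choose g hg hgu using fun i => D.Omega_subset (hu i)
    obtain ⟨z, hz, hzw, -⟩ := mem_image_of_mem_closure D.arc.cont D.tendsto_im_zero
      D.tendsto_im_infty (g := g) (Eventually.of_forall fun i => quadrant_subset (hg i))
      (by simpa only [hgu] using hlim)
    exact ⟨z, hz, hzw⟩

/-- Above the level `B` the closure of `Ω` does not meet the line `u = πk`. -/
theorem re_ne_of_lt_im {k m : ℕ} {B : ℝ} (hB : 0 < B) {w : ℂ} (hw : w ∈ closure (Omega k m B))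
    (hv : B < w.im) : w.re ≠ Real.pi * k := fun h0 => by
  refine (closure_Omega_subset hB hw).2.2.2 ?_
  rw [h0, sub_self, abs_zero, Real.cos_zero, one_mul]
  refine ⟨by have := Real.pi_pos; linarith, ?_⟩
  rw [Real.cosh_lt_cosh, abs_of_pos hB, abs_of_pos (hB.trans hv)]
  exact hv

/-- Polar coordinates. Connected quarter annuli around 0 and ∞ decide on which side of the deleted
region φ runs off to infinity. -/
theorem isPreconnected_quadrantBar_norm {S : Set ℝ} (hS : IsPreconnected S) (hS0 : S ⊆ Ioi 0) :
    IsPreconnected (quadrantBar ∩ {z | ‖z‖ ∈ S}) := by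
  have hcont : Continuous fun p : ℝ × ℝ => (p.1 : ℂ) * exp (p.2 * I) := by fun_prop
  have himg : (fun p : ℝ × ℝ => (p.1 : ℂ) * exp (p.2 * I)) '' (S ×ˢ Icc 0 (Real.pi / 2)) =
      quadrantBar ∩ {z | ‖z‖ ∈ S} := by
    ext z
    constructor
    · rintro ⟨⟨r, θ⟩, ⟨hr, hθ⟩, rfl⟩
      have hr0 : 0 < r := hS0 hr
      have hpi := Real.pi_pos
      have hθ' : θ ∈ Icc 0 (Real.pi / 2) := hθ
      refine ⟨⟨?_, ?_, mul_ne_zero (ofReal_ne_zero.2 hr0.ne') (exp_ne_zero _)⟩, ?_⟩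
      · rw [re_ofReal_mul, exp_ofReal_mul_I_re]
        exact mul_nonneg hr0.le (Real.cos_nonneg_of_mem_Icc ⟨by linarith [hθ'.1], hθ'.2⟩)
      · rw [im_ofReal_mul, exp_ofReal_mul_I_im]
        exact mul_nonneg hr0.le (Real.sin_nonneg_of_nonneg_of_le_pi hθ'.1 (by linarith [hθ'.2]))
      · show ‖_‖ ∈ S
        rw [norm_mul, norm_exp_ofReal_mul_I, mul_one, norm_real, Real.norm_of_nonneg hr0.le]
        exact hr
    · rintro ⟨hz, hzS⟩
      exact ⟨(‖z‖, arg z), ⟨hzS, arg_nonneg_iff.2 hz.2.1, arg_le_pi_div_two_iff.2 (Or.inl hz.1)⟩,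
        norm_mul_exp_arg_mul_I z⟩
  rw [← himg]
  exact (hS.prod isPreconnected_Icc).image _ hcont.continuousOn

theorem ArccosData.continuousOn_re (D : ArccosData k n m a L σ c B Q x φ) :
    ContinuousOn (fun z => (φ z).re) quadrantBar := continuous_re.comp_continuousOn D.arc.cont

theorem ArccosData.isConformalMap (D : ArccosData k n m a L σ c B Q x φ) :
    IsConformalMap k m B φ := by
  have hpi := Real.pi_pos
  have hk : (1 : ℝ) ≤ k := by exact_mod_cast D.one_le
  have hm : (1 : ℝ) ≤ m := by
    have : 1 ≤ m := by have := D.n_eq; have := D.le; omega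
    exact_mod_cast this
  refine ⟨D.arc.holo, D.bijOn, D.arc.cont, D.bijOn_closure, D.tendsto_im_zero, ?_, ?_,
    D.tendsto_im_infty, ?_⟩
  · obtain ⟨r, hr, hr1⟩ := Metric.mem_nhdsWithin_iff.1 (D.tendsto_im_zero.eventually_gt_atTop B)
    refine Metric.mem_nhdsWithin_iff.2 ⟨r, hr, fun z hz => ?_⟩
    have ha0 := D.a_pos
    have hy : 0 < min (a / 2) (r / 2) := by positivity
    -- Near 0 the image is above height B, where it cannot meet u = πk. By connectedness the side is
    -- that of a real point below a, where Re φ = 0.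
    refine lt_of_forall_ne_of_isPreconnected
      (isPreconnected_quadrantBar_norm (isPreconnected_Ioo (a := 0) (b := r)) Ioo_subset_Ioi_self)
      (D.continuousOn_re.mono inter_subset_left) (r := Real.pi * k) ?_
      (x := ((min (a / 2) (r / 2) : ℝ) : ℂ)) ?_ ⟨hz.2, norm_pos_iff.2 hz.2.2.2, by simpa using hz.1⟩ ?_
    · intro w hw
      exact re_ne_of_lt_im D.B_pos (D.bijOn_closure.mapsTo hw.1)
        (hr1 ⟨by simpa using hw.2.2, hw.1⟩)
    · refine ⟨mem_quadrantBar_ofReal hy, ?_⟩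
      show ‖_‖ ∈ Ioo 0 r
      rw [norm_real, Real.norm_of_nonneg hy.le]
      exact ⟨hy, (min_le_right _ _).trans_lt (by linarith)⟩
    · show (φ _).re < _
      rw [D.arc.re_left D.alt ha0 D.one_le D.le hy ((min_le_left _ _).trans (by linarith))]
      positivity
  · rw [D.arc.map_one D.alt D.a_pos D.one_le D.le]
    have : (n : ℂ) + 1 = k + m := by exact_mod_cast D.n_eq
    rw [this]
  · have h2 := eventually_inf_principal.1 (D.tendsto_im_infty.eventually_gt_atTop B)
    rw [← comap_norm_atTop] at h2 ⊢
    obtain ⟨R, -, hR⟩ := (atTop_basis_Ioi.comap _).eventually_iff.1 h2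
    rw [eventually_inf_principal]
    refine (atTop_basis_Ioi.comap _).eventually_iff.2 ⟨max R 1, trivial, fun z hz hzQ => ?_⟩
    have hy : 0 < max R 1 + 1 := by have := le_max_right R 1; linarith
    -- Near infinity the reference point is a real number beyond 1, where Re φ = (k + m)π.
    refine gt_of_forall_ne_of_isPreconnected
      (isPreconnected_quadrantBar_norm (isPreconnected_Ioi (a := max R 1))
        fun t (ht : max R 1 < t) => one_pos.trans_le ((le_max_right _ _).trans ht.le))
      (D.continuousOn_re.mono inter_subset_left) (r := Real.pi * k) ?_
      (x := ((max R 1 + 1 : ℝ) : ℂ)) ?_ ⟨hzQ, hz⟩ ?_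
    · intro w hw
      exact re_ne_of_lt_im D.B_pos (D.bijOn_closure.mapsTo hw.1)
        (hR (lt_of_le_of_lt (le_max_left R 1) hw.2) hw.1)
    · refine ⟨mem_quadrantBar_ofReal hy, ?_⟩
      show ‖_‖ ∈ Ioi (max R 1)
      rw [norm_real, Real.norm_of_nonneg hy.le]
      exact lt_add_one (max R 1)
    · show _ < (φ _).re
      rw [D.arc.re_right D.alt D.a_pos D.one_le D.le (by have := le_max_right R 1; linarith),
        D.re_one]
      nlinarith

end

/-- The extremal function yields the conformal map with parameter `B`, `cosh B = 1 / L`. -/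
theorem IsAlternant.isParam {k n m : ℕ} {a L σ c : ℝ} {Q : ℝ[X]} {x : ℕ → ℝ}
    (h : IsAlternant k n a L σ c Q x) (ha0 : 0 < a) (hk : 1 ≤ k) (hm : 1 ≤ m) (hn : n + 1 = k + m)
    {B : ℝ} (hB : 0 < B) (hBL : Real.cosh B = 1 / L) : IsParam k m a B := by
  obtain ⟨φ, h1, h2, h3, h4, h5, h6, h7, h8⟩ := h.exists_arccos ha0 hk (by omega)
  have D : ArccosData k n m a L σ c B Q x φ :=
    ⟨h, ⟨h1, h2, h3, h4, h5, h6, h7, h8⟩, ha0, hk, by omega, hn, hB, hBL⟩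
  exact ⟨hB, φ, D.isConformalMap, h6⟩

end SgnLaurent

end

noncomputable section
namespace SgnLaurent

open Polynomial Set Complex Filter Topology

/-! ### Holomorphy across the real axis -/

/-- Morera's theorem: a rectangle crossing the real axis is cut along it, and Cauchy's theorem holds
on each half because continuity up to the edge suffices. -/
theorem differentiableOn_of_off_real {U : Set ℂ} (hU : IsOpen U) {f : ℂ → ℂ}
    (hc : ContinuousOn f U) (hd : ∀ z ∈ U, z.im ≠ 0 → DifferentiableAt ℂ f z) :
    DifferentiableOn ℂ f U := by
  refine (isConservativeOn_and_continuousOn_iff_isDifferentiableOn hU).1 ⟨fun z w hzw => ?_, hc⟩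
  rw [← add_eq_zero_iff_eq_neg, wedgeIntegral_add_wedgeIntegral_eq]
  have hsub : ∀ p q : ℂ, p.re = z.re → q.re = w.re → p.im ∈ uIcc z.im w.im →
      q.im ∈ uIcc z.im w.im → (0 : ℝ) ∉ Ioo (min p.im q.im) (max p.im q.im) →
      (∫ x : ℝ in z.re..w.re, f (x + p.im * I)) - (∫ x : ℝ in z.re..w.re, f (x + q.im * I)) +
        I • (∫ y : ℝ in p.im..q.im, f (w.re + y * I)) -
        I • (∫ y : ℝ in p.im..q.im, f (z.re + y * I)) = 0 := by
    intro p q hp hq hpi hqi h0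
    rw [← hp, ← hq]
    have hR : (uIcc p.re q.re) ×ℂ (uIcc p.im q.im) ⊆ U := by
      refine subset_trans ?_ hzw
      rw [hp, hq]
      exact inter_subset_inter le_rfl (preimage_mono (uIcc_subset_uIcc hpi hqi))
    refine integral_boundary_rect_eq_zero_of_continuousOn_of_differentiableOn f p q (hc.mono hR) ?_
    intro t ht
    refine (hd t (hR ⟨Ioo_subset_Icc_self ht.1, Ioo_subset_Icc_self ht.2⟩) ?_).differentiableWithinAt
    intro ht0
    have := ht.2
    rw [mem_preimage, ht0] at this
    exact h0 this
  by_cases h0 : (0 : ℝ) ∈ uIcc z.im w.im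
  · have h1 := hsub z ⟨w.re, 0⟩ rfl rfl left_mem_uIcc h0 (by
      rintro ⟨h1, h2⟩
      simp only [lt_sup_iff, lt_irrefl, or_false, inf_lt_iff] at h1 h2
      linarith)
    have h2 := hsub ⟨z.re, 0⟩ w rfl rfl h0 right_mem_uIcc (by
      rintro ⟨h1, h2⟩
      simp only [lt_sup_iff, lt_irrefl, false_or, inf_lt_iff] at h1 h2
      linarith)
    have hInt : ∀ r ∈ uIcc z.re w.re, ∀ s t : ℝ, s ∈ uIcc z.im w.im → t ∈ uIcc z.im w.im →
        IntervalIntegrable (fun y : ℝ => f (r + y * I)) MeasureTheory.volume s t := by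
      intro r hr s t hs ht
      refine ContinuousOn.intervalIntegrable (hc.comp (by fun_prop) fun y hy => hzw ?_)
      have hy' := uIcc_subset_uIcc hs ht hy
      constructor
      · simpa using hr
      · simpa using hy'
    have h3 := intervalIntegral.integral_add_adjacent_intervals
      (hInt w.re right_mem_uIcc z.im 0 left_mem_uIcc h0)
      (hInt w.re right_mem_uIcc 0 w.im h0 right_mem_uIcc)
    have h4 := intervalIntegral.integral_add_adjacent_intervals
      (hInt z.re left_mem_uIcc z.im 0 left_mem_uIcc h0)
      (hInt z.re left_mem_uIcc 0 w.im h0 right_mem_uIcc)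
    rw [← h3, ← h4]
    simp only [smul_eq_mul] at h1 h2 ⊢
    linear_combination h1 + h2
  · exact hsub z w rfl rfl left_mem_uIcc right_mem_uIcc
      (fun h1 => h0 (Ioo_subset_Icc_self h1))

/-- The open right half plane. -/
def rightHalf : Set ℂ := {z | 0 < z.re}

theorem isOpen_rightHalf : IsOpen rightHalf := isOpen_lt continuous_const continuous_re

/-- A holomorphic self-map of the right half plane with two fixed points is the identity. -/
theorem eq_id_of_two_fixed {X : ℂ → ℂ} (hd : DifferentiableOn ℂ X rightHalf)
    (hm : MapsTo X rightHalf rightHalf) {a : ℂ} (ha : a ∈ rightHalf) (ha1 : a ≠ 1)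
    (hfa : X a = a) (hf1 : X 1 = 1) : ∀ z ∈ rightHalf, X z = z := by
  -- The Cayley transform carries the right half plane to the unit disk and the fixed point 1 to the
  -- origin.
  set T : ℂ → ℂ := fun z => (z - 1) / (z + 1) with hT
  set S : ℂ → ℂ := fun z => (1 + z) / (1 - z) with hS
  have hne : ∀ z ∈ rightHalf, z + 1 ≠ 0 := by
    intro z hz h0
    have := congrArg re h0
    simp only [add_re, one_re, zero_re] at this
    have hz' : 0 < z.re := hz
    linarith
  have hTball : ∀ z ∈ rightHalf, T z ∈ Metric.ball (0 : ℂ) 1 := by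
    intro z hz
    have hz' : 0 < z.re := hz
    rw [mem_ball_zero_iff, norm_div, div_lt_one (norm_pos_iff.2 (hne z hz))]
    refine lt_of_pow_lt_pow_left₀ 2 (norm_nonneg _) ?_
    rw [← normSq_eq_norm_sq, ← normSq_eq_norm_sq, normSq_apply, normSq_apply]
    simp
    nlinarith
  have hne1 : ∀ z ∈ Metric.ball (0 : ℂ) 1, 1 - z ≠ 0 := by
    intro z hz h0
    rw [mem_ball_zero_iff, ← sub_eq_zero.1 h0] at hz
    simp at hz
  have hSmem : ∀ z ∈ Metric.ball (0 : ℂ) 1, S z ∈ rightHalf := by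
    intro z hz
    have h1 := normSq_pos.2 (hne1 z hz)
    rw [mem_ball_zero_iff] at hz
    have h2 : normSq z < 1 := by
      rw [normSq_eq_norm_sq]; exact pow_lt_one₀ (norm_nonneg _) hz two_ne_zero
    show 0 < (S z).re
    simp only [hS]
    rw [div_re, ← add_div]
    refine div_pos ?_ h1
    rw [normSq_apply] at h2
    simp
    nlinarith
  have hST : ∀ z ∈ rightHalf, S (T z) = z := by
    intro z hz
    have h1 := hne z hz
    have h2 := hne1 _ (hTball z hz)
    simp only [hT, hS] at h2 ⊢
    rw [div_eq_iff h2]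
    field_simp
    ring
  have hSd : DifferentiableOn ℂ S (Metric.ball 0 1) := fun z hz =>
    (((differentiableAt_const _).add differentiableAt_id).div
      ((differentiableAt_const _).sub differentiableAt_id) (hne1 z hz)).differentiableWithinAt
  have hTd : DifferentiableOn ℂ T rightHalf := fun z hz =>
    DifferentiableAt.differentiableWithinAt (DifferentiableAt.div
      (differentiableAt_id.sub_const _) (differentiableAt_id.add_const _) (hne z hz))
  set F : ℂ → ℂ := fun z => T (X (S z)) with hF
  have hFd : DifferentiableOn ℂ F (Metric.ball 0 1) :=
    hTd.comp (hd.comp hSd hSmem) fun z hz => hm (hSmem z hz)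
  have hF0 : F 0 = 0 := by simp [hF, hS, hT, hf1]
  have hFmaps : MapsTo F (Metric.ball 0 1) (Metric.closedBall (F 0) 1) := by
    intro z hz
    rw [hF0]
    exact Metric.ball_subset_closedBall (hTball _ (hm (hSmem z hz)))
  have hTa : T a ≠ 0 := div_ne_zero (sub_ne_zero.2 ha1) (hne a ha)
  have hFa : F (T a) = T a := by simp only [hF]; rw [hST a ha, hfa]
  -- The second fixed point is the equality case of Schwarz's lemma, which makes F affine.
  have hds : dslope F 0 (T a) = 1 := by
    rw [dslope_of_ne _ hTa, slope_def_field, hFa, hF0, sub_zero, div_self hTa]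
  have key := affine_of_mapsTo_ball_of_norm_dslope_eq_div hFd hFmaps (hTball a ha)
    (by rw [hds]; simp)
  intro z hz
  have h1 := key (hTball z hz)
  simp only [hF0, hds, smul_eq_mul, mul_one, sub_zero, zero_add] at h1
  have h2 : T (X z) = T z := by
    have : F (T z) = T (X z) := by simp only [hF]; rw [hST z hz]
    rw [← this, h1]
  rw [← hST _ (hm hz), h2, hST z hz]

/-- Reflection: a holomorphic self-map of the quadrant, real on the positive axis, which fixes two
points of the axis is the identity. -/
theorem eq_id_of_quadrant {χ : ℂ → ℂ} (hc : ContinuousOn χ quadrantBar)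
    (hd : DifferentiableOn ℂ χ quadrant) (hm : MapsTo χ quadrant quadrant)
    (hreal : ∀ y : ℝ, 0 < y → ∃ t : ℝ, 0 < t ∧ χ y = t) {a : ℝ} (ha0 : 0 < a) (ha1 : a ≠ 1)
    (hfa : χ a = a) (hf1 : χ 1 = 1) : ∀ z ∈ quadrant, χ z = z := by
  classical
  -- Schwarz reflection across the positive axis, where χ takes real values.
  set X : ℂ → ℂ := fun z => if 0 ≤ z.im then χ z else (starRingEnd ℂ) (χ ((starRingEnd ℂ) z)) with hX
  have hup : ∀ z : ℂ, 0 < z.re → 0 ≤ z.im → z ∈ quadrantBar := fun z h1 h2 =>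
    ⟨h1.le, h2, by rintro rfl; exact lt_irrefl _ h1⟩
  have hXc : ContinuousOn X rightHalf := by
    refine ContinuousOn.if ?_ ?_ ?_
    · rintro z ⟨hz, hz2⟩
      have hz' : 0 < z.re := hz
      rw [frontier_setOfPred_le_im] at hz2
      have h0 : z.im = 0 := hz2
      have hzr : z = (z.re : ℂ) := by apply Complex.ext <;> simp [h0]
      obtain ⟨t, -, ht⟩ := hreal z.re hz'
      rw [hzr, conj_ofReal, ht, conj_ofReal]
    · rw [(isClosed_le continuous_const continuous_im : IsClosed {z : ℂ | 0 ≤ z.im}).closure_eq]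
      exact hc.mono fun z hz => hup z hz.1 hz.2
    · simp only [not_le]
      rw [closure_setOfPred_im_lt]
      refine continuous_conj.comp_continuousOn (hc.comp continuous_conj.continuousOn ?_)
      intro z hz
      exact hup _ (by rw [conj_re]; exact hz.1) (by simpa using hz.2)
  have hXd : DifferentiableOn ℂ X rightHalf := by
    refine differentiableOn_of_off_real isOpen_rightHalf hXc fun z hz hz0 => ?_
    rcases lt_or_gt_of_ne hz0 with h1 | h1
    · have h2 : DifferentiableAt ℂ χ ((starRingEnd ℂ) z) :=
        hd.differentiableAt (isOpen_quadrant.mem_nhds ⟨by rw [conj_re]; exact hz, by simpa using h1⟩)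
      have h3 := h2.conj_conj
      rw [conj_conj] at h3
      refine h3.congr_of_eventuallyEq ?_
      filter_upwards [(isOpen_lt continuous_im continuous_const).mem_nhds h1] with w hw
      simp only [hX]
      rw [if_neg (not_le.2 hw)]
      rfl
    · refine (hd.differentiableAt (isOpen_quadrant.mem_nhds ⟨hz, h1⟩)).congr_of_eventuallyEq ?_
      filter_upwards [(isOpen_lt continuous_const continuous_im).mem_nhds h1] with w hw
      simp only [hX]
      rw [if_pos (le_of_lt hw)]
  have hXm : MapsTo X rightHalf rightHalf := by
    intro z hz
    show 0 < (X z).re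
    have hz' : 0 < z.re := hz
    simp only [hX]
    split_ifs with h1
    · rcases h1.eq_or_lt with h2 | h2
      · have hzr : z = (z.re : ℂ) := by apply Complex.ext <;> simp [← h2]
        obtain ⟨t, ht0, ht⟩ := hreal z.re hz'
        rw [hzr, ht, ofReal_re]; exact ht0
      · exact (hm ⟨hz', h2⟩).1
    · rw [conj_re]
      exact (hm (x := (starRingEnd ℂ) z) ⟨by simpa using hz', by simpa using h1⟩).1
  have hXup : ∀ z : ℂ, 0 ≤ z.im → X z = χ z := fun z hz => by simp only [hX]; rw [if_pos hz]
  intro z hz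
  rw [← hXup z hz.2.le]
  refine eq_id_of_two_fixed hXd hXm (a := a) (by simpa [rightHalf] using ha0)
    (by exact_mod_cast ha1) ?_ ?_ z hz.1
  · rw [hXup _ (by simp), hfa]
  · rw [hXup _ (by simp), hf1]

/-! ### Boundary correspondence for conformal maps -/

/-- A function separating the two components of the boundary of `Ω`. -/
def sepFun (k : ℕ) (B : ℝ) (w : ℂ) : ℝ := max (|w.re - Real.pi * k| - Real.pi / 2) (B / 2 - w.im)

theorem continuous_sepFun (k : ℕ) (B : ℝ) : Continuous (sepFun k B) := by
  unfold sepFun; fun_prop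

theorem sepFun_pos_of_edge {k m : ℕ} {B : ℝ} (hk : 1 ≤ k) (hm : 1 ≤ m) (hB : 0 < B) {w : ℂ}
    (h : w.im = 0 ∨ w.re = 0 ∨ w.re = (k + m) * Real.pi) : 0 < sepFun k B w := by
  have hpi := Real.pi_pos
  have hk' : (1 : ℝ) ≤ k := by exact_mod_cast hk
  have hm' : (1 : ℝ) ≤ m := by exact_mod_cast hm
  rcases h with h | h | h
  · exact lt_max_of_lt_right (by rw [h]; linarith)
  · refine lt_max_of_lt_left ?_
    rw [h, zero_sub, abs_neg, abs_of_nonneg (by positivity)]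
    nlinarith
  · refine lt_max_of_lt_left ?_
    rw [h, show (k + m) * Real.pi - Real.pi * k = m * Real.pi by ring, abs_of_nonneg (by positivity)]
    nlinarith

/-- `sepFun` is positive on the bottom and vertical edges and negative on the edge of the deleted
region. A connected piece of the boundary is therefore confined to one of the two parts. -/
theorem boundary_Omega {k m : ℕ} {B : ℝ} (hB : 0 < B) {w : ℂ}
    (hw : w ∈ closure (Omega k m B)) (hw' : w ∉ Omega k m B) :
    (w.im = 0 ∨ w.re = 0 ∨ w.re = (k + m) * Real.pi) ∨ sepFun k B w < 0 := by
  obtain ⟨h1, h2, h3, h4⟩ := closure_Omega_subset hB hw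
  rw [mem_Omega_iff hB] at hw'
  by_contra hcon
  push Not at hcon
  obtain ⟨⟨h5, h6, h7⟩, h8⟩ := hcon
  refine hw' ⟨lt_of_le_of_ne h1 (Ne.symm h5), lt_of_le_of_ne h2 (Ne.symm h6), lt_of_le_of_ne h3 h7,
    fun h9 => ?_⟩
  have h10 := (deleted_iff hB h1).2 h9
  refine absurd h8 (not_le.2 (max_lt ?_ ?_))
  · linarith [h9.1]
  · linarith [h10.2]

theorem sepFun_ne_zero {k m : ℕ} {B : ℝ} (hk : 1 ≤ k) (hm : 1 ≤ m) (hB : 0 < B) {w : ℂ}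
    (hw : w ∈ closure (Omega k m B)) (hw' : w ∉ Omega k m B) : sepFun k B w ≠ 0 := by
  rcases boundary_Omega hB hw hw' with h | h
  · exact (sepFun_pos_of_edge hk hm hB h).ne'
  · exact h.ne

section
variable {k m : ℕ} {B : ℝ} {φ : ℂ → ℂ}

theorem IsConformalMap.notMem (h : IsConformalMap k m B φ) {z : ℂ} (hz : z ∈ quadrantBar)
    (hz' : z ∉ quadrant) : φ z ∉ Omega k m B := fun hmem => by
  obtain ⟨z', hz'Q, he⟩ := h.bij.surjOn hmem
  have := h.bij_closure.injOn (quadrant_subset hz'Q) hz he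
  exact hz' (this ▸ hz'Q)

theorem ofReal_notMem_quadrant (y : ℝ) : (y : ℂ) ∉ quadrant := fun h => by
  have := h.2; simp at this

theorem mul_I_notMem_quadrant (y : ℝ) : (y : ℂ) * I ∉ quadrant := fun h => by
  have := h.1; simp at this

/-- The normalization φ(1) = (k + m)π places one point of the positive axis on the outer boundary,
and connectedness places all of it there. -/
theorem IsConformalMap.sepFun_real (h : IsConformalMap k m B φ) (hk : 1 ≤ k) (hm : 1 ≤ m)
    (hB : 0 < B) {y : ℝ} (hy : 0 < y) : 0 < sepFun k B (φ y) := by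
  have hc : ContinuousOn (fun y : ℝ => sepFun k B (φ y)) (Ioi 0) :=
    (continuous_sepFun k B).comp_continuousOn (h.cont.comp continuous_ofReal.continuousOn
      fun _ hy => mem_quadrantBar_ofReal hy)
  refine gt_of_forall_ne_of_isPreconnected isPreconnected_Ioi hc (fun t ht => ?_)
    (x := 1) (mem_Ioi.2 one_pos) hy ?_
  · exact sepFun_ne_zero hk hm hB (h.bij_closure.mapsTo (mem_quadrantBar_ofReal ht))
      (h.notMem (mem_quadrantBar_ofReal ht) (ofReal_notMem_quadrant t))
  · refine sepFun_pos_of_edge hk hm hB (Or.inr (Or.inr ?_))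
    rw [ofReal_one, h.map_one]
    have : ((k : ℂ) + m) * Real.pi = (((k + m) * Real.pi : ℝ) : ℂ) := by push_cast; ring
    rw [this, ofReal_re]

/-- The tip πk + iB of the deleted region has a preimage on the boundary of the quadrant. It is not
on the positive axis, so it is on the imaginary one, whose image then lies in the inner boundary. -/
theorem IsConformalMap.sepFun_mul_I (h : IsConformalMap k m B φ) (hk : 1 ≤ k) (hm : 1 ≤ m)
    (hB : 0 < B) {y : ℝ} (hy : 0 < y) : sepFun k B (φ (y * I)) < 0 := by
  have hpi := Real.pi_pos
  have hk' : (1 : ℝ) ≤ k := by exact_mod_cast hk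
  have hm' : (1 : ℝ) ≤ m := by exact_mod_cast hm
  set p : ℂ := ⟨Real.pi * k, B⟩ with hp
  have hpcl : p ∈ closure (Omega k m B) := by
    have hc : Continuous fun t : ℝ => (⟨Real.pi * k, t⟩ : ℂ) := by
      have : (fun t : ℝ => (⟨Real.pi * k, t⟩ : ℂ)) = fun t : ℝ => ((Real.pi * k : ℝ) : ℂ) + t * I := by
        ext t; exact mk_eq_add_mul_I _ _
      rw [this]; fun_prop
    refine (hc.continuousWithinAt (s := Ioo 0 B) (x := B)).mem_closure ?_ fun t ht => ?_
    · rw [closure_Ioo hB.ne]; exact ⟨hB.le, le_rfl⟩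
    · exact mem_Omega_of_im_lt ht.1 (show 0 < Real.pi * k by positivity)
        (show Real.pi * k < _ by nlinarith) ht.2
  have hpsep : sepFun k B p < 0 := by
    refine max_lt ?_ ?_ <;> simp only [hp]
    · rw [sub_self, abs_zero]; linarith
    · linarith
  obtain ⟨z, hz, hzp⟩ := h.bij_closure.surjOn hpcl
  have hpΩ : p ∉ Omega k m B := fun h1 => by
    refine ((mem_Omega_iff hB).1 h1).2.2.2 ?_
    simp only [hp, sub_self, abs_zero, Real.cos_zero, one_mul]
    exact ⟨by linarith, le_rfl⟩
  have hc : ContinuousOn (fun y : ℝ => sepFun k B (φ (y * I))) (Ioi 0) :=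
    (continuous_sepFun k B).comp_continuousOn (h.cont.comp (by fun_prop)
      fun _ hy => mem_quadrantBar_mul_I hy)
  rcases boundary_cases hz with h1 | ⟨t, ht, rfl⟩ | ⟨t, ht, rfl⟩
  · exact absurd (hzp ▸ h.bij.mapsTo h1) hpΩ
  · have := h.sepFun_real hk hm hB ht
    rw [hzp] at this
    exact absurd hpsep (not_lt.2 this.le)
  · refine lt_of_forall_ne_of_isPreconnected isPreconnected_Ioi hc (fun s hs => ?_) (x := t) ht hy ?_
    · exact sepFun_ne_zero hk hm hB (h.bij_closure.mapsTo (mem_quadrantBar_mul_I hs))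
        (h.notMem (mem_quadrantBar_mul_I hs) (mul_I_notMem_quadrant s))
    · show sepFun k B (φ (t * I)) < 0
      rw [hzp]; exact hpsep

/-- The inverse of the extended conformal map. -/
def closedInv (φ : ℂ → ℂ) : ℂ → ℂ := Function.invFunOn φ quadrantBar

theorem IsConformalMap.closedInv_mem (h : IsConformalMap k m B φ) {w : ℂ}
    (hw : w ∈ closure (Omega k m B)) : closedInv φ w ∈ quadrantBar :=
  Function.invFunOn_mem (h.bij_closure.surjOn hw)

theorem IsConformalMap.map_closedInv (h : IsConformalMap k m B φ) {w : ℂ}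
    (hw : w ∈ closure (Omega k m B)) : φ (closedInv φ w) = w :=
  Function.invFunOn_eq (h.bij_closure.surjOn hw)

theorem IsConformalMap.closedInv_map (h : IsConformalMap k m B φ) {z : ℂ} (hz : z ∈ quadrantBar) :
    closedInv φ (φ z) = z :=
  h.bij_closure.injOn.leftInvOn_invFunOn hz

/-- Properness supplies a cluster point of preimages in the punctured closed quadrant; it is a
preimage of w, hence the only one. -/
theorem IsConformalMap.continuousOn_closedInv (h : IsConformalMap k m B φ) :
    ContinuousOn (closedInv φ) (closure (Omega k m B)) := by
  intro w hw
  refine tendsto_iff_ultrafilter _ _ _ |>.2 fun g hg => ?_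
  have hg1 : ∀ᶠ w in (g : Filter ℂ), w ∈ closure (Omega k m B) :=
    hg self_mem_nhdsWithin
  obtain ⟨z, hz, hzw, hcl⟩ := mem_image_of_mem_closure h.cont h.map_zero_im h.map_infty_im
    (l := (g : Filter ℂ)) (g := closedInv φ) (hg1.mono fun w hw => h.closedInv_mem hw) (w := w) (by
      have h1 : Tendsto id (g : Filter ℂ) (𝓝 w) := hg.trans nhdsWithin_le_nhds
      exact h1.congr' (hg1.mono fun w hw => (h.map_closedInv hw).symm))
  have h2 : z = closedInv φ w := by rw [← hzw, h.closedInv_map hz]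
  rw [← h2]
  exact (Ultrafilter.clusterPt_iff (f := g.map (closedInv φ))).1 hcl

theorem IsConformalMap.closedInv_mem_quadrant (h : IsConformalMap k m B φ) {w : ℂ}
    (hw : w ∈ Omega k m B) : closedInv φ w ∈ quadrant := by
  by_contra hn
  have := h.notMem (h.closedInv_mem (subset_closure hw)) hn
  rw [h.map_closedInv (subset_closure hw)] at this
  exact this hw

theorem IsConformalMap.eventually_deriv_ne_zero (h : IsConformalMap k m B φ) {z : ℂ}
    (hz : z ∈ quadrant) : ∀ᶠ w in 𝓝[≠] z, deriv φ w ≠ 0 := by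
  have hd : DifferentiableOn ℂ (deriv φ) quadrant := h.holo.deriv isOpen_quadrant
  have han : AnalyticAt ℂ (deriv φ) z := hd.analyticAt (isOpen_quadrant.mem_nhds hz)
  refine han.eventually_eq_zero_or_eventually_ne_zero.resolve_left fun h0 => ?_
  obtain ⟨r, hr, hball⟩ := Metric.eventually_nhds_iff_ball.1
    (h0.and (isOpen_quadrant.mem_nhds hz))
  have hconst : ∀ w ∈ Metric.ball z r, φ w = φ z := by
    intro w hw
    refine (Metric.isOpen_ball.is_const_of_deriv_eq_zero (convex_ball z r).isPreconnected
      (h.holo.mono fun t ht => (hball t ht).2) (fun t ht => (hball t ht).1) hw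
      (Metric.mem_ball_self hr))
  have hw : z + (r / 2 : ℝ) ∈ Metric.ball z r := by
    rw [Metric.mem_ball, dist_eq, add_sub_cancel_left, norm_real, Real.norm_of_nonneg (by linarith)]
    linarith
  have h1 := h.bij.injOn (hball _ hw).2 hz (hconst _ hw)
  have h2 : ((r / 2 : ℝ) : ℂ) = 0 := by simpa using h1
  have h3 : r / 2 = 0 := by exact_mod_cast h2
  linarith

/-- The inverse is differentiable wherever φ' ≠ 0 at the preimage. Zeros of φ' are isolated, and the
continuous inverse extends holomorphically over isolated points. -/
theorem IsConformalMap.differentiableOn_closedInv (h : IsConformalMap k m B φ) :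
    DifferentiableOn ℂ (closedInv φ) (Omega k m B) := by
  have hΩ := isOpen_Omega k m B
  have hca : ∀ w ∈ Omega k m B, ContinuousAt (closedInv φ) w := fun w hw =>
    (h.continuousOn_closedInv.mono subset_closure).continuousAt (hΩ.mem_nhds hw)
  have hgood : ∀ w ∈ Omega k m B, deriv φ (closedInv φ w) ≠ 0 →
      DifferentiableAt ℂ (closedInv φ) w := by
    intro w hw hne
    have hd := (h.holo.differentiableAt
      (isOpen_quadrant.mem_nhds (h.closedInv_mem_quadrant hw))).hasDerivAt
    refine (hd.of_local_left_inverse (hca w hw) hne ?_).differentiableAt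
    filter_upwards [hΩ.mem_nhds hw] with w' hw' using h.map_closedInv (subset_closure hw')
  intro w hw
  have hev : ∀ᶠ w' in 𝓝[≠] w, DifferentiableAt ℂ (closedInv φ) w' := by
    have ht : Tendsto (closedInv φ) (𝓝[≠] w) (𝓝[≠] (closedInv φ w)) := by
      refine tendsto_nhdsWithin_iff.2 ⟨(hca w hw).tendsto.mono_left nhdsWithin_le_nhds, ?_⟩
      filter_upwards [self_mem_nhdsWithin, nhdsWithin_le_nhds (hΩ.mem_nhds hw)] with w' hne hw' he
      refine hne ?_
      have he' : closedInv φ w' = closedInv φ w := he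
      rw [mem_singleton_iff, ← h.map_closedInv (subset_closure hw'), he',
        h.map_closedInv (subset_closure hw)]
    filter_upwards [ht.eventually (h.eventually_deriv_ne_zero (h.closedInv_mem_quadrant hw)),
      nhdsWithin_le_nhds (hΩ.mem_nhds hw)] with w' h1 h2 using hgood w' h2 h1
  exact (analyticAt_of_differentiable_on_punctured_nhds_of_continuousAt hev
    (hca w hw)).differentiableAt.differentiableWithinAt

end

theorem Omega_subset_Omega {k m : ℕ} {B₁ B₂ : ℝ} (h1 : 0 < B₁) (h12 : B₁ ≤ B₂) :
    Omega k m B₁ ⊆ Omega k m B₂ := by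
  intro w hw
  rw [mem_Omega_iff h1] at hw
  rw [mem_Omega_iff (h1.trans_le h12)]
  refine ⟨hw.1, hw.2.1, hw.2.2.1, fun h => hw.2.2.2 ⟨h.1, le_trans ?_ h.2⟩⟩
  rw [Real.cosh_le_cosh, abs_of_pos h1, abs_of_pos (h1.trans_le h12)]
  exact h12

/-- φ₂⁻¹ ∘ φ₁ maps the quadrant into itself, the positive axis into itself, and fixes a and 1. It is
the identity by `eq_id_of_quadrant`, so Ω(B₂) would be contained in Ω(B₁). -/
theorem IsParam.not_lt_param {k m : ℕ} {a B₁ B₂ : ℝ} (h1 : IsParam k m a B₁) (hk : 1 ≤ k)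
    (hm : 1 ≤ m) (ha0 : 0 < a) (ha1 : a < 1) (h2 : IsParam k m a B₂) : ¬ B₁ < B₂ := fun hlt => by
  obtain ⟨hB₁, φ₁, hφ₁, ha₁⟩ := h1
  obtain ⟨hB₂, φ₂, hφ₂, ha₂⟩ := h2
  have hsub := Omega_subset_Omega (k := k) (m := m) hB₁ hlt.le
  have hsubc := closure_mono hsub
  have hχ : ∀ z ∈ quadrantBar, φ₁ z ∈ closure (Omega k m B₂) := fun z hz =>
    hsubc (hφ₁.bij_closure.mapsTo hz)
  have hid : ∀ z ∈ quadrant, closedInv φ₂ (φ₁ z) = z := by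
    refine eq_id_of_quadrant (χ := fun z => closedInv φ₂ (φ₁ z))
      (hφ₂.continuousOn_closedInv.comp hφ₁.cont hχ)
      (hφ₂.differentiableOn_closedInv.comp hφ₁.holo fun z hz => hsub (hφ₁.bij.mapsTo hz))
      (fun z hz => hφ₂.closedInv_mem_quadrant (hsub (hφ₁.bij.mapsTo hz))) ?_ ha0 ha1.ne ?_ ?_
    · intro y hy
      have hyQ := mem_quadrantBar_ofReal hy
      have hcl := hφ₁.bij_closure.mapsTo hyQ
      have hedge : (φ₁ y).im = 0 ∨ (φ₁ y).re = 0 ∨ (φ₁ y).re = (k + m) * Real.pi := by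
        refine (boundary_Omega hB₁ hcl (hφ₁.notMem hyQ (ofReal_notMem_quadrant y))).resolve_right ?_
        exact (hφ₁.sepFun_real hk hm hB₁ hy).not_gt
      have hinv := hφ₂.map_closedInv (hχ _ hyQ)
      rcases boundary_cases (hφ₂.closedInv_mem (hχ _ hyQ)) with h3 | ⟨t, ht, h3⟩ | ⟨t, ht, h3⟩
      · have h4 := hφ₂.bij.mapsTo h3
        rw [hinv, mem_Omega_iff hB₂] at h4
        rcases hedge with h5 | h5 | h5
        · exact absurd h5 h4.1.ne'
        · exact absurd h5 h4.2.1.ne'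
        · exact absurd h5 h4.2.2.1.ne
      · exact ⟨t, ht, h3⟩
      · have h4 := hφ₂.sepFun_mul_I hk hm hB₂ ht
        rw [← h3, hinv] at h4
        exact absurd (sepFun_pos_of_edge hk hm hB₂ hedge) h4.not_gt
    · show closedInv φ₂ (φ₁ a) = a
      rw [ha₁, ← ha₂, hφ₂.closedInv_map (mem_quadrantBar_ofReal ha0)]
    · show closedInv φ₂ (φ₁ 1) = 1
      rw [hφ₁.map_one, ← hφ₂.map_one, hφ₂.closedInv_map (by simpa using mem_quadrantBar_ofReal one_pos)]
  have hpi := Real.pi_pos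
  have hk' : (1 : ℝ) ≤ k := by exact_mod_cast hk
  have hm' : (1 : ℝ) ≤ m := by exact_mod_cast hm
  -- The tip of the region deleted from the smaller domain belongs only to the larger one.
  set p : ℂ := ⟨Real.pi * k, B₁⟩ with hp
  have hp2 : p ∈ Omega k m B₂ := mem_Omega_of_im_lt hB₁ (show 0 < Real.pi * k by positivity)
    (show Real.pi * k < _ by nlinarith) hlt
  have hp1 : p ∉ Omega k m B₁ := fun h1 => by
    refine ((mem_Omega_iff hB₁).1 h1).2.2.2 ?_
    simp only [hp, sub_self, abs_zero, Real.cos_zero, one_mul]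
    exact ⟨by linarith, le_rfl⟩
  have hz := hφ₂.closedInv_mem_quadrant hp2
  have h3 := hφ₂.map_closedInv (subset_closure hp2)
  have h4 := hφ₂.map_closedInv (hχ _ (quadrant_subset hz))
  rw [hid _ hz, h3] at h4
  exact hp1 (h4 ▸ hφ₁.bij.mapsTo hz)

theorem IsParam.unique {k m : ℕ} {a B₁ B₂ : ℝ} (hk : 1 ≤ k) (hm : 1 ≤ m) (ha0 : 0 < a)
    (ha1 : a < 1) (h1 : IsParam k m a B₁) (h2 : IsParam k m a B₂) : B₁ = B₂ :=
  le_antisymm (_root_.not_lt.1 (h2.not_lt_param hk hm ha0 ha1 h1)) (_root_.not_lt.1 (h1.not_lt_param hk hm ha0 ha1 h2))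

end SgnLaurent

end

noncomputable section
namespace SgnLaurent

open Polynomial Set Complex Filter Topology MeasureTheory

/-! ### Symmetric Laurent polynomials -/

/-- The polynomial with `D_j(z + z⁻¹) = z^j + z^{-j}`. -/
def symmPoly : ℕ → ℝ[X]
  | 0 => 2
  | 1 => X
  | (j + 2) => X * symmPoly (j + 1) - symmPoly j

theorem natDegree_symmPoly_le (j : ℕ) :
    (symmPoly j).natDegree ≤ j ∧ (symmPoly (j + 1)).natDegree ≤ j + 1 := by
  induction j with
  | zero => simp [symmPoly]
  | succ j ih =>
    refine ⟨ih.2, ?_⟩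
    rw [symmPoly]
    refine (natDegree_sub_le _ _).trans (max_le ?_ (ih.1.trans (by omega)))
    refine natDegree_mul_le.trans ?_
    rw [natDegree_X]
    have := ih.2
    omega

theorem aeval_symmPoly {K : Type*} [Field K] [Algebra ℝ K] {z : K} (hz : z ≠ 0) (j : ℕ) :
    aeval (z + z⁻¹) (symmPoly j) = z ^ j + z⁻¹ ^ j ∧
      aeval (z + z⁻¹) (symmPoly (j + 1)) = z ^ (j + 1) + z⁻¹ ^ (j + 1) := by
  induction j with
  | zero =>
    refine ⟨?_, by simp [symmPoly]⟩
    rw [symmPoly, map_ofNat]; norm_num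
  | succ j ih =>
    refine ⟨ih.2, ?_⟩
    rw [symmPoly, map_sub, map_mul, aeval_X, ih.1, ih.2]
    have h1 : z * z⁻¹ = 1 := mul_inv_cancel₀ hz
    linear_combination (z ^ j + z⁻¹ ^ j) * h1

/-- The field is left general because the same D is evaluated at a real point, to normalize it, and
at complex z, in the error formula. -/
theorem exists_symm_poly (A : ℝ[X]) {d : ℕ} (hA : A.natDegree ≤ d) :
    ∃ D : ℝ[X], D.natDegree ≤ d ∧ ∀ (K : Type) [Field K] [Algebra ℝ K] (z : K), z ≠ 0 →
      aeval (z + z⁻¹) D = aeval z A + aeval z⁻¹ A := by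
  refine ⟨∑ j ∈ Finset.range (d + 1), C (A.coeff j) * symmPoly j, ?_, ?_⟩
  · refine natDegree_sum_le_of_forall_le _ _ fun j hj => ?_
    refine (natDegree_C_mul_le _ _).trans ((natDegree_symmPoly_le j).1.trans ?_)
    have := Finset.mem_range.1 hj
    omega
  · intro K _ _ z hz
    rw [aeval_eq_sum_range' (Nat.lt_succ_of_le hA), aeval_eq_sum_range' (Nat.lt_succ_of_le hA),
      map_sum, ← Finset.sum_add_distrib]
    refine Finset.sum_congr rfl fun j _ => ?_
    rw [map_mul, aeval_C, (aeval_symmPoly hz j).1, Algebra.smul_def, Algebra.smul_def, mul_add]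

/-! ### The kernel of the nearly optimal approximation -/

/-- The parametrization of the negative axis. -/
def tauFun (ρ y : ℝ) : ℝ := (Real.exp y - 1) * (1 - ρ ^ 2 * Real.exp (-y)) / (1 + ρ) ^ 2

/-- The derivative of `tauFun`. -/
def tauDeriv (ρ y : ℝ) : ℝ := (Real.exp y - ρ ^ 2 * Real.exp (-y)) / (1 + ρ) ^ 2

/-- The weight of the error integral. -/
def kern (k m : ℕ) (ρ y : ℝ) : ℝ :=
  √(tauFun ρ y) ^ (2 * k - 1) * (ρ * Real.exp (-y)) ^ (m + k) /
    (1 - ρ ^ 2 * Real.exp (-y)) ^ (2 * k)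

/-- The oscillating factor of the error integral. -/
def waveFun (k m : ℕ) (ρ y : ℝ) (z : ℂ) : ℂ :=
  z ^ (m - k) * (z + ρ) ^ (2 * k) / (1 + (ρ * Real.exp (-y) : ℝ) * z)

section
variable {ρ y : ℝ}

theorem one_sub_pos (h0 : 0 < ρ) (h1 : ρ < 1) (hy : 0 ≤ y) :
    0 < 1 - ρ ^ 2 * Real.exp (-y) := by
  have h2 : Real.exp (-y) ≤ 1 := Real.exp_le_one_iff.2 (by linarith)
  have h3 := Real.exp_pos (-y)
  nlinarith

theorem tauFun_pos (h0 : 0 < ρ) (h1 : ρ < 1) (hy : 0 < y) : 0 < tauFun ρ y := by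
  have h2 : 1 < Real.exp y := Real.one_lt_exp_iff.2 hy
  have h3 := one_sub_pos h0 h1 hy.le
  exact div_pos (mul_pos (by linarith) h3) (by positivity)

theorem hasDerivAt_tauFun (ρ y : ℝ) : HasDerivAt (tauFun ρ) (tauDeriv ρ y) y := by
  have h1 := (Real.hasDerivAt_exp y).sub_const 1
  have h2 : HasDerivAt (fun y : ℝ => 1 - ρ ^ 2 * Real.exp (-y)) (ρ ^ 2 * Real.exp (-y)) y := by
    have := (((Real.hasDerivAt_exp (-y)).comp y (hasDerivAt_neg y)).const_mul (ρ ^ 2)).const_sub 1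
    refine this.congr_deriv ?_
    ring
  refine ((h1.mul h2).div_const ((1 + ρ) ^ 2)).congr_deriv ?_
  rw [tauDeriv]
  have h3 : Real.exp y * Real.exp (-y) = 1 := by rw [← Real.exp_add]; simp
  congr 1
  linear_combination 0 * h3

theorem tauDeriv_pos (h0 : 0 < ρ) (h1 : ρ < 1) (hy : 0 ≤ y) : 0 < tauDeriv ρ y := by
  have h2 : 1 ≤ Real.exp y := Real.one_le_exp_iff.2 hy
  have h3 := one_sub_pos h0 h1 hy
  exact div_pos (by linarith) (by positivity)

/-- In the variable z one has x² + τ = const · (1 + qz)(1 + q/z). A symmetric Laurent polynomial S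
equal to 1 at x² = -τ makes x^{2k} - (-τ)^k S divisible by x² + τ; the quotient is P and the
remainder is explicit. The factor (z + ρ)^{2k} in S has modulus ((1 + ρ)x)^{2k} on |z| = 1, which
makes the error, divided by x^{2k-1}, nearly equioscillating. -/
theorem exists_kernel_poly {k m : ℕ} (hk : 1 ≤ k) (hm : k + 1 ≤ m) (h0 : 0 < ρ) (h1 : ρ < 1)
    (hy : 0 < y) : ∃ P : ℝ[X], P.natDegree ≤ m + k - 1 ∧
      ∀ x : ℝ, 0 < x → ∀ z : ℂ, z ≠ 0 → (1 + ρ * z) * (1 + ρ * z⁻¹) = (1 + ρ) ^ 2 * x ^ 2 →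
        ((tauDeriv ρ y / √(tauFun ρ y) * (x ^ (2 * k) / (x ^ 2 + tauFun ρ y) - P.eval (x ^ 2)) : ℝ) : ℂ)
          = (-1) ^ m * kern k m ρ y * (waveFun k m ρ y z + waveFun k m ρ y z⁻¹) := by
  obtain ⟨j, rfl⟩ : ∃ j, m = k + 1 + j := ⟨m - (k + 1), by omega⟩
  set q := ρ * Real.exp (-y) with hq
  have hq0 : 0 < q := mul_pos h0 (Real.exp_pos _)
  have hqρ : q < ρ := by
    rw [hq]; exact mul_lt_of_lt_one_right h0 (Real.exp_lt_one_iff.2 (by linarith))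
  have he : Real.exp y = ρ / q := by rw [hq, Real.exp_neg]; field_simp
  have hτ : tauFun ρ y = (ρ / q - 1) * (1 - ρ * q) / (1 + ρ) ^ 2 := by
    rw [tauFun, he, hq]; ring
  have hτ' : tauDeriv ρ y = ρ * (1 - q ^ 2) / (q * (1 + ρ) ^ 2) := by
    rw [tauDeriv, he, show ρ ^ 2 * Real.exp (-y) = ρ * q by rw [hq]; ring]
    field_simp
  have hτpos := tauFun_pos h0 h1 hy
  set τ := tauFun ρ y with hτdef
  have hρq : 0 < 1 - ρ * q := by nlinarith
  have hq2 : 0 < 1 - q ^ 2 := by nlinarith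
  -- The constant normalizes S to 1 at x² = -τ. Of the two terms there, the one at z = -q vanishes
  -- through the factor X + C q of A, so only z = -1/q contributes.
  set c : ℝ := (-1) ^ (j + 1) * q ^ (k + 1 + j + k) / ((1 - ρ * q) ^ (2 * k) * (1 - q ^ 2)) with hc
  set A : ℝ[X] := X ^ j * (X + C ρ) ^ (2 * k) * (X + C q) with hA
  have hAdeg : A.natDegree ≤ k + 1 + j + k := by
    rw [hA]
    refine natDegree_mul_le.trans ?_
    rw [natDegree_X_add_C]
    have h2 : (X ^ j * (X + C ρ) ^ (2 * k)).natDegree ≤ j + 2 * k := by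
      refine natDegree_mul_le.trans ?_
      rw [natDegree_X_pow, natDegree_pow, natDegree_X_add_C, mul_one]
    omega
  obtain ⟨D, hDdeg, hD⟩ := exists_symm_poly A hAdeg
  set l : ℝ[X] := C ((1 + ρ) ^ 2 / ρ) * X - C ((1 + ρ ^ 2) / ρ) with hl
  have hldeg : l.natDegree ≤ 1 := by
    rw [hl]
    refine (natDegree_sub_le _ _).trans (max_le ((natDegree_C_mul_le _ _).trans ?_) ?_)
    · rw [natDegree_X]
    · rw [natDegree_C]; omega
  set S : ℝ[X] := C c * D.comp l with hS
  have hSdeg : S.natDegree ≤ k + 1 + j + k := by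
    refine (natDegree_C_mul_le _ _).trans (natDegree_comp_le.trans ?_)
    calc D.natDegree * l.natDegree ≤ (k + 1 + j + k) * 1 := Nat.mul_le_mul hDdeg hldeg
      _ = _ := by ring
  set R : ℝ[X] := X ^ k - C ((-τ) ^ k) * S with hR
  have hRdeg : R.natDegree ≤ k + 1 + j + k := by
    refine (natDegree_sub_le _ _).trans (max_le ?_ ((natDegree_C_mul_le _ _).trans hSdeg))
    rw [natDegree_X_pow]; omega
  have hSτ : S.eval (-τ) = 1 := by
    have h2 : l.eval (-τ) = (-q) + (-q)⁻¹ := by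
      simp only [hl, eval_sub, eval_mul, eval_C, eval_X]
      rw [hτ]
      field_simp
      ring
    have h3 := hD ℝ (-q) (neg_ne_zero.2 hq0.ne')
    rw [coe_aeval_eq_eval, coe_aeval_eq_eval, coe_aeval_eq_eval] at h3
    rw [hS, eval_mul, eval_C, eval_comp, h2, h3, hA]
    simp only [eval_mul, eval_pow, eval_X, eval_add, eval_C, neg_add_cancel, mul_zero, zero_add]
    have e1 : (-q)⁻¹ = (-1) * q⁻¹ := by rw [inv_neg]; ring
    have e2 : (-1) * q⁻¹ + ρ = (-1) * ((1 - ρ * q) / q) := by field_simp; ring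
    have e3 : (-1) * q⁻¹ + q = (-1) * ((1 - q ^ 2) / q) := by field_simp; ring
    rw [e1, e2, e3, mul_pow, mul_pow (-1 : ℝ) _ (2 * k), (even_two_mul k).neg_one_pow, one_mul,
      div_pow, hc, inv_pow]
    have e4 : ((-1 : ℝ) ^ (j + 1)) * ((-1) ^ j * (-1)) = 1 := by
      rw [← pow_succ, ← pow_add, Even.neg_one_pow ⟨_, rfl⟩]
    have e5 : q ^ (k + 1 + j + k) = q ^ j * q ^ (2 * k) * q := by ring
    rw [e5]
    have e6 := pow_ne_zero (2 * k) hρq.ne'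
    have e7 := pow_ne_zero (2 * k) hq0.ne'
    have e8 := pow_ne_zero j hq0.ne'
    have e9 := hq2.ne'
    generalize (1 - ρ * q) ^ (2 * k) = u at e6 ⊢
    generalize 1 - q ^ 2 = v at e9 ⊢
    field_simp
    linear_combination e4
  have hRroot : R.IsRoot (-τ) := by
    rw [IsRoot.def, hR, eval_sub, eval_mul, eval_C, hSτ, eval_pow, eval_X, mul_one, sub_self]
  refine ⟨R /ₘ (X - C (-τ)), ?_, ?_⟩
  · rw [natDegree_divByMonic _ (monic_X_sub_C _), natDegree_X_sub_C]; omega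
  intro x hx z hz hxz
  set P := R /ₘ (X - C (-τ)) with hP
  have hRP : (X - C (-τ)) * P = R := mul_divByMonic_eq_iff_isRoot.2 hRroot
  have hxτ : 0 < x ^ 2 + τ := by positivity
  have hreal : x ^ (2 * k) / (x ^ 2 + τ) - P.eval (x ^ 2)
      = (-τ) ^ k * (c * D.eval (l.eval (x ^ 2))) / (x ^ 2 + τ) := by
    have h2 := congrArg (eval (x ^ 2)) hRP
    rw [hR, hS] at h2
    simp only [eval_mul, eval_sub, eval_X, eval_C, eval_pow, eval_comp, sub_neg_eq_add] at h2
    rw [eq_div_iff hxτ.ne', sub_mul, div_mul_cancel₀ _ hxτ.ne', pow_mul]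
    linear_combination -h2
  have hρC : (ρ : ℂ) ≠ 0 := ofReal_ne_zero.2 h0.ne'
  have hqC : (q : ℂ) ≠ 0 := ofReal_ne_zero.2 hq0.ne'
  have h1ρ : (1 + (ρ : ℂ)) ≠ 0 := by
    have : (1 + ρ : ℝ) ≠ 0 := by positivity
    exact_mod_cast this
  have hlz : ((l.eval (x ^ 2) : ℝ) : ℂ) = z + z⁻¹ := by
    simp only [hl, eval_sub, eval_mul, eval_C, eval_X]
    push_cast
    rw [← sub_eq_zero]
    have h2 : (1 + (ρ : ℂ)) ^ 2 / ρ * x ^ 2 = (1 + ρ * z) * (1 + ρ * z⁻¹) / ρ := by rw [hxz]; ring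
    rw [h2]
    field_simp
    ring
  have hDz : ((D.eval (l.eval (x ^ 2)) : ℝ) : ℂ) = aeval z A + aeval z⁻¹ A := by
    rw [← hD ℂ z hz, ← hlz]
    exact (aeval_algebraMap_apply_eq_algebraMap_eval (l.eval (x ^ 2)) D).symm
  have hAz : ∀ w : ℂ, w ≠ 0 → aeval w A = (1 + q * w⁻¹) * (w ^ (j + 1) * (w + ρ) ^ (2 * k)) := by
    intro w hw
    rw [hA]
    simp only [map_mul, map_pow, map_add, aeval_X, aeval_C, coe_algebraMap]
    field_simp
    ring
  have hT : ((x ^ 2 + τ : ℝ) : ℂ) = ρ / ((1 + ρ) ^ 2 * q) * ((1 + q * z) * (1 + q * z⁻¹)) := by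
    have h2 : (x : ℂ) ^ 2 = (1 + ρ * z) * (1 + ρ * z⁻¹) / (1 + ρ) ^ 2 := by
      rw [hxz]; field_simp
    rw [hτ]
    push_cast
    rw [h2]
    field_simp
    ring
  have hT0 : ((x ^ 2 + τ : ℝ) : ℂ) ≠ 0 := ofReal_ne_zero.2 hxτ.ne'
  have hz1 : 1 + q * z ≠ 0 := fun h2 => hT0 (by rw [hT, h2]; ring)
  have hz2 : 1 + q * z⁻¹ ≠ 0 := fun h2 => hT0 (by rw [hT, h2]; ring)
  have hsq : √τ ^ (2 * k) = τ ^ k := by rw [pow_mul, Real.sq_sqrt hτpos.le]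
  have hsqrt : 0 < √τ := Real.sqrt_pos.2 hτpos
  have hreal2 : tauDeriv ρ y / √τ * (x ^ (2 * k) / (x ^ 2 + τ) - P.eval (x ^ 2))
      = (-1) ^ (k + 1 + j) * kern k (k + 1 + j) ρ y * ((ρ / ((1 + ρ) ^ 2 * q)) / (x ^ 2 + τ)) *
        D.eval (l.eval (x ^ 2)) := by
    rw [hreal, kern, ← hτdef, ← hq, hτ', hc, show ρ ^ 2 * Real.exp (-y) = ρ * q by rw [hq]; ring,
      neg_pow, ← hsq, show 2 * k = 2 * k - 1 + 1 by omega, pow_succ (√τ), Nat.add_sub_cancel]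
    have e9 := hq2.ne'
    have e10 := pow_ne_zero (2 * k - 1 + 1) hρq.ne'
    field_simp
    rw [pow_add (-1 : ℝ) (k + 1) j, pow_add (-1 : ℝ) k 1, pow_add (-1 : ℝ) j 1]
    ring
  rw [hreal2, ofReal_mul, hDz, hAz z hz, hAz z⁻¹ (inv_ne_zero hz), inv_inv]
  rw [ofReal_mul, ofReal_div, hT]
  simp only [waveFun]
  rw [← hq, show k + 1 + j - k = j + 1 by omega]
  push_cast
  have h3 : (ρ : ℂ) / ((1 + ρ) ^ 2 * q) ≠ 0 := div_ne_zero hρC (mul_ne_zero (pow_ne_zero _ h1ρ) hqC)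
  rw [mul_assoc ((-1 : ℂ) ^ (k + 1 + j) * (kern k (k + 1 + j) ρ y : ℂ))]
  congr 1
  rw [div_mul_eq_div_div, div_self h3, one_div, ← div_eq_inv_mul]
  generalize z ^ (j + 1) * (z + ρ) ^ (2 * k) = u
  generalize z⁻¹ ^ (j + 1) * (z⁻¹ + ρ) ^ (2 * k) = v
  rw [div_add_div _ _ hz1 hz2]
  congr 1
  ring

end

end SgnLaurent

end

noncomputable section
namespace SgnLaurent

open Polynomial Set Complex Filter Topology MeasureTheory

/-! ### Integration over τ and the nearly optimal approximation -/

section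
variable {ρ : ℝ}

theorem continuous_tauFun (ρ : ℝ) : Continuous (tauFun ρ) := by unfold tauFun; fun_prop

theorem tauFun_le (h0 : 0 < ρ) (h1 : ρ < 1) {y : ℝ} (hy : 0 ≤ y) :
    tauFun ρ y ≤ Real.exp y - 1 := by
  have h2 : 1 ≤ Real.exp y := Real.one_le_exp_iff.2 hy
  have h3 := one_sub_pos h0 h1 hy
  have h4 : 0 ≤ ρ ^ 2 * Real.exp (-y) := by positivity
  rw [tauFun, div_le_iff₀ (by positivity)]
  have h5 : (1 : ℝ) ≤ (1 + ρ) ^ 2 := by nlinarith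
  calc (Real.exp y - 1) * (1 - ρ ^ 2 * Real.exp (-y)) ≤ (Real.exp y - 1) * 1 := by
        refine mul_le_mul_of_nonneg_left ?_ (by linarith); linarith
    _ ≤ (Real.exp y - 1) * (1 + ρ) ^ 2 := mul_le_mul_of_nonneg_left h5 (by linarith)

theorem tendsto_tauFun (h0 : 0 < ρ) : Tendsto (tauFun ρ) atTop atTop := by
  have h2 : Tendsto (fun y : ℝ => 1 - ρ ^ 2 * Real.exp (-y)) atTop (𝓝 (1 - ρ ^ 2 * 0)) :=
    ((Real.tendsto_exp_atBot.comp tendsto_neg_atTop_atBot).const_mul _).const_sub _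
  have h3 : Tendsto (fun y : ℝ => Real.exp y - 1) atTop atTop :=
    tendsto_atTop_add_const_right _ _ Real.tendsto_exp_atTop
  have h4 := h3.atTop_mul_pos (by norm_num) h2
  exact h4.atTop_div_const (by positivity)

theorem hasDerivAt_arctan_sqrt_tau (h0 : 0 < ρ) (h1 : ρ < 1) {x y : ℝ} (hx : 0 < x) (hy : 0 < y) :
    HasDerivAt (fun y => 2 / x * Real.arctan (√(tauFun ρ y) / x))
      (tauDeriv ρ y / √(tauFun ρ y) * (1 / (x ^ 2 + tauFun ρ y))) y := by
  have hτ := tauFun_pos h0 h1 hy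
  have h2 := (((hasDerivAt_tauFun ρ y).sqrt hτ.ne').div_const x).arctan.const_mul (2 / x)
  refine h2.congr_deriv ?_
  have h3 : 0 < √(tauFun ρ y) := Real.sqrt_pos.2 hτ
  rw [div_pow, Real.sq_sqrt hτ.le]
  have h4 : 0 < x ^ 2 + tauFun ρ y := by positivity
  have h5 : 1 + tauFun ρ y / x ^ 2 = (x ^ 2 + tauFun ρ y) / x ^ 2 := by field_simp
  rw [h5]
  field_simp

/-- This is the integral of dτ / (√τ (x² + τ)) over (0, ∞) after the substitution τ = τ(y), with an
arctangent as antiderivative. -/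
theorem integral_inv_add_tau (h0 : 0 < ρ) (h1 : ρ < 1) {x : ℝ} (hx : 0 < x) :
    IntegrableOn (fun y => tauDeriv ρ y / √(tauFun ρ y) * (1 / (x ^ 2 + tauFun ρ y))) (Ioi 0) ∧
      ∫ y in Ioi 0, tauDeriv ρ y / √(tauFun ρ y) * (1 / (x ^ 2 + tauFun ρ y)) = Real.pi / x := by
  have hc : ContinuousWithinAt (fun y => 2 / x * Real.arctan (√(tauFun ρ y) / x)) (Ici 0) 0 := by
    have := continuous_tauFun ρ
    have h2 : Continuous fun y => 2 / x * Real.arctan (√(tauFun ρ y) / x) := by fun_prop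
    exact h2.continuousWithinAt
  have hd : ∀ y ∈ Ioi (0 : ℝ), _ := fun y hy => hasDerivAt_arctan_sqrt_tau h0 h1 hx hy
  have hpos : ∀ y ∈ Ioi (0 : ℝ),
      0 ≤ tauDeriv ρ y / √(tauFun ρ y) * (1 / (x ^ 2 + tauFun ρ y)) := by
    intro y hy
    have h2 := tauDeriv_pos h0 h1 (le_of_lt hy)
    have h3 := tauFun_pos h0 h1 hy
    positivity
  have hlim : Tendsto (fun y => 2 / x * Real.arctan (√(tauFun ρ y) / x)) atTop (𝓝 (Real.pi / x)) := by
    have h2 : Tendsto (fun y => √(tauFun ρ y) / x) atTop atTop :=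
      (Real.tendsto_sqrt_atTop.comp (tendsto_tauFun h0)).atTop_div_const hx
    have h3 := (((Real.tendsto_arctan_atTop).mono_right nhdsWithin_le_nhds).comp h2).const_mul (2 / x)
    have e : 2 / x * (Real.pi / 2) = Real.pi / x := by field_simp
    rw [e] at h3
    exact h3
  refine ⟨integrableOn_Ioi_deriv_of_nonneg hc hd hpos hlim, ?_⟩
  rw [integral_Ioi_of_hasDerivAt_of_nonneg hc hd hpos hlim]
  simp [tauFun]

theorem continuousOn_kern (k m : ℕ) (h0 : 0 < ρ) (h1 : ρ < 1) :
    ContinuousOn (kern k m ρ) (Ici 0) := by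
  have := continuous_tauFun ρ
  unfold kern
  refine ContinuousOn.div (by fun_prop) (by fun_prop) fun y hy => ?_
  exact pow_ne_zero _ (one_sub_pos h0 h1 hy).ne'

theorem kern_nonneg (k m : ℕ) (h0 : 0 < ρ) (h1 : ρ < 1) {y : ℝ} (hy : 0 ≤ y) :
    0 ≤ kern k m ρ y := by
  have := one_sub_pos h0 h1 hy
  unfold kern
  positivity

/-- Domination of the kernel, with the growth of `τ` absorbed by one half of the decay. -/
theorem kern_le {k m : ℕ} (hm : k ≤ m) (h0 : 0 < ρ) (h1 : ρ < 1) {y : ℝ} (hy : 0 ≤ y) :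
    kern k m ρ y ≤ ρ ^ (m + k) / (1 - ρ ^ 2) ^ (2 * k) *
      (√y ^ (2 * k - 1) * Real.exp (-((m + k : ℕ) * y) / 2)) := by
  have h2 : 0 < 1 - ρ ^ 2 := by nlinarith
  have h3 : 1 - ρ ^ 2 ≤ 1 - ρ ^ 2 * Real.exp (-y) := by
    have : Real.exp (-y) ≤ 1 := Real.exp_le_one_iff.2 (by linarith)
    nlinarith [sq_nonneg ρ]
  have h4 : √(tauFun ρ y) ≤ √y * Real.exp (y / 2) := by
    rw [Real.sqrt_le_left (by positivity), mul_pow, Real.sq_sqrt hy, ← Real.exp_nat_mul]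
    refine (tauFun_le h0 h1 hy).trans ?_
    have h5 : (1 - y) * Real.exp y ≤ 1 := by
      have h6 := Real.add_one_le_exp (-y)
      have h7 : Real.exp (-y) * Real.exp y = 1 := by rw [← Real.exp_add]; simp
      nlinarith [Real.exp_pos y]
    have e : ((2 : ℕ) : ℝ) * (y / 2) = y := by push_cast; ring
    rw [e]; linarith
  have h5 : √(tauFun ρ y) ^ (2 * k - 1) ≤ √y ^ (2 * k - 1) * Real.exp ((m + k : ℕ) * y / 2) := by
    refine (pow_le_pow_left₀ (Real.sqrt_nonneg _) h4 _).trans ?_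
    rw [mul_pow, ← Real.exp_nat_mul]
    refine mul_le_mul_of_nonneg_left (Real.exp_le_exp.2 ?_) (by positivity)
    have : ((2 * k - 1 : ℕ) : ℝ) ≤ (m + k : ℕ) := by exact_mod_cast (by omega : 2 * k - 1 ≤ m + k)
    nlinarith
  unfold kern
  calc √(tauFun ρ y) ^ (2 * k - 1) * (ρ * Real.exp (-y)) ^ (m + k) /
      (1 - ρ ^ 2 * Real.exp (-y)) ^ (2 * k)
      ≤ (√y ^ (2 * k - 1) * Real.exp ((m + k : ℕ) * y / 2)) * (ρ * Real.exp (-y)) ^ (m + k) /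
        (1 - ρ ^ 2) ^ (2 * k) := by gcongr
    _ = _ := by
      rw [mul_pow, ← Real.exp_nat_mul]
      have e : Real.exp ((m + k : ℕ) * y / 2) * Real.exp ((m + k : ℕ) * -y)
          = Real.exp (-((m + k : ℕ) * y) / 2) := by rw [← Real.exp_add]; congr 1; ring
      rw [← e]; ring

theorem integrableOn_sqrt_pow_mul_exp (j : ℕ) {b : ℝ} (hb : 0 < b) :
    IntegrableOn (fun y => √y ^ j * Real.exp (-(b * y))) (Ioi 0) := by
  have h1 := integrableOn_rpow_mul_exp_neg_mul_rpow (s := (j : ℝ) / 2) (p := 1) (b := b)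
    (by have : (0 : ℝ) ≤ j := by positivity
        linarith) one_pos hb
  refine h1.congr_fun (fun y hy => ?_) measurableSet_Ioi
  have hy' : (0 : ℝ) < y := hy
  simp only [Real.rpow_one]
  rw [Real.sqrt_eq_rpow, ← Real.rpow_natCast, ← Real.rpow_mul hy'.le]
  congr 2
  · ring
  · ring

theorem integrableOn_kern {k m : ℕ} (hk : 1 ≤ k) (hm : k ≤ m) (h0 : 0 < ρ) (h1 : ρ < 1) :
    IntegrableOn (kern k m ρ) (Ioi 0) := by
  have hb : 0 < ((m + k : ℕ) : ℝ) / 2 := by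
    have : 0 < m + k := by omega
    positivity
  refine Integrable.mono' ((integrableOn_sqrt_pow_mul_exp (2 * k - 1) hb).const_mul
    (ρ ^ (m + k) / (1 - ρ ^ 2) ^ (2 * k)))
    (((continuousOn_kern k m h0 h1).mono Ioi_subset_Ici_self).aestronglyMeasurable measurableSet_Ioi) ?_
  refine (ae_restrict_iff' measurableSet_Ioi).2 (Eventually.of_forall fun y hy => ?_)
  have hy' : (0 : ℝ) ≤ y := le_of_lt hy
  rw [Real.norm_of_nonneg (kern_nonneg k m h0 h1 hy')]
  refine (kern_le hm h0 h1 hy').trans_eq ?_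
  congr 3
  ring

theorem norm_waveFun_le_of_pos (k m : ℕ) (h0 : 0 < ρ) {y t : ℝ} (ht : 0 < t) :
    ‖waveFun k m ρ y t‖ ≤ t ^ (m - k) * (t + ρ) ^ (2 * k) := by
  have hq : 0 < ρ * Real.exp (-y) := by positivity
  have e : waveFun k m ρ y t =
      ((t ^ (m - k) * (t + ρ) ^ (2 * k) / (1 + (ρ * Real.exp (-y)) * t) : ℝ) : ℂ) := by
    rw [waveFun]; push_cast; ring
  rw [e, norm_real, Real.norm_of_nonneg (by positivity)]
  refine div_le_self (by positivity) ?_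
  have := mul_pos hq ht
  linarith

theorem continuousOn_waveFun {k m : ℕ} {z : ℂ} {s : Set ℝ}
    (hz : ∀ y ∈ s, 1 + (ρ * Real.exp (-y) : ℝ) * z ≠ 0) :
    ContinuousOn (fun y => waveFun k m ρ y z) s := by
  unfold waveFun
  refine ContinuousOn.div continuousOn_const ?_ hz
  have : Continuous fun y : ℝ => (1 : ℂ) + (ρ * Real.exp (-y) : ℝ) * z := by fun_prop
  exact this.continuousOn

/-- The nearly optimal polynomial, with an integral representation of its error. -/
theorem exists_near_optimal {k m : ℕ} (hk : 1 ≤ k) (hm : k + 1 ≤ m) (h0 : 0 < ρ) (h1 : ρ < 1) :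
    ∃ P : ℝ[X], P.natDegree ≤ m + k - 1 ∧
      ∀ x : ℝ, 0 < x → ∀ z : ℂ, z ≠ 0 → (1 + ρ * z) * (1 + ρ * z⁻¹) = (1 + ρ) ^ 2 * x ^ 2 →
        ((x ^ (2 * k - 1) - P.eval (x ^ 2) : ℝ) : ℂ) = (-1) ^ m / Real.pi *
          ∫ y in Ioi (0 : ℝ), (kern k m ρ y : ℂ) * (waveFun k m ρ y z + waveFun k m ρ y z⁻¹) := by
  classical
  have hex : ∀ y : ℝ, ∃ P : ℝ[X], 0 < y → _ := fun y =>
    if hy : 0 < y then (exists_kernel_poly hk hm h0 h1 hy).imp fun P hP _ => hP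
    else ⟨0, fun h => absurd h hy⟩
  choose p hp using hex
  set M : ℝ → ℝ := fun y => tauDeriv ρ y / √(tauFun ρ y) with hM
  -- nodes
  set ν : ℕ → ℝ := fun i => √((1 + ρ * (i + 1 : ℝ)) * (1 + ρ * (i + 1 : ℝ)⁻¹) / (1 + ρ) ^ 2) with hν
  have hν0 : ∀ i, 0 < ν i := fun i => Real.sqrt_pos.2 (by positivity)
  have hν2 : ∀ i, ν i ^ 2 = (1 + ρ * (i + 1 : ℝ)) * (1 + ρ * (i + 1 : ℝ)⁻¹) / (1 + ρ) ^ 2 :=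
    fun i => Real.sq_sqrt (by positivity)
  have hνz : ∀ i : ℕ, (1 + ρ * (((i + 1 : ℝ)) : ℂ)) * (1 + ρ * (((i + 1 : ℝ)) : ℂ)⁻¹)
      = (1 + ρ) ^ 2 * (ν i : ℂ) ^ 2 := by
    intro i
    have : (1 + ρ * (i + 1 : ℝ)) * (1 + ρ * (i + 1 : ℝ)⁻¹) = (1 + ρ) ^ 2 * ν i ^ 2 := by
      rw [hν2]; field_simp
    exact_mod_cast this
  -- The nodes come from z = i + 1, and z + 1/z is injective on [1, ∞).
  have hνinj : Set.InjOn (fun i => ν i ^ 2) (Finset.range (m + k) : Set ℕ) := by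
    intro i _ j _ hij
    simp only [hν2] at hij
    have hi : (0 : ℝ) < i + 1 := by positivity
    have hj : (0 : ℝ) < j + 1 := by positivity
    have h2 : ((i : ℝ) + 1 - (j + 1)) * ((i + 1) * (j + 1) - 1) = 0 := by
      rw [div_left_inj' (by positivity)] at hij
      field_simp at hij
      have h3 : ρ * (((i : ℝ) + 1 - (j + 1)) * ((i + 1) * (j + 1) - 1)) = 0 := by linear_combination hij
      exact (mul_eq_zero.1 h3).resolve_left h0.ne'
    rcases mul_eq_zero.1 h2 with h3 | h3
    · have : (i : ℝ) = j := by linarith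
      exact_mod_cast this
    · have h4 : ((i : ℝ)) * j + i + j = 0 := by linarith
      have hi' : (0 : ℝ) ≤ i := by positivity
      have hj' : (0 : ℝ) ≤ j := by positivity
      have h5 : (i : ℝ) = 0 := by nlinarith
      have h6 : (j : ℝ) = 0 := by nlinarith
      have : (i : ℝ) = j := by rw [h5, h6]
      exact_mod_cast this
  -- The polynomials p y are chosen separately for each y, so nothing is known about their
  -- dependence on y. Their values at fixed nodes are integrable by the error formula, and Lagrange
  -- interpolation carries this to every x.
  have hlag : ∀ y, 0 < y → ∀ t, (p y).eval t = ∑ i ∈ Finset.range (m + k),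
      (p y).eval (ν i ^ 2) * (Lagrange.basis (Finset.range (m + k)) (fun i => ν i ^ 2) i).eval t := by
    intro y hy t
    have hdeg : (p y).degree < (Finset.range (m + k)).card := by
      rw [Finset.card_range]
      refine lt_of_le_of_lt degree_le_natDegree ?_
      have := (hp y hy).1
      exact_mod_cast (by omega : (p y).natDegree < m + k)
    conv_lhs => rw [Lagrange.eq_interpolate hνinj hdeg]
    rw [Lagrange.interpolate_apply, eval_finsetSum]
    exact Finset.sum_congr rfl fun i _ => by rw [eval_mul, eval_C]
  have hfirst : ∀ x : ℝ, 0 < x →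
      IntegrableOn (fun y => M y * (x ^ (2 * k) / (x ^ 2 + tauFun ρ y))) (Ioi 0) ∧
      ∫ y in Ioi 0, M y * (x ^ (2 * k) / (x ^ 2 + tauFun ρ y)) = Real.pi * x ^ (2 * k - 1) := by
    intro x hx
    obtain ⟨h2, h3⟩ := integral_inv_add_tau h0 h1 hx
    have e : (fun y => M y * (x ^ (2 * k) / (x ^ 2 + tauFun ρ y))) =
        fun y => x ^ (2 * k) * (tauDeriv ρ y / √(tauFun ρ y) * (1 / (x ^ 2 + tauFun ρ y))) := by
      funext y; simp only [hM]; ring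
    rw [e]
    refine ⟨h2.const_mul _, ?_⟩
    rw [integral_const_mul, h3, show 2 * k = 2 * k - 1 + 1 by omega, pow_succ, Nat.add_sub_cancel]
    field_simp
  have herr : ∀ i, IntegrableOn (fun y => M y * ((ν i) ^ (2 * k) / ((ν i) ^ 2 + tauFun ρ y)
      - (p y).eval (ν i ^ 2))) (Ioi 0) := by
    intro i
    have hi : (0 : ℝ) < i + 1 := by positivity
    have hne : (((i + 1 : ℝ)) : ℂ) ≠ 0 := ofReal_ne_zero.2 hi.ne'
    have hg : IntegrableOn (fun y => (-1 : ℂ) ^ m * (kern k m ρ y : ℂ) *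
        (waveFun k m ρ y ((i + 1 : ℝ) : ℂ) + waveFun k m ρ y ((i + 1 : ℝ) : ℂ)⁻¹)) (Ioi 0) := by
      have hcw : ∀ t : ℝ, 0 < t → ContinuousOn (fun y => waveFun k m ρ y (t : ℂ)) (Ioi 0) := by
        intro t ht
        refine continuousOn_waveFun fun y _ => ?_
        have : (0 : ℝ) < 1 + ρ * Real.exp (-y) * t := by positivity
        exact_mod_cast this.ne'
      rw [← ofReal_inv]
      have hbd : ∀ y : ℝ, ‖waveFun k m ρ y ((i + 1 : ℝ) : ℂ) + waveFun k m ρ y (((i + 1 : ℝ)⁻¹ : ℝ) : ℂ)‖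
          ≤ (i + 1 : ℝ) ^ (m - k) * ((i + 1 : ℝ) + ρ) ^ (2 * k) +
            (i + 1 : ℝ)⁻¹ ^ (m - k) * ((i + 1 : ℝ)⁻¹ + ρ) ^ (2 * k) := fun y =>
        (norm_add_le _ _).trans (add_le_add (norm_waveFun_le_of_pos k m h0 hi)
          (norm_waveFun_le_of_pos k m h0 (inv_pos.2 hi)))
      have h3 : IntegrableOn (fun y => (-1 : ℂ) ^ m * (kern k m ρ y : ℂ)) (Ioi 0) :=
        (integrableOn_kern hk (by omega) h0 h1).ofReal.const_mul _
      exact Integrable.mul_bdd h3 (((hcw _ hi).add (hcw _ (inv_pos.2 hi))).aestronglyMeasurable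
        measurableSet_Ioi) (Eventually.of_forall hbd)
    have h4 := hg.re
    refine (integrableOn_congr_fun (fun y hy => ?_) measurableSet_Ioi).1 h4
    have h5 := (hp y hy).2 (ν i) (hν0 i) _ hne (hνz i)
    simp only [← h5]
    exact ofReal_re _
  have hpint : ∀ i, IntegrableOn (fun y => M y * (p y).eval (ν i ^ 2)) (Ioi 0) := by
    intro i
    refine ((hfirst (ν i) (hν0 i)).1.sub (herr i)).congr_fun (fun y _ => ?_) measurableSet_Ioi
    simp only [Pi.sub_apply]; ring
  set cf : ℕ → ℝ := fun i => (∫ y in Ioi 0, M y * (p y).eval (ν i ^ 2)) / Real.pi with hcf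
  refine ⟨∑ i ∈ Finset.range (m + k), C (cf i) *
    Lagrange.basis (Finset.range (m + k)) (fun i => ν i ^ 2) i, ?_, ?_⟩
  · refine natDegree_sum_le_of_forall_le _ _ fun i hi => ?_
    refine (natDegree_C_mul_le _ _).trans ?_
    rw [Lagrange.natDegree_basis hνinj hi, Finset.card_range]
  intro x hx z hz hxz
  have hPx : (∑ i ∈ Finset.range (m + k), C (cf i) *
      Lagrange.basis (Finset.range (m + k)) (fun i => ν i ^ 2) i).eval (x ^ 2)
      = (∫ y in Ioi 0, M y * (p y).eval (x ^ 2)) / Real.pi := by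
    rw [eval_finsetSum]
    have e : ∫ y in Ioi 0, M y * (p y).eval (x ^ 2) = ∫ y in Ioi 0, ∑ i ∈ Finset.range (m + k),
        (M y * (p y).eval (ν i ^ 2)) *
          (Lagrange.basis (Finset.range (m + k)) (fun i => ν i ^ 2) i).eval (x ^ 2) := by
      refine setIntegral_congr_fun measurableSet_Ioi fun y hy => ?_
      rw [hlag y hy, Finset.mul_sum]
      exact Finset.sum_congr rfl fun i _ => by ring
    rw [e, integral_finsetSum _ fun i _ => (hpint i).mul_const _, Finset.sum_div]
    refine Finset.sum_congr rfl fun i _ => ?_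
    rw [eval_mul, eval_C, integral_mul_const, hcf]
    ring
  have hpx : IntegrableOn (fun y => M y * (p y).eval (x ^ 2)) (Ioi 0) := by
    have h2 : IntegrableOn (fun y => ∑ i ∈ Finset.range (m + k), (M y * (p y).eval (ν i ^ 2)) *
          (Lagrange.basis (Finset.range (m + k)) (fun i => ν i ^ 2) i).eval (x ^ 2)) (Ioi 0) :=
      integrable_finsetSum _ fun i _ => (hpint i).mul_const _
    refine h2.congr_fun (fun y hy => ?_) measurableSet_Ioi
    simp only
    rw [hlag y hy, Finset.mul_sum]
    exact Finset.sum_congr rfl fun i _ => by ring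
  have hR : x ^ (2 * k - 1) - (∫ y in Ioi 0, M y * (p y).eval (x ^ 2)) / Real.pi =
      (∫ y in Ioi 0, M y * (x ^ (2 * k) / (x ^ 2 + tauFun ρ y) - (p y).eval (x ^ 2))) / Real.pi := by
    simp only [mul_sub]
    rw [integral_sub (hfirst x hx).1 hpx, (hfirst x hx).2]
    field_simp [Real.pi_pos.ne']
  rw [hPx, hR, ofReal_div, ← integral_complex_ofReal]
  have e2 : ∫ y in Ioi 0, ((M y * (x ^ (2 * k) / (x ^ 2 + tauFun ρ y) - (p y).eval (x ^ 2)) : ℝ) : ℂ)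
      = ∫ y in Ioi 0, (-1) ^ m * ((kern k m ρ y : ℂ) *
        (waveFun k m ρ y z + waveFun k m ρ y z⁻¹)) := by
    refine setIntegral_congr_fun measurableSet_Ioi fun y hy => ?_
    rw [(hp y hy).2 x hx z hz hxz]
    ring
  rw [e2, integral_const_mul]
  ring

end

end SgnLaurent

end

noncomputable section
namespace SgnLaurent

open Polynomial Set Complex Filter Topology MeasureTheory

/-! ### The error of the nearly optimal approximation on the circle -/

/-- Least preimages of the values jc are taken. They increase with j by the intermediate value
theorem, so f need not be monotone. -/
theorem exists_strictMono_preimages {f : ℝ → ℝ} {b c : ℝ} {N : ℕ} (hb : 0 ≤ b) (hc : 0 < c)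
    (hf : ContinuousOn f (Icc 0 b)) (hf0 : f 0 = 0) (hfb : f b = N * c) :
    ∃ θ : ℕ → ℝ, (∀ j ≤ N, θ j ∈ Icc 0 b ∧ f (θ j) = j * c) ∧ ∀ i j, i < j → j ≤ N → θ i < θ j := by
  have hne : ∀ j ≤ N, ∃ t, IsLeast (Icc 0 b ∩ f ⁻¹' {(j : ℝ) * c}) t := by
    intro j hj
    have hcpt : IsCompact (Icc 0 b ∩ f ⁻¹' {(j : ℝ) * c}) :=
      isCompact_Icc.of_isClosed_subset (hf.preimage_isClosed_of_isClosed isClosed_Icc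
        isClosed_singleton) inter_subset_left
    refine hcpt.exists_isLeast ?_
    have h1 := intermediate_value_Icc hb hf
    rw [hf0, hfb] at h1
    have hjN : (j : ℝ) ≤ N := by exact_mod_cast hj
    obtain ⟨t, ht, hft⟩ := h1 (⟨by positivity, by gcongr⟩ : (j : ℝ) * c ∈ Icc 0 (N * c))
    exact ⟨t, ht, hft⟩
  choose! θ hθ using hne
  refine ⟨θ, fun j hj => ⟨(hθ j hj).1.1, (hθ j hj).1.2⟩, fun i j hij hj => ?_⟩
  have h1 := (hθ j hj).1
  have hfj : f (θ j) = j * c := h1.2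
  have hfi : f (θ i) = i * c := (hθ i (by omega)).1.2
  have hij' : (i : ℝ) * c < j * c := by
    have : (i : ℝ) < j := by exact_mod_cast hij
    gcongr
  have h2 := intermediate_value_Icc h1.1.1 (hf.mono (Icc_subset_Icc_right h1.1.2))
  rw [hf0, hfj] at h2
  obtain ⟨t, ht, hft⟩ := h2 (⟨by positivity, hij'.le⟩ : (i : ℝ) * c ∈ Icc 0 (j * c))
  have h3 : θ i ≤ t := (hθ i (by omega)).2 ⟨⟨ht.1, ht.2.trans h1.1.2⟩, hft⟩
  refine lt_of_le_of_ne (h3.trans ht.2) fun h => ?_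
  rw [h, hfj] at hfi
  linarith

section
variable {ρ : ℝ}

/-- The value `1 + ρ e^{iθ}`. -/
def circleVal (ρ θ : ℝ) : ℂ := 1 + ρ * exp (θ * I)

/-- The phase of the leading term of the error. -/
def phase (k m : ℕ) (ρ θ : ℝ) : ℝ := (m + k : ℕ) * θ - (2 * k + 1 : ℕ) * (circleVal ρ θ).arg

theorem circleVal_re (ρ θ : ℝ) : (circleVal ρ θ).re = 1 + ρ * Real.cos θ := by
  simp [circleVal, exp_ofReal_mul_I_re]

theorem circleVal_im (ρ θ : ℝ) : (circleVal ρ θ).im = ρ * Real.sin θ := by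
  simp [circleVal, exp_ofReal_mul_I_im]

theorem circleVal_re_pos (h0 : 0 < ρ) (h1 : ρ < 1) (θ : ℝ) : 0 < (circleVal ρ θ).re := by
  rw [circleVal_re]
  nlinarith [Real.neg_one_le_cos θ]

theorem circleVal_ne_zero (h0 : 0 < ρ) (h1 : ρ < 1) (θ : ℝ) : circleVal ρ θ ≠ 0 := fun h => by
  have := circleVal_re_pos h0 h1 θ
  rw [h] at this; simp at this

theorem norm_circleVal_sq (ρ θ : ℝ) :
    ‖circleVal ρ θ‖ ^ 2 = 1 + 2 * ρ * Real.cos θ + ρ ^ 2 := by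
  rw [← normSq_eq_norm_sq, normSq_apply, circleVal_re, circleVal_im]
  linear_combination ρ ^ 2 * Real.sin_sq_add_cos_sq θ

theorem continuous_phase (k m : ℕ) (h0 : 0 < ρ) (h1 : ρ < 1) : Continuous (phase k m ρ) := by
  have h2 : Continuous (circleVal ρ) := by unfold circleVal; fun_prop
  have h3 : Continuous fun θ => (circleVal ρ θ).arg :=
    continuous_iff_continuousAt.2 fun θ =>
      (continuousAt_arg (Or.inl (circleVal_re_pos h0 h1 θ))).comp h2.continuousAt
  unfold phase
  fun_prop

theorem phase_zero (k m : ℕ) (h0 : 0 < ρ) : phase k m ρ 0 = 0 := by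
  have : circleVal ρ 0 = ((1 + ρ : ℝ) : ℂ) := by simp [circleVal]
  rw [phase, this, arg_ofReal_of_nonneg (by linarith)]; simp

theorem phase_pi (k m : ℕ) (h1 : ρ < 1) : phase k m ρ Real.pi = (m + k : ℕ) * Real.pi := by
  have : circleVal ρ Real.pi = ((1 - ρ : ℝ) : ℂ) := by simp [circleVal, exp_pi_mul_I, sub_eq_add_neg]
  rw [phase, this, arg_ofReal_of_nonneg (by linarith)]; simp

/-- The point of `[a, 1]` that corresponds to the angle `θ`. -/
def circlePt (ρ θ : ℝ) : ℝ := ‖circleVal ρ θ‖ / (1 + ρ)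

theorem circlePt_pos (h0 : 0 < ρ) (h1 : ρ < 1) (θ : ℝ) : 0 < circlePt ρ θ :=
  div_pos (norm_pos_iff.2 (circleVal_ne_zero h0 h1 θ)) (by linarith)

theorem circlePt_mem (h0 : 0 < ρ) (h1 : ρ < 1) (θ : ℝ) :
    circlePt ρ θ ∈ Icc ((1 - ρ) / (1 + ρ)) 1 := by
  have h2 := norm_circleVal_sq ρ θ
  have h3 := Real.neg_one_le_cos θ
  have h4 := Real.cos_le_one θ
  have h5 := norm_nonneg (circleVal ρ θ)
  rw [circlePt]
  refine ⟨?_, ?_⟩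
  · gcongr
    refine le_of_sq_le_sq ?_ h5
    nlinarith
  · rw [div_le_one (by linarith)]
    refine le_of_sq_le_sq ?_ (by linarith)
    nlinarith

theorem exists_circlePt (h0 : 0 < ρ) (h1 : ρ < 1) {x : ℝ} (hx : x ∈ Icc ((1 - ρ) / (1 + ρ)) 1) :
    ∃ θ, circlePt ρ θ = x := by
  have h2 : 1 - ρ ≤ (1 + ρ) * x := by
    have := (div_le_iff₀ (by linarith : 0 < 1 + ρ)).1 hx.1
    linarith
  have h3 : (1 + ρ) * x ≤ 1 + ρ := by nlinarith [hx.2]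
  refine ⟨Real.arccos ((((1 + ρ) * x) ^ 2 - 1 - ρ ^ 2) / (2 * ρ)), ?_⟩
  rw [circlePt, div_eq_iff (by linarith)]
  refine (sq_eq_sq₀ (norm_nonneg _) ?_).1 ?_
  · nlinarith
  rw [norm_circleVal_sq, Real.cos_arccos]
  · field_simp; ring
  · rw [le_div_iff₀ (by positivity)]; nlinarith
  · rw [div_le_iff₀ (by positivity)]; nlinarith

theorem circlePt_strictAntiOn (h0 : 0 < ρ) : StrictAntiOn (circlePt ρ) (Icc 0 Real.pi) := by
  intro s hs t ht hst
  have h2 := Real.strictAntiOn_cos hs ht hst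
  rw [circlePt, circlePt]
  gcongr
  refine lt_of_pow_lt_pow_left₀ 2 (norm_nonneg _) ?_
  rw [norm_circleVal_sq, norm_circleVal_sq]
  nlinarith

/-- The leading term of `waveFun` on the unit circle. -/
theorem waveFun_zero_circle {k m : ℕ} (hk : 1 ≤ k) (hm : k ≤ m) (h0 : 0 < ρ) (h1 : ρ < 1) (θ : ℝ) :
    waveFun k m ρ 0 (exp (θ * I)) =
      (‖circleVal ρ θ‖ ^ (2 * k - 1) : ℝ) * exp (phase k m ρ θ * I) := by
  set w := circleVal ρ θ with hw
  set z := exp (θ * I) with hz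
  have hz0 : z ≠ 0 := exp_ne_zero _
  have hw0 : w ≠ 0 := circleVal_ne_zero h0 h1 θ
  have hr : (‖w‖ : ℂ) ≠ 0 := by exact_mod_cast norm_ne_zero_iff.2 hw0
  set e := exp (w.arg * I) with he
  have he0 : e ≠ 0 := exp_ne_zero _
  have hwe : w = ‖w‖ * e := (norm_mul_exp_arg_mul_I w).symm
  have hzz : z * exp (-(θ * I)) = 1 := by rw [hz, ← exp_add]; simp
  have hconj : z + ρ = z * (‖w‖ * e⁻¹) := by
    have h2 : (starRingEnd ℂ) w = ‖w‖ * e⁻¹ := by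
      conv_lhs => rw [hwe]
      rw [map_mul, conj_ofReal, he, ← exp_conj, ← exp_neg]
      simp
    rw [← h2, hw, circleVal, map_add, map_one, map_mul, conj_ofReal, ← exp_conj, map_mul, conj_ofReal,
      conj_I, mul_neg]
    linear_combination -(ρ : ℂ) * hzz
  have hph : exp (phase k m ρ θ * I) = z ^ (m + k) * e⁻¹ ^ (2 * k + 1) := by
    rw [phase, hz, he, ← exp_nat_mul, ← exp_neg, ← exp_nat_mul, ← exp_add]
    congr 1
    push_cast
    ring
  have hden : (1 : ℂ) + (ρ * Real.exp (-0) : ℝ) * z = ‖w‖ * e := by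
    rw [← hwe, hw, circleVal]; simp [hz]
  rw [waveFun, hden, hconj, hph, ofReal_pow, div_eq_iff (mul_ne_zero hr he0), mul_pow, mul_pow,
    show m + k = (m - k) + 2 * k by omega, pow_add, pow_succ e⁻¹]
  obtain ⟨j, hj⟩ : ∃ j, 2 * k = j + 1 := ⟨2 * k - 1, by omega⟩
  rw [show 2 * k - 1 = j by omega, hj, pow_succ (‖w‖ : ℂ)]
  field_simp

/-- The two denominators differ by ρ(1 - e^{-y})z, at most ρy in modulus, and the remaining
denominator is at least 1 - ρ. -/
theorem norm_waveFun_sub_le {k m : ℕ} (hk : 1 ≤ k) (hm : k ≤ m) (h0 : 0 < ρ) (h1 : ρ < 1) (θ : ℝ)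
    {y : ℝ} (hy : 0 ≤ y) :
    ‖waveFun k m ρ y (exp (θ * I)) - waveFun k m ρ 0 (exp (θ * I))‖ ≤
      ‖circleVal ρ θ‖ ^ (2 * k - 1) * (ρ / (1 - ρ) * y) := by
  set z := exp (θ * I) with hz
  have hzn : ‖z‖ = 1 := norm_exp_ofReal_mul_I θ
  have hq1 : Real.exp (-y) ≤ 1 := Real.exp_le_one_iff.2 (by linarith)
  have hq : 0 < Real.exp (-y) := Real.exp_pos _
  have hden : 1 - ρ ≤ ‖(1 : ℂ) + (ρ * Real.exp (-y) : ℝ) * z‖ := by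
    have h2 := norm_sub_le_norm_add (1 : ℂ) ((ρ * Real.exp (-y) : ℝ) * z)
    rw [norm_mul, hzn, norm_real, Real.norm_of_nonneg (by positivity), norm_one] at h2
    nlinarith
  have hden0 : (1 : ℂ) + (ρ * Real.exp (-y) : ℝ) * z ≠ 0 := fun h => by
    rw [h, norm_zero] at hden; linarith
  have hw0 : (1 : ℂ) + (ρ * Real.exp (-0) : ℝ) * z ≠ 0 := by
    have := circleVal_ne_zero h0 h1 θ
    rw [circleVal] at this
    simpa using this
  have e : waveFun k m ρ y z - waveFun k m ρ 0 z = waveFun k m ρ 0 z *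
      ((ρ * (1 - Real.exp (-y)) : ℝ) * z / (1 + (ρ * Real.exp (-y) : ℝ) * z)) := by
    have h2 : ((ρ * (1 - Real.exp (-y)) : ℝ) : ℂ) * z = (1 + (ρ * Real.exp (-0) : ℝ) * z) -
        (1 + (ρ * Real.exp (-y) : ℝ) * z) := by rw [neg_zero, Real.exp_zero]; push_cast; ring
    rw [h2, waveFun, waveFun]
    generalize z ^ (m - k) * (z + ρ) ^ (2 * k) = X
    generalize (1 : ℂ) + (ρ * Real.exp (-0) : ℝ) * z = w at *
    generalize (1 : ℂ) + (ρ * Real.exp (-y) : ℝ) * z = d at *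
    field_simp
  rw [e, norm_mul, waveFun_zero_circle hk hm h0 h1, norm_mul, norm_exp_ofReal_mul_I, mul_one, norm_real,
    Real.norm_of_nonneg (by positivity)]
  gcongr
  rw [norm_div, norm_mul, hzn, mul_one, norm_real, Real.norm_of_nonneg (by nlinarith), div_mul_eq_mul_div]
  have h3 : 1 - Real.exp (-y) ≤ y := by linarith [Real.add_one_le_exp (-y)]
  gcongr

/-- The total mass of the kernel. -/
def kernMass (k m : ℕ) (ρ : ℝ) : ℝ := ∫ y in Ioi (0 : ℝ), kern k m ρ y

/-- The first moment of the kernel. -/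
def kernMoment (k m : ℕ) (ρ : ℝ) : ℝ := ∫ y in Ioi (0 : ℝ), y * kern k m ρ y

theorem mul_kern_le {k m : ℕ} (hk : 1 ≤ k) (hm : k ≤ m) (h0 : 0 < ρ) (h1 : ρ < 1) {y : ℝ} (hy : 0 ≤ y) :
    y * kern k m ρ y ≤ ρ ^ (m + k) / (1 - ρ ^ 2) ^ (2 * k) *
      (√y ^ (2 * k + 1) * Real.exp (-((m + k : ℕ) / 2 * y))) := by
  refine (mul_le_mul_of_nonneg_left (kern_le hm h0 h1 hy) hy).trans_eq ?_
  rw [show 2 * k + 1 = 2 * k - 1 + 2 by omega, pow_add (√y), Real.sq_sqrt hy,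
    show -((m + k : ℕ) * y) / 2 = -(((m + k : ℕ) : ℝ) / 2 * y) by ring]
  ring

theorem integrableOn_mul_kern {k m : ℕ} (hk : 1 ≤ k) (hm : k ≤ m) (h0 : 0 < ρ) (h1 : ρ < 1) :
    IntegrableOn (fun y => y * kern k m ρ y) (Ioi 0) := by
  have hb : 0 < ((m + k : ℕ) : ℝ) / 2 := by
    have : 0 < m + k := by omega
    positivity
  refine Integrable.mono' ((integrableOn_sqrt_pow_mul_exp (2 * k + 1) hb).const_mul
    (ρ ^ (m + k) / (1 - ρ ^ 2) ^ (2 * k)))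
    ((continuousOn_id.mul ((continuousOn_kern k m h0 h1).mono
      Ioi_subset_Ici_self)).aestronglyMeasurable measurableSet_Ioi) ?_
  refine (ae_restrict_iff' measurableSet_Ioi).2 (Eventually.of_forall fun y hy => ?_)
  have hy' : (0 : ℝ) ≤ y := le_of_lt hy
  rw [Real.norm_of_nonneg (mul_nonneg hy' (kern_nonneg k m h0 h1 hy'))]
  exact mul_kern_le hk hm h0 h1 hy'

/-- The amplitude of the error. -/
def amp (k m : ℕ) (ρ : ℝ) : ℝ := 2 / Real.pi * (1 + ρ) ^ (2 * k - 1) * kernMass k m ρ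

/-- The bound for the relative deviation from the pure oscillation. -/
def ampErr (k m : ℕ) (ρ : ℝ) : ℝ :=
  2 / Real.pi * (1 + ρ) ^ (2 * k - 1) * (ρ / (1 - ρ) * kernMoment k m ρ)

/-- Freezing `waveFun` at y = 0 costs only the first moment of the kernel. The factor ((1 +
ρ)x)^{2k-1} of the frozen wave cancels the denominator x^{2k-1}, so the main term is a pure cosine
of the phase. -/
theorem abs_error_sub_le {k m : ℕ} (hk : 1 ≤ k) (hm : k + 1 ≤ m) (h0 : 0 < ρ) (h1 : ρ < 1) {P : ℝ[X]}
    (hP : ∀ x : ℝ, 0 < x → ∀ z : ℂ, z ≠ 0 → (1 + ρ * z) * (1 + ρ * z⁻¹) = (1 + ρ) ^ 2 * x ^ 2 →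
        ((x ^ (2 * k - 1) - P.eval (x ^ 2) : ℝ) : ℂ) = (-1) ^ m / Real.pi *
          ∫ y in Ioi (0 : ℝ), (kern k m ρ y : ℂ) * (waveFun k m ρ y z + waveFun k m ρ y z⁻¹))
    (θ : ℝ) :
    |1 - oddFun k P (circlePt ρ θ) - (-1) ^ m * (amp k m ρ * Real.cos (phase k m ρ θ))| ≤
      ampErr k m ρ := by
  set x := circlePt ρ θ with hx
  have hx0 : 0 < x := circlePt_pos h0 h1 θ
  set z := exp (θ * I) with hz
  set w := circleVal ρ θ with hw
  have hz0 : z ≠ 0 := exp_ne_zero _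
  have hzinv : z⁻¹ = (starRingEnd ℂ) z := by
    rw [hz, ← exp_neg, ← exp_conj]; simp
  have hwn : ‖w‖ = (1 + ρ) * x := by rw [hx, circlePt, ← hw]; field_simp
  have hzx : (1 + ρ * z) * (1 + ρ * z⁻¹) = (1 + ρ) ^ 2 * (x : ℂ) ^ 2 := by
    have h2 : (1 : ℂ) + ρ * z⁻¹ = (starRingEnd ℂ) w := by rw [hw, circleVal, hzinv]; simp [hz]
    rw [h2, show (1 : ℂ) + ρ * z = w from rfl, mul_conj, normSq_eq_norm_sq, hwn]
    push_cast; ring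
  have h2 := hP x hx0 z hz0 hzx
  have hcj : ∀ y, waveFun k m ρ y z⁻¹ = (starRingEnd ℂ) (waveFun k m ρ y z) := by
    intro y
    rw [hzinv, waveFun, waveFun]
    simp only [map_div₀, map_mul, map_pow, map_add, map_one, conj_ofReal]
  have hsum : ∀ y, waveFun k m ρ y z + waveFun k m ρ y z⁻¹ = ((2 * (waveFun k m ρ y z).re : ℝ) : ℂ) := by
    intro y; rw [hcj, add_conj]
  simp only [hsum, ← ofReal_mul] at h2
  rw [integral_complex_ofReal] at h2
  have h3 : x ^ (2 * k - 1) - P.eval (x ^ 2) = (-1) ^ m / Real.pi *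
      ∫ y in Ioi (0 : ℝ), kern k m ρ y * (2 * (waveFun k m ρ y z).re) := by exact_mod_cast h2
  have hre0 : (waveFun k m ρ 0 z).re = ‖w‖ ^ (2 * k - 1) * Real.cos (phase k m ρ θ) := by
    rw [hz, waveFun_zero_circle hk (by omega) h0 h1, re_ofReal_mul, exp_ofReal_mul_I_re]
  have hdiff : ∀ y, 0 ≤ y → |kern k m ρ y * (2 * (waveFun k m ρ y z).re)
      - kern k m ρ y * (2 * (waveFun k m ρ 0 z).re)| ≤
        2 * ‖w‖ ^ (2 * k - 1) * (ρ / (1 - ρ)) * (y * kern k m ρ y) := by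
    intro y hy
    have hkn := kern_nonneg k m h0 h1 hy
    have h4 := (abs_re_le_norm _).trans (norm_waveFun_sub_le hk (by omega : k ≤ m) h0 h1 θ hy)
    rw [← mul_sub, ← mul_sub, ← sub_re, abs_mul, abs_mul, abs_of_nonneg hkn, abs_two]
    calc _ ≤ kern k m ρ y * (2 * (‖w‖ ^ (2 * k - 1) * (ρ / (1 - ρ) * y))) := by gcongr
      _ = _ := by ring
  have hcw : ContinuousOn (fun y => waveFun k m ρ y z) (Ioi 0) := by
    refine continuousOn_waveFun fun y hy h => ?_
    have hy' : (0 : ℝ) < y := hy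
    have h5 : (1 : ℂ) = -((ρ * Real.exp (-y) : ℝ) * z) := by linear_combination h
    have h6 := congrArg norm h5
    rw [norm_neg, norm_mul, norm_one, norm_real, Real.norm_of_nonneg (by positivity),
      norm_exp_ofReal_mul_I, mul_one] at h6
    have h7 : Real.exp (-y) ≤ 1 := Real.exp_le_one_iff.2 (by linarith)
    nlinarith
  have hI0 : IntegrableOn (fun y => kern k m ρ y * (2 * (waveFun k m ρ 0 z).re)) (Ioi 0) :=
    (integrableOn_kern hk (by omega) h0 h1).mul_const _
  have hmaj := (integrableOn_mul_kern hk (by omega : k ≤ m) h0 h1).const_mul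
    (2 * ‖w‖ ^ (2 * k - 1) * (ρ / (1 - ρ)))
  have hId : IntegrableOn (fun y => kern k m ρ y * (2 * (waveFun k m ρ y z).re)
      - kern k m ρ y * (2 * (waveFun k m ρ 0 z).re)) (Ioi 0) := by
    have hck := (continuousOn_kern k m h0 h1).mono Ioi_subset_Ici_self
    refine Integrable.mono' hmaj (ContinuousOn.aestronglyMeasurable ?_ measurableSet_Ioi) ?_
    · exact (hck.mul ((continuous_re.comp_continuousOn hcw).const_mul 2 )).sub (hck.mul continuousOn_const)
    · exact (ae_restrict_iff' measurableSet_Ioi).2 (Eventually.of_forall fun y hy => hdiff y (le_of_lt hy))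
  have h4 : ‖∫ y in Ioi (0 : ℝ), (kern k m ρ y * (2 * (waveFun k m ρ y z).re)
      - kern k m ρ y * (2 * (waveFun k m ρ 0 z).re))‖ ≤
      2 * ‖w‖ ^ (2 * k - 1) * (ρ / (1 - ρ)) * kernMoment k m ρ := by
    rw [kernMoment, ← integral_const_mul]
    refine norm_integral_le_of_norm_le hmaj ?_
    exact (ae_restrict_iff' measurableSet_Ioi).2 (Eventually.of_forall fun y hy => hdiff y (le_of_lt hy))
  have hI : IntegrableOn (fun y => kern k m ρ y * (2 * (waveFun k m ρ y z).re)) (Ioi 0) := by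
    refine (hId.add hI0).congr_fun (fun y _ => ?_) measurableSet_Ioi
    simp
  rw [integral_sub hI hI0, integral_mul_const, ← kernMass, hre0, Real.norm_eq_abs] at h4
  have hxk : 0 < x ^ (2 * k - 1) := by positivity
  have e1 : 1 - oddFun k P x = (x ^ (2 * k - 1) - P.eval (x ^ 2)) / x ^ (2 * k - 1) := by
    rw [oddFun]; field_simp
  have e2 : 1 - oddFun k P x - (-1) ^ m * (amp k m ρ * Real.cos (phase k m ρ θ)) =
      (-1) ^ m * (1 / (Real.pi * x ^ (2 * k - 1)) *
      ((∫ y in Ioi (0 : ℝ), kern k m ρ y * (2 * (waveFun k m ρ y z).re)) -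
        kernMass k m ρ * (2 * (‖w‖ ^ (2 * k - 1) * Real.cos (phase k m ρ θ))))) := by
    rw [e1, h3, amp, hwn, mul_pow]
    generalize (∫ y in Ioi (0 : ℝ), kern k m ρ y * (2 * (waveFun k m ρ y z).re)) = J
    field_simp
  rw [e2, abs_mul, abs_pow, abs_neg, abs_one, one_pow, one_mul, abs_mul,
    abs_of_pos (by positivity : 0 < 1 / (Real.pi * x ^ (2 * k - 1)))]
  refine (mul_le_mul_of_nonneg_left h4 (by positivity)).trans_eq ?_
  rw [ampErr, hwn, mul_pow]
  field_simp

theorem kernMass_nonneg (k m : ℕ) (h0 : 0 < ρ) (h1 : ρ < 1) : 0 ≤ kernMass k m ρ :=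
  setIntegral_nonneg measurableSet_Ioi fun _ hy => kern_nonneg k m h0 h1 (le_of_lt hy)

theorem amp_nonneg (k m : ℕ) (h0 : 0 < ρ) (h1 : ρ < 1) : 0 ≤ amp k m ρ := by
  have := kernMass_nonneg k m h0 h1
  unfold amp
  positivity

/-- Two-sided estimate of the least error by the amplitude. -/
theorem IsAlternant.abs_sub_amp_le {k m : ℕ} (hk : 1 ≤ k) (hm : k + 1 ≤ m) (h0 : 0 < ρ) (h1 : ρ < 1)
    {L σ c : ℝ} {Q : ℝ[X]} {x : ℕ → ℝ}
    (h : IsAlternant k (m + k - 1) ((1 - ρ) / (1 + ρ)) L σ c Q x) {P : ℝ[X]}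
    (hdeg : P.natDegree ≤ m + k - 1)
    (hP : ∀ θ : ℝ, |1 - oddFun k P (circlePt ρ θ) -
      (-1) ^ m * (amp k m ρ * Real.cos (phase k m ρ θ))| ≤ ampErr k m ρ) :
    |L - amp k m ρ| ≤ ampErr k m ρ ∧
      ∀ y ∈ Icc ((1 - ρ) / (1 + ρ)) 1, |1 - oddFun k P y| ≤ amp k m ρ + ampErr k m ρ := by
  have ha0 : 0 < (1 - ρ) / (1 + ρ) := div_pos (by linarith) (by linarith)
  have hA := amp_nonneg k m h0 h1
  have hbd : ∀ y ∈ Icc ((1 - ρ) / (1 + ρ)) 1, |1 - oddFun k P y| ≤ amp k m ρ + ampErr k m ρ := by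
    intro y hy
    obtain ⟨θ, rfl⟩ := exists_circlePt h0 h1 hy
    have h2 := hP θ
    have h3 : |(-1) ^ m * (amp k m ρ * Real.cos (phase k m ρ θ))| ≤ amp k m ρ := by
      rw [abs_mul, abs_pow, abs_neg, abs_one, one_pow, one_mul, abs_mul, abs_of_nonneg hA]
      exact mul_le_of_le_one_right hA (Real.abs_cos_le_one _)
    calc _ = |(-1) ^ m * (amp k m ρ * Real.cos (phase k m ρ θ)) + (1 - oddFun k P (circlePt ρ θ) -
      (-1) ^ m * (amp k m ρ * Real.cos (phase k m ρ θ)))| := by congr 1; ring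
      _ ≤ _ := (abs_add_le _ _).trans (add_le_add h3 h2)
  refine ⟨?_, hbd⟩
  have hup := h.le_of_bound ha0 hdeg hbd
  -- The phase runs from 0 to (m + k)π and so meets m + k + 1 multiples of π, exactly the number of
  -- points needed for alternation.
  obtain ⟨θ, hθ, hmono⟩ := exists_strictMono_preimages (N := m + k) Real.pi_pos.le Real.pi_pos
    (continuous_phase k m h0 h1).continuousOn (phase_zero k m h0) (phase_pi k m h1)
  have hlow : amp k m ρ - ampErr k m ρ ≤ L := by
    -- x decreases as the angle grows, hence the reversed index.
    refine h.le_of_alternation ha0 hdeg (y := fun i => circlePt ρ (θ (m + k - i)))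
      (fun i j hij hj => ?_) (fun i _ => circlePt_mem h0 h1 _) (τ := (-1) ^ k) (neg_one_pow_eq_or ℝ k)
      fun i hi => ?_
    · exact circlePt_strictAntiOn h0 (hθ _ (by omega)).1 (hθ _ (by omega)).1
        (hmono _ _ (by omega) (by omega))
    · have h2 := (hθ (m + k - i) (by omega)).2
      have h3 := hP (θ (m + k - i))
      rw [h2, Real.cos_nat_mul_pi] at h3
      have h4 : ∀ j : ℕ, ((-1 : ℝ) ^ j) * (-1) ^ j = 1 := fun j => by
        rw [← pow_add, Even.neg_one_pow ⟨j, rfl⟩]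
      have h5 : ((-1 : ℝ) ^ k * (-1) ^ i) * ((-1) ^ m * (-1) ^ (m + k - i)) = 1 := by
        rw [← pow_add, ← pow_add, ← pow_add]
        exact Even.neg_one_pow ⟨m + k, by omega⟩
      have h6 : |(-1 : ℝ) ^ k * (-1) ^ i| = 1 := by rw [← pow_add, abs_pow, abs_neg, abs_one, one_pow]
      set E := 1 - oddFun k P (circlePt ρ (θ (m + k - i))) with hE
      have h7 : (-1 : ℝ) ^ k * (-1) ^ i * E = amp k m ρ + (-1 : ℝ) ^ k * (-1) ^ i *
          (E - (-1) ^ m * (amp k m ρ * (-1) ^ (m + k - i))) := by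
        linear_combination (amp k m ρ) * h5
      have h8 : |(-1 : ℝ) ^ k * (-1) ^ i * (E - (-1) ^ m * (amp k m ρ * (-1) ^ (m + k - i)))| ≤
          ampErr k m ρ := by rw [abs_mul, h6, one_mul]; exact h3
      show _ ≤ (-1 : ℝ) ^ k * (-1) ^ i * E
      rw [h7]
      linarith [(abs_le.1 h8).1]
  rw [abs_le]
  constructor <;> linarith

end

end SgnLaurent

end

noncomputable section
namespace SgnLaurent

open Polynomial Set Complex Filter Topology MeasureTheory

/-! ### Rescaling of the kernel -/

section
variable {ρ : ℝ}

/-- The kernel in the variable `s = N y`, normalized. -/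
def scaledKern (k : ℕ) (ρ N s : ℝ) : ℝ :=
  √(N * tauFun ρ (s / N)) ^ (2 * k - 1) * Real.exp (-s) /
    (1 - ρ ^ 2 * Real.exp (-(s / N))) ^ (2 * k)

/-- Substitution s = (m + k)y: the factor e^{-(m+k)y} concentrates the kernel at y of order 1 / (m +
k). -/
theorem integral_kern_mul {k m : ℕ} (hk : 1 ≤ k) (h : ℝ → ℝ) :
    ∫ y in Ioi (0 : ℝ), kern k m ρ y * h y = ρ ^ (m + k) / √(m + k : ℕ) ^ (2 * k + 1) *
      ∫ s in Ioi (0 : ℝ), scaledKern k ρ (m + k : ℕ) s * h (s / (m + k : ℕ)) := by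
  have hN : (0 : ℝ) < (m + k : ℕ) := by
    have : 0 < m + k := by omega
    exact_mod_cast this
  have h1 := integral_comp_mul_left_Ioi (fun y => kern k m ρ y * h y) 0 (inv_pos.2 hN)
  rw [mul_zero, inv_inv, smul_eq_mul] at h1
  have h2 : ∀ s : ℝ, kern k m ρ (((m + k : ℕ) : ℝ)⁻¹ * s) * h (((m + k : ℕ) : ℝ)⁻¹ * s) =
      ρ ^ (m + k) / √(m + k : ℕ) ^ (2 * k - 1) *
        (scaledKern k ρ (m + k : ℕ) s * h (s / (m + k : ℕ))) := by
    intro s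
    have e1 : ((m + k : ℕ) : ℝ)⁻¹ * s = s / (m + k : ℕ) := by ring
    have e2 : Real.exp (-(s / (m + k : ℕ))) ^ (m + k) = Real.exp (-s) := by
      rw [← Real.exp_nat_mul]; congr 1; field_simp
    rw [e1, kern, scaledKern, Real.sqrt_mul hN.le, mul_pow, mul_pow, e2]
    have : √(m + k : ℕ) ≠ 0 := (Real.sqrt_pos.2 hN).ne'
    field_simp
  simp only [h2] at h1
  rw [integral_const_mul] at h1
  have h3 : √(m + k : ℕ) ^ (2 * k + 1) = √(m + k : ℕ) ^ (2 * k - 1) * (m + k : ℕ) := by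
    rw [show 2 * k + 1 = 2 * k - 1 + 2 by omega, pow_add, Real.sq_sqrt hN.le]
  rw [h3, ← div_div, div_mul_eq_mul_div, h1]
  field_simp

theorem scaledKern_nonneg (k : ℕ) (h0 : 0 < ρ) (h1 : ρ < 1) {N s : ℝ} (hN : 0 < N) (hs : 0 ≤ s) :
    0 ≤ scaledKern k ρ N s := by
  have := one_sub_pos h0 h1 (div_nonneg hs hN.le)
  unfold scaledKern
  positivity

theorem continuousOn_scaledKern (k : ℕ) (h0 : 0 < ρ) (h1 : ρ < 1) {N : ℝ} (hN : 0 < N) :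
    ContinuousOn (scaledKern k ρ N) (Ici 0) := by
  have := continuous_tauFun ρ
  unfold scaledKern
  refine ContinuousOn.div (by fun_prop) (by fun_prop) fun s hs => ?_
  exact pow_ne_zero _ (one_sub_pos h0 h1 (div_nonneg hs hN.le)).ne'

theorem exp_sub_one_le {y : ℝ} : Real.exp y - 1 ≤ y * Real.exp y := by
  have h6 := Real.add_one_le_exp (-y)
  have h7 : Real.exp (-y) * Real.exp y = 1 := by rw [← Real.exp_add]; simp
  nlinarith [Real.exp_pos y]

/-- A majorant independent of N: the growth e^{(2k-1)s/(2N)} of the square root is absorbed by half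
of e^{-s} once N ≥ 2k. -/
theorem scaledKern_le {k : ℕ} (h0 : 0 < ρ) (h1 : ρ < 1) {N s : ℝ} (hN : 0 < N)
    (hkN : 2 * k ≤ N) (hs : 0 ≤ s) :
    scaledKern k ρ N s ≤ 1 / (1 - ρ ^ 2) ^ (2 * k) * (√s ^ (2 * k - 1) * Real.exp (-(1 / 2 * s))) := by
  have hy : 0 ≤ s / N := div_nonneg hs hN.le
  have h2 : 0 < 1 - ρ ^ 2 := by nlinarith
  have h3 : 1 - ρ ^ 2 ≤ 1 - ρ ^ 2 * Real.exp (-(s / N)) := by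
    have : Real.exp (-(s / N)) ≤ 1 := Real.exp_le_one_iff.2 (by linarith)
    nlinarith [sq_nonneg ρ]
  have h4 : √(N * tauFun ρ (s / N)) ≤ √s * Real.exp (s / N / 2) := by
    rw [Real.sqrt_le_left (by positivity), mul_pow, Real.sq_sqrt hs, ← Real.exp_nat_mul]
    have e : ((2 : ℕ) : ℝ) * (s / N / 2) = s / N := by push_cast; ring
    rw [e]
    calc N * tauFun ρ (s / N) ≤ N * (s / N * Real.exp (s / N)) := by
          gcongr; exact (tauFun_le h0 h1 hy).trans exp_sub_one_le
      _ = _ := by field_simp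
  have h5 : √(N * tauFun ρ (s / N)) ^ (2 * k - 1) ≤ √s ^ (2 * k - 1) * Real.exp (1 / 2 * s) := by
    refine (pow_le_pow_left₀ (Real.sqrt_nonneg _) h4 _).trans ?_
    rw [mul_pow, ← Real.exp_nat_mul]
    refine mul_le_mul_of_nonneg_left (Real.exp_le_exp.2 ?_) (by positivity)
    have h6 : ((2 * k - 1 : ℕ) : ℝ) ≤ N := by
      refine le_trans ?_ hkN
      exact_mod_cast (by omega : 2 * k - 1 ≤ 2 * k)
    calc ((2 * k - 1 : ℕ) : ℝ) * (s / N / 2) ≤ N * (s / N / 2) := by gcongr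
      _ = _ := by field_simp
  unfold scaledKern
  calc _ ≤ (√s ^ (2 * k - 1) * Real.exp (1 / 2 * s)) * Real.exp (-s) / (1 - ρ ^ 2) ^ (2 * k) := by
        gcongr
    _ = _ := by
      rw [mul_assoc, ← Real.exp_add, show 1 / 2 * s + -s = -(1 / 2 * s) by ring]; ring

theorem tendsto_mul_tauFun {ι : Type*} {l : Filter ι} {N : ι → ℝ} (hN : Tendsto N l atTop) {s : ℝ}
    (hs : 0 < s) :
    Tendsto (fun i => N i * tauFun ρ (s / N i)) l (𝓝 (tauDeriv ρ 0 * s)) := by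
  have h1 := (hasDerivAt_tauFun ρ 0).tendsto_slope_zero
  have h2 : Tendsto (fun i => s / N i) l (𝓝[≠] 0) := by
    refine tendsto_nhdsWithin_iff.2 ⟨hN.const_div_atTop s, ?_⟩
    filter_upwards [hN.eventually_gt_atTop 0] with i hi
    exact (div_pos hs hi).ne'
  have h3 := (h1.comp h2).mul_const s
  refine h3.congr' ?_
  filter_upwards [hN.eventually_gt_atTop 0] with i hi
  simp only [Function.comp, zero_add, smul_eq_mul]
  have : tauFun ρ 0 = 0 := by simp [tauFun]
  rw [this]
  field_simp
  simp

theorem tendsto_scaledKern (k : ℕ) (h0 : 0 < ρ) (h1 : ρ < 1) {ι : Type*} {l : Filter ι} {N : ι → ℝ}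
    (hN : Tendsto N l atTop) {s : ℝ} (hs : 0 < s) :
    Tendsto (fun i => scaledKern k ρ (N i) s) l
      (𝓝 (√(tauDeriv ρ 0 * s) ^ (2 * k - 1) * Real.exp (-s) / (1 - ρ ^ 2) ^ (2 * k))) := by
  have h2 : Tendsto (fun i => s / N i) l (𝓝 0) := hN.const_div_atTop s
  have h3 : Tendsto (fun i => 1 - ρ ^ 2 * Real.exp (-(s / N i))) l (𝓝 (1 - ρ ^ 2)) := by
    have := ((Real.continuous_exp.tendsto _).comp h2.neg).const_mul (ρ ^ 2) |>.const_sub 1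
    simpa using this
  refine Tendsto.div ?_ (h3.pow _) (pow_ne_zero _ (by nlinarith))
  exact ((((Real.continuous_sqrt.tendsto _).comp (tendsto_mul_tauFun hN hs)).pow _).mul_const _)

/-- Dominated convergence for Laplace's method. Linear growth of H suffices for the mass, the first
moment and the integral in the gap. -/
theorem tendsto_integral_scaledKern {k : ℕ} (hk : 1 ≤ k) (h0 : 0 < ρ) (h1 : ρ < 1) {ι : Type*}
    {l : Filter ι} [l.IsCountablyGenerated] {N : ι → ℝ} (hN : Tendsto N l atTop) {H : ι → ℝ → ℝ}
    {H₀ : ℝ → ℝ} {C : ℝ} (hcont : ∀ᶠ i in l, ContinuousOn (H i) (Ioi 0))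
    (hbd : ∀ᶠ i in l, ∀ s, 0 < s → |H i s| ≤ C * (1 + s))
    (hlim : ∀ s, 0 < s → Tendsto (fun i => H i s) l (𝓝 (H₀ s))) :
    Tendsto (fun i => ∫ s in Ioi (0 : ℝ), scaledKern k ρ (N i) s * H i s) l
      (𝓝 (√(tauDeriv ρ 0) ^ (2 * k - 1) / (1 - ρ ^ 2) ^ (2 * k) *
        ∫ s in Ioi (0 : ℝ), √s ^ (2 * k - 1) * Real.exp (-s) * H₀ s)) := by
  have hτ : 0 ≤ tauDeriv ρ 0 := (tauDeriv_pos h0 h1 le_rfl).le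
  have e : √(tauDeriv ρ 0) ^ (2 * k - 1) / (1 - ρ ^ 2) ^ (2 * k) *
        ∫ s in Ioi (0 : ℝ), √s ^ (2 * k - 1) * Real.exp (-s) * H₀ s =
      ∫ s in Ioi (0 : ℝ), √(tauDeriv ρ 0 * s) ^ (2 * k - 1) * Real.exp (-s) / (1 - ρ ^ 2) ^ (2 * k) *
        H₀ s := by
    rw [← integral_const_mul]
    congr 1
    funext s
    rw [Real.sqrt_mul hτ, mul_pow]
    ring
  rw [e]
  have hInt := ((integrableOn_sqrt_pow_mul_exp (2 * k - 1) one_half_pos).add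
    (integrableOn_sqrt_pow_mul_exp (2 * k + 1) one_half_pos)).const_mul (C / (1 - ρ ^ 2) ^ (2 * k))
  refine tendsto_integral_filter_of_dominated_convergence _ ?_ ?_ hInt ?_
  · filter_upwards [hcont, hN.eventually_gt_atTop 0] with i hi hNi
    exact (((continuousOn_scaledKern k h0 h1 hNi).mono Ioi_subset_Ici_self).mul
      hi).aestronglyMeasurable measurableSet_Ioi
  · filter_upwards [hbd, hN.eventually_gt_atTop 0, hN.eventually_ge_atTop (2 * k)] with i hi hNi hNk
    refine (ae_restrict_iff' measurableSet_Ioi).2 (Eventually.of_forall fun s hs => ?_)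
    have hs' : (0 : ℝ) < s := hs
    have h2 := scaledKern_nonneg k h0 h1 hNi hs'.le
    have h3 := scaledKern_le h0 h1 hNi hNk hs'.le
    rw [norm_mul, Real.norm_of_nonneg h2, Real.norm_eq_abs]
    refine (mul_le_mul h3 (hi s hs') (abs_nonneg _) (h2.trans h3)).trans_eq ?_
    simp only [Pi.add_apply]
    rw [show 2 * k + 1 = 2 * k - 1 + 2 by omega, pow_add (√s), Real.sq_sqrt hs'.le]
    ring
  · refine (ae_restrict_iff' measurableSet_Ioi).2 (Eventually.of_forall fun s hs => ?_)
    exact (tendsto_scaledKern k h0 h1 hN hs).mul (hlim s hs)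

theorem integral_sqrt_pow_mul_exp {k : ℕ} (hk : 1 ≤ k) :
    ∫ s in Ioi (0 : ℝ), √s ^ (2 * k - 1) * Real.exp (-s) = Real.Gamma (k + 1 / 2) := by
  have hk' : (1 : ℝ) ≤ k := by exact_mod_cast hk
  rw [Real.Gamma_eq_integral (by linarith)]
  refine setIntegral_congr_fun measurableSet_Ioi fun s hs => ?_
  have hs' : (0 : ℝ) < s := hs
  rw [Real.sqrt_eq_rpow, ← Real.rpow_natCast, ← Real.rpow_mul hs'.le, mul_comm]
  congr 2
  rw [Nat.cast_sub (by omega)]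
  push_cast
  ring

theorem tendsto_natCast_add (k : ℕ) : Tendsto (fun m : ℕ => ((m + k : ℕ) : ℝ)) atTop atTop :=
  tendsto_natCast_atTop_atTop.comp (tendsto_add_atTop_nat k)

theorem tendsto_kernMass {k : ℕ} (hk : 1 ≤ k) (h0 : 0 < ρ) (h1 : ρ < 1) :
    Tendsto (fun m : ℕ => √(m + k : ℕ) ^ (2 * k + 1) / ρ ^ (m + k) * kernMass k m ρ) atTop
      (𝓝 (√(tauDeriv ρ 0) ^ (2 * k - 1) / (1 - ρ ^ 2) ^ (2 * k) * Real.Gamma (k + 1 / 2))) := by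
  have h2 := tendsto_integral_scaledKern (C := 1) hk h0 h1 (tendsto_natCast_add k)
    (H := fun _ _ => 1) (H₀ := fun _ => 1) (Eventually.of_forall fun _ => continuousOn_const)
    (Eventually.of_forall fun _ s hs => by simp; linarith) (fun s _ => tendsto_const_nhds)
  simp only [mul_one] at h2
  rw [integral_sqrt_pow_mul_exp hk] at h2
  refine h2.congr fun m => ?_
  have h3 := integral_kern_mul (ρ := ρ) (m := m) hk fun _ => 1
  simp only [mul_one] at h3
  rw [kernMass, h3]
  have hN : (0 : ℝ) < (m + k : ℕ) := by
    have : 0 < m + k := by omega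
    exact_mod_cast this
  have : √(m + k : ℕ) ≠ 0 := (Real.sqrt_pos.2 hN).ne'
  field_simp

/-- One more factor y = s / (m + k) makes the first moment smaller than the mass by one order. -/
theorem tendsto_kernMoment {k : ℕ} (hk : 1 ≤ k) (h0 : 0 < ρ) (h1 : ρ < 1) :
    Tendsto (fun m : ℕ => √(m + k : ℕ) ^ (2 * k + 1) / ρ ^ (m + k) * kernMoment k m ρ) atTop
      (𝓝 0) := by
  have h2 := tendsto_integral_scaledKern (C := 1) hk h0 h1 (tendsto_natCast_add k)
    (H := fun m s => s / (m + k : ℕ)) (H₀ := fun _ => 0)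
    (Eventually.of_forall fun _ => by fun_prop)
    (Eventually.of_forall fun m s hs => by
      have hN : (1 : ℝ) ≤ (m + k : ℕ) := by
        have : 1 ≤ m + k := by omega
        exact_mod_cast this
      rw [abs_of_nonneg (by positivity)]
      have := div_le_self hs.le hN
      linarith)
    (fun s _ => (tendsto_natCast_add k).const_div_atTop s)
  simp only [mul_zero, integral_zero] at h2
  refine h2.congr fun m => ?_
  have h3 := integral_kern_mul (ρ := ρ) (m := m) hk fun y => y
  simp only [kernMoment, mul_comm _ (kern k m ρ _)]
  rw [h3]
  have hN : (0 : ℝ) < (m + k : ℕ) := by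
    have : 0 < m + k := by omega
    exact_mod_cast this
  have : √(m + k : ℕ) ≠ 0 := (Real.sqrt_pos.2 hN).ne'
  generalize (∫ s in Ioi (0 : ℝ), scaledKern k ρ (m + k : ℕ) s * (s / (m + k : ℕ))) = J
  field_simp

/-- The limit of the normalized amplitude. -/
def ampLim (k : ℕ) (ρ : ℝ) : ℝ := 2 / Real.pi * (1 + ρ) ^ (2 * k - 1) *
  (√(tauDeriv ρ 0) ^ (2 * k - 1) / (1 - ρ ^ 2) ^ (2 * k) * Real.Gamma (k + 1 / 2))

theorem tendsto_amp {k : ℕ} (hk : 1 ≤ k) (h0 : 0 < ρ) (h1 : ρ < 1) :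
    Tendsto (fun m : ℕ => √(m + k : ℕ) ^ (2 * k + 1) / ρ ^ (m + k) * amp k m ρ) atTop
      (𝓝 (ampLim k ρ)) := by
  refine ((tendsto_kernMass hk h0 h1).const_mul (2 / Real.pi * (1 + ρ) ^ (2 * k - 1))).congr fun m => ?_
  rw [amp]; ring

theorem tendsto_ampErr {k : ℕ} (hk : 1 ≤ k) (h0 : 0 < ρ) (h1 : ρ < 1) :
    Tendsto (fun m : ℕ => √(m + k : ℕ) ^ (2 * k + 1) / ρ ^ (m + k) * ampErr k m ρ) atTop (𝓝 0) := by
  have h2 := (tendsto_kernMoment hk h0 h1).const_mul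
    (2 / Real.pi * (1 + ρ) ^ (2 * k - 1) * (ρ / (1 - ρ)))
  rw [mul_zero] at h2
  refine h2.congr fun m => ?_
  rw [ampErr]; ring

/-- The leading asymptotics of the least error. -/
theorem tendsto_bestError_scaled {k : ℕ} (hk : 1 ≤ k) (h0 : 0 < ρ) (h1 : ρ < 1) :
    Tendsto (fun m : ℕ => √(m + k : ℕ) ^ (2 * k + 1) / ρ ^ (m + k) *
      bestError k m ((1 - ρ) / (1 + ρ))) atTop (𝓝 (ampLim k ρ)) := by
  have ha0 : 0 < (1 - ρ) / (1 + ρ) := div_pos (by linarith) (by linarith)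
  have ha1 : (1 - ρ) / (1 + ρ) < 1 := by rw [div_lt_one (by linarith)]; linarith
  have hkey : ∀ᶠ m : ℕ in atTop, |bestError k m ((1 - ρ) / (1 + ρ)) - amp k m ρ| ≤ ampErr k m ρ := by
    filter_upwards [eventually_ge_atTop (k + 1)] with m hm
    obtain ⟨P, hdeg, hP⟩ := exists_near_optimal hk hm h0 h1
    obtain ⟨L, σ, c, Q, x, h⟩ := exists_isAlternant hk (by omega : k ≤ m + k - 1) ha0 ha1
    rw [h.bestError_eq hk (by omega) ha0]
    exact (h.abs_sub_amp_le hk hm h0 h1 hdeg (abs_error_sub_le hk hm h0 h1 hP)).1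
  have hz : Tendsto (fun m : ℕ => √(m + k : ℕ) ^ (2 * k + 1) / ρ ^ (m + k) *
      (bestError k m ((1 - ρ) / (1 + ρ)) - amp k m ρ)) atTop (𝓝 0) := by
    refine squeeze_zero_norm' ?_ (tendsto_ampErr hk h0 h1)
    filter_upwards [hkey] with m hm
    rw [norm_mul, Real.norm_of_nonneg (by positivity), Real.norm_eq_abs]
    gcongr
  have := hz.add (tendsto_amp hk h0 h1)
  rw [zero_add] at this
  refine this.congr fun m => ?_
  ring

end

end SgnLaurent

end

noncomputable section
namespace SgnLaurent

open Polynomial Set Complex Filter Topology MeasureTheory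

/-! ### Asymptotics of the error and of the parameter -/

theorem rpow_add_half {r : ℝ} (hr : 0 ≤ r) (k : ℕ) : r ^ ((k : ℝ) + 1 / 2) = √r ^ (2 * k + 1) := by
  rw [Real.sqrt_eq_rpow, ← Real.rpow_natCast, ← Real.rpow_mul hr]
  congr 1
  push_cast
  ring

theorem ampLim_eq {k : ℕ} (hk : 1 ≤ k) {ρ : ℝ} (h0 : 0 < ρ) (h1 : ρ < 1) :
    √(2 * ρ) ^ (2 * k + 1) * ampLim k ρ =
      2 * Real.Gamma (k + 1 / 2) / Real.pi * √(2 * ρ / (1 - ρ ^ 2)) ^ (2 * k + 1) := by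
  have hp : 0 < 1 + ρ := by linarith
  have hq : 0 < 1 - ρ := by linarith
  have e1 : tauDeriv ρ 0 = (1 - ρ) / (1 + ρ) := by
    rw [tauDeriv]; simp; field_simp; ring
  have e2 : 1 - ρ ^ 2 = (1 + ρ) * (1 - ρ) := by ring
  have hp' := Real.sqrt_pos.2 hp
  have hq' := Real.sqrt_pos.2 hq
  rw [ampLim, e1, e2, Real.sqrt_div hq.le, Real.sqrt_div (by positivity), Real.sqrt_mul hp.le]
  have e3 : 1 + ρ = √(1 + ρ) ^ 2 := (Real.sq_sqrt hp.le).symm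
  have e4 : 1 - ρ = √(1 - ρ) ^ 2 := (Real.sq_sqrt hq.le).symm
  set p := √(1 + ρ)
  set q := √(1 - ρ)
  rw [e3, e4]
  obtain ⟨j, rfl⟩ : ∃ j, k = j + 1 := ⟨k - 1, by omega⟩
  rw [show 2 * (j + 1) - 1 = 2 * j + 1 by omega]
  simp only [div_pow, mul_pow]
  field_simp
  ring

theorem tendsto_bestError {k : ℕ} (hk : 1 ≤ k) {a : ℝ} (ha0 : 0 < a) (ha1 : a < 1) :
    Tendsto (fun m : ℕ => ((1 + a) / (1 - a)) ^ ((m : ℝ) - 1 / 2)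
        * (2 * (m : ℝ) - 1) ^ ((k : ℝ) + 1 / 2) * bestError k m a) atTop
      (𝓝 (2 * Real.Gamma ((k : ℝ) + 1 / 2) / Real.pi
        * ((1 - a ^ 2) / (2 * a)) ^ ((k : ℝ) + 1 / 2))) := by
  set ρ := (1 - a) / (1 + a) with hρ
  have h0 : 0 < ρ := div_pos (by linarith) (by linarith)
  have h1 : ρ < 1 := by rw [hρ, div_lt_one (by linarith)]; linarith
  have ea : (1 - ρ) / (1 + ρ) = a := by rw [hρ]; field_simp; ring
  have hA : 0 < 1 - a ^ 2 := by nlinarith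
  have e2 : (1 - a ^ 2) / (2 * a) = 2 * ρ / (1 - ρ ^ 2) := by
    have : 1 - ρ ^ 2 = 4 * a / (1 + a) ^ 2 := by rw [hρ]; field_simp; ring
    rw [this, hρ]
    field_simp
    ring
  have h2 := tendsto_bestError_scaled hk h0 h1
  rw [ea] at h2
  have h3 : Tendsto (fun m : ℕ => √(ρ * ((2 * (m : ℝ) - 1) / (m + k : ℕ))) ^ (2 * k + 1)) atTop
      (𝓝 (√(2 * ρ) ^ (2 * k + 1))) := by
    have h4 : Tendsto (fun m : ℕ => (2 * (m : ℝ) - 1) / (m + k : ℕ)) atTop (𝓝 2) := by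
      have h5 := ((tendsto_natCast_add k).const_div_atTop (2 * (k : ℝ) + 1)).const_sub 2
      rw [sub_zero] at h5
      refine h5.congr fun m => ?_
      have hN : (0 : ℝ) < (m + k : ℕ) := by
        have : 0 < m + k := by omega
        exact_mod_cast this
      field_simp
      push_cast
      ring
    have h5 := ((Real.continuous_sqrt.tendsto _).comp (h4.const_mul ρ)).pow (2 * k + 1)
    rwa [mul_comm ρ 2] at h5
  have h4 := h3.mul h2
  rw [ampLim_eq hk h0 h1, ← rpow_add_half (by rw [← e2]; positivity), ← e2] at h4
  refine h4.congr' ?_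
  filter_upwards [eventually_ge_atTop 1] with m hm
  have hm' : (1 : ℝ) ≤ m := by exact_mod_cast hm
  have hN : (0 : ℝ) < (m + k : ℕ) := by
    have : 0 < m + k := by omega
    exact_mod_cast this
  -- Here (1 + a) / (1 - a) = 1/ρ, and m - 1/2 = (m + k) - (k + 1/2).
  have e3 : ((1 + a) / (1 - a)) ^ ((m : ℝ) - 1 / 2) = √ρ ^ (2 * k + 1) / ρ ^ (m + k) := by
    have : (1 + a) / (1 - a) = ρ⁻¹ := by rw [hρ, inv_div]
    rw [this, ← rpow_add_half h0.le, Real.inv_rpow h0.le, ← Real.rpow_natCast, ← Real.rpow_sub h0,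
      ← Real.rpow_neg h0.le]
    congr 1
    push_cast
    ring
  have h2m : 0 ≤ 2 * (m : ℝ) - 1 := by linarith
  rw [e3, rpow_add_half h2m, Real.sqrt_mul h0.le, Real.sqrt_div h2m, mul_pow, div_pow]
  have := Real.sqrt_pos.2 hN
  field_simp

/-- The extremal function realizes the parameter with cosh B = 1 / L, and `IsParam.unique` excludes
any other. -/
theorem isParam_iff {k m : ℕ} (hk : 1 ≤ k) (hm : 1 ≤ m) {a : ℝ} (ha0 : 0 < a) (ha1 : a < 1) {B : ℝ} :
    IsParam k m a B ↔ 0 < B ∧ Real.cosh B = 1 / bestError k m a := by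
  obtain ⟨L, σ, c, Q, x, h⟩ := exists_isAlternant hk (by omega : k ≤ m + k - 1) ha0 ha1
  rw [h.bestError_eq hk hm ha0]
  have hp : ∀ {B : ℝ}, 0 < B → Real.cosh B = 1 / L → IsParam k m a B := fun h1 h2 =>
    h.isParam ha0 hk hm (by omega) h1 h2
  refine ⟨fun hB => ?_, fun hB => hp hB.1 hB.2⟩
  have hL : 1 < 1 / L := by rw [lt_div_iff₀ h.L_pos]; linarith [h.L_lt_one]
  have hc := Real.cosh_arcosh hL.le
  have hpos : 0 < Real.arcosh (1 / L) := Real.arcosh_pos hL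
  rw [hB.unique hk hm ha0 ha1 (hp hpos hc)]
  exact ⟨hpos, hc⟩

theorem existsUnique_isParam {k m : ℕ} (hk : 1 ≤ k) (hm : 1 ≤ m) {a : ℝ} (ha0 : 0 < a) (ha1 : a < 1) :
    ∃! B, IsParam k m a B := by
  obtain ⟨L, σ, c, Q, x, h⟩ := exists_isAlternant hk (by omega : k ≤ m + k - 1) ha0 ha1
  have hL : 1 < 1 / L := by rw [lt_div_iff₀ h.L_pos]; linarith [h.L_lt_one]
  have hp := h.isParam ha0 hk hm (by omega) (Real.arcosh_pos hL) (Real.cosh_arcosh hL.le)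
  exact ⟨_, hp, fun B hB => hB.unique hk hm ha0 ha1 hp⟩

theorem existsUnique_isExtremal {k m : ℕ} (hk : 1 ≤ k) (hm : 1 ≤ m) {a : ℝ} (ha0 : 0 < a)
    (ha1 : a < 1) : ∃! f, IsExtremal k m a f := by
  obtain ⟨L, σ, c, Q, x, h⟩ := exists_isAlternant hk (by omega : k ≤ m + k - 1) ha0 ha1
  exact ⟨_, (h.isExtremal_iff hk hm ha0).2 rfl, fun f hf => (h.isExtremal_iff hk hm ha0).1 hf⟩

theorem cosh_paramB {k m : ℕ} (hk : 1 ≤ k) (hm : 1 ≤ m) {a : ℝ} (ha0 : 0 < a) (ha1 : a < 1) :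
    0 < paramB k m a ∧ Real.cosh (paramB k m a) = 1 / bestError k m a :=
  (isParam_iff hk hm ha0 ha1).1 (Classical.epsilon_spec (existsUnique_isParam hk hm ha0 ha1).exists)

theorem bestError_eq_inv_cosh {k m : ℕ} (hk : 1 ≤ k) (hm : 1 ≤ m) {a : ℝ} (ha0 : 0 < a)
    (ha1 : a < 1) : bestError k m a = 1 / Real.cosh (paramB k m a) := by
  rw [(cosh_paramB hk hm ha0 ha1).2, one_div_one_div]

theorem tendsto_bestError_zero {k : ℕ} (hk : 1 ≤ k) {a : ℝ} (ha0 : 0 < a) (ha1 : a < 1) :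
    Tendsto (fun m : ℕ => bestError k m a) atTop (𝓝 0) := by
  have hq : 1 < (1 + a) / (1 - a) := by rw [lt_div_iff₀ (by linarith)]; linarith
  have h2 : Tendsto (fun m : ℕ => 2 * (m : ℝ) - 1) atTop atTop :=
    tendsto_atTop_add_const_right _ _ (tendsto_natCast_atTop_atTop.const_mul_atTop two_pos)
  have h3 : Tendsto (fun m : ℕ => ((1 + a) / (1 - a)) ^ ((m : ℝ) - 1 / 2)
        * (2 * (m : ℝ) - 1) ^ ((k : ℝ) + 1 / 2)) atTop atTop := by
    refine tendsto_atTop_mono' _ ?_ ((tendsto_rpow_atTop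
      (by positivity : 0 < (k : ℝ) + 1 / 2)).comp h2)
    filter_upwards [eventually_ge_atTop 1] with m hm
    have hm' : (1 : ℝ) ≤ m := by exact_mod_cast hm
    refine le_mul_of_one_le_left (Real.rpow_nonneg (by linarith) _) ?_
    exact Real.one_le_rpow hq.le (by linarith)
  have h4 := (tendsto_bestError hk ha0 ha1).mul h3.inv_tendsto_atTop
  rw [mul_zero] at h4
  refine h4.congr' ?_
  filter_upwards [h3.eventually_gt_atTop 0] with m hm
  simp only [Pi.inv_apply]
  rw [mul_comm _ (bestError k m a), mul_assoc, mul_inv_cancel₀ hm.ne', mul_one]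

theorem tendsto_paramB {k : ℕ} (hk : 1 ≤ k) {a : ℝ} (ha0 : 0 < a) (ha1 : a < 1) :
    Tendsto (fun m : ℕ => paramB k m a - ((m : ℝ) - 1 / 2) * Real.log ((1 + a) / (1 - a))
        - ((k : ℝ) + 1 / 2) * Real.log (2 * (m : ℝ) - 1)) atTop
      (𝓝 (((k : ℝ) + 1 / 2) * Real.log (2 * a / (1 - a ^ 2))
        - Real.log (Real.Gamma ((k : ℝ) + 1 / 2) / Real.pi))) := by
  have hq : 0 < (1 + a) / (1 - a) := div_pos (by linarith) (by linarith)
  have hr : 0 < (1 - a ^ 2) / (2 * a) := div_pos (by nlinarith) (by linarith)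
  have hΓ : 0 < Real.Gamma ((k : ℝ) + 1 / 2) := Real.Gamma_pos_of_pos (by positivity)
  have hT : 0 < 2 * Real.Gamma ((k : ℝ) + 1 / 2) / Real.pi *
      ((1 - a ^ 2) / (2 * a)) ^ ((k : ℝ) + 1 / 2) := by
    have := Real.rpow_pos_of_pos hr ((k : ℝ) + 1 / 2)
    positivity
  have h1 := (tendsto_bestError hk ha0 ha1).log hT.ne'
  have hL := tendsto_bestError_zero hk ha0 ha1
  have h2 : Tendsto (fun m : ℕ => Real.log (1 - Real.exp (-paramB k m a) * bestError k m a / 2)) atTop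
      (𝓝 0) := by
    have h3 : Tendsto (fun m : ℕ => Real.exp (-paramB k m a) * bestError k m a / 2) atTop (𝓝 0) := by
      refine squeeze_zero_norm' ?_ hL
      filter_upwards [eventually_ge_atTop 1] with m hm
      have hB := (cosh_paramB hk hm ha0 ha1).1
      have hL0 : 0 ≤ bestError k m a := by
        rw [bestError_eq_inv_cosh hk hm ha0 ha1]
        have := Real.cosh_pos (paramB k m a)
        positivity
      have he : Real.exp (-paramB k m a) ≤ 1 := Real.exp_le_one_iff.2 (by linarith)
      rw [Real.norm_of_nonneg (by positivity)]
      nlinarith [Real.exp_pos (-paramB k m a)]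
    have h4 := (h3.const_sub 1).log (by norm_num)
    simpa using h4
  have h5 := (h2.add_const (Real.log 2)).sub h1
  have e : 0 + Real.log 2 - Real.log (2 * Real.Gamma ((k : ℝ) + 1 / 2) / Real.pi *
      ((1 - a ^ 2) / (2 * a)) ^ ((k : ℝ) + 1 / 2)) = ((k : ℝ) + 1 / 2) * Real.log (2 * a / (1 - a ^ 2))
        - Real.log (Real.Gamma ((k : ℝ) + 1 / 2) / Real.pi) := by
    have e1 : 2 * a / (1 - a ^ 2) = ((1 - a ^ 2) / (2 * a))⁻¹ := by rw [inv_div]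
    rw [e1, Real.log_inv, Real.log_mul (by positivity) (Real.rpow_pos_of_pos hr _).ne',
      Real.log_rpow hr, mul_div_assoc, Real.log_mul two_ne_zero (by positivity)]
    ring
  rw [e] at h5
  refine h5.congr' ?_
  filter_upwards [eventually_ge_atTop 1] with m hm
  have hm' : (1 : ℝ) ≤ m := by exact_mod_cast hm
  have hc := Real.cosh_pos (paramB k m a)
  have hLe := bestError_eq_inv_cosh hk hm ha0 ha1
  have hL0 : 0 < bestError k m a := by rw [hLe]; positivity
  -- L cosh B = 1 rewritten; hence B = log(2 / L) + log(1 - e^{-B} L / 2), whose last term tends to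
  -- 0.
  have e2 : 1 - Real.exp (-paramB k m a) * bestError k m a / 2 =
      Real.exp (paramB k m a) * bestError k m a / 2 := by
    rw [hLe]
    field_simp
    rw [Real.cosh_eq]
    ring
  have hm2 : 0 < 2 * (m : ℝ) - 1 := by linarith
  rw [e2, Real.log_div (by positivity) two_ne_zero, Real.log_mul (Real.exp_pos _).ne' hL0.ne',
    Real.log_exp, Real.log_mul (mul_pos (Real.rpow_pos_of_pos hq _)
      (Real.rpow_pos_of_pos hm2 _)).ne' hL0.ne', Real.log_mul (Real.rpow_pos_of_pos hq _).ne'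
      (Real.rpow_pos_of_pos hm2 _).ne', Real.log_rpow hq, Real.log_rpow hm2]
  ring

end SgnLaurent

end

noncomputable section
namespace SgnLaurent

open Polynomial Set Complex Filter Topology MeasureTheory

/-! ### Behaviour near the origin -/

section
variable {ρ : ℝ}

/-- A Bernstein–Walsh estimate. -/
theorem norm_pow_mul_abs_eval_le (h0 : 0 < ρ) (h1 : ρ < 1) {D : ℝ[X]} {n : ℕ} (hD : D.natDegree ≤ n)
    {M : ℝ} (hM : ∀ x ∈ Icc ((1 - ρ) / (1 + ρ)) 1, |D.eval (x ^ 2)| ≤ M) {t : ℝ} {z₀ : ℂ}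
    (hz : z₀ ≠ 0) (hz1 : ‖z₀‖ ≤ 1) (ht : (1 + ρ * z₀) * (1 + ρ * z₀⁻¹) = (1 + ρ) ^ 2 * t) :
    ‖z₀‖ ^ n * |D.eval t| ≤ M := by
  have hρ1 : (1 + ρ : ℂ) ≠ 0 := by
    have : (1 + ρ : ℝ) ≠ 0 := by linarith
    exact_mod_cast this
  -- z^n D(x²) is a polynomial in z, because z x² is one. The maximum principle on the unit disk
  -- applies to it.
  set F : ℂ → ℂ := fun z => ∑ j ∈ Finset.range (n + 1),
    (D.coeff j : ℂ) * (((1 + ρ * z) * (z + ρ) / (1 + ρ) ^ 2) ^ j * z ^ (n - j)) with hF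
  have hFd : Differentiable ℂ F := by simp only [hF]; fun_prop
  have hFz : ∀ (z : ℂ) (t : ℝ), z ≠ 0 → (1 + ρ * z) * (1 + ρ * z⁻¹) = (1 + ρ) ^ 2 * t →
      F z = z ^ n * (D.eval t : ℝ) := by
    intro z t hz h
    have h2 : (1 + ρ * z) * (z + ρ) / (1 + ρ) ^ 2 = z * t := by
      rw [div_eq_iff (pow_ne_zero 2 hρ1), show z * t * (1 + ρ : ℂ) ^ 2 = z * ((1 + ρ) ^ 2 * t) by ring,
        ← h]
      field_simp
    rw [eval_eq_sum_range' (Nat.lt_succ_of_le hD), ofReal_sum, Finset.mul_sum]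
    refine Finset.sum_congr rfl fun j hj => ?_
    have hj' : j ≤ n := by have := Finset.mem_range.1 hj; omega
    rw [h2, mul_pow, ofReal_mul, ofReal_pow]
    calc (D.coeff j : ℂ) * (z ^ j * (t : ℂ) ^ j * z ^ (n - j)) =
        (z ^ j * z ^ (n - j)) * (D.coeff j * (t : ℂ) ^ j) := by ring
      _ = _ := by rw [← pow_add, Nat.add_sub_cancel' hj']
  have h2 : ‖F z₀‖ ≤ M := by
    refine norm_le_of_forall_mem_frontier_norm_le (U := Metric.ball (0 : ℂ) 1) Metric.isBounded_ball
      hFd.diffContOnCl (fun z hzf => ?_) ?_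
    · rw [frontier_ball _ one_ne_zero, mem_sphere_zero_iff_norm] at hzf
      have hze : z = exp (z.arg * I) := by
        conv_lhs => rw [← norm_mul_exp_arg_mul_I z, hzf, ofReal_one, one_mul]
      have hz0 : z ≠ 0 := fun h => by rw [h, norm_zero] at hzf; exact zero_ne_one hzf
      have hcv : circleVal ρ z.arg = 1 + ρ * z := by rw [circleVal, ← hze]
      have hzinv : z⁻¹ = (starRingEnd ℂ) z := by
        rw [inv_def, normSq_eq_norm_sq, hzf]; simp
      have h3 : (1 + ρ * z) * (1 + ρ * z⁻¹) = (1 + ρ) ^ 2 * ((circlePt ρ z.arg ^ 2 : ℝ) : ℂ) := by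
        have h4 : (1 : ℂ) + ρ * z⁻¹ = (starRingEnd ℂ) (circleVal ρ z.arg) := by
          rw [hcv, hzinv]; simp
        rw [h4, ← hcv, mul_conj, normSq_eq_norm_sq, circlePt]
        push_cast
        field_simp
      rw [hFz z _ hz0 h3, norm_mul, norm_pow, hzf, one_pow, one_mul, norm_real]
      exact hM _ (circlePt_mem h0 h1 _)
    · rw [closure_ball _ one_ne_zero, mem_closedBall_zero_iff]; exact hz1
  rwa [hFz z₀ t hz ht, norm_mul, norm_pow, norm_real, Real.norm_eq_abs] at h2

theorem tauDeriv_zero (h0 : 0 < ρ) : tauDeriv ρ 0 = (1 - ρ) / (1 + ρ) := by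
  rw [tauDeriv]; simp; field_simp; ring

/-- The inverse of `η ↦ √(-τ(-η))`. -/
theorem exists_eta (h0 : 0 < ρ) (h1 : ρ < 1) : ∃ η : ℝ → ℝ,
    (∀ x ∈ Ioo 0 ((1 - ρ) / (1 + ρ)), 0 < η x ∧ ρ * Real.exp (η x) < 1 ∧
      tauFun ρ (-η x) = -x ^ 2) ∧
    Tendsto (fun x => η x / x ^ 2) (𝓝[>] 0) (𝓝 (tauDeriv ρ 0)⁻¹) ∧ Tendsto η (𝓝[>] 0) (𝓝 0) := by
  have hlog : 0 < -Real.log ρ := by have := Real.log_neg h0 h1; linarith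
  have hex : ∀ x ∈ Ioo 0 ((1 - ρ) / (1 + ρ)), ∃ η, 0 < η ∧ ρ * Real.exp η < 1 ∧
      tauFun ρ (-η) = -x ^ 2 := by
    intro x hx
    -- As η runs from 0 to -log ρ, the function -τ(-η) goes from 0 to a², so every x in (0, a) is
    -- reached.
    have hc : ContinuousOn (fun η => -tauFun ρ (-η)) (Icc 0 (-Real.log ρ)) :=
      ((continuous_tauFun ρ).comp continuous_neg).neg.continuousOn
    have h2 := intermediate_value_Ioo hlog.le hc
    have e0 : -tauFun ρ (-0) = 0 := by simp [tauFun]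
    have e1 : -tauFun ρ (-(-Real.log ρ)) = ((1 - ρ) / (1 + ρ)) ^ 2 := by
      rw [neg_neg, tauFun, Real.exp_neg, Real.exp_log h0]
      field_simp
      ring
    rw [e0, e1] at h2
    obtain ⟨η, hη, he⟩ := h2 (⟨by have := hx.1; positivity,
      pow_lt_pow_left₀ hx.2 hx.1.le two_ne_zero⟩ : x ^ 2 ∈ Ioo 0 (((1 - ρ) / (1 + ρ)) ^ 2))
    refine ⟨η, hη.1, ?_, by simp only at he; linarith⟩
    have h3 : Real.exp η < Real.exp (-Real.log ρ) := Real.exp_lt_exp.2 hη.2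
    rw [Real.exp_neg, Real.exp_log h0] at h3
    calc ρ * Real.exp η < ρ * ρ⁻¹ := by gcongr
      _ = 1 := mul_inv_cancel₀ h0.ne'
  choose! η hη using hex
  have ha0 : 0 < (1 - ρ) / (1 + ρ) := div_pos (by linarith) (by linarith)
  have hev : ∀ᶠ x in 𝓝[>] (0 : ℝ), x ∈ Ioo 0 ((1 - ρ) / (1 + ρ)) := Ioo_mem_nhdsGT ha0
  have hlim : Tendsto η (𝓝[>] 0) (𝓝 0) := by
    have h2 : Tendsto (fun x : ℝ => (1 + ρ) ^ 2 / (1 - ρ) * x ^ 2) (𝓝[>] 0) (𝓝 0) := by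
      have : Continuous fun x : ℝ => (1 + ρ) ^ 2 / (1 - ρ) * x ^ 2 := by fun_prop
      have h3 := this.tendsto 0
      simp only [ne_eq, OfNat.ofNat_ne_zero, not_false_eq_true, zero_pow, mul_zero] at h3
      exact h3.mono_left nhdsWithin_le_nhds
    have h3 : Tendsto (fun x => 1 - Real.exp (-η x)) (𝓝[>] 0) (𝓝 0) := by
      refine squeeze_zero' ?_ ?_ h2
      · filter_upwards [hev] with x hx
        have : Real.exp (-η x) ≤ 1 := Real.exp_le_one_iff.2 (by linarith [(hη x hx).1])
        linarith
      · filter_upwards [hev] with x hx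
        obtain ⟨h4, h5, h6⟩ := hη x hx
        rw [tauFun, neg_neg, div_eq_iff (by positivity)] at h6
        have h7 : Real.exp (-η x) ≤ 1 := Real.exp_le_one_iff.2 (by linarith)
        rw [div_mul_eq_mul_div, le_div_iff₀ (by linarith)]
        have h8 : 1 - ρ ≤ 1 - ρ ^ 2 * Real.exp (η x) := by nlinarith
        nlinarith
    have h4 := ((h3.const_sub 1).log (by norm_num)).neg
    simp only [sub_zero, Real.log_one, neg_zero, sub_sub_cancel, Real.log_exp, neg_neg] at h4
    exact h4
  refine ⟨η, hη, ?_, hlim⟩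
  have h2 := (hasDerivAt_tauFun ρ 0).tendsto_slope_zero
  have h3 : Tendsto (fun x => -η x) (𝓝[>] 0) (𝓝[≠] 0) := by
    refine tendsto_nhdsWithin_iff.2 ⟨by simpa using hlim.neg, ?_⟩
    filter_upwards [hev] with x hx
    exact neg_ne_zero.2 (hη x hx).1.ne'
  refine ((h2.comp h3).inv₀ (tauDeriv_pos h0 h1 le_rfl).ne').congr' ?_
  filter_upwards [hev] with x hx
  obtain ⟨h4, h5, h6⟩ := hη x hx
  have : tauFun ρ 0 = 0 := by simp [tauFun]
  simp only [Function.comp, zero_add, smul_eq_mul, this, h6, sub_zero]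
  have := hx.1
  field_simp

/-- The error of the nearly optimal approximation in the gap. -/
theorem abs_gap_error_sub_le {k m : ℕ} (hk : 1 ≤ k) (hm : k + 1 ≤ m) (h0 : 0 < ρ) (h1 : ρ < 1)
    {P : ℝ[X]}
    (hP : ∀ x : ℝ, 0 < x → ∀ z : ℂ, z ≠ 0 → (1 + ρ * z) * (1 + ρ * z⁻¹) = (1 + ρ) ^ 2 * x ^ 2 →
        ((x ^ (2 * k - 1) - P.eval (x ^ 2) : ℝ) : ℂ) = (-1) ^ m / Real.pi *
          ∫ y in Ioi (0 : ℝ), (kern k m ρ y : ℂ) * (waveFun k m ρ y z + waveFun k m ρ y z⁻¹))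
    {x η : ℝ} (hx : 0 < x) (hη : 0 < η) (hη1 : ρ * Real.exp η < 1) (hηx : tauFun ρ (-η) = -x ^ 2) :
    |1 - oddFun k P x - (-1) ^ k / Real.pi * (Real.exp (-((m + k : ℕ) * η)) *
      (1 - ρ ^ 2 * Real.exp η) ^ (2 * k) / (√(m + k : ℕ) * x) ^ (2 * k - 1) *
      ∫ s in Ioi (0 : ℝ), scaledKern k ρ (m + k : ℕ) s *
        (1 / ((m + k : ℕ) * (1 - Real.exp (-(s / (m + k : ℕ) + η))))))| ≤
      kernMass k m ρ / (Real.pi * (1 - ρ) * x ^ (2 * k - 1)) := by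
  have hN : (0 : ℝ) < (m + k : ℕ) := by
    have : 0 < m + k := by omega
    exact_mod_cast this
  have hsN := Real.sqrt_pos.2 hN
  -- Points of the gap correspond to negative real z. Of the two choices z and 1/z this one has
  -- modulus above 1, so w₁ is the main term while w₂ stays bounded by 1 / (1 - ρ).
  set zr : ℝ := -(Real.exp (-η) / ρ) with hzr
  have hzr0 : zr ≠ 0 := by rw [hzr]; exact neg_ne_zero.2 (by positivity)
  have hzri : zr⁻¹ = -(ρ * Real.exp η) := by
    rw [hzr, inv_neg, inv_div, Real.exp_neg, div_inv_eq_mul]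
  have hrel : (1 + ρ * zr) * (1 + ρ * zr⁻¹) = (1 + ρ) ^ 2 * x ^ 2 := by
    rw [tauFun, neg_neg, div_eq_iff (by positivity)] at hηx
    rw [hzri, hzr]
    field_simp
    linear_combination -hηx
  have h2 := hP x hx zr (by exact_mod_cast hzr0) (by exact_mod_cast hrel)
  set w₁ : ℝ → ℝ := fun y => zr ^ (m + k) * (1 - ρ ^ 2 * Real.exp η) ^ (2 * k) *
    (1 / (1 - Real.exp (-(y + η)))) with hw₁
  set w₂ : ℝ → ℝ := fun y => zr⁻¹ ^ (m - k) * (zr⁻¹ + ρ) ^ (2 * k) /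
    (1 + ρ * Real.exp (-y) * zr⁻¹) with hw₂
  have e₁ : ∀ y, waveFun k m ρ y zr = w₁ y := by
    intro y
    rw [waveFun, hw₁]
    have h3 : zr + ρ = zr * (1 - ρ ^ 2 * Real.exp η) := by
      have : zr * zr⁻¹ = 1 := mul_inv_cancel₀ hzr0
      rw [hzri] at this
      linear_combination -ρ * this
    have h4 : 1 + ρ * Real.exp (-y) * zr = 1 - Real.exp (-(y + η)) := by
      rw [hzr, neg_add, Real.exp_add]; field_simp; ring
    have h5 : zr ^ (m - k) * (zr + ρ) ^ (2 * k) / (1 + ρ * Real.exp (-y) * zr) =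
        zr ^ (m + k) * (1 - ρ ^ 2 * Real.exp η) ^ (2 * k) * (1 / (1 - Real.exp (-(y + η)))) := by
      rw [h3, h4, mul_pow, show m + k = m - k + 2 * k by omega, pow_add]; ring
    exact_mod_cast congrArg ofReal h5
  have e₂ : ∀ y, waveFun k m ρ y (zr : ℂ)⁻¹ = w₂ y := by
    intro y
    rw [waveFun, hw₂]
    push_cast
    rfl
  simp only [e₁, e₂, ← ofReal_add, ← ofReal_mul] at h2
  rw [integral_complex_ofReal] at h2
  have h3 : x ^ (2 * k - 1) - P.eval (x ^ 2) = (-1) ^ m / Real.pi *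
      ∫ y in Ioi (0 : ℝ), kern k m ρ y * (w₁ y + w₂ y) := by exact_mod_cast h2
  have hKI := integrableOn_kern hk (by omega : k ≤ m) h0 h1
  have hexp : ∀ y, 0 < y → Real.exp (-(y + η)) ≤ Real.exp (-η) := fun y hy =>
    Real.exp_le_exp.2 (by linarith)
  have hη' : Real.exp (-η) < 1 := Real.exp_lt_one_iff.2 (by linarith)
  have hI₁ : IntegrableOn (fun y => kern k m ρ y * w₁ y) (Ioi 0) := by
    refine Integrable.mul_bdd (c := |zr ^ (m + k) * (1 - ρ ^ 2 * Real.exp η) ^ (2 * k)| *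
      (1 / (1 - Real.exp (-η)))) hKI
      (ContinuousOn.aestronglyMeasurable ?_ measurableSet_Ioi) ?_
    · refine continuousOn_const.mul (continuousOn_const.div (by fun_prop) fun y hy => ?_)
      have := hexp y hy
      exact (by linarith : 0 < 1 - Real.exp (-(y + η))).ne'
    · refine (ae_restrict_iff' measurableSet_Ioi).2 (Eventually.of_forall fun y hy => ?_)
      have h4 := hexp y hy
      rw [hw₁, Real.norm_eq_abs, abs_mul]
      gcongr
      rw [abs_of_nonneg (div_nonneg zero_le_one (by linarith))]
      exact one_div_le_one_div_of_le (by linarith) (by linarith)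
  have hden : ∀ y, 0 < y → 1 - ρ ≤ 1 + ρ * Real.exp (-y) * zr⁻¹ := by
    intro y hy
    have h4 : Real.exp (-y) < 1 := Real.exp_lt_one_iff.2 (by linarith)
    have h5 := Real.exp_pos (-y)
    rw [hzri]
    have h6 : ρ * Real.exp (-y) ≤ ρ := by nlinarith
    have h7 : 0 < ρ * Real.exp (-y) := by positivity
    nlinarith
  have hb₂ : ∀ y, 0 < y → |w₂ y| ≤ 1 / (1 - ρ) := by
    intro y hy
    have h4 := hden y hy
    have h5 : 1 ≤ Real.exp η := Real.one_le_exp_iff.2 hη.le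
    rw [hw₂, abs_div, abs_of_pos (by linarith : 0 < 1 + ρ * Real.exp (-y) * zr⁻¹), abs_mul, abs_pow,
      abs_pow]
    refine div_le_div₀ zero_le_one (mul_le_one₀ (pow_le_one₀ (abs_nonneg _) ?_) (by positivity)
      (pow_le_one₀ (abs_nonneg _) ?_)) (by linarith) h4
    · rw [hzri, abs_neg, abs_of_pos (by positivity)]; exact hη1.le
    · rw [hzri, abs_le]; constructor <;> nlinarith
  have hI₂ : IntegrableOn (fun y => kern k m ρ y * w₂ y) (Ioi 0) := by
    refine Integrable.mul_bdd (c := 1 / (1 - ρ)) hKI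
      (ContinuousOn.aestronglyMeasurable ?_ measurableSet_Ioi) ?_
    · refine continuousOn_const.div (by fun_prop) fun y hy => ?_
      have := hden y hy
      exact (by linarith : 0 < 1 + ρ * Real.exp (-y) * zr⁻¹).ne'
    · exact (ae_restrict_iff' measurableSet_Ioi).2 (Eventually.of_forall hb₂)
  have h4 : ∫ y in Ioi (0 : ℝ), kern k m ρ y * w₁ y = (-1) ^ (m + k) *
      (Real.exp (-((m + k : ℕ) * η)) * (1 - ρ ^ 2 * Real.exp η) ^ (2 * k) /
        √(m + k : ℕ) ^ (2 * k - 1)) * ∫ s in Ioi (0 : ℝ), scaledKern k ρ (m + k : ℕ) s *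
        (1 / ((m + k : ℕ) * (1 - Real.exp (-(s / (m + k : ℕ) + η))))) := by
    rw [integral_kern_mul hk, ← integral_const_mul, ← integral_const_mul]
    congr 1
    funext s
    have h5 : zr ^ (m + k) = (-1) ^ (m + k) * Real.exp (-((m + k : ℕ) * η)) / ρ ^ (m + k) := by
      rw [hzr, neg_pow, div_pow, ← Real.exp_nat_mul, mul_div_assoc]
      congr 4
      ring
    have h6 : √(m + k : ℕ) ^ (2 * k + 1) = √(m + k : ℕ) ^ (2 * k - 1) * (m + k : ℕ) := by
      rw [show 2 * k + 1 = 2 * k - 1 + 2 by omega, pow_add, Real.sq_sqrt hN.le]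
    simp only [hw₁]
    rw [h5, h6, ← div_div 1 (((m + k : ℕ) : ℝ))]
    generalize (1 - Real.exp (-(s / (m + k : ℕ) + η))) = E
    field_simp
  have h5 : |∫ y in Ioi (0 : ℝ), kern k m ρ y * w₂ y| ≤ kernMass k m ρ * (1 / (1 - ρ)) := by
    rw [kernMass, ← integral_mul_const, ← Real.norm_eq_abs]
    refine norm_integral_le_of_norm_le (hKI.mul_const _) ?_
    refine (ae_restrict_iff' measurableSet_Ioi).2 (Eventually.of_forall fun y hy => ?_)
    have h6 := kern_nonneg k m h0 h1 (le_of_lt hy)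
    rw [norm_mul, Real.norm_of_nonneg h6, Real.norm_eq_abs]
    exact mul_le_mul_of_nonneg_left (hb₂ y hy) h6
  simp only [mul_add] at h3
  rw [integral_add hI₁ hI₂, h4] at h3
  have hxk : 0 < x ^ (2 * k - 1) := by positivity
  have e1 : 1 - oddFun k P x = (x ^ (2 * k - 1) - P.eval (x ^ 2)) / x ^ (2 * k - 1) := by
    rw [oddFun]; field_simp
  have hsg : (-1 : ℝ) ^ m * (-1) ^ (m + k) = (-1) ^ k := by
    rw [← pow_add, show m + (m + k) = 2 * m + k by ring, pow_add, pow_mul]; simp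
  generalize (∫ s in Ioi (0 : ℝ), scaledKern k ρ (m + k : ℕ) s *
        (1 / ((m + k : ℕ) * (1 - Real.exp (-(s / (m + k : ℕ) + η)))))) = J at *
  generalize (∫ y in Ioi (0 : ℝ), kern k m ρ y * w₂ y) = J₂ at *
  have e2 : 1 - oddFun k P x - (-1) ^ k / Real.pi * (Real.exp (-((m + k : ℕ) * η)) *
      (1 - ρ ^ 2 * Real.exp η) ^ (2 * k) / (√(m + k : ℕ) * x) ^ (2 * k - 1) * J) =
      (-1) ^ m * (1 / (Real.pi * x ^ (2 * k - 1)) * J₂) := by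
    rw [e1, h3, ← hsg, mul_pow]
    field_simp
    ring
  have hπ := Real.pi_pos
  rw [e2, abs_mul, abs_pow, abs_neg, abs_one, one_pow, one_mul, abs_mul,
    abs_of_pos (by positivity : 0 < 1 / (Real.pi * x ^ (2 * k - 1)))]
  refine (mul_le_mul_of_nonneg_left h5 (by positivity)).trans_eq ?_
  have : 0 < 1 - ρ := by linarith
  field_simp

end

end SgnLaurent

end

noncomputable section
namespace SgnLaurent

open Polynomial Set Complex Filter Topology MeasureTheory

/-! ### The limit function -/

/-- Substitution s = μ², which matches the scaled kernel. -/
theorem limitFun_eq {k : ℕ} (l : ℝ) : limitFun k l = 1 - (-1) ^ k / Real.pi *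
    (Real.exp (-l ^ 2) / l ^ (2 * k - 1) *
      ∫ s in Ioi (0 : ℝ), √s ^ (2 * k - 1) * Real.exp (-s) * (1 / (s + l ^ 2))) := by
  have h1 := integral_comp_rpow_Ioi_of_pos (p := 2)
    (g := fun s : ℝ => √s ^ (2 * k - 1) * Real.exp (-s) * (1 / (s + l ^ 2))) two_pos
  rw [limitFun, ← h1, pow_succ]
  have e : ∫ μ in Ioi (0 : ℝ), (μ / l) ^ (2 * k - 1) * Real.exp (-(l ^ 2 + μ ^ 2)) *
      (2 * μ / (l ^ 2 + μ ^ 2)) = ∫ x in Ioi (0 : ℝ), Real.exp (-l ^ 2) / l ^ (2 * k - 1) *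
      ((2 * x ^ ((2 : ℝ) - 1)) • (√(x ^ (2 : ℝ)) ^ (2 * k - 1) * Real.exp (-x ^ (2 : ℝ)) *
        (1 / (x ^ (2 : ℝ) + l ^ 2)))) := by
    refine setIntegral_congr_fun measurableSet_Ioi fun x hx => ?_
    have hx' : (0 : ℝ) < x := hx
    have e1 : x ^ ((2 : ℝ) - 1) = x := by norm_num
    have e2 : x ^ (2 : ℝ) = x ^ 2 := Real.rpow_two x
    simp only [e1, e2, smul_eq_mul]
    rw [Real.sqrt_sq hx'.le, neg_add, Real.exp_add, div_pow, add_comm (l ^ 2)]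
    ring
  rw [e, integral_const_mul]
  ring

theorem mul_exp_neg_le_one_sub_exp_neg (u : ℝ) : u * Real.exp (-u) ≤ 1 - Real.exp (-u) := by
  have h6 := Real.add_one_le_exp u
  have h7 : Real.exp u * Real.exp (-u) = 1 := by rw [← Real.exp_add]; simp
  nlinarith [Real.exp_pos (-u)]

theorem tendsto_mul_one_sub_exp_neg {ι : Type*} {l : Filter ι} {N u : ι → ℝ} {c : ℝ}
    (hN : ∀ᶠ i in l, 0 ≤ N i) (hu : Tendsto u l (𝓝 0)) (hc : Tendsto (fun i => N i * u i) l (𝓝 c)) :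
    Tendsto (fun i => N i * (1 - Real.exp (-u i))) l (𝓝 c) := by
  have h1 : Tendsto (fun i => N i * u i * Real.exp (-u i)) l (𝓝 c) := by
    have := hc.mul ((Real.continuous_exp.tendsto _).comp hu.neg)
    simpa using this
  refine tendsto_of_tendsto_of_tendsto_of_le_of_le' h1 hc ?_ ?_
  · filter_upwards [hN] with i hi
    rw [mul_assoc]
    exact mul_le_mul_of_nonneg_left (mul_exp_neg_le_one_sub_exp_neg _) hi
  · filter_upwards [hN] with i hi
    exact mul_le_mul_of_nonneg_left (by linarith [Real.add_one_le_exp (-u i)]) hi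

/-- The limit is taken jointly in m and the point λ, so that uniformity on compact sets follows from
continuous convergence. The error formula in the gap handles P, and Bernstein–Walsh handles Q - P.
-/
theorem tendsto_extremalFun {k : ℕ} (hk : 1 ≤ k) {a : ℝ} (ha0 : 0 < a) (ha1 : a < 1) {l : ℝ}
    (hl : 0 < l) :
    Tendsto (fun p : ℕ × ℝ => extremalFun k p.1 a (√(2 * a / (2 * (p.1 : ℝ) - 1)) * p.2))
      (atTop ×ˢ 𝓝 l) (𝓝 (limitFun k l)) := by
  obtain ⟨ρ, h0, h1, rfl⟩ : ∃ ρ, 0 < ρ ∧ ρ < 1 ∧ a = (1 - ρ) / (1 + ρ) :=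
    ⟨(1 - a) / (1 + a), div_pos (by linarith) (by linarith), by
      rw [div_lt_one (by linarith)]; linarith, by field_simp; ring⟩
  set a := (1 - ρ) / (1 + ρ) with ha
  have hτ0 : tauDeriv ρ 0 = a := tauDeriv_zero h0
  set F : Filter (ℕ × ℝ) := atTop ×ˢ 𝓝 l with hF
  obtain ⟨η, hη, hηlim, hη0⟩ := exists_eta h0 h1
  rw [hτ0] at hηlim
  have hfst : Tendsto (fun p : ℕ × ℝ => p.1) F atTop := tendsto_fst
  have hsnd : Tendsto (fun p : ℕ × ℝ => p.2) F (𝓝 l) := tendsto_snd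
  set N : ℕ × ℝ → ℝ := fun p => (p.1 + k : ℕ) with hNdef
  set X : ℕ × ℝ → ℝ := fun p => √(2 * a / (2 * (p.1 : ℝ) - 1)) * p.2 with hXdef
  have hN : Tendsto N F atTop := (tendsto_natCast_add k).comp hfst
  have hN0 : ∀ p, 0 < N p := fun p => by
    have : 0 < p.1 + k := by omega
    simp only [hNdef]
    exact_mod_cast this
  have hm1 : ∀ᶠ p in F, k + 1 ≤ p.1 := hfst.eventually (eventually_ge_atTop _)
  have hX0 : ∀ᶠ p in F, 0 < X p := by
    filter_upwards [hm1, hsnd.eventually (lt_mem_nhds hl)] with p hp hp2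
    have h2 : (1 : ℝ) ≤ p.1 := by exact_mod_cast (by omega : 1 ≤ p.1)
    exact mul_pos (Real.sqrt_pos.2 (div_pos (by linarith) (by linarith))) hp2
  -- the scale `√N x → √a l`
  have hsc : Tendsto (fun p => √(N p) * X p) F (𝓝 (√a * l)) := by
    have h2 : Tendsto (fun m : ℕ => ((m + k : ℕ) : ℝ) * (2 * a / (2 * (m : ℝ) - 1))) atTop (𝓝 a) := by
      have h3 : Tendsto (fun m : ℕ => 2 * (m : ℝ) - 1) atTop atTop :=
        tendsto_atTop_add_const_right _ _ (tendsto_natCast_atTop_atTop.const_mul_atTop two_pos)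
      have h4 := (h3.const_div_atTop (a * (2 * k + 1))).const_add a
      rw [add_zero] at h4
      refine h4.congr' ?_
      filter_upwards [h3.eventually_gt_atTop 0] with m hm
      push_cast
      field_simp
      ring
    have h3 := (((Real.continuous_sqrt.tendsto _).comp (h2.comp hfst))).mul hsnd
    refine h3.congr fun p => ?_
    simp only [Function.comp, hXdef, hNdef]
    rw [Real.sqrt_mul (by positivity)]
    ring
  have hNsq : Tendsto (fun p => √(N p)) F atTop := Real.tendsto_sqrt_atTop.comp hN
  have hXlim : Tendsto X F (𝓝 0) := by
    have h2 := hsc.mul hNsq.inv_tendsto_atTop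
    rw [mul_zero] at h2
    refine h2.congr fun p => ?_
    have := Real.sqrt_pos.2 (hN0 p)
    simp only [Pi.inv_apply]
    field_simp
  have hXgt : Tendsto X F (𝓝[>] 0) := tendsto_nhdsWithin_iff.2 ⟨hXlim, hX0⟩
  have hXI : ∀ᶠ p in F, X p ∈ Ioo 0 a := hXgt.eventually (Ioo_mem_nhdsGT ha0)
  have hηX : Tendsto (fun p => η (X p)) F (𝓝 0) := hη0.comp hXgt
  -- η is asymptotically x² / a and N x² tends to a l².
  have hNη : Tendsto (fun p => N p * η (X p)) F (𝓝 (l ^ 2)) := by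
    have h2 := (hsc.pow 2).mul (hηlim.comp hXgt)
    have e : (√a * l) ^ 2 * a⁻¹ = l ^ 2 := by
      rw [mul_pow, Real.sq_sqrt ha0.le]; field_simp
    rw [e] at h2
    refine h2.congr' ?_
    filter_upwards [hX0] with p hp
    simp only [Function.comp]
    rw [mul_pow, Real.sq_sqrt (hN0 p).le]
    field_simp
  -- the main term
  have hlow : ∀ᶠ p in F, l ^ 2 / 2 < N p * (1 - Real.exp (-η (X p))) :=
    (tendsto_mul_one_sub_exp_neg (Eventually.of_forall fun p => (hN0 p).le) hηX hNη).eventually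
      (lt_mem_nhds (by have := pow_pos hl 2; linarith))
  have hlow' : ∀ᶠ p in F, ∀ s, 0 < s →
      l ^ 2 / 2 < N p * (1 - Real.exp (-(s / N p + η (X p)))) := by
    filter_upwards [hlow] with p hp s hs
    refine hp.trans_le (mul_le_mul_of_nonneg_left ?_ (hN0 p).le)
    have h3 : 0 < s / N p := div_pos hs (hN0 p)
    have := Real.exp_le_exp.2 (by linarith : -(s / N p + η (X p)) ≤ -η (X p))
    linarith
  have hl2 : 0 < l ^ 2 / 2 := by positivity
  -- N(1 - e^{-(s/N + η)}) tends to s + l² and stays above l² / 2, which provides the constant C.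
  have hInt := tendsto_integral_scaledKern (k := k) (l := F) (N := N) (C := 1 / (l ^ 2 / 2)) hk h0 h1 hN
    (H := fun p s => 1 / (N p * (1 - Real.exp (-(s / N p + η (X p))))))
    (H₀ := fun s => 1 / (s + l ^ 2))
    (by
      filter_upwards [hlow'] with p hp
      exact continuousOn_const.div (by fun_prop) fun s hs => (hl2.trans (hp s hs)).ne')
    (by
      filter_upwards [hlow'] with p hp s hs
      have h2 := hp s hs
      rw [abs_of_pos (one_div_pos.2 (hl2.trans h2))]
      refine (one_div_le_one_div_of_le hl2 h2.le).trans (le_mul_of_one_le_right ?_ ?_)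
      · positivity
      · linarith)
    (by
      intro s hs
      have h2 : Tendsto (fun p => s / N p + η (X p)) F (𝓝 0) := by
        simpa using (hN.const_div_atTop s).add hηX
      have h3 : Tendsto (fun p => N p * (s / N p + η (X p))) F (𝓝 (s + l ^ 2)) := by
        refine (hNη.const_add s).congr fun p => ?_
        have := hN0 p
        field_simp
      exact tendsto_const_nhds.div (tendsto_mul_one_sub_exp_neg
        (Eventually.of_forall fun p => (hN0 p).le) h2 h3) (by positivity))
  have hsa : 0 < √a := Real.sqrt_pos.2 ha0
  have hρ2 : 0 < 1 - ρ ^ 2 := by nlinarith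
  have hpre : Tendsto (fun p => Real.exp (-(N p * η (X p))) *
      (1 - ρ ^ 2 * Real.exp (η (X p))) ^ (2 * k) / (√(N p) * X p) ^ (2 * k - 1)) F
      (𝓝 (Real.exp (-l ^ 2) * (1 - ρ ^ 2) ^ (2 * k) / (√a * l) ^ (2 * k - 1))) := by
    refine Tendsto.div (Tendsto.mul ((Real.continuous_exp.tendsto _).comp hNη.neg) (Tendsto.pow ?_ _))
      (hsc.pow _) (by positivity)
    have := (((Real.continuous_exp.tendsto _).comp hηX).const_mul (ρ ^ 2)).const_sub 1
    simpa using this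
  have hmain := ((hpre.mul hInt).const_mul ((-1) ^ k / Real.pi)).const_sub 1
  have elim : 1 - (-1) ^ k / Real.pi * (Real.exp (-l ^ 2) * (1 - ρ ^ 2) ^ (2 * k) /
      (√a * l) ^ (2 * k - 1) * (√(tauDeriv ρ 0) ^ (2 * k - 1) / (1 - ρ ^ 2) ^ (2 * k) *
        ∫ s in Ioi (0 : ℝ), √s ^ (2 * k - 1) * Real.exp (-s) * (1 / (s + l ^ 2)))) = limitFun k l := by
    rw [limitFun_eq, hτ0, mul_pow]
    generalize (∫ s in Ioi (0 : ℝ), √s ^ (2 * k - 1) * Real.exp (-s) * (1 / (s + l ^ 2))) = J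
    field_simp
  rw [elim] at hmain
  -- the error terms
  have hbig : Tendsto (fun p => N p * (√(N p) * X p) ^ (2 * k - 1)) F atTop :=
    hN.atTop_mul_pos (by positivity) (hsc.pow (2 * k - 1))
  have hNX : ∀ p, √(N p) ^ (2 * k + 1) * X p ^ (2 * k - 1) = N p * (√(N p) * X p) ^ (2 * k - 1) := by
    intro p
    rw [show 2 * k + 1 = 2 * k - 1 + 2 by omega, pow_add, Real.sq_sqrt (hN0 p).le, mul_pow]
    ring
  -- Both terms gain 1 / N: amplitude and mass are of order ρ^N N^{-k-1/2}, while x^{2k-1} is of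
  -- order N^{-k+1/2}. The first term even keeps the factor ρ^N.
  have herr : Tendsto (fun p => kernMass k p.1 ρ / (Real.pi * (1 - ρ) * X p ^ (2 * k - 1)) +
      2 * (amp k p.1 ρ + ampErr k p.1 ρ) / ρ ^ (p.1 + k) / X p ^ (2 * k - 1)) F (𝓝 0) := by
    have h2 : Tendsto (fun p : ℕ × ℝ => ρ ^ (p.1 + k)) F (𝓝 0) :=
      (tendsto_pow_atTop_nhds_zero_of_lt_one h0.le h1).comp ((tendsto_add_atTop_nat k).comp hfst)
    have h3 := (((tendsto_kernMass hk h0 h1).comp hfst).mul h2).const_mul (1 / (Real.pi * (1 - ρ)))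
    have h4 := (((tendsto_amp hk h0 h1).add (tendsto_ampErr hk h0 h1)).comp hfst).const_mul 2
    have h5 := (h3.add h4).mul hbig.inv_tendsto_atTop
    rw [mul_zero] at h5
    refine h5.congr' ?_
    filter_upwards [hX0] with p hp
    have h6 : 0 < √(N p) := Real.sqrt_pos.2 (hN0 p)
    have h7 : 0 < 1 - ρ := by linarith
    simp only [Function.comp, Pi.inv_apply]
    rw [← hNX, show (((p.1 + k : ℕ) : ℝ)) = N p from rfl]
    have := Real.pi_pos
    field_simp
  have hz : Tendsto (fun p : ℕ × ℝ => extremalFun k p.1 a (X p) - (1 - (-1) ^ k / Real.pi *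
      (Real.exp (-(N p * η (X p))) *
      (1 - ρ ^ 2 * Real.exp (η (X p))) ^ (2 * k) / (√(N p) * X p) ^ (2 * k - 1) *
      ∫ s in Ioi (0 : ℝ), scaledKern k ρ (N p) s *
        (1 / (N p * (1 - Real.exp (-(s / N p + η (X p))))))))) F (𝓝 0) := by
    refine squeeze_zero_norm' ?_ herr
    filter_upwards [hm1, hXI] with p hm hx
    obtain ⟨m, l'⟩ := p
    simp only at hm
    obtain ⟨P, hdeg, hP⟩ := exists_near_optimal hk hm h0 h1
    obtain ⟨L, σ, c, Q, y, h⟩ := exists_isAlternant hk (by omega : k ≤ m + k - 1) ha0 ha1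
    rw [h.extremalFun_eq hk (by omega) ha0]
    obtain ⟨hη1, hη2, hη3⟩ := hη _ hx
    have hgap := abs_gap_error_sub_le hk hm h0 h1 hP hx.1 hη1 hη2 hη3
    obtain ⟨hLA, hPb⟩ := h.abs_sub_amp_le hk hm h0 h1 hdeg (abs_error_sub_le hk hm h0 h1 hP)
    have hLA' := (abs_le.1 hLA).2
    set x := X (m, l') with hx_def
    have hx0 : 0 < x := hx.1
    -- Both Q and P are within the amplitude, up to its error bound, of the function 1 on [a, 1].
    have hD : ∀ t ∈ Icc a 1, |(Q - P).eval (t ^ 2)| ≤ 2 * (amp k m ρ + ampErr k m ρ) := by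
      intro t ht
      have ht0 : 0 < t := ha0.trans_le ht.1
      have h2 := abs_le.1 (h.bound t ht)
      have h3 := abs_le.1 (hPb t ht)
      have e : (Q - P).eval (t ^ 2) = t ^ (2 * k - 1) * (oddFun k Q t - oddFun k P t) := by
        rw [oddFun, oddFun, eval_sub]; field_simp
      rw [e, abs_mul, abs_of_pos (by positivity)]
      refine (mul_le_of_le_one_left (abs_nonneg _) (pow_le_one₀ ht0.le ht.2)).trans ?_
      rw [abs_le]
      constructor <;> linarith [h2.1, h2.2, h3.1, h3.2]
    -- For Bernstein–Walsh the point inside the disk is used, z₀ = -ρe^η, the reciprocal of the one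
    -- in the gap formula.
    have hrel : (1 + (ρ : ℂ) * ((-(ρ * Real.exp (η x)) : ℝ) : ℂ)) *
        (1 + ρ * ((-(ρ * Real.exp (η x)) : ℝ) : ℂ)⁻¹) = (1 + ρ) ^ 2 * ((x ^ 2 : ℝ) : ℂ) := by
      have : (1 + ρ * (-(ρ * Real.exp (η x)))) * (1 + ρ * (-(ρ * Real.exp (η x)))⁻¹) =
          (1 + ρ) ^ 2 * x ^ 2 := by
        rw [tauFun, neg_neg, div_eq_iff (by positivity), Real.exp_neg] at hη3
        have := Real.exp_pos (η x)
        field_simp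
        field_simp at hη3
        linear_combination -hη3
      exact_mod_cast this
    have hne : ((-(ρ * Real.exp (η x)) : ℝ) : ℂ) ≠ 0 :=
      ofReal_ne_zero.2 (neg_ne_zero.2 (by positivity))
    have hnorm : ‖((-(ρ * Real.exp (η x)) : ℝ) : ℂ)‖ = ρ * Real.exp (η x) := by
      rw [norm_real, norm_neg, Real.norm_of_nonneg (by positivity)]
    have hBW := norm_pow_mul_abs_eval_le h0 h1
      ((natDegree_sub_le Q P).trans (max_le h.deg hdeg)) hD hne (by rw [hnorm]; exact hη2.le) hrel
    rw [hnorm] at hBW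
    have hex1 : 1 ≤ Real.exp (η x) := Real.one_le_exp_iff.2 hη1.le
    have hpow : ρ ^ (m + k) ≤ (ρ * Real.exp (η x)) ^ (m + k - 1) := by
      calc ρ ^ (m + k) ≤ ρ ^ (m + k - 1) := pow_le_pow_of_le_one h0.le h1.le (by omega)
        _ ≤ _ := pow_le_pow_left₀ h0.le (by nlinarith) _
    have hDx : |(Q - P).eval (x ^ 2)| ≤ 2 * (amp k m ρ + ampErr k m ρ) / ρ ^ (m + k) := by
      rw [le_div_iff₀ (by positivity), mul_comm]
      exact (mul_le_mul_of_nonneg_right hpow (abs_nonneg _)).trans hBW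
    have e2 : oddFun k Q x - oddFun k P x = (Q - P).eval (x ^ 2) / x ^ (2 * k - 1) := by
      rw [oddFun, oddFun, eval_sub]; ring
    have h2 : |oddFun k Q x - oddFun k P x| ≤
        2 * (amp k m ρ + ampErr k m ρ) / ρ ^ (m + k) / x ^ (2 * k - 1) := by
      rw [e2, abs_div, abs_of_pos (by positivity : 0 < x ^ (2 * k - 1))]
      gcongr
    have hNm : N (m, l') = ((m + k : ℕ) : ℝ) := rfl
    rw [hNm]
    rw [Real.norm_eq_abs]
    generalize (∫ s in Ioi (0 : ℝ), scaledKern k ρ (m + k : ℕ) s *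
        (1 / ((m + k : ℕ) * (1 - Real.exp (-(s / (m + k : ℕ) + η x)))))) = J at *
    generalize Real.exp (-((m + k : ℕ) * η x)) * (1 - ρ ^ 2 * Real.exp (η x)) ^ (2 * k) /
      (√(m + k : ℕ) * x) ^ (2 * k - 1) = T at *
    rw [abs_le] at hgap h2 ⊢
    constructor <;> linarith [hgap.1, hgap.2, h2.1, h2.2]
  have := hz.add hmain
  rw [zero_add] at this
  refine this.congr fun p => ?_
  ring

/-- Continuous convergence on an open set is uniform on compact subsets. -/
theorem tendstoUniformlyOn_of_tendsto_prod {G : ℕ → ℝ → ℝ} {f : ℝ → ℝ} {U K : Set ℝ} (hU : IsOpen U)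
    (hlim : ∀ l ∈ U, Tendsto (fun p : ℕ × ℝ => G p.1 p.2) (atTop ×ˢ 𝓝 l) (𝓝 (f l)))
    (hK : IsCompact K) (hKU : K ⊆ U) : TendstoUniformlyOn G f atTop K := by
  -- Joint convergence forces the limit to be continuous, with no separate study of the integral.
  have hcont : ∀ l ∈ U, Tendsto f (𝓝 l) (𝓝 (f l)) := by
    intro l hl
    refine Metric.tendsto_nhds.2 fun ε hε => ?_
    obtain ⟨pa, hpa, pb, hpb, hp⟩ :=
      eventually_prod_iff.1 (Metric.tendsto_nhds.1 (hlim l hl) (ε / 2) (half_pos hε))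
    filter_upwards [hpb, hU.mem_nhds hl] with x hx hx0
    have h2 : Tendsto (fun m : ℕ => G m x) atTop (𝓝 (f x)) :=
      (hlim x hx0).comp (tendsto_id.prodMk tendsto_const_nhds)
    have h3 := le_of_tendsto (h2.dist tendsto_const_nhds) (hpa.mono fun m hm => (hp hm hx).le)
    exact h3.trans_lt (half_lt_self hε)
  refine (tendstoLocallyUniformlyOn_iff_tendstoUniformlyOn_of_compact hK).1 ?_
  rw [tendstoLocallyUniformlyOn_iff_forall_tendsto]
  intro l hl
  have h1 : Tendsto (fun p : ℕ × ℝ => f p.2) (atTop ×ˢ 𝓝[K] l) (𝓝 (f l)) :=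
    (hcont l (hKU hl)).comp (tendsto_snd.mono_right nhdsWithin_le_nhds)
  have h2 := (hlim l (hKU hl)).mono_left (prod_mono_right atTop (nhdsWithin_le_nhds (s := K)))
  exact (h1.prodMk_nhds h2).mono_right (nhds_le_uniformity _)

end SgnLaurent

end

theorem theorem4p1 (k : ℕ) (hk : 1 ≤ k) (a : ℝ) (ha0 : 0 < a) (ha1 : a < 1) :
    -- the parameter `B^k_m(a)` and the extremal function are well defined
    (∀ m : ℕ, 1 ≤ m → ∃! B : ℝ, SgnLaurent.IsParam k m a B) ∧
    (∀ m : ℕ, 1 ≤ m → ∃! f : ℝ → ℝ, SgnLaurent.IsExtremal k m a f) ∧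
    -- asymptotics of `B^k_m(a)`
    Filter.Tendsto
      (fun m : ℕ => SgnLaurent.paramB k m a
        - ((m : ℝ) - 1 / 2) * Real.log ((1 + a) / (1 - a))
        - ((k : ℝ) + 1 / 2) * Real.log (2 * (m : ℝ) - 1))
      Filter.atTop
      (nhds (((k : ℝ) + 1 / 2) * Real.log (2 * a / (1 - a ^ 2))
        - Real.log (Real.Gamma ((k : ℝ) + 1 / 2) / Real.pi))) ∧
    -- the approximation error and its asymptotics
    (∀ m : ℕ, 1 ≤ m →
      SgnLaurent.bestError k m a = 1 / Real.cosh (SgnLaurent.paramB k m a)) ∧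
    Filter.Tendsto
      (fun m : ℕ => ((1 + a) / (1 - a)) ^ ((m : ℝ) - 1 / 2)
        * (2 * (m : ℝ) - 1) ^ ((k : ℝ) + 1 / 2) * SgnLaurent.bestError k m a)
      Filter.atTop
      (nhds (2 * Real.Gamma ((k : ℝ) + 1 / 2) / Real.pi
        * ((1 - a ^ 2) / (2 * a)) ^ ((k : ℝ) + 1 / 2))) ∧
    -- asymptotics of the extremal function, uniformly on compact subsets of `(0, ∞)`
    (∀ K : Set ℝ, IsCompact K → K ⊆ Set.Ioi 0 →
      TendstoUniformlyOn
        (fun (m : ℕ) (l : ℝ) =>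
          SgnLaurent.extremalFun k m a (Real.sqrt (2 * a / (2 * (m : ℝ) - 1)) * l))
        (SgnLaurent.limitFun k) Filter.atTop K) :=
  ⟨fun _ hm => SgnLaurent.existsUnique_isParam hk hm ha0 ha1,
    fun _ hm => SgnLaurent.existsUnique_isExtremal hk hm ha0 ha1,
    SgnLaurent.tendsto_paramB hk ha0 ha1,
    fun _ hm => SgnLaurent.bestError_eq_inv_cosh hk hm ha0 ha1,
    SgnLaurent.tendsto_bestError hk ha0 ha1,
    fun _ hK hK0 => SgnLaurent.tendstoUniformlyOn_of_tendsto_prod isOpen_Ioi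
      (fun _ hl => SgnLaurent.tendsto_extremalFun hk ha0 ha1 hl) hK hK0⟩
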